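/- Let $F$ be a local field (any characteristic, archimedean or not) with normalized absolute value $\|\cdot\|$ (so $d(ax)=\|a\|\,dx$), and let $\|ds\|$ be the Haar measure on $F$ normalized by $\int_{1<\|s\|\le\|x\|}\|ds/s\|=\log\|x\|$ for $\|x\|\ge 1$. Let $\Gamma^F$ be the Gamma function of $F$, i.e. the meromorphic function with $\mathcal F\|u\|^{a-1}=\Gamma^F(a)\|u\|^{-a}$, where $\mathcal F$ is the Fourier transform for $\|ds\|$ and some fixed nontrivial additive character of $F$. Let $m\ge 1$, let $t_0,\dots,t_m\in F$ be distinct, let $\lambda_0,\dots,\lambda_{m+1}\in -1+i\mathbb R$, and set $c=\lambda_{m+1}+1$. Let $\mathcal H(\lambda)$ be the Hilbert space of functions $\psi(y_0,\dots,y_m)$ on $F^{m+1}$ which are invariant under simultaneous translations, homogeneous of degree $\frac12(\sum_{j=0}^m\lambda_j-\lambda_{m+1})$ (that is, $\psi(ky)=\|k\|^{\deg}\psi(y)$), and square integrable on the slice $y_0=0,\ y_m=1$, with the $L^2$ inner product of $L^2(F^{m-1})$. Let $\lambda'=(\lambda_0,\dots,\lambda_m,-\lambda_{m+1}-2)$.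 Let $\mathcal S\subset L^2(F^{m-1})$ be the space of compactly supported Lipschitz functions on the slice (it contains all smooth, resp. locally constant, functions with compact support, and is dense). For $x\in F\setminus\{t_0,\dots,t_m\}$ the Hecke operator $$(H_{x}\psi)(y)=\prod_{j=0}^m\|x-t_j\|^{-\lambda_j/2}\int_F\psi\Big(\frac{t_0-x}{s-y_0},\dots,\frac{t_m-x}{s-y_m}\Big)\prod_{j=0}^m\|s-y_j\|^{\lambda_j}\,\|ds\|$$ is a bounded operator $\mathcal H(\lambda)\to\mathcal H(\lambda')$ (the integral converges absolutely for almost every $y$); it is denoted by $H_{x+}$, and the operator $\mathcal H(\lambda')\to\mathcal H(\lambda)$ given by the same formula with $\lambda'$ in place of $\lambda$ is denoted by $H_{x-}$. Below, $A_x=o(1)$ as $x\to\infty$ means that $A_x\varphi\to0$ in norm for every $\varphi\in\mathcal S$ and that $\langle\eta,A_x\varphi\rangle\to0$ for every vector $\varphi$ of the Hilbert space and every $\eta\in\mathcal S$ (for block operators, with $\mathcal S\oplus\mathcal S$ in place of $\mathcal S$). (i) Suppose that $\|\cdot\|^c\ne 1$ as a character of $F^\times$. Then there are unitary operators $Q_+,R_+:\mathcal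 H(\lambda)\to\mathcal H(\lambda')$ and $Q_-,R_-:\mathcal H(\lambda')\to\mathcal H(\lambda)$ such that, for $\psi$ with restriction in $\mathcal S$ and almost every $y$ in the slice, $$(Q_+\psi)(y)=\frac1{\Gamma^F(c)}\lim_{\varepsilon\to0+}\int_F\psi(y_0-t_0s,\dots,y_m-t_ms)\,\|s\|^{\lambda_{m+1}+\varepsilon}\|ds\|,$$ $$(R_+\psi)(y)=\frac1{\Gamma^F(-c)}\lim_{\varepsilon\to0+}\int_F\psi\Big(\frac1{s-y_0},\dots,\frac1{s-y_m}\Big)\prod_{j=0}^m\|s-y_j\|^{\lambda_j}\,\|s\|^{-\varepsilon}\|ds\|,$$ with $Q_-,R_-$ given by the same formulas for $\lambda'$ (so $c$ is replaced by $-c$), and as $x\to\infty$ $$\|x\|^{-1/2}H_{x\pm}=\Gamma^F(\pm c)\|x\|^{\pm c/2}Q_\pm+\Gamma^F(\mp c)\|x\|^{\mp c/2}R_\pm+o(1).$$ Moreover, for $H_{x,\mathrm{full}}=\begin{pmatrix}0&H_{x-}\\H_{x+}&0\end{pmatrix}$ and $D=\begin{pmatrix}0&R_-\\Q_+&0\end{pmatrix}$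 on $\mathcal H(\lambda)\oplus\mathcal H(\lambda')$, $$\|x\|^{-1/2}H_{x,\mathrm{full}}=\Gamma^F(c)\|x\|^{c/2}D+\Gamma^F(-c)\|x\|^{-c/2}D^\dagger+o(1).$$ (ii) Suppose that $c=0$ (so $\lambda'=\lambda$ and $H_{x+}=H_{x-}$). For $\psi$ with restriction in $\mathcal S$ the integral $$(M\psi)(y)=\int_F\Big(\psi(y_0-t_0s,\dots,y_m-t_ms)+\psi\Big(\frac{y_0}{1-y_0s^{-1}},\dots,\frac{y_m}{1-y_ms^{-1}}\Big)\prod_{j=0}^m\|1-y_js^{-1}\|^{\lambda_j}-\psi(y)\Big)\Big\|\frac{ds}s\Big\|$$ converges absolutely for almost every $y$ in the slice $y_0=0$, $y_m=1$, it defines a linear operator $M:\mathcal S\to L^2(F^{m-1})$, and for every such $\psi$ $$\|x\|^{-1/2}H_{x\pm}\psi=\log\|x\|\,\psi+M\psi+o(1),\qquad x\to\infty,$$ in norm. -/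

import Mathlib

open MeasureTheory Filter Topology Bornology
open scoped ENNReal NNReal

noncomputable section

namespace TameHecke

section LocalField

variable {F : Type*} [NontriviallyNormedField F] [ProperSpace F] [MeasurableSpace F] [BorelSpace F]

open scoped Classical in
/-- The normalized absolute value of the local field `F`: multiplication by `x` scales every
additive Haar measure by `nrm x`. (For `F = ℂ` this is the square of the usual modulus.) -/
def nrm (x : F) : ℝ :=
  if hx : x = 0 then 0 else (distribHaarChar F (Units.mk0 x hx) : ℝ)

/-- The complex power `‖x‖ ^ z` of the normalized absolute value. -/
def npow (x : F) (z : ℂ) : ℂ := ((nrm x : ℝ) : ℂ) ^ z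

/-- The normalization of the Haar measure `‖ds‖` on `F`: the annulus `1 < ‖s‖ ≤ ‖x‖` has volume
`log ‖x‖` with respect to `‖ds/s‖`. (Half the Lebesgue measure for `F = ℝ`, the Lebesgue measure
divided by `π` for `F = ℂ`, and `vol (𝒪ˣ) = log q` for `F` non-archimedean.) -/
def IsNormalizedHaar (μ : Measure F) : Prop :=
  ∀ x : F, 1 ≤ nrm x →
    ∫ s in {s : F | 1 < nrm s ∧ nrm s ≤ nrm x}, (nrm s)⁻¹ ∂μ = Real.log (nrm x)

/-- The Fourier transform on `F` with respect to the additive character `e` and the measure `μ`. -/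
def fourier (e : AddChar F Circle) (μ : Measure F) (f : F → ℂ) (u : F) : ℂ :=
  ∫ v, (e (u * v) : ℂ) * f v ∂μ

/-- The identity of distributions `𝓕 ‖u‖^(a-1) = γ ‖u‖^(-a)`. For `0 < Re a < 1` both sides
are locally integrable functions of at most polynomial growth, and we pair them with all
integrable functions that have an integrable Fourier transform. -/
def IsGammaFactor (e : AddChar F Circle) (μ : Measure F) (a γ : ℂ) : Prop :=
  ∀ f : F → ℂ, Integrable f μ → Integrable (fourier e μ f) μ →
    ∫ u, npow u (a - 1) * fourier e μ f u ∂μ = γ * ∫ u, npow u (-a) * f u ∂μ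

/-- The Gamma function of `F` in the open strip `0 < Re a < 1`, where it is holomorphic. -/
def gammaStrip (e : AddChar F Circle) (μ : Measure F) (a : ℂ) : ℂ :=
  Classical.epsilon (IsGammaFactor e μ a)

/-- The Gamma function of `F` for `0 ≤ Re a < 1`: in the open strip it is the (continuous) function
`gammaStrip`, and on the line `Re a = 0` it is the limit from the right, that is, the value of
the meromorphic continuation at the points that are not poles (`‖·‖^a ≠ 1`). -/
def gammaF (e : AddChar F Circle) (μ : Measure F) (a : ℂ) : ℂ :=
  limUnder (𝓝[>] (0 : ℝ)) fun ε : ℝ => gammaStrip e μ (a + ε)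

end LocalField

section Operators

/- There are `n + 2` finite ramification points `t 0, …, t (n + 1)` with parameters `lam j`, and the
ramification point `∞` with parameter `lamInf`; in the usual notation `m = n + 1`. -/

variable {F : Type*} [NontriviallyNormedField F] [ProperSpace F] [MeasurableSpace F] [BorelSpace F]
  {n : ℕ}

/-- The point `(0, y_1, …, y_{m-1}, 1)` of `F ^ (m + 1)`. -/
def gauge (y : Fin n → F) : Fin (n + 2) → F :=
  Fin.cons (α := fun _ => F) 0 (Fin.snoc (α := fun _ => F) y 1)

/-- The degree of homogeneity of the elements of the space with parameters `lam`, `lamInf`. -/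
def degree (lam : Fin (n + 2) → ℂ) (lamInf : ℂ) : ℂ := ((∑ j, lam j) - lamInf) / 2

/-- The function on `F ^ (m + 1)` that is translation invariant, homogeneous of degree `d`, and
equal to `φ` on the slice `z_0 = 0`, `z_m = 1`. -/
def homExt (d : ℂ) (φ : (Fin n → F) → ℂ) (z : Fin (n + 2) → F) : ℂ :=
  npow (z (Fin.last (n + 1)) - z 0) d *
    φ fun i => (z i.succ.castSucc - z 0) / (z (Fin.last (n + 1)) - z 0)

/-- The Hilbert space: a translation invariant homogeneous function of the given degree is
identified with its restriction to the slice `y_0 = 0`, `y_m = 1`, a square integrable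
function on `F ^ (m - 1)`. -/
abbrev HSpace (n : ℕ) (μ : Measure F) := Lp ℂ 2 (Measure.pi fun _ : Fin n => μ)

/-- The integrand (in `s`) of the modified Hecke operator. -/
def heckeIntegrand (t : Fin (n + 2) → F) (lam : Fin (n + 2) → ℂ) (lamInf : ℂ) (x : F)
    (φ : (Fin n → F) → ℂ) (y : Fin n → F) (s : F) : ℂ :=
  homExt (degree lam lamInf) φ (fun j => (t j - x) / (s - gauge y j)) *
    ∏ j, npow (s - gauge y j) (lam j)

/-- The bounded operator `H` is the Hecke operator `H_x`, from the space with parameters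
`(lam, lamInf)` to the space with parameters `(lam, -lamInf - 2)`. -/
def IsHecke (μ : Measure F) (t : Fin (n + 2) → F) (lam : Fin (n + 2) → ℂ) (lamInf : ℂ) (x : F)
    (H : HSpace n μ →L[ℂ] HSpace n μ) : Prop :=
  ∀ φ : HSpace n μ, ∀ᵐ y ∂(Measure.pi fun _ : Fin n => μ),
    Integrable (heckeIntegrand t lam lamInf x φ y) μ ∧
    H φ y = (∏ j, npow (x - t j) (-lam j / 2)) *
      ∫ s, heckeIntegrand t lam lamInf x φ y s ∂μ

/-- Lipschitz functions with compact support; all smooth (for non-archimedean `F`: locally constant)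
functions with compact support are among them. -/
def IsTest (g : (Fin n → F) → ℂ) : Prop :=
  (∃ K : ℝ≥0, LipschitzWith K g) ∧ HasCompactSupport g

/-- The integrand of the regularized integral that defines `R`. -/
def rIntegrand (lam : Fin (n + 2) → ℂ) (lamInf : ℂ) (ε : ℝ)
    (φ : (Fin n → F) → ℂ) (y : Fin n → F) (s : F) : ℂ :=
  homExt (degree lam lamInf) φ (fun j => 1 / (s - gauge y j)) *
    (∏ j, npow (s - gauge y j) (lam j)) * npow s (-(ε : ℂ))

/-- The integrand of the regularized integral that defines `Q`. -/
def qIntegrand (t : Fin (n + 2) → F) (lam : Fin (n + 2) → ℂ) (lamInf : ℂ) (ε : ℝ)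
    (φ : (Fin n → F) → ℂ) (y : Fin n → F) (s : F) : ℂ :=
  homExt (degree lam lamInf) φ (fun j => gauge y j - t j * s) * npow s (lamInf + ε)

/-- The unitary operator `T` is given on test functions by
`T g = γ⁻¹ lim_{ε → 0+} ∫ k ε g y s ‖ds‖`. -/
def IsRegularizedIntegral (μ : Measure F)
    (γ : ℂ) (k : ℝ → ((Fin n → F) → ℂ) → (Fin n → F) → F → ℂ)
    (T : HSpace n μ ≃ₗᵢ[ℂ] HSpace n μ) : Prop :=
  ∀ (g : (Fin n → F) → ℂ) (φ : HSpace n μ), IsTest g →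
    φ =ᵐ[Measure.pi fun _ : Fin n => μ] g →
    ∀ᵐ y ∂(Measure.pi fun _ : Fin n => μ),
      (∀ᶠ ε : ℝ in 𝓝[>] 0, Integrable (k ε g y) μ) ∧
      Tendsto (fun ε : ℝ => γ⁻¹ * ∫ s, k ε g y s ∂μ) (𝓝[>] 0) (𝓝 (T φ y))

/-- `T` is the operator `R` from the space with parameters `(lam, lamInf)` to the space with
parameters `(lam, -lamInf - 2)`, induced by the intertwining operator at `∞`. -/
def IsR (e : AddChar F Circle) (μ : Measure F) (lam : Fin (n + 2) → ℂ) (lamInf : ℂ)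
    (T : HSpace n μ ≃ₗᵢ[ℂ] HSpace n μ) : Prop :=
  IsRegularizedIntegral μ (gammaF e μ (-lamInf - 1)) (rIntegrand lam lamInf) T

/-- `T` is the operator `Q` from the space with parameters `(lam, lamInf)` to the space with
parameters `(lam, -lamInf - 2)`. -/
def IsQ (e : AddChar F Circle) (μ : Measure F) (t : Fin (n + 2) → F) (lam : Fin (n + 2) → ℂ)
    (lamInf : ℂ) (T : HSpace n μ ≃ₗᵢ[ℂ] HSpace n μ) : Prop :=
  IsRegularizedIntegral μ (gammaF e μ (lamInf + 1)) (qIntegrand t lam lamInf) T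

/-- The integrand of the operator `M` (for `lamInf = -1`). -/
def mIntegrand (t : Fin (n + 2) → F) (lam : Fin (n + 2) → ℂ)
    (φ : (Fin n → F) → ℂ) (y : Fin n → F) (s : F) : ℂ :=
  (homExt (degree lam (-1)) φ (fun j => gauge y j - t j * s) +
    homExt (degree lam (-1)) φ (fun j => gauge y j / (1 - gauge y j * s⁻¹)) *
      (∏ j, npow (1 - gauge y j * s⁻¹) (lam j)) -
    φ y) * npow s (-1)

/-- The subspace of test functions in the Hilbert space. -/
def testSpace (n : ℕ) (μ : Measure F) : Submodule ℂ (HSpace n μ) where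
  carrier := {φ | ∃ g, IsTest g ∧ φ =ᵐ[Measure.pi fun _ : Fin n => μ] g}
  zero_mem' := ⟨0, ⟨⟨0, LipschitzWith.const' 0⟩, HasCompactSupport.zero⟩, Lp.coeFn_zero _ _ _⟩
  add_mem' := by
    rintro φ ψ ⟨g, ⟨⟨K, hK⟩, hg⟩, hφ⟩ ⟨h, ⟨⟨L, hL⟩, hh⟩, hψ⟩
    exact ⟨g + h, ⟨⟨K + L, hK.add hL⟩, hg.add hh⟩, (Lp.coeFn_add φ ψ).trans (hφ.add hψ)⟩
  smul_mem' := by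
    rintro a φ ⟨g, ⟨⟨K, hK⟩, hg⟩, hφ⟩
    refine ⟨a • g, ⟨⟨‖a‖₊ * K, ?_⟩, ?_⟩, (Lp.coeFn_smul a φ).trans (hφ.const_smul a)⟩
    · exact (lipschitzWith_smul a).comp hK
    · exact hg.comp_left (g := fun z : ℂ => a • z) (smul_zero a)

/-- `M` is the operator of the case `lamInf = -1`, defined on test functions. -/
def IsM (μ : Measure F) (t : Fin (n + 2) → F) (lam : Fin (n + 2) → ℂ)
    (M : testSpace n μ →ₗ[ℂ] HSpace n μ) : Prop :=
  ∀ (g : (Fin n → F) → ℂ) (φ : testSpace n μ), IsTest g →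
    (φ : HSpace n μ) =ᵐ[Measure.pi fun _ : Fin n => μ] g →
    ∀ᵐ y ∂(Measure.pi fun _ : Fin n => μ),
      Integrable (mIntegrand t lam g y) μ ∧ M φ y = ∫ s, mIntegrand t lam g y s ∂μ

end Operators

section Asymptotics

variable {F : Type*} [NontriviallyNormedField F]
  {E : Type*} [NormedAddCommGroup E] [InnerProductSpace ℂ E]

/-- The operators `A x` are `o(1)` as `x → ∞`: they tend to zero strongly on the subspace `S`
(which is dense in the applications), and weakly on all of `E`, when tested against the elements
of `S`. -/
def IsLittleOOne (S : Submodule ℂ E) (A : F → E →L[ℂ] E) : Prop :=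
  (∀ u ∈ S, Tendsto (fun x => A x u) (cobounded F) (𝓝 0)) ∧
  (∀ u : E, ∀ v ∈ S, Tendsto (fun x => inner ℂ v (A x u)) (cobounded F) (𝓝 0))

/-- The block matrix with rows `(0, A)` and `(B, 0)` as an operator on the Hilbert sum `E ⊕ E`. -/
def offDiag (A B : E →L[ℂ] E) : WithLp 2 (E × E) →L[ℂ] WithLp 2 (E × E) :=
  ((WithLp.prodContinuousLinearEquiv 2 ℂ E E).symm : E × E →L[ℂ] WithLp 2 (E × E)) ∘L
    ((A ∘L ContinuousLinearMap.snd ℂ E E).prod (B ∘L ContinuousLinearMap.fst ℂ E E)) ∘L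
    (WithLp.prodContinuousLinearEquiv 2 ℂ E E : WithLp 2 (E × E) →L[ℂ] E × E)

/-- The subspace `S ⊕ S` of the Hilbert sum `E ⊕ E`. -/
def sumSpace (S : Submodule ℂ E) : Submodule ℂ (WithLp 2 (E × E)) :=
  (S.prod S).comap ((WithLp.prodContinuousLinearEquiv 2 ℂ E E).toLinearEquiv :
    WithLp 2 (E × E) →ₗ[ℂ] E × E)

end Asymptotics

end TameHecke

end

open TameHecke

/-!
All operators are expressed through one family `gOp μ t lam d ρ r` on `L²(F ^ (m - 1))` with two
parameters in `F`: the weighted composition of a function with a Möbius transformation in every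
coordinate, whose kernel `gFun` is
`φ((y j - (t j - t 0) r) / (1 - y j ρ)) ∏ ‖1 - y j ρ‖ ^ λ j`. With `x` in place of `x - t 0`, the
integrand of the Hecke operator is, up to a scalar, `‖s‖ ^ (c - 1) gOp (1 / s) (s / x)`
(`heckeIntegrand_eq`), the integrand of `Q` is `‖s‖ ^ (c - 1) gOp 0 s`, that of `R` is
`‖s‖ ^ (c - 1) gOp (1 / s) 0`, and that of `M` is
`‖s‖⁻¹ (gOp 0 s + gOp (1 / s) 0 - 1)`. The operators `gOp` are multiples of
unitary operators with explicit constants (`norm_gOp`), depend strongly continuously on the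
parameters (`tendsto_gOp`), and are Lipschitz at the origin on test functions
(`exists_norm_gOp_sub_le`). All integrals over `F` are Bochner integrals in `L²(F ^ (m - 1))`;
`ae_integral_apply` translates them into the pointwise statements.

*Asymptotics.* In the integral of `‖s‖ ^ (c - 1) gOp (1 / s) (s / x) φ` the operator is close to the
identity for `1 ≪ ‖s‖ ≪ ‖x‖`, so the integral over `1 ≤ ‖s‖ ≤ ‖x‖` of `‖s‖ ^ (c - 1) φ` is
subtracted. The rest is cut at `‖s‖ ^ 2 = ‖x‖`. For smaller `s` the second parameter tends to zero,
for larger `s`, after the substitution `s = x r`, the first one does, and dominated convergence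
applies to both parts (`tendsto_integral_two_parameter`). For `‖·‖ ^ c ≠ 1` the subtracted integral
is a combination of `1` and `‖x‖ ^ c` that completes the two limits to regularized integrals
(`regInt`, `tendsto_heckeVec_sub_regInt`); for `c = 0` it is `log ‖x‖` plus the volume of the unit
sphere, which gives `M`.

*Unitarity.* With `w = 1 - (t m - t 0) r`, respectively `w = 1 - ρ`, the operators `gOp 0 r` and
`gOp ρ 0` become unitary representations `u` of the multiplicative group (`repQ`, `repR`), and the
regularized integrals are boundary values at `a = c` of
`B(ρ, a) = ∫ ‖w‖ ^ ρ ‖1 - w‖ ^ (a - 1) u(w) dw` (`betaOp`). These operators satisfy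
`B(ρ + a, b) B(ρ, a) = β(a, b) B(ρ, a + b)` with the beta function `β` of `F` (`betaOp_betaOp`), the
adjoint of `B(ρ, a)` is one of them (`inner_betaOp`), and `2 ε B(ρ - ε, 2 ε)` tends to the identity.
Hence a boundary value `B` satisfies `B* B = lim β(c + ε, -c + ε) / (2 ε)`, and this is
`|Γ(c)|²` since `β(a, b) Γ(a + b) = Γ(a) Γ(b)` and `Γ` has residue `1` at the origin
(`exists_unitary`, `tendsto_betaF_div`).

*The Gamma function* is constructed from the local functional equation (`zint_mul_zint_comm`), its
reflection formula from Fourier inversion on `F` (`exists_fourier_inversion`). The inversion formula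
is proved with convolution powers of the tent function `max (0, 1 - ‖v‖)`, whose Fourier transforms
are integrable for every local field.

*Weak convergence.* An involution of the variable `s` shows that the Hecke operators in the two
directions are adjoint to each other (`IsHeckeFamily.inner_eq`), and the operators `Q` and `R` for
the second set of parameters are the inverses of those for the first one. Therefore weak convergence
of the error terms follows from strong convergence of their adjoints.
-/

set_option linter.unusedSectionVars false

namespace TameHecke


/-! ### The normalized absolute value -/

section Modulus

lemma le_of_pow_le_mul_pow {a b C : ℝ} (hb : 0 < b) (h : ∀ k : ℕ, a ^ k ≤ C * b ^ k) :
    a ≤ b := by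
  by_contra! hlt
  obtain ⟨k, hk⟩ := pow_unbounded_of_one_lt C ((one_lt_div hb).2 hlt)
  rw [div_pow, lt_div_iff₀ (pow_pos hb k)] at hk
  exact absurd (h k) (not_le.2 hk)

variable {F : Type*} [NontriviallyNormedField F] [ProperSpace F] [MeasurableSpace F] [BorelSpace F]

lemma nrm_of_ne {x : F} (hx : x ≠ 0) : nrm x = (distribHaarChar F (Units.mk0 x hx) : ℝ) := by
  simp [nrm, hx]

@[simp] lemma nrm_zero : nrm (0 : F) = 0 := by simp [nrm]

lemma nrm_pos {x : F} (hx : x ≠ 0) : 0 < nrm x := by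
  rw [nrm_of_ne hx]; exact_mod_cast distribHaarChar_pos

lemma nrm_nonneg (x : F) : 0 ≤ nrm x := by
  by_cases hx : x = 0
  · simp [hx]
  · exact (nrm_pos hx).le

lemma nrm_mul (x y : F) : nrm (x * y) = nrm x * nrm y := by
  by_cases hx : x = 0
  · simp [hx]
  by_cases hy : y = 0
  · simp [hy]
  rw [nrm_of_ne hx, nrm_of_ne hy, nrm_of_ne (mul_ne_zero hx hy), ← NNReal.coe_mul, ← map_mul]
  congr 2
  ext; simp

@[simp] lemma nrm_one : nrm (1 : F) = 1 := by
  rw [nrm_of_ne one_ne_zero, Units.mk0_one, map_one, NNReal.coe_one]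

lemma nrm_pow (x : F) (k : ℕ) : nrm (x ^ k) = nrm x ^ k := by
  induction k with
  | zero => simp
  | succ k ih => rw [pow_succ, pow_succ, nrm_mul, ih]

lemma nrm_inv (x : F) : nrm x⁻¹ = (nrm x)⁻¹ := by
  by_cases hx : x = 0
  · simp [hx]
  · refine eq_inv_of_mul_eq_one_left ?_
    rw [← nrm_mul, inv_mul_cancel₀ hx, nrm_one]

lemma nrm_div (x y : F) : nrm (x / y) = nrm x / nrm y := by
  rw [div_eq_mul_inv, nrm_mul, nrm_inv, div_eq_mul_inv]

@[simp] lemma nrm_neg (x : F) : nrm (-x) = nrm x := by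
  have h : nrm (-1 : F) = 1 := by
    have h1 : nrm (-1 : F) ^ 2 = 1 := by rw [← nrm_pow]; simp
    nlinarith [nrm_nonneg (-1 : F)]
  rw [neg_eq_neg_one_mul, nrm_mul, h, one_mul]

lemma nrm_sub_comm (x y : F) : nrm (x - y) = nrm (y - x) := by rw [← nrm_neg, neg_sub]

variable (μ : Measure F) [μ.IsAddHaarMeasure]

lemma map_mul_left {a : F} (ha : a ≠ 0) :
    μ.map (a * ·) = ENNReal.ofReal (nrm a)⁻¹ • μ := by
  have hm : Measurable (a * · : F → F) := measurable_const_mul a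
  ext s hs
  rw [Measure.map_apply hm hs, Measure.smul_apply, smul_eq_mul, ← nrm_inv,
    nrm_of_ne (inv_ne_zero ha), ENNReal.ofReal_coe_nnreal, distribHaarChar_mul]
  congr 1
  ext y
  simp only [Set.mem_preimage, Set.mem_smul_set, Units.smul_def, Units.val_mk0, smul_eq_mul]
  constructor
  · intro h; exact ⟨_, h, by field_simp⟩
  · rintro ⟨z, hz, rfl⟩
    rwa [mul_inv_cancel_left₀ ha]

/-- Multiplication by `a ≠ 0` as a measurable equivalence. -/
noncomputable def mulEquiv {a : F} (ha : a ≠ 0) : F ≃ᵐ F := (Homeomorph.mulLeft₀ a ha).toMeasurableEquiv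

lemma coe_mulEquiv {a : F} (ha : a ≠ 0) : ⇑(mulEquiv ha) = (a * ·) := rfl

lemma lintegral_mul_left {a : F} (ha : a ≠ 0) (f : F → ℝ≥0∞) :
    ∫⁻ x, f (a * x) ∂μ = ENNReal.ofReal (nrm a)⁻¹ * ∫⁻ x, f x ∂μ := by
  have := lintegral_map_equiv (μ := μ) f (mulEquiv ha)
  rw [coe_mulEquiv, map_mul_left μ ha, lintegral_smul_measure] at this
  simpa using this.symm

variable {E : Type*} [NormedAddCommGroup E]

lemma integrable_mul_left {a : F} (ha : a ≠ 0) {f : F → E} :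
    Integrable (fun x => f (a * x)) μ ↔ Integrable f μ := by
  have := integrable_map_equiv (μ := μ) (mulEquiv ha) f
  rw [coe_mulEquiv, map_mul_left μ ha, integrable_smul_measure] at this
  · exact this.symm
  · simpa using nrm_pos ha
  · simp

lemma integral_mul_left [NormedSpace ℝ E] {a : F} (ha : a ≠ 0) (f : F → E) :
    ∫ x, f (a * x) ∂μ = (nrm a)⁻¹ • ∫ x, f x ∂μ := by
  have := integral_map_equiv (μ := μ) (mulEquiv ha) f
  rw [coe_mulEquiv, map_mul_left μ ha, integral_smul_measure] at this
  rw [← this, ENNReal.toReal_ofReal (inv_nonneg.2 (nrm_nonneg a))]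

lemma nrm_le_one {x : F} (hx : ‖x‖ ≤ 1) : nrm x ≤ 1 := by
  by_cases h0 : x = 0
  · simp [h0]
  let μ : Measure F := Measure.addHaar
  have hpos : 0 < μ (Metric.closedBall 0 1) := Metric.measure_closedBall_pos _ _ one_pos
  have hfin : μ (Metric.closedBall 0 1) < ∞ := measure_closedBall_lt_top
  have h1 : μ (Metric.closedBall 0 1) ≤ μ ((x * ·) ⁻¹' Metric.closedBall 0 1) := by
    refine measure_mono fun y hy => ?_
    simp only [Set.mem_preimage, mem_closedBall_zero_iff, norm_mul] at hy ⊢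
    exact mul_le_one₀ hx (norm_nonneg _) hy
  rw [← Measure.map_apply (measurable_const_mul x) Metric.isClosed_closedBall.measurableSet,
    map_mul_left μ h0, Measure.smul_apply, smul_eq_mul] at h1
  have h2 : 1 ≤ ENNReal.ofReal (nrm x)⁻¹ := by
    by_contra! h
    exact absurd h1 (not_le.2 (by
      conv_rhs => rw [← one_mul (μ (Metric.closedBall 0 1))]
      exact (ENNReal.mul_lt_mul_iff_left hpos.ne' hfin.ne).2 h))
  rw [ENNReal.one_le_ofReal] at h2
  exact (one_le_inv₀ (nrm_pos h0)).1 h2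

lemma nrm_le_nrm {x y : F} (h : ‖x‖ ≤ ‖y‖) : nrm x ≤ nrm y := by
  by_cases hy : y = 0
  · have : x = 0 := by simpa [hy] using h
    simp [this, nrm_nonneg]
  have := nrm_le_one (x := x / y) (by rw [norm_div]; exact div_le_one_of_le₀ h (norm_nonneg _))
  rwa [nrm_div, div_le_one (nrm_pos hy)] at this

lemma one_lt_nrm {x : F} (hx : 1 < ‖x‖) : 1 < nrm x := by
  by_contra! h
  have h0 : x ≠ 0 := by rintro rfl; simp at hx; linarith
  let μ : Measure F := Measure.addHaar
  have hk : ∀ k : ℕ, μ (Metric.closedBall 0 (‖x‖ ^ k)) ≤ μ (Metric.closedBall 0 1) := by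
    intro k
    have e : Metric.closedBall (0 : F) 1 = (x ^ k * ·) ⁻¹' Metric.closedBall 0 (‖x‖ ^ k) := by
      ext y
      simp only [Set.mem_preimage, mem_closedBall_zero_iff, norm_mul, norm_pow]
      rw [mul_le_iff_le_one_right (by positivity)]
    rw [e, ← Measure.map_apply (measurable_const_mul _) Metric.isClosed_closedBall.measurableSet,
      map_mul_left μ (pow_ne_zero k h0), Measure.smul_apply, smul_eq_mul]
    refine le_mul_of_one_le_left' ?_
    rw [ENNReal.one_le_ofReal, nrm_pow]
    exact (one_le_inv₀ (pow_pos (nrm_pos h0) k)).2 (pow_le_one₀ (nrm_nonneg _) h)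
  have hu : (⋃ k : ℕ, Metric.closedBall (0 : F) (‖x‖ ^ k)) = Set.univ := by
    refine Set.eq_univ_of_forall fun y => ?_
    obtain ⟨k, hk⟩ := pow_unbounded_of_one_lt ‖y‖ hx
    exact Set.mem_iUnion.2 ⟨k, by simpa using hk.le⟩
  have hmono : Monotone fun k : ℕ => Metric.closedBall (0 : F) (‖x‖ ^ k) := fun i j hij =>
    Metric.closedBall_subset_closedBall (pow_le_pow_right₀ hx.le hij)
  have : μ Set.univ ≤ μ (Metric.closedBall 0 1) := by
    rw [← hu, hmono.measure_iUnion]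
    exact iSup_le hk
  have h2 : μ (Metric.closedBall 0 1) < ∞ := measure_closedBall_lt_top
  have hnc : NoncompactSpace F := NontriviallyNormedField.toNormedField.noncompactSpace F
  rw [measure_univ_of_isAddLeftInvariant] at this
  exact absurd this (not_le.2 h2)

variable (F) in
/-- The exponent relating the normalized absolute value to the given norm of `F`:
`nrm x = ‖x‖ ^ nrmExp F`. -/
noncomputable def nrmExp : ℝ :=
  Real.log (nrm (NormedField.exists_one_lt_norm F).choose) /
    Real.log ‖(NormedField.exists_one_lt_norm F).choose‖

variable (F) in
lemma nrmExp_pos : 0 < nrmExp F :=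
  div_pos (Real.log_pos (one_lt_nrm (NormedField.exists_one_lt_norm F).choose_spec))
    (Real.log_pos (NormedField.exists_one_lt_norm F).choose_spec)

/-- Both `nrm` and the norm are multiplicative, and `nrm` is monotone in the norm; comparing the
powers of `x` with those of a fixed element gives the identity up to a bounded factor, which
disappears on taking roots. -/
lemma nrm_eq_rpow (x : F) : nrm x = ‖x‖ ^ nrmExp F := by
  have key : ∀ x : F, 1 ≤ ‖x‖ → nrm x = ‖x‖ ^ nrmExp F := by
    intro x hx
    set b := (NormedField.exists_one_lt_norm F).choose with hb
    have hb1 : 1 < ‖b‖ := (NormedField.exists_one_lt_norm F).choose_spec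
    have hb2 : 1 < nrm b := one_lt_nrm hb1
    have hbe : ‖b‖ ^ nrmExp F = nrm b := by
      rw [Real.rpow_def_of_pos (by linarith), nrmExp, ← hb,
        mul_div_cancel₀ _ (Real.log_pos hb1).ne', Real.exp_log (by linarith)]
    have hbk : ∀ k : ℕ, (‖b‖ ^ k) ^ nrmExp F = nrm (b ^ k) := fun k => by
      rw [nrm_pow, ← hbe, ← Real.rpow_natCast, ← Real.rpow_natCast,
        ← Real.rpow_mul (norm_nonneg _), ← Real.rpow_mul (norm_nonneg _), mul_comm (nrmExp F)]
    -- compare `y` with the power of `b` of nearly the same norm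
    have h1 : ∀ y : F, 1 ≤ ‖y‖ →
        nrm y ≤ nrm b * ‖y‖ ^ nrmExp F ∧ ‖y‖ ^ nrmExp F ≤ nrm b * nrm y := by
      intro y hy
      obtain ⟨k, hk1, hk2⟩ := exists_nat_pow_near hy hb1
      have he := (nrmExp_pos F).le
      constructor
      · calc nrm y ≤ nrm (b ^ (k + 1)) := nrm_le_nrm (by rw [norm_pow]; exact hk2.le)
          _ = nrm b * (‖b‖ ^ k) ^ nrmExp F := by rw [hbk, pow_succ, mul_comm, nrm_mul]
          _ ≤ nrm b * ‖y‖ ^ nrmExp F := by gcongr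
      · calc ‖y‖ ^ nrmExp F ≤ (‖b‖ ^ (k + 1)) ^ nrmExp F := by gcongr
          _ = nrm b * nrm (b ^ k) := by rw [hbk, pow_succ, mul_comm, nrm_mul]
          _ ≤ nrm b * nrm y := by
              gcongr
              exact nrm_le_nrm (by rw [norm_pow]; exact hk1)
    have hx0 : 0 < ‖x‖ := by linarith
    have hxk : ∀ k : ℕ, ‖x ^ k‖ ^ nrmExp F = (‖x‖ ^ nrmExp F) ^ k := fun k => by
      rw [norm_pow, ← Real.rpow_natCast ‖x‖ k, ← Real.rpow_mul hx0.le,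
        mul_comm (k : ℝ), Real.rpow_mul hx0.le, Real.rpow_natCast]
    have h2 : ∀ k : ℕ, 1 ≤ ‖x ^ k‖ := fun k => by rw [norm_pow]; exact one_le_pow₀ hx
    -- the identity for all powers `x ^ k` up to the factor `nrm b` implies the identity for `x`
    refine le_antisymm (le_of_pow_le_mul_pow (C := nrm b) (Real.rpow_pos_of_pos hx0 _) fun k => ?_)
      (le_of_pow_le_mul_pow (C := nrm b) (nrm_pos (norm_pos_iff.1 hx0)) fun k => ?_)
    · have := (h1 _ (h2 k)).1
      rwa [hxk, nrm_pow] at this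
    · have := (h1 _ (h2 k)).2
      rwa [hxk, nrm_pow] at this
  rcases le_total 1 ‖x‖ with h | h
  · exact key x h
  · by_cases h0 : x = 0
    · simp [h0, Real.zero_rpow (nrmExp_pos F).ne']
    have := key x⁻¹ (by rw [norm_inv]; exact (one_le_inv₀ (norm_pos_iff.2 h0)).2 h)
    rw [nrm_inv, norm_inv, Real.inv_rpow (norm_nonneg _)] at this
    exact inv_injective this

lemma continuous_nrm : Continuous (nrm : F → ℝ) := by
  have : (nrm : F → ℝ) = fun x => ‖x‖ ^ nrmExp F := funext nrm_eq_rpow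
  rw [this]
  exact continuous_norm.rpow_const fun _ => Or.inr (nrmExp_pos F).le

lemma nrm_le_one_iff {x : F} : nrm x ≤ 1 ↔ ‖x‖ ≤ 1 := by
  constructor
  · intro h
    by_contra! h1
    exact absurd h (not_le.2 (one_lt_nrm h1))
  · exact nrm_le_one

end Modulus


/-! ### Complex powers and inversion -/

section ComplexPowers

variable {F : Type*} [NontriviallyNormedField F] [ProperSpace F] [MeasurableSpace F] [BorelSpace F]

lemma npow_mul (x y : F) (z : ℂ) : npow (x * y) z = npow x z * npow y z := by
  rw [npow, nrm_mul, Complex.ofReal_mul, Complex.mul_cpow_ofReal_nonneg (nrm_nonneg x) (nrm_nonneg y)]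
  rfl

@[simp] lemma npow_one (z : ℂ) : npow (1 : F) z = 1 := by simp [npow]

@[simp] lemma npow_neg_arg (x : F) (z : ℂ) : npow (-x) z = npow x z := by simp [npow]

@[simp] lemma npow_zero_exp (x : F) : npow x 0 = 1 := by simp [npow]

lemma npow_zero_base {z : ℂ} (hz : z ≠ 0) : npow (0 : F) z = 0 := by simp [npow, hz]

lemma nrm_cast_ne {x : F} (hx : x ≠ 0) : ((nrm x : ℝ) : ℂ) ≠ 0 :=
  Complex.ofReal_ne_zero.2 (nrm_pos hx).ne'

lemma npow_ne_zero {x : F} (hx : x ≠ 0) (z : ℂ) : npow x z ≠ 0 :=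
  (Complex.cpow_ne_zero_iff_of_exponent_ne_zero (x := (nrm x : ℂ)) (y := z) · |>.2 (nrm_cast_ne hx))
    |> fun h => by
      by_cases hz : z = 0
      · simp [hz]
      · exact h hz

lemma npow_add {x : F} (hx : x ≠ 0) (z w : ℂ) : npow x (z + w) = npow x z * npow x w :=
  Complex.cpow_add _ _ (nrm_cast_ne hx)

lemma npow_sub {x : F} (hx : x ≠ 0) (z w : ℂ) : npow x (z - w) = npow x z / npow x w :=
  Complex.cpow_sub _ _ (nrm_cast_ne hx)

lemma npow_neg (x : F) (z : ℂ) : npow x (-z) = (npow x z)⁻¹ := Complex.cpow_neg _ _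

lemma npow_inv (x : F) (z : ℂ) : npow x⁻¹ z = (npow x z)⁻¹ := by
  by_cases hx : x = 0
  · by_cases hz : z = 0
    · simp [hz]
    · simp [hx, npow_zero_base hz]
  · refine eq_inv_of_mul_eq_one_left ?_
    rw [← npow_mul, inv_mul_cancel₀ hx, npow_one]

lemma npow_div (x y : F) (z : ℂ) : npow (x / y) z = npow x z / npow y z := by
  rw [div_eq_mul_inv, npow_mul, npow_inv, div_eq_mul_inv]

lemma norm_npow {x : F} (hx : x ≠ 0) (z : ℂ) : ‖npow x z‖ = nrm x ^ z.re :=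
  Complex.norm_cpow_eq_rpow_re_of_pos (nrm_pos hx) z

lemma norm_npow_imag {x : F} (hx : x ≠ 0) {z : ℂ} (hz : z.re = 0) : ‖npow x z‖ = 1 := by
  rw [norm_npow hx, hz, Real.rpow_zero]

lemma norm_npow_le (x : F) (z : ℂ) : ‖npow x z‖ ≤ nrm x ^ z.re := by
  by_cases hx : x = 0
  · by_cases hz : z = 0
    · simp [hz]
    · rw [hx, npow_zero_base hz, norm_zero]; exact Real.rpow_nonneg (nrm_nonneg _) _
  · exact (norm_npow hx z).le

lemma npow_ofReal (x : F) (r : ℝ) : npow x (r : ℂ) = ((nrm x ^ r : ℝ) : ℂ) :=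
  (Complex.ofReal_cpow (nrm_nonneg x) r).symm

lemma npow_neg_one (x : F) : npow x (-1) = (((nrm x)⁻¹ : ℝ) : ℂ) := by
  rw [npow, Complex.cpow_neg_one, Complex.ofReal_inv]

lemma npow_one_exp (x : F) : npow x 1 = ((nrm x : ℝ) : ℂ) := by rw [npow, Complex.cpow_one]

lemma conj_npow (x : F) (z : ℂ) : (starRingEnd ℂ) (npow x z) = npow x ((starRingEnd ℂ) z) := by
  rw [npow, npow, Complex.cpow_conj, Complex.conj_ofReal]
  rw [Complex.arg_ofReal_of_nonneg (nrm_nonneg x)]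
  exact Real.pi_pos.ne

lemma measurable_nrm : Measurable (nrm : F → ℝ) := continuous_nrm.measurable

lemma measurable_npow (z : ℂ) : Measurable fun x : F => npow x z :=
  (Complex.measurable_ofReal.comp measurable_nrm).pow_const z

lemma continuousAt_npow {x : F} (hx : x ≠ 0) (z : ℂ) : ContinuousAt (fun x : F => npow x z) x := by
  refine ContinuousAt.cpow (Complex.continuous_ofReal.comp continuous_nrm).continuousAt
    continuousAt_const (Or.inl ?_)
  simpa using nrm_pos hx

lemma continuousAt_npow_exp {x : F} (hx : x ≠ 0) (z : ℂ) :
    ContinuousAt (fun z : ℂ => npow x z) z :=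
  (continuousAt_const_cpow (nrm_cast_ne hx))

/-- The powers `‖x‖ ^ z` are Lipschitz at `x = 1`, uniformly for `z` in a bounded set. -/
lemma norm_npow_sub_one_le {Z : ℝ} (hZ : 0 ≤ Z) : ∃ C : ℝ, 0 ≤ C ∧ ∀ (x : F) (z : ℂ), ‖z‖ ≤ Z →
    ‖x - 1‖ ≤ 1 / 2 → ‖npow x z - 1‖ ≤ C * ‖x - 1‖ := by
  refine ⟨2 * (Z * nrmExp F * 2) * Real.exp (Z * nrmExp F), by have := nrmExp_pos F; positivity,
    fun x z hz hx => ?_⟩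
  have he := nrmExp_pos F
  have h1 : |‖x‖ - 1| ≤ ‖x - 1‖ := by simpa using abs_norm_sub_norm_le x 1
  have hx2 : 1 / 2 ≤ ‖x‖ := by have := abs_le.1 h1; linarith
  have hx0 : x ≠ 0 := by rintro rfl; norm_num at hx2
  have hxp : 0 < ‖x‖ := by linarith
  have hlog : |Real.log ‖x‖| ≤ 2 * ‖x - 1‖ := by
    have hu : Real.log ‖x‖ ≤ ‖x - 1‖ := by
      have := Real.log_le_sub_one_of_pos hxp
      have := abs_le.1 h1; linarith
    have hl : -(2 * ‖x - 1‖) ≤ Real.log ‖x‖ := by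
      have h2 := Real.one_sub_inv_le_log_of_pos hxp
      have h3 : ‖x‖⁻¹ - 1 ≤ 2 * ‖x - 1‖ := by
        have : ‖x‖⁻¹ - 1 = (1 - ‖x‖) * ‖x‖⁻¹ := by field_simp
        rw [this]
        have h4 : ‖x‖⁻¹ ≤ 2 := by
          rw [inv_le_comm₀ hxp two_pos]; linarith
        calc (1 - ‖x‖) * ‖x‖⁻¹ ≤ ‖x - 1‖ * ‖x‖⁻¹ := by
              gcongr; have := abs_le.1 h1; linarith
          _ ≤ ‖x - 1‖ * 2 := by gcongr
          _ = _ := by ring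
      linarith
    rw [abs_le]; constructor <;> [linarith; linarith [norm_nonneg (x - 1)]]
  have hlogn : Real.log (nrm x) = nrmExp F * Real.log ‖x‖ := by
    rw [nrm_eq_rpow, Real.log_rpow hxp]
  have e : npow x z = Complex.exp (Real.log (nrm x) * z) := by
    rw [npow, Complex.cpow_def_of_ne_zero (nrm_cast_ne hx0), Complex.ofReal_log (nrm_nonneg x)]
  set v : ℂ := Real.log (nrm x) * z with hv
  have hvn : ‖v‖ ≤ Z * nrmExp F * 2 * ‖x - 1‖ := by
    rw [hv, norm_mul, Complex.norm_real, Real.norm_eq_abs, hlogn, abs_mul, abs_of_pos he]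
    calc nrmExp F * |Real.log ‖x‖| * ‖z‖ ≤ nrmExp F * (2 * ‖x - 1‖) * Z := by gcongr
      _ = _ := by ring
  have hvn2 : ‖v‖ ≤ Z * nrmExp F := by
    refine hvn.trans ?_
    have : 0 ≤ Z * nrmExp F := by positivity
    nlinarith
  rw [e]
  calc ‖Complex.exp v - 1‖ ≤ ‖v‖ * Real.exp ‖v‖ := by
        simpa using Complex.norm_exp_sub_sum_le_norm_mul_exp v 1
    _ ≤ (Z * nrmExp F * 2 * ‖x - 1‖) * Real.exp (Z * nrmExp F) := by gcongr
    _ ≤ 2 * (Z * nrmExp F * 2) * Real.exp (Z * nrmExp F) * ‖x - 1‖ := by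
      have : 0 ≤ (Z * nrmExp F * 2 * ‖x - 1‖) * Real.exp (Z * nrmExp F) := by positivity
      linarith

end ComplexPowers

section Inversion

variable {F : Type*} [NontriviallyNormedField F] [ProperSpace F] [MeasurableSpace F] [BorelSpace F]
  (μ : Measure F) [μ.IsAddHaarMeasure]

lemma ae_ne (a : F) : ∀ᵐ x ∂μ, x ≠ a := by
  simp [ae_iff, measure_singleton]

lemma lintegral_haar_mul {a : F} (ha : a ≠ 0) (f : F → ℝ≥0∞) :
    ∫⁻ x, f (a * x) * ENNReal.ofReal (nrm x)⁻¹ ∂μ = ∫⁻ x, f x * ENNReal.ofReal (nrm x)⁻¹ ∂μ := by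
  have h := lintegral_mul_left μ ha fun x => f x * ENNReal.ofReal (nrm x)⁻¹
  have hp := nrm_pos ha
  calc ∫⁻ x, f (a * x) * ENNReal.ofReal (nrm x)⁻¹ ∂μ
      = ∫⁻ x, ENNReal.ofReal (nrm a) * (f (a * x) * ENNReal.ofReal (nrm (a * x))⁻¹) ∂μ := by
        refine lintegral_congr fun x => ?_
        rw [mul_left_comm, ← ENNReal.ofReal_mul hp.le, nrm_mul, mul_inv, mul_inv_cancel_left₀ hp.ne']
    _ = ∫⁻ x, f x * ENNReal.ofReal (nrm x)⁻¹ ∂μ := by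
        rw [lintegral_const_mul' _ _ ENNReal.ofReal_ne_top, h, ← mul_assoc,
          ← ENNReal.ofReal_mul hp.le, mul_inv_cancel₀ hp.ne', ENNReal.ofReal_one, one_mul]

/-- The multiplicative Haar measure is invariant under inversion: compare the double integrals of
`f x * g (x / y)` and `f (x y) * g x`. -/
lemma lintegral_haar_inv {g : F → ℝ≥0∞} (hg : Measurable g) :
    ∫⁻ x, g x⁻¹ * ENNReal.ofReal (nrm x)⁻¹ ∂μ = ∫⁻ x, g x * ENNReal.ofReal (nrm x)⁻¹ ∂μ := by
  set k : F → ℝ≥0∞ := fun x => ENNReal.ofReal (nrm x)⁻¹ with hk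
  have hkm : Measurable k := ENNReal.measurable_ofReal.comp measurable_nrm.inv
  -- the auxiliary function `f` only has to have a finite positive integral
  set f : F → ℝ≥0∞ := (Metric.closedBall (0 : F) 1).indicator fun x => ENNReal.ofReal (nrm x)
    with hf
  have hfm : Measurable f := (ENNReal.measurable_ofReal.comp measurable_nrm).indicator
    Metric.isClosed_closedBall.measurableSet
  have hfk : ∫⁻ x, f x * k x ∂μ = μ (Metric.closedBall 0 1) := by
    rw [← lintegral_indicator_one Metric.isClosed_closedBall.measurableSet]
    refine lintegral_congr_ae ?_
    filter_upwards [ae_ne μ 0] with x hx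
    by_cases h : x ∈ Metric.closedBall (0 : F) 1
    · simp only [hf, hk, Set.indicator_of_mem h, Pi.one_apply]
      rw [← ENNReal.ofReal_mul (nrm_nonneg x), mul_inv_cancel₀ (nrm_pos hx).ne', ENNReal.ofReal_one]
    · simp [hf, Set.indicator_of_notMem h]
  have key : (∫⁻ x, f x * k x ∂μ) * ∫⁻ y, g y⁻¹ * k y ∂μ
      = (∫⁻ x, g x * k x ∂μ) * ∫⁻ y, f y * k y ∂μ := by
    calc (∫⁻ x, f x * k x ∂μ) * ∫⁻ y, g y⁻¹ * k y ∂μ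
        = ∫⁻ x, f x * k x * ∫⁻ y, g (x * y⁻¹) * k y ∂μ ∂μ := by
          rw [← lintegral_mul_const (f := fun x => f x * k x) _ (hfm.mul hkm)]
          refine lintegral_congr_ae ?_
          filter_upwards [ae_ne μ 0] with x hx
          congr 1
          rw [← lintegral_haar_mul μ (inv_ne_zero hx) fun y => g y⁻¹]
          simp [hk, mul_comm]
      _ = ∫⁻ x, ∫⁻ y, f x * k x * (g (x * y⁻¹) * k y) ∂μ ∂μ := by
          refine lintegral_congr fun x => ?_
          rw [lintegral_const_mul]
          exact (hg.comp (measurable_const.mul measurable_id.inv)).mul hkm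
      _ = ∫⁻ y, ∫⁻ x, f x * k x * (g (x * y⁻¹) * k y) ∂μ ∂μ := by
          refine lintegral_lintegral_swap (Measurable.aemeasurable ?_)
          exact ((hfm.comp measurable_fst).mul (hkm.comp measurable_fst)).mul
            ((hg.comp (measurable_fst.mul measurable_snd.inv)).mul (hkm.comp measurable_snd))
      _ = ∫⁻ y, ∫⁻ x, f (x * y) * g x * k x * k y ∂μ ∂μ := by
          refine lintegral_congr_ae ?_
          filter_upwards [ae_ne μ 0] with y hy
          have := lintegral_haar_mul μ hy fun x => f x * g (x * y⁻¹) * k y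
          rw [show (fun x => f x * k x * (g (x * y⁻¹) * k y)) =
            fun x => f x * g (x * y⁻¹) * k y * k x by ext; ring, ← this]
          refine lintegral_congr fun x => ?_
          rw [mul_comm y x, mul_inv_cancel_right₀ hy]; ring
      _ = ∫⁻ x, ∫⁻ y, f (x * y) * g x * k x * k y ∂μ ∂μ := by
          refine lintegral_lintegral_swap (Measurable.aemeasurable ?_)
          exact (((hfm.comp (measurable_snd.mul measurable_fst)).mul (hg.comp measurable_snd)).mul
            (hkm.comp measurable_snd)).mul (hkm.comp measurable_fst)
      _ = ∫⁻ x, g x * k x * ∫⁻ y, f y * k y ∂μ ∂μ := by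
          refine lintegral_congr_ae ?_
          filter_upwards [ae_ne μ 0] with x hx
          rw [← lintegral_haar_mul μ hx f, ← lintegral_const_mul]
          · exact lintegral_congr fun y => by ring
          · exact (hfm.comp (measurable_const_mul x)).mul hkm
      _ = _ := lintegral_mul_const _ (hg.mul hkm)
  rw [hfk, mul_comm] at key
  exact (ENNReal.mul_left_inj (Metric.measure_closedBall_pos _ _ one_pos).ne'
    measure_closedBall_lt_top.ne).1 key

/-- The Jacobian `‖x‖ ^ (-2)` of the inversion `x ↦ x⁻¹`. -/
noncomputable def invJac (x : F) : ℝ≥0 := Real.toNNReal ((nrm x)⁻¹ ^ 2)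

lemma coe_invJac (x : F) : (invJac x : ℝ) = (nrm x)⁻¹ ^ 2 := Real.coe_toNNReal _ (by positivity)

lemma measurable_invJac : Measurable (invJac : F → ℝ≥0) :=
  measurable_real_toNNReal.comp (measurable_nrm.inv.pow_const 2)

lemma map_inv_withDensity :
    (μ.withDensity fun x => (invJac x : ℝ≥0∞)).map Inv.inv = μ := by
  ext s hs
  have hsm : Measurable (s.indicator (1 : F → ℝ≥0∞)) := measurable_one.indicator hs
  rw [← lintegral_indicator_one hs, ← lintegral_indicator_one hs,
    lintegral_map hsm measurable_inv]
  have h0 := lintegral_withDensity_eq_lintegral_mul μ measurable_invJac.coe_nnreal_ennreal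
    (hsm.comp measurable_inv)
  simp only [Function.comp_def] at h0
  rw [h0]
  have h := lintegral_haar_inv μ (g := fun x => s.indicator 1 x * ENNReal.ofReal (nrm x))
    (hsm.mul
      (ENNReal.measurable_ofReal.comp measurable_nrm))
  refine Eq.trans (lintegral_congr fun x => ?_) (h.trans (lintegral_congr_ae ?_))
  · rw [nrm_inv, mul_assoc, ← ENNReal.ofReal_mul (inv_nonneg.2 (nrm_nonneg x)), ← sq,
      Pi.mul_apply, mul_comm]
    congr 1
  · filter_upwards [ae_ne μ 0] with x hx
    rw [mul_assoc, ← ENNReal.ofReal_mul (nrm_nonneg x), mul_inv_cancel₀ (nrm_pos hx).ne',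
      ENNReal.ofReal_one, mul_one]

lemma lintegral_inv (f : F → ℝ≥0∞) (hf : Measurable f) :
    ∫⁻ x, ENNReal.ofReal ((nrm x)⁻¹ ^ 2) * f x⁻¹ ∂μ = ∫⁻ x, f x ∂μ := by
  conv_rhs => rw [← map_inv_withDensity μ, lintegral_map hf measurable_inv]
  exact (lintegral_withDensity_eq_lintegral_mul μ measurable_invJac.coe_nnreal_ennreal
    (hf.comp measurable_inv)).symm

variable {E : Type*} [NormedAddCommGroup E] [NormedSpace ℝ E]

lemma integral_inv (f : F → E) : ∫ x, ((nrm x)⁻¹ ^ 2) • f x⁻¹ ∂μ = ∫ x, f x ∂μ := by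
  conv_rhs => rw [← map_inv_withDensity μ]
  have h := integral_map_equiv (μ := μ.withDensity fun x => (invJac x : ℝ≥0∞))
    (MeasurableEquiv.inv F) f
  rw [show ⇑(MeasurableEquiv.inv F) = Inv.inv from rfl] at h
  rw [h,
    integral_withDensity_eq_integral_smul measurable_invJac]
  simp [NNReal.smul_def, coe_invJac]

lemma integrable_inv {f : F → E} :
    Integrable (fun x => ((nrm x)⁻¹ ^ 2) • f x⁻¹) μ ↔ Integrable f μ := by
  have h := integrable_map_equiv (μ := μ.withDensity fun x => (invJac x : ℝ≥0∞))
    (MeasurableEquiv.inv F) f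
  rw [show ⇑(MeasurableEquiv.inv F) = Inv.inv from rfl] at h
  conv_rhs => rw [← map_inv_withDensity μ]
  rw [h,
    integrable_withDensity_iff_integrable_smul measurable_invJac]
  simp [NNReal.smul_def, coe_invJac]

end Inversion


/-! ### Integrability of powers of the absolute value -/

section Integrability

variable {F : Type*} [NontriviallyNormedField F] [ProperSpace F] [MeasurableSpace F] [BorelSpace F]
  (μ : Measure F) [μ.IsAddHaarMeasure]

lemma measurableSet_nrm_le (r : ℝ) : MeasurableSet {x : F | nrm x ≤ r} :=
  measurableSet_le measurable_nrm measurable_const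

lemma measurableSet_nrm_lt (r : ℝ) : MeasurableSet {x : F | r < nrm x} :=
  measurableSet_lt measurable_const measurable_nrm

/-- Local integrability at the origin, from the geometric decomposition of the unit ball into
multiples of a fundamental annulus. -/
lemma integrableOn_nrm_rpow {α : ℝ} (hα : -1 < α) :
    IntegrableOn (fun x : F => nrm x ^ α) {x | nrm x ≤ 1} μ := by
  have hmeas : Measurable fun x : F => nrm x ^ α := measurable_nrm.pow_const α
  refine ⟨hmeas.aestronglyMeasurable, ?_⟩
  rw [hasFiniteIntegral_iff_ofReal (Eventually.of_forall fun x => Real.rpow_nonneg (nrm_nonneg x) _)]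
  obtain ⟨b, hb0, hb1⟩ := NormedField.exists_norm_lt_one F
  have hbn : b ≠ 0 := norm_pos_iff.1 hb0
  set q := nrm b with hq
  have hq0 : 0 < q := nrm_pos hbn
  have hq1 : q < 1 := by
    have := one_lt_nrm (x := b⁻¹) (by rw [norm_inv]; exact (one_lt_inv₀ hb0).2 hb1)
    rw [nrm_inv] at this
    exact (one_lt_inv₀ hq0).1 this
  -- the unit ball without the origin is the union of the sets `b ^ k A`
  set A : Set F := {x | ‖b‖ < ‖x‖ ∧ ‖x‖ ≤ 1} with hA
  have hAm : MeasurableSet A :=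
    (measurableSet_lt measurable_const measurable_norm).inter
      (measurableSet_le measurable_norm measurable_const)
  have hAf : μ A < ∞ :=
    (measure_mono (show A ⊆ Metric.closedBall 0 1 from fun x hx => by simpa using hx.2)).trans_lt
      measure_closedBall_lt_top
  set M : ℝ := 1 + q ^ α with hM
  have hM0 : 0 ≤ M := by positivity
  have hAM : ∀ a ∈ A, nrm a ^ α ≤ M := by
    intro a ha
    have h1 : q ≤ nrm a := nrm_le_nrm ha.1.le
    have h2 : nrm a ≤ 1 := nrm_le_one ha.2
    rcases le_total 0 α with h | h
    · have := Real.rpow_le_one (nrm_nonneg a) h2 h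
      have := Real.rpow_nonneg hq0.le α
      linarith
    · have := Real.rpow_le_rpow_of_nonpos hq0 h1 h
      linarith
  set g : ℕ → F → ℝ≥0∞ := fun k x =>
    A.indicator (fun _ => ENNReal.ofReal (M * (q ^ k) ^ α)) ((b ^ k)⁻¹ * x) with hg
  have hbound : ∀ x : F, x ≠ 0 → nrm x ≤ 1 → ENNReal.ofReal (nrm x ^ α) ≤ ∑' k, g k x := by
    intro x hx hx1
    obtain ⟨k, hk1, hk2⟩ := exists_nat_pow_near_of_lt_one (norm_pos_iff.2 hx) (nrm_le_one_iff.1 hx1)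
      hb0 hb1
    refine le_trans ?_ (ENNReal.le_tsum k)
    have hbk : 0 < ‖b‖ ^ k := pow_pos hb0 k
    have hmem : (b ^ k)⁻¹ * x ∈ A := by
      simp only [hA, Set.mem_ofPred_eq, norm_mul, norm_inv, norm_pow]
      rw [inv_mul_eq_div, lt_div_iff₀ hbk, div_le_one hbk]
      exact ⟨by rwa [pow_succ, mul_comm] at hk1, hk2⟩
    simp only [hg, Set.indicator_of_mem hmem]
    refine ENNReal.ofReal_le_ofReal ?_
    have hxe : nrm x = q ^ k * nrm ((b ^ k)⁻¹ * x) := by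
      rw [nrm_mul, nrm_inv, nrm_pow, mul_inv_cancel_left₀ (pow_pos hq0 k).ne']
    rw [hxe, Real.mul_rpow (by positivity) (nrm_nonneg _), mul_comm]
    have := hAM _ hmem
    gcongr
  have hgm : ∀ k, Measurable (g k) := fun k =>
    (measurable_const.indicator hAm).comp (measurable_const_mul _)
  -- the integrals form a geometric series with ratio `q ^ (α + 1) < 1`
  have hint : ∀ k, ∫⁻ x, g k x ∂μ = ENNReal.ofReal (M * (q ^ (α + 1)) ^ k) * μ A := by
    intro k
    rw [hg]
    simp only
    rw [lintegral_mul_left μ (inv_ne_zero (pow_ne_zero k hbn)), lintegral_indicator hAm,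
      setLIntegral_const, ← mul_assoc, ← ENNReal.ofReal_mul (by simp [nrm_nonneg]), nrm_inv, inv_inv,
      nrm_pow]
    congr 2
    rw [Real.rpow_add_one hq0.ne', mul_pow, ← Real.rpow_natCast (q ^ α), ← Real.rpow_natCast q,
      ← Real.rpow_mul hq0.le, ← Real.rpow_mul hq0.le, mul_comm α]
    ring
  calc ∫⁻ x in {x | nrm x ≤ 1}, ENNReal.ofReal (nrm x ^ α) ∂μ
      ≤ ∫⁻ x, ∑' k, g k x ∂μ := by
        rw [← lintegral_indicator (measurableSet_nrm_le 1)]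
        refine lintegral_mono_ae ?_
        filter_upwards [ae_ne μ 0] with x hx
        by_cases h : nrm x ≤ 1
        · rw [Set.indicator_of_mem (show x ∈ {x : F | nrm x ≤ 1} from h)]; exact hbound x hx h
        · rw [Set.indicator_of_notMem (show x ∉ {x : F | nrm x ≤ 1} from h)]; exact zero_le
    _ = ∑' k : ℕ, ENNReal.ofReal (M * (q ^ (α + 1)) ^ k) * μ A := by
        rw [lintegral_tsum fun k => (hgm k).aemeasurable]
        exact tsum_congr hint
    _ < ∞ := by
        rw [ENNReal.tsum_mul_right]
        refine ENNReal.mul_lt_top ?_ hAf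
        refine Summable.tsum_ofReal_lt_top (Summable.mul_left M ?_)
        exact summable_geometric_of_lt_one (by positivity)
          (Real.rpow_lt_one hq0.le hq1 (by linarith))

lemma integrableOn_nrm_rpow_ge {α : ℝ} (hα : α < -1) :
    IntegrableOn (fun x : F => nrm x ^ α) {x | 1 ≤ nrm x} μ := by
  have h := integrableOn_nrm_rpow μ (α := -α - 2) (by linarith)
  rw [← integrable_indicator_iff (measurableSet_nrm_le 1), ← integrable_inv] at h
  have hms : MeasurableSet {x : F | 1 ≤ nrm x} := measurableSet_le measurable_const measurable_nrm
  rw [← integrable_indicator_iff hms]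
  refine h.congr ?_
  filter_upwards [ae_ne μ 0] with x hx
  have hp := nrm_pos hx
  by_cases h1 : 1 ≤ nrm x
  · rw [Set.indicator_of_mem (show x⁻¹ ∈ {x : F | nrm x ≤ 1} by
      simpa [nrm_inv] using inv_le_one_of_one_le₀ h1),
      Set.indicator_of_mem (show x ∈ {x : F | 1 ≤ nrm x} from h1), nrm_inv, smul_eq_mul,
      Real.inv_rpow hp.le, ← Real.rpow_neg hp.le, inv_pow, ← Real.rpow_natCast,
      ← Real.rpow_neg hp.le, ← Real.rpow_add hp]
    congr 1; push_cast; ring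
  · rw [Set.indicator_of_notMem (show x⁻¹ ∉ {x : F | nrm x ≤ 1} by
      simp only [Set.mem_ofPred_eq, nrm_inv, not_le]; exact (one_lt_inv₀ hp).2 (not_le.1 h1)),
      Set.indicator_of_notMem (show x ∉ {x : F | 1 ≤ nrm x} from h1), smul_zero]

lemma isCompact_nrm_le (r : ℝ) : IsCompact {x : F | nrm x ≤ r} := by
  refine Metric.isCompact_of_isClosed_isBounded (isClosed_le continuous_nrm continuous_const) ?_
  refine (Metric.isBounded_closedBall (x := (0 : F)) (r := r ^ (nrmExp F)⁻¹)).subset fun x hx => ?_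
  simp only [Set.mem_ofPred_eq, nrm_eq_rpow] at hx
  rw [mem_closedBall_zero_iff]
  have := Real.rpow_le_rpow (by positivity) hx (inv_nonneg.2 (nrmExp_pos F).le)
  rwa [Real.rpow_rpow_inv (norm_nonneg _) (nrmExp_pos F).ne'] at this

lemma integrableAtFilter_nhds_rpow_mul {γ : ℝ} (hγ : -1 < γ) (x : F) {g : F → ℝ}
    (hg : ContinuousAt g x) (hgm : Measurable g) :
    IntegrableAtFilter (fun s => nrm (s - x) ^ γ * g s) (𝓝 x) μ := by
  have hU : ∀ᶠ s in 𝓝 x, ‖g s‖ ≤ ‖g x‖ + 1 :=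
    (hg.norm.eventually_lt continuousAt_const (lt_add_one _)).mono fun s hs => hs.le
  have hV : ∀ᶠ s in 𝓝 x, nrm (s - x) ≤ 1 := by
    have : ContinuousAt (fun s => nrm (s - x)) x :=
      (continuous_nrm.comp (continuous_id.sub continuous_const)).continuousAt
    exact (this.eventually_lt continuousAt_const (by simp)).mono fun s hs => hs.le
  have hns : Measurable fun s => nrm (s - x) := measurable_nrm.comp (measurable_id.sub_const x)
  have hms : MeasurableSet {s | nrm (s - x) ≤ 1} := measurableSet_le hns measurable_const
  have hm : Measurable fun s => nrm (s - x) ^ γ := hns.pow_const γ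
  refine ⟨{s | ‖g s‖ ≤ ‖g x‖ + 1} ∩ {s | nrm (s - x) ≤ 1}, inter_mem hU hV, ?_⟩
  have h1 : IntegrableOn (fun s => nrm (s - x) ^ γ) {s | nrm (s - x) ≤ 1} μ := by
    have h := integrableOn_nrm_rpow μ hγ
    rw [← integrable_indicator_iff (measurableSet_nrm_le 1)] at h
    have h2 := h.comp_sub_right x
    rw [← integrable_indicator_iff hms]
    exact h2
  have h2 : IntegrableOn (fun s => nrm (s - x) ^ γ)
    ({s | ‖g s‖ ≤ ‖g x‖ + 1} ∩ {s | nrm (s - x) ≤ 1}) μ := h1.mono_set Set.inter_subset_right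
  refine Integrable.mono' (h2.const_mul (‖g x‖ + 1)) (hm.mul hgm).aestronglyMeasurable ?_
  refine (ae_restrict_iff' (((measurableSet_le hgm.norm measurable_const)).inter
    hms)).2
    (Eventually.of_forall fun s hs => ?_)
  rw [norm_mul, Real.norm_of_nonneg (Real.rpow_nonneg (nrm_nonneg _) _), mul_comm]
  gcongr
  · exact Real.rpow_nonneg (nrm_nonneg _) _
  · exact hs.1

lemma continuousAt_nrm_sub_rpow {a x : F} (h : x ≠ a) (α : ℝ) :
    ContinuousAt (fun s : F => nrm (s - a) ^ α) x :=
  (continuous_nrm.comp (continuous_id.sub continuous_const)).continuousAt.rpow_const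
    (Or.inl (nrm_pos (sub_ne_zero.2 h)).ne')

/-- Integrability of a product of powers of the distances to distinct points. -/
lemma integrable_prod_rpow {ι : Type*} [Fintype ι] {a : ι → F} (ha : Function.Injective a)
    {α : ι → ℝ} (hα : ∀ i, -1 < α i) (hsum : ∑ i, α i < -1) :
    Integrable (fun s => ∏ i, nrm (s - a i) ^ α i) μ := by
  classical
  have hm : ∀ i, Measurable fun s => nrm (s - a i) ^ α i := fun i =>
    (measurable_nrm.comp (measurable_id.sub_const _)).pow_const _
  refine LocallyIntegrable.integrable_of_isBigO_cocompact
    (g := fun s => ∏ i, nrm s ^ α i) (fun x => ?_) ?_ ?_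
  · by_cases hx : ∃ i, x = a i
    · obtain ⟨i, rfl⟩ := hx
      simp_rw [← Finset.mul_prod_erase Finset.univ _ (Finset.mem_univ i)]
      refine integrableAtFilter_nhds_rpow_mul μ (hα i) (a i) ?_ (Finset.measurable_prod _ fun j _ => hm j)
      refine tendsto_finsetProd _ fun j hj => continuousAt_nrm_sub_rpow ?_ _
      exact fun h => (Finset.ne_of_mem_erase hj) (ha h).symm
    · push Not at hx
      have := integrableAtFilter_nhds_rpow_mul μ (γ := 0) (by norm_num) x
        (g := fun s => ∏ i, nrm (s - a i) ^ α i)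
        (tendsto_finsetProd _ fun j hj => continuousAt_nrm_sub_rpow (hx j) _)
        (Finset.measurable_prod _ fun j _ => hm j)
      simpa using this
  · refine Asymptotics.IsBigO.finsetProd fun i _ => ?_
    have h1 : Tendsto (fun s : F => nrm (1 - a i * s⁻¹) ^ α i) (cocompact F) (𝓝 1) := by
      have h0 : Tendsto (fun s : F => 1 - a i * s⁻¹) (cocompact F) (𝓝 1) := by
        have := (tendsto_inv₀_cobounded (α := F)).const_mul (a i)
        rw [Metric.cobounded_eq_cocompact] at this
        simpa using this.const_sub 1
      have h2 := ((continuous_nrm (F := F)).tendsto 1).comp h0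
      rw [nrm_one] at h2
      simpa using h2.rpow_const (p := α i) (Or.inl one_ne_zero)
    have h3 : (fun s : F => nrm (s - a i) ^ α i) =ᶠ[cocompact F]
        fun s => nrm (1 - a i * s⁻¹) ^ α i * nrm s ^ α i := by
      have : ∀ᶠ s in cocompact F, s ≠ 0 := by
        have := (isCompact_singleton (x := (0 : F))).compl_mem_cocompact
        exact this
      filter_upwards [this] with s hs
      rw [← Real.mul_rpow (nrm_nonneg _) (nrm_nonneg _), ← nrm_mul]
      congr 2
      field_simp
    refine h3.trans_isBigO ?_
    simpa using h1.isBigO_one ℝ |>.mul (Asymptotics.isBigO_refl (fun s => nrm s ^ α i) _)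
  · refine ⟨{x | 1 ≤ nrm x}, ?_, ?_⟩
    · refine mem_of_superset (isCompact_nrm_le (F := F) 1).compl_mem_cocompact fun x hx => ?_
      simp only [Set.mem_compl_iff, Set.mem_ofPred_eq, not_le] at hx
      exact hx.le
    · refine (integrableOn_nrm_rpow_ge μ hsum).congr_fun (fun x hx => ?_)
        (measurableSet_le measurable_const measurable_nrm)
      exact Real.rpow_sum_of_pos (lt_of_lt_of_le one_pos hx) _ _

end Integrability


/-! ### Radial integrals and their regularization -/

section RadialIntegrals

variable {F : Type*} [NontriviallyNormedField F] [ProperSpace F] [MeasurableSpace F] [BorelSpace F]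
  (μ : Measure F) [μ.IsAddHaarMeasure]

/-- The integral of `‖p‖ ^ (a - 1)` over the unit ball; it converges for `Re a > 0`. -/
noncomputable def unitInt (a : ℂ) : ℂ := ∫ p in {p : F | nrm p ≤ 1}, npow p (a - 1) ∂μ

/-- The integral of `‖p‖ ^ (a - 1)` over the annulus `1 < ‖p‖ ≤ ‖b‖`. -/
noncomputable def annInt (b : F) (a : ℂ) : ℂ :=
  ∫ p in {p : F | 1 < nrm p ∧ nrm p ≤ nrm b}, npow p (a - 1) ∂μ

/-- The value at `Re c = 0` of the continuation of `unitInt`, as a limit from the right; the limit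
exists if `‖·‖ ^ c` is nontrivial (`tendsto_unitInt`). -/
noncomputable def unitReg (c : ℂ) : ℂ := limUnder (𝓝[>] (0 : ℝ)) fun ε : ℝ => unitInt μ (c + ε)

/-- The volume of the unit sphere. -/
noncomputable def sphereVol : ℝ := μ.real {p : F | nrm p = 1}

lemma measurableSet_annulus (b : F) : MeasurableSet {p : F | 1 < nrm p ∧ nrm p ≤ nrm b} :=
  (measurableSet_nrm_lt 1).inter (measurableSet_nrm_le _)

lemma integrableOn_npow_unit {a : ℂ} (ha : 0 < a.re) :
    IntegrableOn (fun p : F => npow p (a - 1)) {p | nrm p ≤ 1} μ := by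
  refine Integrable.mono' (integrableOn_nrm_rpow μ (α := a.re - 1) (by linarith))
    (measurable_npow _).aestronglyMeasurable (Eventually.of_forall fun p => ?_)
  simpa using norm_npow_le p (a - 1)

lemma measure_nrm_le_lt_top (r : ℝ) : μ {p : F | nrm p ≤ r} < ∞ :=
  (isCompact_nrm_le r).measure_lt_top

lemma integrableOn_npow_annulus (b : F) (a : ℂ) :
    IntegrableOn (fun p : F => npow p (a - 1)) {p | 1 < nrm p ∧ nrm p ≤ nrm b} μ := by
  have hc : IsCompact {p : F | 1 ≤ nrm p ∧ nrm p ≤ nrm b} :=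
    (isCompact_nrm_le (nrm b)).inter_left (isClosed_le continuous_const continuous_nrm)
  have : ContinuousOn (fun p : F => npow p (a - 1)) {p | 1 ≤ nrm p ∧ nrm p ≤ nrm b} := by
    intro p hp
    refine (continuousAt_npow ?_ _).continuousWithinAt
    rintro rfl
    have := hp.1
    rw [nrm_zero] at this; linarith
  exact (this.integrableOn_compact hc).mono_set fun p hp => ⟨hp.1.le, hp.2⟩

lemma npow_mul_unitInt {b : F} (hb : b ≠ 0) (a : ℂ) :
    npow b a * unitInt μ a = ∫ p in {p : F | nrm p ≤ nrm b}, npow p (a - 1) ∂μ := by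
  have hb' := nrm_pos hb
  rw [unitInt, ← integral_indicator (measurableSet_nrm_le _),
    ← integral_indicator (measurableSet_nrm_le _)]
  have h := integral_mul_left μ hb ({p : F | nrm p ≤ nrm b}.indicator fun p => npow p (a - 1))
  rw [eq_comm, inv_smul_eq_iff₀ hb'.ne'] at h
  rw [h, Complex.real_smul, ← integral_const_mul, ← integral_const_mul]
  congr 1
  ext p
  have hmem : b * p ∈ {p : F | nrm p ≤ nrm b} ↔ p ∈ {p : F | nrm p ≤ 1} := by
    simp only [Set.mem_ofPred_eq, nrm_mul]
    rw [mul_le_iff_le_one_right hb']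
  by_cases hp : p ∈ {p : F | nrm p ≤ 1}
  · rw [Set.indicator_of_mem hp, Set.indicator_of_mem (hmem.2 hp), npow_mul, ← mul_assoc,
      ← npow_one_exp, ← npow_add hb]
    ring_nf
  · rw [Set.indicator_of_notMem hp, Set.indicator_of_notMem (fun h => hp (hmem.1 h))]
    simp

lemma ne_zero_of_one_le_nrm {b : F} (hb : 1 ≤ nrm b) : b ≠ 0 := by
  rintro rfl; rw [nrm_zero] at hb; linarith

lemma npow_sub_one_mul_unitInt {a : ℂ} (ha : 0 < a.re) {b : F} (hb : 1 ≤ nrm b) :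
    (npow b a - 1) * unitInt μ a = annInt μ b a := by
  rw [sub_mul, one_mul, npow_mul_unitInt μ (ne_zero_of_one_le_nrm hb), sub_eq_iff_eq_add, annInt,
    unitInt, ← setIntegral_union _ (measurableSet_nrm_le 1) (integrableOn_npow_annulus μ b a)
      (integrableOn_npow_unit μ ha)]
  · congr 2
    ext p
    simp only [Set.mem_union, Set.mem_ofPred_eq]
    constructor
    · intro h
      rcases le_or_gt (nrm p) 1 with h1 | h1
      · exact Or.inr h1
      · exact Or.inl ⟨h1, h⟩
    · rintro (h | h)
      · exact h.2
      · exact h.trans hb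
  · rw [Set.disjoint_left]
    rintro p ⟨h1, -⟩ h2
    exact absurd h1 (not_lt.2 h2)

lemma tendsto_annInt {ι : Type*} {l : Filter ι} [l.IsCountablyGenerated] (b : F) {a : ι → ℂ}
    {a₀ : ℂ} (ha : Tendsto a l (𝓝 a₀)) (h1 : ∀ᶠ i in l, (a i).re ≤ 1) :
    Tendsto (fun i => annInt μ b (a i)) l (𝓝 (annInt μ b a₀)) := by
  refine tendsto_integral_filter_of_dominated_convergence (fun _ => (1 : ℝ))
    (Eventually.of_forall fun i => (measurable_npow _).aestronglyMeasurable) ?_ ?_ ?_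
  · filter_upwards [h1] with i hi
    refine (ae_restrict_iff' (measurableSet_annulus b)).2 (Eventually.of_forall fun p hp => ?_)
    refine (norm_npow_le p _).trans (Real.rpow_le_one_of_one_le_of_nonpos hp.1.le ?_)
    simpa using hi
  · refine (integrableOn_const (μ := μ) ?_ (by simp))
    exact ((measure_mono fun p hp => hp.2).trans_lt (measure_nrm_le_lt_top μ (nrm b))).ne
  · refine (ae_restrict_iff' (measurableSet_annulus b)).2 (Eventually.of_forall fun p hp => ?_)
    exact (continuousAt_npow_exp (ne_zero_of_one_le_nrm hp.1.le) _).tendsto.comp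
      (ha.sub_const 1)

lemma annInt_zero (hμ : IsNormalizedHaar μ) {b : F} (hb : 1 ≤ nrm b) :
    annInt μ b 0 = Real.log (nrm b) := by
  rw [annInt, ← hμ b hb]
  simp only [zero_sub, npow_neg_one]
  exact integral_ofReal

lemma tendsto_add_ofReal (c : ℂ) : Tendsto (fun ε : ℝ => c + ε) (𝓝[>] (0 : ℝ)) (𝓝 c) := by
  have : Tendsto (fun ε : ℝ => c + (ε : ℂ)) (𝓝 0) (𝓝 (c + ((0 : ℝ) : ℂ))) :=
    (Complex.continuous_ofReal.tendsto 0).const_add c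
  simpa using this.mono_left nhdsWithin_le_nhds

lemma eventually_small {δ : ℝ} (hδ : 0 < δ) : ∀ᶠ ε : ℝ in 𝓝[>] 0, 0 < ε ∧ ε < δ := by
  filter_upwards [Ioo_mem_nhdsGT hδ] with ε hε using hε

lemma exists_one_lt_nrm : ∃ b : F, 1 < nrm b := by
  obtain ⟨b, hb⟩ := NormedField.exists_one_lt_norm F
  exact ⟨b, one_lt_nrm hb⟩

/-- The residue at `0` of the radial integral is `1`, by the normalization of the measure. -/
lemma tendsto_mul_unitInt (hμ : IsNormalizedHaar μ) :
    Tendsto (fun ε : ℝ => (ε : ℂ) * unitInt μ ε) (𝓝[>] 0) (𝓝 1) := by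
  obtain ⟨b, hb⟩ := exists_one_lt_nrm (F := F)
  have hb0 : b ≠ 0 := ne_zero_of_one_le_nrm hb.le
  have hl : Real.log (nrm b) ≠ 0 := (Real.log_pos hb).ne'
  have h1 : Tendsto (fun ε : ℝ => annInt μ b ε) (𝓝[>] 0) (𝓝 (Real.log (nrm b))) := by
    rw [← annInt_zero μ hμ hb.le]
    refine tendsto_annInt μ b (by simpa using tendsto_add_ofReal 0) ?_
    filter_upwards [eventually_small one_pos] with ε hε
    simpa using hε.2.le
  have h2 : Tendsto (fun ε : ℝ => (((nrm b ^ ε - 1) / ε : ℝ) : ℂ)) (𝓝[>] 0)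
      (𝓝 (Real.log (nrm b))) := by
    refine (Complex.continuous_ofReal.tendsto _).comp ?_
    have := (Real.hasStrictDerivAt_const_rpow (nrm_pos hb0) 0).hasDerivAt.tendsto_slope_zero_right
    simp only [zero_add, Real.rpow_zero, one_mul, smul_eq_mul] at this
    refine this.congr fun ε => ?_
    rw [div_eq_inv_mul]
  have h3 := h1.div h2 (Complex.ofReal_ne_zero.2 hl)
  rw [div_self (Complex.ofReal_ne_zero.2 hl)] at h3
  refine h3.congr' ?_
  filter_upwards [eventually_small one_pos] with ε hε
  have hne : ((nrm b ^ ε - 1 : ℝ) : ℂ) ≠ 0 := by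
    rw [Complex.ofReal_ne_zero]
    have := Real.one_lt_rpow hb hε.1
    exact (by linarith : (0 : ℝ) < nrm b ^ ε - 1).ne'
  have hε0 : (ε : ℂ) ≠ 0 := Complex.ofReal_ne_zero.2 hε.1.ne'
  rw [Pi.div_apply, ← npow_sub_one_mul_unitInt μ (by simpa using hε.1) hb.le, npow_ofReal]
  push_cast at hne ⊢
  field_simp

/-- A nontrivial unitary power of the absolute value is nontrivial on elements of absolute value
greater than one. -/
lemma exists_npow_ne_one {c : ℂ} (h : ∃ x : F, x ≠ 0 ∧ npow x c ≠ 1) :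
    ∃ b : F, 1 ≤ nrm b ∧ npow b c ≠ 1 := by
  obtain ⟨x, hx, hxc⟩ := h
  rcases le_total 1 (nrm x) with h1 | h1
  · exact ⟨x, h1, hxc⟩
  · refine ⟨x⁻¹, ?_, ?_⟩
    · rw [nrm_inv]; exact (one_le_inv₀ (nrm_pos hx)).2 h1
    · rwa [npow_inv, Ne, inv_eq_one]

lemma tendsto_unitInt_aux {c : ℂ} (hc : c.re = 0) {b : F} (hb : 1 ≤ nrm b) (hbc : npow b c ≠ 1) :
    Tendsto (fun ε : ℝ => unitInt μ (c + ε)) (𝓝[>] 0) (𝓝 (annInt μ b c / (npow b c - 1))) := by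
  have hb0 := ne_zero_of_one_le_nrm hb
  have h1 : Tendsto (fun ε : ℝ => annInt μ b (c + ε)) (𝓝[>] 0) (𝓝 (annInt μ b c)) := by
    refine tendsto_annInt μ b (tendsto_add_ofReal c) ?_
    filter_upwards [eventually_small one_pos] with ε hε
    simpa [hc] using hε.2.le
  have h2 : Tendsto (fun ε : ℝ => npow b (c + ε) - 1) (𝓝[>] 0) (𝓝 (npow b c - 1)) :=
    ((continuousAt_npow_exp hb0 c).tendsto.comp (tendsto_add_ofReal c)).sub_const 1
  refine (h1.div h2 (sub_ne_zero.2 hbc)).congr' ?_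
  filter_upwards [eventually_small one_pos, h2.eventually_ne (sub_ne_zero.2 hbc)] with ε hε hne
  rw [Pi.div_apply, ← npow_sub_one_mul_unitInt μ (by simpa [hc] using hε.1) hb, mul_comm,
    mul_div_cancel_right₀ _ hne]

lemma tendsto_unitInt {c : ℂ} (hc : c.re = 0) (h : ∃ x : F, x ≠ 0 ∧ npow x c ≠ 1) :
    Tendsto (fun ε : ℝ => unitInt μ (c + ε)) (𝓝[>] 0) (𝓝 (unitReg μ c)) := by
  obtain ⟨b, hb, hbc⟩ := exists_npow_ne_one h
  exact tendsto_nhds_limUnder ⟨_, tendsto_unitInt_aux μ hc hb hbc⟩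

lemma npow_sub_one_mul_unitReg {c : ℂ} (hc : c.re = 0) (h : ∃ x : F, x ≠ 0 ∧ npow x c ≠ 1)
    {b : F} (hb : 1 ≤ nrm b) : (npow b c - 1) * unitReg μ c = annInt μ b c := by
  have h1 : Tendsto (fun ε : ℝ => annInt μ b (c + ε)) (𝓝[>] 0) (𝓝 (annInt μ b c)) := by
    refine tendsto_annInt μ b (tendsto_add_ofReal c) ?_
    filter_upwards [eventually_small one_pos] with ε hε
    simpa [hc] using hε.2.le
  have h2 : Tendsto (fun ε : ℝ => npow b (c + ε) - 1) (𝓝[>] 0) (𝓝 (npow b c - 1)) :=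
    ((continuousAt_npow_exp (ne_zero_of_one_le_nrm hb) c).tendsto.comp
      (tendsto_add_ofReal c)).sub_const 1
  refine tendsto_nhds_unique (h2.mul (tendsto_unitInt μ hc h)) (h1.congr' ?_)
  filter_upwards [eventually_small one_pos] with ε hε
  rw [← npow_sub_one_mul_unitInt μ (by simpa [hc] using hε.1) hb]

lemma integral_sphere (a : ℂ) :
    ∫ p in {p : F | nrm p = 1}, npow p a ∂μ = sphereVol μ := by
  have : ∫ p in {p : F | nrm p = 1}, npow p a ∂μ = ∫ p in {p : F | nrm p = 1}, (1 : ℂ) ∂μ := by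
    refine setIntegral_congr_fun (measurableSet_eq_fun measurable_nrm measurable_const)
      fun p hp => ?_
    simp only [Set.mem_ofPred_eq] at hp
    simp [npow, hp]
  rw [this, setIntegral_const, sphereVol]
  simp

/-- The scaling relation for the part of the unit ball inside the unit sphere, which corresponds
to the exterior of the unit ball under inversion. -/
lemma npow_sub_one_mul_unitInt_neg {a : ℂ} (ha : 0 < a.re) {b : F} (hb : 1 ≤ nrm b) :
    (1 - npow b (-a)) * (unitInt μ a - sphereVol μ) = annInt μ b (-a) := by
  have hb0 := ne_zero_of_one_le_nrm hb
  have hbp := nrm_pos hb0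
  have hS : MeasurableSet {p : F | nrm p = 1} := measurableSet_eq_fun measurable_nrm measurable_const
  have hlt : ∀ r : ℝ, MeasurableSet {p : F | nrm p < r} := fun r =>
    measurableSet_lt measurable_nrm measurable_const
  -- the left side is an integral over the open unit ball minus one over a smaller open ball, and
  -- the inversion takes the difference of these balls to the annulus
  have hJ : unitInt μ a - sphereVol μ = ∫ p in {p : F | nrm p < 1}, npow p (a - 1) ∂μ := by
    rw [sub_eq_iff_eq_add, ← integral_sphere μ (a - 1), unitInt, ← setIntegral_union _ hS]
    · congr 2
      ext p
      simp only [Set.mem_union, Set.mem_ofPred_eq]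
      exact le_iff_lt_or_eq
    · exact (integrableOn_npow_unit μ ha).mono_set fun p hp => (show nrm p < 1 from hp).le
    · exact (integrableOn_npow_unit μ ha).mono_set fun p hp => le_of_eq hp
    · rw [Set.disjoint_left]
      intro p h1 h2
      exact absurd h2 (ne_of_lt h1)
  have hJb : npow b (-a) * ∫ p in {p : F | nrm p < 1}, npow p (a - 1) ∂μ =
      ∫ p in {p : F | nrm p < (nrm b)⁻¹}, npow p (a - 1) ∂μ := by
    rw [← integral_indicator (hlt _), ← integral_indicator (hlt _)]
    have h := integral_mul_left μ hb0 ({p : F | nrm p < 1}.indicator fun p => npow p (a - 1))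
    rw [eq_comm, inv_smul_eq_iff₀ hbp.ne'] at h
    rw [h, Complex.real_smul, ← integral_const_mul, ← integral_const_mul]
    congr 1
    ext p
    have hmem : b * p ∈ {p : F | nrm p < 1} ↔ p ∈ {p : F | nrm p < (nrm b)⁻¹} := by
      simp only [Set.mem_ofPred_eq, nrm_mul]
      rw [mul_comm, ← lt_div_iff₀ hbp, one_div]
    by_cases hp : p ∈ {p : F | nrm p < (nrm b)⁻¹}
    · rw [Set.indicator_of_mem hp, Set.indicator_of_mem (hmem.2 hp), npow_mul, ← mul_assoc,
        ← mul_assoc, ← npow_one_exp, ← npow_add hb0, ← npow_add hb0]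
      simp
    · rw [Set.indicator_of_notMem hp, Set.indicator_of_notMem (fun h => hp (hmem.1 h))]
      simp
  have hdiff : ∫ p in {p : F | nrm p < 1}, npow p (a - 1) ∂μ =
      (∫ p in {p : F | nrm p < (nrm b)⁻¹}, npow p (a - 1) ∂μ) +
      ∫ p in {p : F | (nrm b)⁻¹ ≤ nrm p ∧ nrm p < 1}, npow p (a - 1) ∂μ := by
    have hbi : (nrm b)⁻¹ ≤ 1 := inv_le_one_of_one_le₀ hb
    rw [← setIntegral_union]
    · congr 2
      ext p
      simp only [Set.mem_union, Set.mem_ofPred_eq]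
      constructor
      · intro h
        rcases lt_or_ge (nrm p) (nrm b)⁻¹ with h1 | h1
        · exact Or.inl h1
        · exact Or.inr ⟨h1, h⟩
      · rintro (h | h)
        · exact h.trans_le hbi
        · exact h.2
    · rw [Set.disjoint_left]
      rintro p h1 ⟨h2, -⟩
      exact absurd h1 (not_lt.2 h2)
    · exact (measurableSet_le measurable_const measurable_nrm).inter (hlt 1)
    · exact (integrableOn_npow_unit μ ha).mono_set fun p hp => (le_of_lt hp).trans hbi
    · exact (integrableOn_npow_unit μ ha).mono_set fun p hp => hp.2.le
  have hann : ∫ p in {p : F | (nrm b)⁻¹ ≤ nrm p ∧ nrm p < 1}, npow p (a - 1) ∂μ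
      = annInt μ b (-a) := by
    have hm : MeasurableSet {p : F | (nrm b)⁻¹ ≤ nrm p ∧ nrm p < 1} :=
      (measurableSet_le measurable_const measurable_nrm).inter (hlt 1)
    rw [annInt, ← integral_indicator hm, ← integral_indicator (measurableSet_annulus b), ← integral_inv]
    refine integral_congr_ae ?_
    filter_upwards [ae_ne μ 0] with p hp
    have hpp := nrm_pos hp
    have hmem : p⁻¹ ∈ {p : F | (nrm b)⁻¹ ≤ nrm p ∧ nrm p < 1} ↔
        p ∈ {p : F | 1 < nrm p ∧ nrm p ≤ nrm b} := by
      simp only [Set.mem_ofPred_eq, nrm_inv]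
      rw [inv_le_inv₀ hbp hpp, inv_lt_one₀ hpp, and_comm]
    by_cases h : p ∈ {p : F | 1 < nrm p ∧ nrm p ≤ nrm b}
    · rw [Set.indicator_of_mem h, Set.indicator_of_mem (hmem.2 h), Complex.real_smul,
        Complex.ofReal_pow, ← npow_neg_one, npow_inv, ← npow_neg, sq, ← npow_add hp, ← npow_add hp]
      ring_nf
    · rw [Set.indicator_of_notMem h, Set.indicator_of_notMem (fun h' => h (hmem.1 h')), smul_zero]
  rw [hJ, sub_mul, one_mul, hJb, ← hann, hdiff]
  ring

/-- The unit ball and its image under inversion overlap in the unit sphere. -/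
lemma unitReg_add_neg {c : ℂ} (hc : c.re = 0) (h : ∃ x : F, x ≠ 0 ∧ npow x c ≠ 1) :
    unitReg μ c + unitReg μ (-c) = sphereVol μ := by
  obtain ⟨b, hb, hbc⟩ := exists_npow_ne_one h
  have hb0 := ne_zero_of_one_le_nrm hb
  have h' : ∃ x : F, x ≠ 0 ∧ npow x (-c) ≠ 1 := by
    refine ⟨b, hb0, ?_⟩
    rwa [npow_neg, Ne, inv_eq_one]
  have hc' : (-c).re = 0 := by simp [hc]
  have h1 : Tendsto (fun ε : ℝ => annInt μ b (-(-c + ε))) (𝓝[>] 0) (𝓝 (annInt μ b c)) := by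
    refine tendsto_annInt μ b (by simpa using (tendsto_add_ofReal (-c)).neg) ?_
    filter_upwards [eventually_small one_pos] with ε hε
    simp [hc]; linarith [hε.1]
  have h2 : Tendsto (fun ε : ℝ => 1 - npow b (-(-c + ε))) (𝓝[>] 0) (𝓝 (1 - npow b c)) := by
    have : Tendsto (fun ε : ℝ => -(-c + (ε : ℂ))) (𝓝[>] 0) (𝓝 c) := by
      simpa using (tendsto_add_ofReal (-c)).neg
    exact ((continuousAt_npow_exp hb0 c).tendsto.comp this).const_sub 1
  have h3 : (1 - npow b c) * (unitReg μ (-c) - sphereVol μ) = annInt μ b c := by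
    refine tendsto_nhds_unique (h2.mul ((tendsto_unitInt μ hc' h').sub_const _)) (h1.congr' ?_)
    filter_upwards [eventually_small one_pos] with ε hε
    rw [← npow_sub_one_mul_unitInt_neg μ (by simpa [hc] using hε.1) hb]
  rw [← npow_sub_one_mul_unitReg μ hc h hb] at h3
  have h4 : (npow b c - 1) * (unitReg μ c + unitReg μ (-c) - sphereVol μ) = 0 := by
    linear_combination -h3
  rcases mul_eq_zero.1 h4 with h5 | h5
  · exact absurd (sub_eq_zero.1 h5) hbc
  · exact sub_eq_zero.1 h5

end RadialIntegrals


/-! ### Regularized integrals of vector-valued functions -/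

section Regularization

variable {F : Type*} [NontriviallyNormedField F] [ProperSpace F] [MeasurableSpace F] [BorelSpace F]
  (μ : Measure F) [μ.IsAddHaarMeasure]

lemma integrable_two_rpow {κ : F} (hκ : κ ≠ 0) {α β : ℝ} (hα : -1 < α) (hβ : -1 < β)
    (h : α + β < -1) : Integrable (fun p : F => nrm p ^ α * nrm (1 - κ * p) ^ β) μ := by
  have hinj : Function.Injective ![(0 : F), κ⁻¹] := by
    intro i j hij
    fin_cases i <;> fin_cases j <;> simp_all [eq_comm]
  have := (integrable_prod_rpow μ hinj (α := ![α, β])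
    (by intro i; fin_cases i <;> simpa) (by simpa using h)).const_mul (nrm κ ^ β)
  refine this.congr (Eventually.of_forall fun p => ?_)
  simp only [Fin.prod_univ_two, Matrix.cons_val_zero, Matrix.cons_val_one, sub_zero]
  rw [mul_left_comm, ← Real.mul_rpow (nrm_nonneg _) (nrm_nonneg _), ← nrm_mul, mul_sub,
    mul_inv_cancel₀ hκ, nrm_sub_comm]

/-- The part of the common majorant that bounds the vector-valued integrands: linear near the
origin, and with an integrable singularity at `κ⁻¹` away from it. The exponent `-1 / 2` comes from
the norms of the operators, and `-3 / 4` leaves room to vary the parameters. -/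
noncomputable def majorant (κ : F) (η : ℝ) (p : F) : ℝ :=
  {p : F | nrm p ≤ 1}.indicator (fun p => ‖p‖) p +
    {p : F | η < ‖p‖}.indicator
      (fun p => nrm (1 - κ * p) ^ (-(1 / 2) : ℝ) + nrm (1 - κ * p) ^ (-(3 / 4) : ℝ)) p

/-- A majorant of `‖p‖ ^ (a - 1)` for `0 ≤ Re a ≤ 1 / 4`. -/
noncomputable def powMajorant (p : F) : ℝ := nrm p ^ (-1 : ℝ) + nrm p ^ (-(3 / 4) : ℝ)

lemma powMajorant_nonneg (p : F) : 0 ≤ powMajorant p :=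
  add_nonneg (Real.rpow_nonneg (nrm_nonneg _) _) (Real.rpow_nonneg (nrm_nonneg _) _)

lemma majorant_nonneg (κ : F) (η : ℝ) (p : F) : 0 ≤ majorant κ η p :=
  add_nonneg (Set.indicator_nonneg (fun _ _ => norm_nonneg _) _)
    (Set.indicator_nonneg (fun _ _ => add_nonneg (Real.rpow_nonneg (nrm_nonneg _) _)
      (Real.rpow_nonneg (nrm_nonneg _) _)) _)

lemma norm_npow_le_powMajorant {p : F} (hp : p ≠ 0) {a : ℂ} (h0 : 0 ≤ a.re) (h1 : a.re ≤ 1 / 4) :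
    ‖npow p (a - 1)‖ ≤ powMajorant p := by
  have hp' := nrm_pos hp
  rw [norm_npow hp, Complex.sub_re, Complex.one_re, powMajorant]
  rcases le_total (nrm p) 1 with h | h
  · have := Real.rpow_le_rpow_of_exponent_ge hp' h (show (-1 : ℝ) ≤ a.re - 1 by linarith)
    have := Real.rpow_nonneg hp'.le (-(3 / 4) : ℝ)
    linarith
  · have := Real.rpow_le_rpow_of_exponent_le h (show a.re - 1 ≤ (-(3 / 4) : ℝ) by linarith)
    have := Real.rpow_nonneg hp'.le (-1 : ℝ)
    linarith

lemma measurable_powMajorant : Measurable (powMajorant : F → ℝ) :=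
  (measurable_nrm.pow_const _).add (measurable_nrm.pow_const _)

lemma measurable_majorant (κ : F) (η : ℝ) : Measurable (majorant κ η) := by
  have h : Measurable fun p : F => nrm (1 - κ * p) :=
    measurable_nrm.comp (measurable_const.sub (measurable_const_mul κ))
  exact (measurable_norm.indicator (measurableSet_nrm_le 1)).add
    (((h.pow_const _).add (h.pow_const _)).indicator
      (measurableSet_lt measurable_const measurable_norm))

lemma integrable_powMajorant_mul_majorant {κ : F} (hκ : κ ≠ 0) {η : ℝ} (hη : 0 < η) :
    Integrable (fun p => powMajorant p * majorant κ η p) μ := by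
  have hE := nrmExp_pos F
  have hmeas : Measurable fun p : F => powMajorant p * majorant κ η p :=
    measurable_powMajorant.mul (measurable_majorant κ η)
  -- near the origin the factor `‖p‖` in `majorant` is a positive power of `nrm p`
  have i1 : IntegrableOn (fun p : F => nrm p ^ (-1 + (nrmExp F)⁻¹) + nrm p ^ (-(3/4) + (nrmExp F)⁻¹))
      {p | nrm p ≤ 1} μ :=
    (integrableOn_nrm_rpow μ (by linarith [inv_pos.2 hE])).add
      (integrableOn_nrm_rpow μ (by linarith [inv_pos.2 hE]))
  rw [← integrable_indicator_iff (measurableSet_nrm_le 1)] at i1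
  -- away from the origin `nrm p ^ (-1)` is at most a multiple of `nrm p ^ (-3 / 4)`; the total
  -- exponents at infinity are then `-5 / 4` and `-3 / 2`
  set C : ℝ := (η ^ nrmExp F) ^ (-(1 / 4) : ℝ) + 1 with hC
  have hη' : 0 < η ^ nrmExp F := Real.rpow_pos_of_pos hη _
  have hC0 : 0 ≤ C := by positivity
  have i2 : Integrable (fun p : F => C * (nrm p ^ (-(3/4) : ℝ) * nrm (1 - κ * p) ^ (-(1/2) : ℝ)) +
      C * (nrm p ^ (-(3/4) : ℝ) * nrm (1 - κ * p) ^ (-(3/4) : ℝ))) μ :=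
    ((integrable_two_rpow μ hκ (by norm_num) (by norm_num) (by norm_num)).const_mul C).add
      ((integrable_two_rpow μ hκ (by norm_num) (by norm_num) (by norm_num)).const_mul C)
  refine Integrable.mono' (i1.add i2) hmeas.aestronglyMeasurable ?_
  filter_upwards [ae_ne μ 0] with p hp
  have hpp := nrm_pos hp
  rw [Real.norm_of_nonneg (mul_nonneg (powMajorant_nonneg p) (majorant_nonneg κ η p)), majorant,
    mul_add, Pi.add_apply]
  have hpn : ‖p‖ = nrm p ^ (nrmExp F)⁻¹ := by
    rw [nrm_eq_rpow, Real.rpow_rpow_inv (norm_nonneg _) hE.ne']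
  refine add_le_add ?_ ?_
  · by_cases h : p ∈ {p : F | nrm p ≤ 1}
    · rw [Set.indicator_of_mem h, Set.indicator_of_mem h, powMajorant, hpn, add_mul,
        ← Real.rpow_add hpp, ← Real.rpow_add hpp]
    · simp [Set.indicator_of_notMem h]
  · have hx1 : 0 ≤ nrm (1 - κ * p) ^ (-(1/2) : ℝ) := Real.rpow_nonneg (nrm_nonneg _) _
    have hx2 : 0 ≤ nrm (1 - κ * p) ^ (-(3/4) : ℝ) := Real.rpow_nonneg (nrm_nonneg _) _
    by_cases h : p ∈ {p : F | η < ‖p‖}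
    · rw [Set.indicator_of_mem h, ← mul_add, ← mul_add, ← mul_assoc]
      refine mul_le_mul_of_nonneg_right ?_ (add_nonneg hx1 hx2)
      have h1 : η ^ nrmExp F ≤ nrm p := by
        rw [nrm_eq_rpow]
        exact Real.rpow_le_rpow hη.le (le_of_lt h) hE.le
      rw [powMajorant, hC, add_mul, one_mul]
      gcongr
      rw [show (-1 : ℝ) = -(1/4) + -(3/4) by norm_num, Real.rpow_add hpp]
      refine mul_le_mul_of_nonneg_right ?_ (Real.rpow_nonneg hpp.le _)
      exact Real.rpow_le_rpow_of_nonpos hη' h1 (by norm_num)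
    · rw [Set.indicator_of_notMem h, mul_zero]
      positivity

variable {E : Type*} [NormedAddCommGroup E] [NormedSpace ℂ E]

lemma norm_npow_smul_le {κ : F} {η C : ℝ} {a : ℂ} (h0 : 0 ≤ a.re) (h1 : a.re ≤ 1 / 4) {p : F}
    (hp : p ≠ 0) {x : E} (hx : ‖x‖ ≤ C * majorant κ η p) :
    ‖npow p (a - 1) • x‖ ≤ C * (powMajorant p * majorant κ η p) := by
  rw [norm_smul, mul_left_comm]
  exact mul_le_mul (norm_npow_le_powMajorant hp h0 h1) hx (norm_nonneg _) (powMajorant_nonneg p)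

lemma integrable_npow_smul {κ : F} (hκ : κ ≠ 0) {η : ℝ} (hη : 0 < η) {C : ℝ} {a : ℂ}
    (h0 : 0 ≤ a.re) (h1 : a.re ≤ 1 / 4) {f : F → E} (hm : AEStronglyMeasurable f μ)
    (hb : ∀ᵐ p ∂μ, ‖f p‖ ≤ C * majorant κ η p) :
    Integrable (fun p => npow p (a - 1) • f p) μ := by
  refine Integrable.mono' ((integrable_powMajorant_mul_majorant μ hκ hη).const_mul C)
    ((measurable_npow _).aestronglyMeasurable.smul hm) ?_
  filter_upwards [hb, ae_ne μ 0] with p hp hp0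
  exact norm_npow_smul_le h0 h1 hp0 hp

lemma tendsto_integral_npow_smul {κ : F} (hκ : κ ≠ 0) {η : ℝ} (hη : 0 < η) {C : ℝ} {ι : Type*}
    {l : Filter ι} [l.IsCountablyGenerated] {a : ι → ℂ} {a₀ : ℂ} (ha : Tendsto a l (𝓝 a₀))
    (ha' : ∀ᶠ i in l, 0 ≤ (a i).re ∧ (a i).re ≤ 1 / 4) {f : ι → F → E} {f₀ : F → E}
    (hm : ∀ᶠ i in l, AEStronglyMeasurable (f i) μ)
    (hb : ∀ᶠ i in l, ∀ᵐ p ∂μ, ‖f i p‖ ≤ C * majorant κ η p)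
    (hf : ∀ᵐ p ∂μ, Tendsto (fun i => f i p) l (𝓝 (f₀ p))) :
    Tendsto (fun i => ∫ p, npow p (a i - 1) • f i p ∂μ) l
      (𝓝 (∫ p, npow p (a₀ - 1) • f₀ p ∂μ)) := by
  refine tendsto_integral_filter_of_dominated_convergence
    (fun p => C * (powMajorant p * majorant κ η p)) ?_ ?_
    ((integrable_powMajorant_mul_majorant μ hκ hη).const_mul C) ?_
  · filter_upwards [hm] with i hi
    exact (measurable_npow _).aestronglyMeasurable.smul hi
  · filter_upwards [ha', hb] with i hi hbi
    filter_upwards [hbi, ae_ne μ 0] with p hp hp0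
    exact norm_npow_smul_le hi.1 hi.2 hp0 hp
  · filter_upwards [hf, ae_ne μ 0] with p hp hp0
    exact ((continuousAt_npow_exp hp0 _).tendsto.comp (ha.sub_const 1)).smul hp

/-- The function `v` with the constant `φ` subtracted on the unit ball. -/
noncomputable def cutOff (φ : E) (v : F → E) (p : F) : E :=
  v p - {p : F | nrm p ≤ 1}.indicator (fun _ => φ) p

lemma norm_cutOff_le {κ : F} {η : ℝ} (hη : 0 < η) (hη1 : η ≤ 1) {φ : E} {v : F → E} {L K : ℝ}
    (hL : 0 ≤ L) (hK : 0 ≤ K) {p : F} (h1 : ‖p‖ ≤ η → ‖v p - φ‖ ≤ L * ‖p‖)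
    (h2 : η < ‖p‖ → ‖v p‖ ≤
      K * (nrm (1 - κ * p) ^ (-(1 / 2) : ℝ) + nrm (1 - κ * p) ^ (-(3 / 4) : ℝ))) :
    ‖cutOff φ v p‖ ≤ (L + K + ‖φ‖ / η) * majorant κ η p := by
  have hφ : 0 ≤ ‖φ‖ / η := by positivity
  rcases le_or_gt ‖p‖ η with h | h
  · have hn : p ∈ {p : F | nrm p ≤ 1} := nrm_le_one (h.trans hη1)
    have hn' : p ∉ {p : F | η < ‖p‖} := by simpa using h
    rw [cutOff, majorant, Set.indicator_of_mem hn, Set.indicator_of_mem hn,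
      Set.indicator_of_notMem hn', add_zero]
    refine (h1 h).trans ?_
    gcongr
    linarith
  · have hn' : p ∈ {p : F | η < ‖p‖} := h
    have hx1 : 0 ≤ nrm (1 - κ * p) ^ (-(1/2) : ℝ) := Real.rpow_nonneg (nrm_nonneg _) _
    have hx2 : 0 ≤ nrm (1 - κ * p) ^ (-(3/4) : ℝ) := Real.rpow_nonneg (nrm_nonneg _) _
    rw [cutOff, majorant, Set.indicator_of_mem hn', mul_add]
    refine (norm_sub_le _ _).trans ?_
    rw [add_comm]
    refine add_le_add ?_ ((h2 h).trans ?_)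
    · by_cases hn : p ∈ {p : F | nrm p ≤ 1}
      · rw [Set.indicator_of_mem hn, Set.indicator_of_mem hn]
        calc ‖φ‖ = ‖φ‖ / η * η := by field_simp
          _ ≤ (L + K + ‖φ‖ / η) * ‖p‖ := by
            gcongr
            linarith
      · simp [Set.indicator_of_notMem hn]
    · gcongr
      linarith

lemma integrable_npow_smul_unit {a : ℂ} (ha : 0 < a.re) (φ : E) :
    Integrable (fun p : F => npow p (a - 1) • {p : F | nrm p ≤ 1}.indicator (fun _ => φ) p) μ := by
  have := (integrable_indicator_iff (measurableSet_nrm_le 1)).2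
    ((integrableOn_npow_unit μ ha).smul_const φ)
  refine this.congr (Eventually.of_forall fun p => ?_)
  by_cases h : p ∈ {p : F | nrm p ≤ 1} <;> simp [h]

lemma integral_npow_smul_unit [CompleteSpace E] (a : ℂ) (φ : E) :
    ∫ p : F, npow p (a - 1) • {p : F | nrm p ≤ 1}.indicator (fun _ => φ) p ∂μ =
      unitInt μ a • φ := by
  rw [unitInt, ← integral_smul_const, ← integral_indicator (measurableSet_nrm_le 1)]
  congr 1
  ext p
  by_cases h : p ∈ {p : F | nrm p ≤ 1} <;> simp [h]

lemma integrable_of_cutOff {a : ℂ} (ha : 0 < a.re) {φ : E} {v : F → E}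
    (h : Integrable (fun p => npow p (a - 1) • cutOff φ v p) μ) :
    Integrable (fun p => npow p (a - 1) • v p) μ := by
  refine (h.add (integrable_npow_smul_unit μ ha φ)).congr (Eventually.of_forall fun p => ?_)
  simp only [Pi.add_apply, ← smul_add, cutOff, sub_add_cancel]

lemma integral_eq_cutOff_add [CompleteSpace E] {a : ℂ} (ha : 0 < a.re) {φ : E} {v : F → E}
    (h : Integrable (fun p => npow p (a - 1) • cutOff φ v p) μ) :
    ∫ p, npow p (a - 1) • v p ∂μ =
      (∫ p, npow p (a - 1) • cutOff φ v p ∂μ) + unitInt μ a • φ := by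
  rw [← integral_npow_smul_unit, ← integral_add h (integrable_npow_smul_unit μ ha φ)]
  simp only [← smul_add, cutOff, sub_add_cancel]

end Regularization


/-! ### Beta operators of a unitary representation -/

section BetaOperators

variable {F : Type*} [NontriviallyNormedField F] [ProperSpace F] [MeasurableSpace F] [BorelSpace F]
  (μ : Measure F) [μ.IsAddHaarMeasure]
  {H : Type*} [NormedAddCommGroup H] [InnerProductSpace ℂ H]

/-- `u` is a strongly continuous unitary representation of the multiplicative group of `F`
(the value at `0` is irrelevant). -/
structure IsUnitaryRep (u : F → H →L[ℂ] H) : Prop where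
  one : ∀ φ, u 1 φ = φ
  mul : ∀ x y, x ≠ 0 → y ≠ 0 → ∀ φ, u (x * y) φ = u x (u y φ)
  norm : ∀ x, x ≠ 0 → ∀ φ, ‖u x φ‖ = ‖φ‖
  cont : ∀ φ, ContinuousOn (fun x => u x φ) {0}ᶜ

/-- The vector `φ` is Lipschitz at the identity under the representation `u`. -/
def IsLipVector (u : F → H →L[ℂ] H) (φ : H) : Prop :=
  ∃ C η : ℝ, 0 ≤ C ∧ 0 < η ∧ ∀ w : F, ‖w - 1‖ ≤ η → ‖u w φ - φ‖ ≤ C * ‖w - 1‖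

/-- The beta integral `∫ ‖w‖ ^ ρ ‖1 - w‖ ^ (a - 1) u(w) φ dw`. -/
noncomputable def betaOp (u : F → H →L[ℂ] H) (ρ a : ℂ) (φ : H) : H :=
  ∫ w, (npow w ρ * npow (1 - w) (a - 1)) • u w φ ∂μ

/-- The beta function of `F`. -/
noncomputable def betaF (a b : ℂ) : ℂ := ∫ s : F, npow s (a - 1) * npow (1 - s) (b - 1) ∂μ

lemma IsUnitaryRep.aesm {u : F → H →L[ℂ] H} (hu : IsUnitaryRep u) (φ : H) :
    AEStronglyMeasurable (fun w => u w φ) μ := by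
  have h : AEStronglyMeasurable (fun w => u w φ) (μ.restrict {0}ᶜ) :=
    (hu.cont φ).aestronglyMeasurable (measurableSet_singleton 0).compl
  rwa [Measure.restrict_eq_self_of_ae_mem] at h
  exact ae_ne μ 0

lemma aesm_kernel (ρ a : ℂ) :
    AEStronglyMeasurable (fun w : F => npow w ρ * npow (1 - w) (a - 1)) μ :=
  ((measurable_npow _).mul ((measurable_npow _).comp
    (measurable_const.sub measurable_id))).aestronglyMeasurable

lemma integrable_beta_rpow {α β : ℝ} (hα : -1 < α) (hβ : 0 < β) (h : α + β < 0) :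
    Integrable (fun w : F => nrm w ^ α * nrm (1 - w) ^ (β - 1)) μ := by
  simpa using integrable_two_rpow μ (one_ne_zero (α := F)) hα (show -1 < β - 1 by linarith)
    (by linarith)

lemma norm_kernel {w : F} (h0 : w ≠ 0) (h1 : w ≠ 1) (ρ a : ℂ) :
    ‖npow w ρ * npow (1 - w) (a - 1)‖ = nrm w ^ ρ.re * nrm (1 - w) ^ (a.re - 1) := by
  rw [norm_mul, norm_npow h0, norm_npow (sub_ne_zero.2 h1.symm)]; simp

lemma integrable_kernel {ρ a : ℂ} (hρ : -1 < ρ.re) (ha : 0 < a.re) (h : ρ.re + a.re < 0) :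
    Integrable (fun w : F => npow w ρ * npow (1 - w) (a - 1)) μ := by
  refine Integrable.mono' (integrable_beta_rpow μ hρ ha h) (aesm_kernel μ ρ a) ?_
  filter_upwards [ae_ne μ 0, ae_ne μ 1] with w h0 h1
  exact (norm_kernel h0 h1 ρ a).le

lemma integrable_betaOp {u : F → H →L[ℂ] H} (hu : IsUnitaryRep u) {ρ a : ℂ} (hρ : -1 < ρ.re)
    (ha : 0 < a.re) (h : ρ.re + a.re < 0) (φ : H) :
    Integrable (fun w => (npow w ρ * npow (1 - w) (a - 1)) • u w φ) μ := by
  refine Integrable.mono' ((integrable_kernel μ hρ ha h).norm.mul_const ‖φ‖)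
    ((aesm_kernel μ ρ a).smul (hu.aesm μ φ)) ?_
  filter_upwards [ae_ne μ 0] with w h0
  rw [norm_smul, hu.norm w h0]

lemma betaOp_add {u : F → H →L[ℂ] H} (hu : IsUnitaryRep u) {ρ a : ℂ} (hρ : -1 < ρ.re)
    (ha : 0 < a.re) (h : ρ.re + a.re < 0) (φ ψ : H) :
    betaOp μ u ρ a (φ + ψ) = betaOp μ u ρ a φ + betaOp μ u ρ a ψ := by
  rw [betaOp, betaOp, betaOp, ← integral_add (integrable_betaOp μ hu hρ ha h φ)
    (integrable_betaOp μ hu hρ ha h ψ)]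
  simp only [map_add, smul_add]

lemma betaOp_smul (u : F → H →L[ℂ] H) (ρ a z : ℂ) (φ : H) :
    betaOp μ u ρ a (z • φ) = z • betaOp μ u ρ a φ := by
  rw [betaOp, betaOp, ← integral_smul]
  simp only [map_smul, smul_comm z]

/-- An affine substitution: the convolution of `‖s‖ ^ (a - 1)` and `‖s‖ ^ (b - 1)`. -/
lemma integral_convolution_npow (a b : ℂ) {v : F} (hv : v ≠ 1) :
    ∫ w : F, npow (w - v) (a - 1) * npow (1 - w) (b - 1) ∂μ =
      npow (1 - v) (a + b - 1) * betaF μ a b := by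
  have hv' : 1 - v ≠ 0 := sub_ne_zero.2 hv.symm
  have h1 := integral_add_right_eq_self (μ := μ)
    (fun w : F => npow (w - v) (a - 1) * npow (1 - w) (b - 1)) v
  rw [← h1]
  have h2 := integral_mul_left μ hv' fun w : F => npow (w + v - v) (a - 1) * npow (1 - (w + v)) (b - 1)
  rw [eq_comm, inv_smul_eq_iff₀ (nrm_pos hv').ne'] at h2
  rw [h2, betaF, Complex.real_smul, ← integral_const_mul, ← integral_const_mul]
  congr 1
  ext s
  rw [show (1 - v) * s + v - v = (1 - v) * s by ring,
    show 1 - ((1 - v) * s + v) = (1 - v) * (1 - s) by ring, npow_mul, npow_mul,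
    show a + b - 1 = 1 + (a - 1) + (b - 1) by ring, npow_add hv', npow_add hv', npow_one_exp]
  ring

lemma integrable_convolution_rpow {α β : ℝ} (hα : 0 < α) (hβ : 0 < β) (h : α + β < 1) {v : F}
    (hv : v ≠ 1) :
    Integrable (fun w : F => nrm (w - v) ^ (α - 1) * nrm (1 - w) ^ (β - 1)) μ := by
  have hinj : Function.Injective ![v, 1] := by
    intro i j hij
    fin_cases i <;> fin_cases j <;> simp_all [eq_comm]
  have := integrable_prod_rpow μ hinj (α := ![α - 1, β - 1])
    (by intro i; fin_cases i <;> simp <;> linarith) (by simp; linarith)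
  refine this.congr (Eventually.of_forall fun p => ?_)
  simp [Fin.prod_univ_two, nrm_sub_comm 1 p]

/-- The kernel of a product of two beta operators in additive coordinates. -/
lemma kernel_mul_kernel {w v : F} (hw : w ≠ 0) (ρ a b : ℂ) :
    npow w (ρ + a) * npow (1 - w) (b - 1) * ((nrm w)⁻¹ : ℝ) *
      (npow (w⁻¹ * v) ρ * npow (1 - w⁻¹ * v) (a - 1)) =
    npow v ρ * (npow (w - v) (a - 1) * npow (1 - w) (b - 1)) := by
  rw [show w - v = w * (1 - w⁻¹ * v) by field_simp, npow_mul w, npow_mul w⁻¹, npow_inv,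
    ← npow_neg_one, show ρ + a = ρ + (a - 1) + 1 by ring, npow_add hw, npow_add hw, npow_neg]
  have h1 := npow_ne_zero hw ρ
  have h2 := npow_ne_zero hw (1 : ℂ)
  field_simp

/-- The semigroup law of the beta operators. -/
lemma betaOp_betaOp [CompleteSpace H] {u : F → H →L[ℂ] H} (hu : IsUnitaryRep u) {ρ a b : ℂ}
    (hρ : -1 < ρ.re) (ha : 0 < a.re) (hb : 0 < b.re) (h : ρ.re + a.re + b.re < 0) (φ : H) :
    betaOp μ u (ρ + a) b (betaOp μ u ρ a φ) = betaF μ a b • betaOp μ u ρ (a + b) φ := by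
  have hab : a.re + b.re < 1 := by linarith
  -- the substitution `v ↦ v / w` makes the product of the kernels depend on `w` only through a
  -- convolution, which is integrated after an exchange of the integrals
  have inner : ∀ w : F, w ≠ 0 → (npow w (ρ + a) * npow (1 - w) (b - 1)) • u w (betaOp μ u ρ a φ) =
      ∫ v, (npow v ρ * (npow (w - v) (a - 1) * npow (1 - w) (b - 1))) • u v φ ∂μ := by
    intro w hw
    rw [betaOp, ← (u w).integral_comp_comm (integrable_betaOp μ hu hρ ha (by linarith) φ)]
    have h1 : ∀ᵐ v ∂μ, u w ((npow v ρ * npow (1 - v) (a - 1)) • u v φ) =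
        (fun x => (npow (w⁻¹ * x) ρ * npow (1 - w⁻¹ * x) (a - 1)) • u x φ) (w * v) := by
      filter_upwards [ae_ne μ 0] with v hv
      simp only [map_smul, inv_mul_cancel_left₀ hw, hu.mul w v hw hv]
    rw [integral_congr_ae h1, integral_mul_left μ hw
      (fun x => (npow (w⁻¹ * x) ρ * npow (1 - w⁻¹ * x) (a - 1)) • u x φ), ← Complex.coe_smul, smul_smul,
      ← integral_smul]
    congr 1
    ext v
    rw [smul_smul, kernel_mul_kernel hw]
  have hK : Integrable (fun q : F × F => (npow q.2 ρ * (npow (q.1 - q.2) (a - 1) *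
      npow (1 - q.1) (b - 1))) • u q.2 φ) (μ.prod μ) := by
    have hm : AEStronglyMeasurable (fun q : F × F => (npow q.2 ρ * (npow (q.1 - q.2) (a - 1) *
      npow (1 - q.1) (b - 1))) • u q.2 φ) (μ.prod μ) := by
      refine AEStronglyMeasurable.smul (Measurable.aestronglyMeasurable ?_)
        (hu.aesm μ φ).comp_snd
      exact ((measurable_npow _).comp measurable_snd).mul
        (((measurable_npow _).comp (measurable_fst.sub measurable_snd)).mul
        ((measurable_npow _).comp (measurable_const.sub measurable_fst)))
    rw [integrable_prod_iff' hm]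
    have hnorm : ∀ v : F, v ≠ 0 → ∀ᵐ w ∂μ, ‖(npow v ρ * (npow (w - v) (a - 1) *
        npow (1 - w) (b - 1))) • u v φ‖ = nrm v ^ ρ.re * ‖φ‖ *
        (nrm (w - v) ^ (a.re - 1) * nrm (1 - w) ^ (b.re - 1)) := by
      intro v hv
      filter_upwards [ae_ne μ v, ae_ne μ 1] with w h1 h2
      rw [norm_smul, norm_mul, norm_mul, norm_npow hv, norm_npow (sub_ne_zero.2 h1),
        norm_npow (sub_ne_zero.2 h2.symm), hu.norm v hv]
      simp only [Complex.sub_re, Complex.one_re]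
      ring
    constructor
    · filter_upwards [ae_ne μ 0, ae_ne μ 1] with v h0 h1
      have hmv : AEStronglyMeasurable (fun w : F => (npow v ρ * (npow (w - v) (a - 1) *
          npow (1 - w) (b - 1))) • u v φ) μ := by
        refine (Measurable.aestronglyMeasurable ?_).smul aestronglyMeasurable_const
        exact measurable_const.mul (((measurable_npow _).comp (measurable_id.sub_const v)).mul
          ((measurable_npow _).comp (measurable_const.sub measurable_id)))
      rw [← integrable_norm_iff hmv, integrable_congr (hnorm v h0)]
      exact (integrable_convolution_rpow μ ha hb hab h1).const_mul _
    · have hI : ∀ v : F, v ≠ 0 → v ≠ 1 → ∫ w, ‖(npow v ρ * (npow (w - v) (a - 1) *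
          npow (1 - w) (b - 1))) • u v φ‖ ∂μ =
          ‖betaF μ (a.re : ℂ) (b.re : ℂ)‖ * ‖φ‖ * (nrm v ^ ρ.re * nrm (1 - v) ^ (a.re + b.re - 1)) := by
        intro v h0 h1
        rw [integral_congr_ae (hnorm v h0), integral_const_mul]
        have hc := integral_convolution_npow μ (a.re : ℂ) (b.re : ℂ) h1
        have e1 : ∫ w : F, npow (w - v) ((a.re : ℂ) - 1) * npow (1 - w) ((b.re : ℂ) - 1) ∂μ =
            ((∫ w : F, nrm (w - v) ^ (a.re - 1) * nrm (1 - w) ^ (b.re - 1) ∂μ : ℝ) : ℂ) := by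
          rw [← integral_complex_ofReal]
          congr 1
          ext w
          rw [Complex.ofReal_mul, ← npow_ofReal, ← npow_ofReal]
          push_cast; rfl
        have hnn : 0 ≤ ∫ w : F, nrm (w - v) ^ (a.re - 1) * nrm (1 - w) ^ (b.re - 1) ∂μ :=
          integral_nonneg fun w => mul_nonneg (Real.rpow_nonneg (nrm_nonneg _) _)
            (Real.rpow_nonneg (nrm_nonneg _) _)
        have e2 := congrArg norm (e1.symm.trans hc)
        rw [Complex.norm_real, Real.norm_of_nonneg hnn, norm_mul,
          norm_npow (sub_ne_zero.2 h1.symm)] at e2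
        rw [e2]
        simp only [Complex.sub_re, Complex.add_re, Complex.ofReal_re, Complex.one_re]
        ring
      have hint := (integrable_beta_rpow μ hρ (show 0 < a.re + b.re by linarith)
        (by linarith)).const_mul (‖betaF μ (a.re : ℂ) (b.re : ℂ)‖ * ‖φ‖)
      refine hint.congr ?_
      filter_upwards [ae_ne μ 0, ae_ne μ 1] with v h0 h1
      exact (hI v h0 h1).symm
  calc betaOp μ u (ρ + a) b (betaOp μ u ρ a φ)
      = ∫ w, ∫ v, (npow v ρ * (npow (w - v) (a - 1) * npow (1 - w) (b - 1))) • u v φ ∂μ ∂μ := by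
        refine integral_congr_ae ?_
        filter_upwards [ae_ne μ 0] with w hw using inner w hw
    _ = ∫ v, ∫ w, (npow v ρ * (npow (w - v) (a - 1) * npow (1 - w) (b - 1))) • u v φ ∂μ ∂μ :=
        integral_integral_swap hK
    _ = betaF μ a b • betaOp μ u ρ (a + b) φ := by
        rw [betaOp, ← integral_smul]
        refine integral_congr_ae ?_
        filter_upwards [ae_ne μ 1] with v h1
        rw [integral_smul_const, integral_const_mul, integral_convolution_npow μ a b h1, smul_smul]
        congr 1
        ring

lemma IsUnitaryRep.inner_map_inv {u : F → H →L[ℂ] H} (hu : IsUnitaryRep u) {w : F} (hw : w ≠ 0)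
    (ψ φ : H) : inner ℂ ψ (u w φ) = inner ℂ (u w⁻¹ ψ) φ := by
  let L : H →ₗᵢ[ℂ] H := ⟨u w, hu.norm w hw⟩
  have h1 : u w (u w⁻¹ ψ) = ψ := by
    rw [← hu.mul w w⁻¹ hw (inv_ne_zero hw), mul_inv_cancel₀ hw, hu.one]
  have h2 := L.inner_map_map (u w⁻¹ ψ) φ
  change inner ℂ (u w (u w⁻¹ ψ)) (u w φ) = _ at h2
  rwa [h1] at h2

/-- The adjoint of a beta operator, by the substitution `w ↦ w⁻¹`. -/
lemma inner_betaOp [CompleteSpace H] {u : F → H →L[ℂ] H} (hu : IsUnitaryRep u) {ρ a : ℂ}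
    (hρ : -1 < ρ.re) (ha : 0 < a.re) (h : ρ.re + a.re < 0) (ψ φ : H) :
    inner ℂ ψ (betaOp μ u ρ a φ) = inner ℂ
      (betaOp μ u (-1 - (starRingEnd ℂ) ρ - (starRingEnd ℂ) a) ((starRingEnd ℂ) a) ψ) φ := by
  rw [betaOp, ← integral_inner (integrable_betaOp μ hu hρ ha h φ), ← integral_inv]
  have h' : Integrable (fun w => (npow w (-1 - (starRingEnd ℂ) ρ - (starRingEnd ℂ) a) *
      npow (1 - w) ((starRingEnd ℂ) a - 1)) • u w ψ) μ :=
    integrable_betaOp μ hu (by simp; linarith) (by simpa using ha) (by simp; linarith) ψ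
  rw [betaOp, ← inner_conj_symm, ← integral_inner h', ← integral_conj]
  refine integral_congr_ae ?_
  filter_upwards [ae_ne μ 0] with w hw
  rw [inner_conj_symm, inner_smul_left, inner_smul_right, hu.inner_map_inv (inv_ne_zero hw), inv_inv,
    map_mul, conj_npow, conj_npow, Complex.real_smul, ← mul_assoc]
  congr 1
  simp only [map_sub, map_neg, map_one, Complex.conj_conj]
  have e : 1 - w⁻¹ = -(w⁻¹ * (1 - w)) := by field_simp; ring
  rw [e, npow_neg_arg, npow_mul, Complex.ofReal_pow, ← npow_neg_one, npow_inv, npow_inv, ← npow_neg,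
    ← npow_neg, sq, show -1 - ρ - a = -1 + -1 + -ρ + -(a - 1) by ring, npow_add hw, npow_add hw,
    npow_add hw]
  ring

end BetaOperators


/-! ### Unitarity of the regularized beta operators -/

section Unitarity

variable {F : Type*} [NontriviallyNormedField F] [ProperSpace F] [MeasurableSpace F] [BorelSpace F]
  (μ : Measure F) [μ.IsAddHaarMeasure]
  {H : Type*} [NormedAddCommGroup H] [InnerProductSpace ℂ H]

/-- The orbit map of `φ` in the coordinate `p = 1 - w`, weighted by `‖w‖ ^ ρ`. -/
noncomputable def betaVec (u : F → H →L[ℂ] H) (ρ : ℂ) (φ : H) (p : F) : H :=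
  npow (1 - p) ρ • u (1 - p) φ

lemma betaOp_eq_integral_betaVec (u : F → H →L[ℂ] H) (ρ a : ℂ) (φ : H) :
    betaOp μ u ρ a φ = ∫ p, npow p (a - 1) • betaVec u ρ φ p ∂μ := by
  rw [betaOp, ← integral_sub_left_eq_self _ μ (1 : F)]
  simp only [betaVec, smul_smul, sub_sub_cancel, mul_comm]

lemma IsUnitaryRep.aesm_betaVec {u : F → H →L[ℂ] H} (hu : IsUnitaryRep u) (ρ : ℂ) (φ : H) :
    AEStronglyMeasurable (betaVec u ρ φ) μ := by
  have h : AEStronglyMeasurable (fun w => npow w ρ • u w φ) μ :=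
    (measurable_npow ρ).aestronglyMeasurable.smul (hu.aesm μ φ)
  exact h.comp_quasiMeasurePreserving (quasiMeasurePreserving_sub_left μ 1)

lemma aesm_cutOff {φ : H} {v : F → H} (hv : AEStronglyMeasurable v μ) :
    AEStronglyMeasurable (cutOff φ v) μ :=
  hv.sub ((stronglyMeasurable_const.indicator (measurableSet_nrm_le 1)).aestronglyMeasurable)

lemma norm_cutOff_betaVec_le {u : F → H →L[ℂ] H} (hu : IsUnitaryRep u) {φ : H}
    (hφ : IsLipVector u φ) {Z : ℝ} (hZ : 0 ≤ Z) : ∃ C η : ℝ, 0 < η ∧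
      ∀ ρ : ℂ, ‖ρ‖ ≤ Z → -(3 / 4) ≤ ρ.re → ρ.re ≤ -(1 / 2) → ∀ᵐ p ∂μ,
        ‖cutOff φ (betaVec u ρ φ) p‖ ≤ C * majorant 1 η p := by
  obtain ⟨C, η, hC, hη, hL⟩ := hφ
  obtain ⟨D, hD, hD'⟩ := norm_npow_sub_one_le (F := F) hZ
  refine ⟨C + D * ‖φ‖ + ‖φ‖ + ‖φ‖ / min η (1 / 2), min η (1 / 2), by positivity, ?_⟩
  intro ρ hρZ hρ1 hρ2
  filter_upwards [ae_ne μ 1] with p hp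
  have hp' : 1 - p ≠ 0 := sub_ne_zero.2 hp.symm
  refine norm_cutOff_le (by positivity) ((min_le_right _ _).trans (by norm_num)) (by positivity)
    (norm_nonneg φ) (fun h => ?_) (fun _ => ?_)
  · have e : ‖(1 - p) - 1‖ = ‖p‖ := by simp
    have h1 := hL (1 - p) (by rw [e]; exact h.trans (min_le_left _ _))
    have h2 := hD' (1 - p) ρ hρZ (by rw [e]; exact h.trans (min_le_right _ _))
    rw [e] at h1 h2
    have h3 : betaVec u ρ φ p - φ = (npow (1 - p) ρ - 1) • u (1 - p) φ + (u (1 - p) φ - φ) := by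
      rw [betaVec, sub_smul, one_smul]; abel
    rw [h3]
    refine (norm_add_le _ _).trans ?_
    rw [norm_smul, hu.norm _ hp']
    calc ‖npow (1 - p) ρ - 1‖ * ‖φ‖ + ‖u (1 - p) φ - φ‖ ≤ D * ‖p‖ * ‖φ‖ + C * ‖p‖ := by gcongr
      _ = (C + D * ‖φ‖) * ‖p‖ := by ring
  · rw [betaVec, norm_smul, hu.norm _ hp', norm_npow hp', mul_comm, one_mul]
    refine mul_le_mul_of_nonneg_left ?_ (norm_nonneg φ)
    have hn := nrm_pos hp'
    rcases le_total (nrm (1 - p)) 1 with h | h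
    · have := Real.rpow_le_rpow_of_exponent_ge hn h hρ1
      have := Real.rpow_nonneg hn.le (-(1 / 2) : ℝ)
      linarith
    · have := Real.rpow_le_rpow_of_exponent_le h hρ2
      have := Real.rpow_nonneg hn.le (-(3 / 4) : ℝ)
      linarith

variable [CompleteSpace H]

lemma tendsto_betaOp_sub {u : F → H →L[ℂ] H} (hu : IsUnitaryRep u) {φ : H}
    (hφ : IsLipVector u φ) {ι : Type*} {l : Filter ι} [l.IsCountablyGenerated] {ρ a : ι → ℂ}
    {ρ₀ a₀ : ℂ} (hρ : Tendsto ρ l (𝓝 ρ₀)) (ha : Tendsto a l (𝓝 a₀))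
    (hρ' : ∀ᶠ i in l, -(3 / 4) ≤ (ρ i).re ∧ (ρ i).re ≤ -(1 / 2))
    (ha' : ∀ᶠ i in l, 0 < (a i).re ∧ (a i).re ≤ 1 / 4) :
    Tendsto (fun i => betaOp μ u (ρ i) (a i) φ - unitInt μ (a i) • φ) l
      (𝓝 (∫ p, npow p (a₀ - 1) • cutOff φ (betaVec u ρ₀ φ) p ∂μ)) := by
  obtain ⟨C, η, hη, hb⟩ := norm_cutOff_betaVec_le μ hu hφ (Z := ‖ρ₀‖ + 1) (by positivity)
  have hZ : ∀ᶠ i in l, ‖ρ i‖ ≤ ‖ρ₀‖ + 1 :=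
    (hρ.norm.eventually_lt_const (lt_add_one _)).mono fun i hi => hi.le
  have hbi : ∀ᶠ i in l, ∀ᵐ p ∂μ, ‖cutOff φ (betaVec u (ρ i) φ) p‖ ≤ C * majorant 1 η p := by
    filter_upwards [hZ, hρ'] with i h1 h2 using hb _ h1 h2.1 h2.2
  have key := tendsto_integral_npow_smul μ (one_ne_zero (α := F)) hη ha
    (ha'.mono fun i hi => ⟨hi.1.le, hi.2⟩)
    (Eventually.of_forall fun i => aesm_cutOff μ (hu.aesm_betaVec μ (ρ i) φ)) hbi
    (f₀ := cutOff φ (betaVec u ρ₀ φ)) ?_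
  · refine key.congr' ?_
    filter_upwards [ha', hbi] with i hi hbi
    rw [betaOp_eq_integral_betaVec, integral_eq_cutOff_add μ hi.1 (integrable_npow_smul μ one_ne_zero hη
      hi.1.le hi.2 (aesm_cutOff μ (hu.aesm_betaVec μ (ρ i) φ)) hbi), add_sub_cancel_right]
  · filter_upwards [ae_ne μ 1] with p hp
    have hp' : 1 - p ≠ 0 := sub_ne_zero.2 hp.symm
    exact ((((continuousAt_npow_exp hp' ρ₀).tendsto.comp hρ).smul_const _).sub_const _)

/-- The boundary value at `Re c = 0` of the integral of `‖p‖ ^ (c - 1) v(p)`, for `v` close to `φ`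
at the origin: the constant `φ` is subtracted on the unit ball, and its integral is replaced by
the continued value. -/
noncomputable def regInt (c : ℂ) (φ : H) (v : F → H) : H :=
  (∫ p, npow p (c - 1) • cutOff φ v p ∂μ) + unitReg μ c • φ

/-- The boundary value of a beta operator. The exponent `ρ` may move with `ε`, which is needed for the
semigroup law. -/
lemma tendsto_betaOp {u : F → H →L[ℂ] H} (hu : IsUnitaryRep u) {φ : H} (hφ : IsLipVector u φ)
    {ρ c : ℂ} (hρ : ρ.re = -(1 / 2)) (hc : c.re = 0) (hc1 : ∃ x : F, x ≠ 0 ∧ npow x c ≠ 1)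
    {k : ℝ} (hk0 : 0 ≤ k) (hk1 : k ≤ 1) :
    Tendsto (fun ε : ℝ => betaOp μ u (ρ - k * ε) (c + ε) φ) (𝓝[>] 0)
      (𝓝 (regInt μ c φ (betaVec u ρ φ))) := by
  have hρ' : Tendsto (fun ε : ℝ => ρ - k * ε) (𝓝[>] 0) (𝓝 ρ) := by
    have h0 : Tendsto (fun ε : ℝ => (ε : ℂ)) (𝓝[>] 0) (𝓝 0) := by simpa using tendsto_add_ofReal 0
    simpa using (h0.const_mul (k : ℂ)).const_sub ρ
  have h := tendsto_betaOp_sub μ hu hφ (l := 𝓝[>] (0 : ℝ)) hρ' (tendsto_add_ofReal c) ?_ ?_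
  · have h2 := h.add ((tendsto_unitInt μ hc hc1).smul_const φ)
    simpa [regInt] using h2
  · filter_upwards [eventually_small (show (0 : ℝ) < 1 / 4 by norm_num)] with ε hε
    simp [hρ]
    constructor <;> nlinarith [hε.1, hε.2]
  · filter_upwards [eventually_small (show (0 : ℝ) < 1 / 4 by norm_num)] with ε hε
    simp [hc]
    constructor <;> linarith [hε.1, hε.2]

/-- As `ε → 0`, the operators `2 ε B(ρ - ε, 2 ε)` tend to the identity. -/
lemma tendsto_mul_betaOp (hμ : IsNormalizedHaar μ) {u : F → H →L[ℂ] H} (hu : IsUnitaryRep u)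
    {φ : H} (hφ : IsLipVector u φ) {ρ : ℂ} (hρ : ρ.re = -(1 / 2)) :
    Tendsto (fun ε : ℝ => ((2 * ε : ℝ) : ℂ) • betaOp μ u (ρ - ε) ((2 * ε : ℝ) : ℂ) φ) (𝓝[>] 0)
      (𝓝 φ) := by
  have h0 : Tendsto (fun ε : ℝ => (ε : ℂ)) (𝓝[>] 0) (𝓝 0) := by simpa using tendsto_add_ofReal 0
  have hρ' : Tendsto (fun ε : ℝ => ρ - ε) (𝓝[>] 0) (𝓝 ρ) := by simpa using h0.const_sub ρ
  have h2 : Tendsto (fun ε : ℝ => 2 * ε) (𝓝[>] (0 : ℝ)) (𝓝[>] 0) := by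
    refine tendsto_nhdsWithin_iff.2 ⟨?_, ?_⟩
    · have : Tendsto (fun ε : ℝ => 2 * ε) (𝓝 0) (𝓝 (2 * 0)) := tendsto_id.const_mul 2
      simpa using this.mono_left nhdsWithin_le_nhds
    · filter_upwards [eventually_small one_pos] with ε hε
      simpa using hε.1
  have h := tendsto_betaOp_sub μ hu hφ (l := 𝓝[>] (0 : ℝ)) hρ' (h0.comp h2) ?_ ?_
  · have h3 := ((h0.comp h2).smul h).add (((tendsto_mul_unitInt μ hμ).comp h2).smul_const φ)
    rw [zero_smul, zero_add, one_smul] at h3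
    refine h3.congr fun ε => ?_
    simp only [Function.comp_apply, smul_sub, smul_smul, sub_add_cancel]
  · filter_upwards [eventually_small (show (0 : ℝ) < 1 / 4 by norm_num)] with ε hε
    simp [hρ]
    constructor <;> linarith [hε.1, hε.2]
  · filter_upwards [eventually_small (show (0 : ℝ) < 1 / 8 by norm_num)] with ε hε
    simp
    constructor <;> linarith [hε.1, hε.2]

lemma conj_eq_neg_of_re {c : ℂ} (hc : c.re = 0) : (starRingEnd ℂ) c = -c := by
  apply Complex.ext <;> simp [hc]

lemma conj_eq_of_re {ρ : ℂ} (hρ : ρ.re = -(1 / 2)) : (starRingEnd ℂ) ρ = -1 - ρ := by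
  apply Complex.ext
  · simp [hρ]; norm_num
  · simp

/-- The adjoint of `B(ρ - ε, c + ε)` is `B(ρ + c, -c + ε)`, and by the semigroup law their product is
`β(c + ε, -c + ε) B(ρ - ε, 2 ε)`, which tends to a multiple of the identity. -/
lemma inner_regInt_self (hμ : IsNormalizedHaar μ) {u : F → H →L[ℂ] H} (hu : IsUnitaryRep u)
    {φ ψ : H} (hφ : IsLipVector u φ) (hψ : IsLipVector u ψ)
    {ρ c g : ℂ} (hρ : ρ.re = -(1 / 2)) (hc : c.re = 0)
    (hc1 : ∃ x : F, x ≠ 0 ∧ npow x c ≠ 1)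
    (hg : Tendsto (fun ε : ℝ => betaF μ (c + ε) (-c + ε) / ((2 * ε : ℝ) : ℂ)) (𝓝[>] 0) (𝓝 g)) :
    inner ℂ (regInt μ c φ (betaVec u ρ φ)) (regInt μ c ψ (betaVec u ρ ψ)) =
      (starRingEnd ℂ) g * inner ℂ φ ψ := by
  have h1 := tendsto_betaOp μ hu hφ hρ hc hc1 zero_le_one le_rfl
  have h2 := tendsto_betaOp μ hu hψ hρ hc hc1 zero_le_one le_rfl
  have h3 := (hg.smul (tendsto_mul_betaOp μ hμ hu hφ hρ)).inner (𝕜 := ℂ) (tendsto_const_nhds (x := ψ))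
  rw [inner_smul_left] at h3
  refine tendsto_nhds_unique (h1.inner h2) (h3.congr' ?_)
  filter_upwards [eventually_small (show (0 : ℝ) < 1 / 8 by norm_num)] with ε hε
  have hε0 : ((2 * ε : ℝ) : ℂ) ≠ 0 := by
    rw [Complex.ofReal_ne_zero]; linarith [hε.1]
  rw [smul_smul, div_mul_cancel₀ _ hε0]
  have e1 : (ρ - ((1 : ℝ) : ℂ) * ε).re = -(1 / 2) - ε := by simp [hρ]
  have e2 : (c + (ε : ℂ)).re = ε := by simp [hc]
  have hcc : -1 - (starRingEnd ℂ) (ρ - ((1 : ℝ) : ℂ) * ε) - (starRingEnd ℂ) (c + ε) =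
      (ρ - ((1 : ℝ) : ℂ) * ε) + (c + ε) := by
    simp only [map_sub, map_add, map_mul, Complex.conj_ofReal, conj_eq_neg_of_re hc,
      conj_eq_of_re hρ]
    push_cast; ring
  rw [inner_betaOp μ hu (by rw [e1]; linarith [hε.2]) (by rw [e2]; exact hε.1)
    (by rw [e1, e2]; linarith), hcc,
    show (starRingEnd ℂ) (c + ε) = -c + ε by simp [conj_eq_neg_of_re hc],
    betaOp_betaOp μ hu (by rw [e1]; linarith [hε.2]) (by rw [e2]; exact hε.1)
      (by simp [hc, hε.1]) (by rw [e1, e2]; simp [hc]; linarith [hε.2])]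
  congr 3
  · push_cast; ring
  · push_cast; ring

lemma inner_regInt {u : F → H →L[ℂ] H} (hu : IsUnitaryRep u)
    {φ ψ : H} (hφ : IsLipVector u φ) (hψ : IsLipVector u ψ)
    {ρ c : ℂ} (hρ : ρ.re = -(1 / 2)) (hc : c.re = 0)
    (hc1 : ∃ x : F, x ≠ 0 ∧ npow x c ≠ 1) :
    inner ℂ ψ (regInt μ c φ (betaVec u ρ φ)) =
      inner ℂ (regInt μ (-c) ψ (betaVec u (ρ + c) ψ)) φ := by
  have hc1' : ∃ x : F, x ≠ 0 ∧ npow x (-c) ≠ 1 := by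
    obtain ⟨x, hx, h⟩ := hc1
    exact ⟨x, hx, by rwa [npow_neg, Ne, inv_eq_one]⟩
  have h1 := tendsto_betaOp μ hu hφ hρ hc hc1 le_rfl zero_le_one
  have h2 := tendsto_betaOp μ hu hψ (ρ := ρ + c) (c := -c) (by simp [hρ, hc]) (by simp [hc]) hc1'
    zero_le_one le_rfl
  refine tendsto_nhds_unique ((tendsto_const_nhds (x := ψ)).inner h1)
    ((h2.inner (𝕜 := ℂ) (tendsto_const_nhds (x := φ))).congr' ?_)
  filter_upwards [eventually_small (show (0 : ℝ) < 1 / 8 by norm_num)] with ε hε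
  rw [inner_betaOp μ hu (by simp [hρ]; norm_num) (by simp [hc, hε.1])
    (by simp [hρ, hc]; linarith [hε.2])]
  simp only [map_sub, map_add, map_mul, Complex.conj_ofReal, conj_eq_neg_of_re hc,
    conj_eq_of_re hρ]
  congr 2
  push_cast; ring

/-- The regularized beta operators, divided by the gamma factors, are unitary: by the semigroup law
and the formula for the adjoint they preserve the inner product, and so do their adjoints, which are
operators of the same kind. -/
theorem exists_unitary (hμ : IsNormalizedHaar μ) {u : F → H →L[ℂ] H} (hu : IsUnitaryRep u)
    (S : Submodule ℂ H) (hS : Dense (S : Set H)) (hlip : ∀ φ ∈ S, IsLipVector u φ)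
    {ρ c γ γ' : ℂ} (hρ : ρ.re = -(1 / 2)) (hc : c.re = 0)
    (hc1 : ∃ x : F, x ≠ 0 ∧ npow x c ≠ 1) (hγ : γ ≠ 0) (hγ' : γ' = (starRingEnd ℂ) γ)
    (hg : Tendsto (fun ε : ℝ => betaF μ (c + ε) (-c + ε) / ((2 * ε : ℝ) : ℂ)) (𝓝[>] 0)
      (𝓝 (γ * γ'))) :
    ∃ V : H ≃ₗᵢ[ℂ] H, (∀ φ ∈ S, regInt μ c φ (betaVec u ρ φ) = γ • V φ) ∧
      ∀ φ ∈ S, regInt μ (-c) φ (betaVec u (ρ + c) φ) = γ' • V.symm φ := by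
  have hγ'0 : γ' ≠ 0 := by rw [hγ']; simpa using hγ
  -- the operator with parameters `(ρ, c)` extends from `S` to an isometry; this applies to the
  -- parameters `(ρ + c, -c)` of the adjoint as well
  have step : ∀ (ρ c γ γ' : ℂ), ρ.re = -(1 / 2) → c.re = 0 → (∃ x : F, x ≠ 0 ∧ npow x c ≠ 1) →
      γ ≠ 0 → γ' = (starRingEnd ℂ) γ →
      Tendsto (fun ε : ℝ => betaF μ (c + ε) (-c + ε) / ((2 * ε : ℝ) : ℂ)) (𝓝[>] 0) (𝓝 (γ * γ')) →
      ∃ T : H →L[ℂ] H, (∀ φ ψ, inner ℂ (T φ) (T ψ) = inner ℂ φ ψ) ∧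
        ∀ φ ∈ S, regInt μ c φ (betaVec u ρ φ) = γ • T φ := by
    intro ρ c γ γ' hρ hc hc1 hγ hγ' hg
    have hlim : ∀ φ : S, Tendsto (fun ε : ℝ => betaOp μ u ρ (c + ε) (φ : H)) (𝓝[>] 0)
        (𝓝 (regInt μ c (φ : H) (betaVec u ρ φ))) := fun φ => by
      simpa using tendsto_betaOp μ hu (hlip φ φ.2) hρ hc hc1 le_rfl zero_le_one
    have hlin : ∀ φ ψ : S, regInt μ c ((φ : H) + ψ) (betaVec u ρ ((φ : H) + ψ)) =
        regInt μ c (φ : H) (betaVec u ρ φ) + regInt μ c (ψ : H) (betaVec u ρ ψ) := fun φ ψ => by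
      refine tendsto_nhds_unique (hlim (φ + ψ)) (((hlim φ).add (hlim ψ)).congr' ?_)
      filter_upwards [eventually_small (show (0 : ℝ) < 1 / 8 by norm_num)] with ε hε
      rw [Submodule.coe_add, betaOp_add μ hu (by rw [hρ]; norm_num) (by simp [hc, hε.1])
        (by simp [hρ, hc]; linarith [hε.2])]
    have hsm : ∀ (z : ℂ) (φ : S), regInt μ c (z • (φ : H)) (betaVec u ρ (z • (φ : H))) =
        z • regInt μ c (φ : H) (betaVec u ρ φ) := fun z φ => by
      refine tendsto_nhds_unique (hlim (z • φ)) (((hlim φ).const_smul z).congr fun ε => ?_)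
      rw [Submodule.coe_smul, betaOp_smul]
    have hinner : ∀ φ ψ : S, inner ℂ (γ⁻¹ • regInt μ c (φ : H) (betaVec u ρ φ))
        (γ⁻¹ • regInt μ c (ψ : H) (betaVec u ρ ψ)) = inner ℂ (φ : H) ψ := fun φ ψ => by
      rw [inner_smul_left, inner_smul_right,
        inner_regInt_self μ hμ hu (hlip φ φ.2) (hlip ψ ψ.2) hρ hc hc1 hg, map_mul, hγ',
        Complex.conj_conj, map_inv₀]
      have : (starRingEnd ℂ) γ ≠ 0 := by simpa using hγ
      field_simp
    let L : S →ₗ[ℂ] H :=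
      { toFun := fun φ => γ⁻¹ • regInt μ c (φ : H) (betaVec u ρ φ)
        map_add' := fun φ ψ => by rw [Submodule.coe_add, hlin, smul_add]
        map_smul' := fun z φ => by rw [Submodule.coe_smul, hsm, smul_comm, RingHom.id_apply] }
    have hLn : ∀ φ : S, ‖L φ‖ ≤ 1 * ‖φ‖ := fun φ => by
      rw [one_mul, ← sq_le_sq₀ (norm_nonneg _) (norm_nonneg _)]
      refine le_of_eq ?_
      have := hinner φ φ
      rw [inner_self_eq_norm_sq_to_K, inner_self_eq_norm_sq_to_K] at this
      exact_mod_cast this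
    let L' : S →L[ℂ] H := L.mkContinuous 1 hLn
    have hd : DenseRange (S.subtypeL : S → H) := by simpa [DenseRange] using hS
    have hui : IsUniformInducing (S.subtypeL : S → H) := isUniformEmbedding_subtype_val.isUniformInducing
    have hext : ∀ φ : S, L'.extend S.subtypeL φ = L φ := fun φ =>
      ContinuousLinearMap.extend_eq L' hd hui φ
    refine ⟨L'.extend S.subtypeL, ?_, ?_⟩
    · have hcl : IsClosed {q : H × H | inner ℂ (L'.extend S.subtypeL q.1) (L'.extend S.subtypeL q.2) =
          inner ℂ q.1 q.2} := by
        refine isClosed_eq ?_ (continuous_fst.inner continuous_snd)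
        exact ((L'.extend S.subtypeL).continuous.comp continuous_fst).inner
          ((L'.extend S.subtypeL).continuous.comp continuous_snd)
      intro φ ψ
      refine closure_minimal (s := (S : Set H) ×ˢ (S : Set H)) ?_ hcl
        (by rw [(hS.prod hS).closure_eq]; exact Set.mem_univ (φ, ψ))
      rintro ⟨φ, ψ⟩ ⟨h1, h2⟩
      simp only [Set.mem_ofPred_eq]
      rw [hext ⟨φ, h1⟩, hext ⟨ψ, h2⟩]
      exact hinner ⟨φ, h1⟩ ⟨ψ, h2⟩
    · intro φ hφ
      rw [hext ⟨φ, hφ⟩]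
      simp [L, smul_smul, hγ]
  have hc1' : ∃ x : F, x ≠ 0 ∧ npow x (-c) ≠ 1 := by
    obtain ⟨x, hx, h⟩ := hc1
    exact ⟨x, hx, by rwa [npow_neg, Ne, inv_eq_one]⟩
  have hsymm : ∀ ε : ℝ, betaF μ (-c + ε) (- -c + ε) = betaF μ (c + ε) (-c + ε) := fun ε => by
    rw [betaF, betaF, ← integral_sub_left_eq_self _ μ (1 : F)]
    simp only [sub_sub_cancel, neg_neg, mul_comm]
  obtain ⟨T, hT, hTS⟩ := step ρ c γ γ' hρ hc hc1 hγ hγ' hg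
  obtain ⟨T', hT', hTS'⟩ := step (ρ + c) (-c) γ' γ (by simp [hρ, hc]) (by simp [hc]) hc1' hγ'0
    (by rw [hγ', Complex.conj_conj]) (by simpa only [hsymm, mul_comm] using hg)
  -- two isometries that are adjoint to each other are inverse to each other
  have hadj : ∀ ψ φ, inner ℂ ψ (T φ) = inner ℂ (T' ψ) φ := by
    have hcl : IsClosed {q : H × H | inner ℂ q.1 (T q.2) = inner ℂ (T' q.1) q.2} :=
      isClosed_eq (continuous_fst.inner (T.continuous.comp continuous_snd))
        ((T'.continuous.comp continuous_fst).inner continuous_snd)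
    intro ψ φ
    refine closure_minimal (s := (S : Set H) ×ˢ (S : Set H)) ?_ hcl
      (by rw [(hS.prod hS).closure_eq]; exact Set.mem_univ (ψ, φ))
    rintro ⟨ψ, φ⟩ ⟨h1, h2⟩
    have h3 := inner_regInt μ hu (hlip φ h2) (hlip ψ h1) hρ hc hc1
    rw [hTS φ h2, hTS' ψ h1, inner_smul_right, inner_smul_left, hγ', Complex.conj_conj] at h3
    exact mul_left_cancel₀ hγ h3
  have h1 : ∀ φ, T' (T φ) = φ := fun φ => ext_inner_right ℂ fun ψ => by rw [← hadj, hT]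
  have h2 : ∀ φ, T (T' φ) = φ := fun φ => ext_inner_left ℂ fun ψ => by rw [hadj, hT']
  refine ⟨⟨⟨T.toLinearMap, T', h1, h2⟩, fun φ => ?_⟩, hTS, hTS'⟩
  change ‖T φ‖ = ‖φ‖
  rw [← sq_eq_sq₀ (norm_nonneg _) (norm_nonneg _)]
  have := hT φ φ
  rw [inner_self_eq_norm_sq_to_K, inner_self_eq_norm_sq_to_K] at this
  exact_mod_cast this

end Unitarity


/-! ### Fourier analysis on the local field -/

section LipschitzTest

/-- A locally integrable function that is orthogonal to all Lipschitz functions with compact support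
vanishes almost everywhere. -/
lemma ae_eq_zero_of_integral_lipschitz_smul {X : Type*} [MetricSpace X] [ProperSpace X]
    [MeasurableSpace X] [BorelSpace X] {ν : Measure X} {h : X → ℂ} (hh : LocallyIntegrable h ν)
    (H : ∀ G : X → ℝ, (∃ K : ℝ≥0, LipschitzWith K G) → HasCompactSupport G →
      ∫ x, G x • h x ∂ν = 0) : h =ᵐ[ν] 0 := by
  refine ae_eq_zero_of_forall_setIntegral_isCompact_eq_zero' hh fun s hs => ?_
  obtain ⟨u, -, u_pos, u_lim⟩ := exists_seq_strictAnti_tendsto' (one_pos (α := ℝ))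
  have hK : IsCompact (Metric.cthickening 1 s) := hs.cthickening
  let G : ℕ → X → ℝ := fun n x => (thickenedIndicator (u_pos n).1 s x : ℝ)
  have hG0 : ∀ n, ∀ x ∉ Metric.cthickening 1 s, G n x = 0 := fun n x hx => by
    have : x ∉ Metric.thickening (u n) s := fun h' =>
      hx (Metric.thickening_subset_cthickening_of_le (u_pos n).2.le _ h')
    simp only [G, thickenedIndicator_zero (u_pos n).1 s this, NNReal.coe_zero]
  have hGl : ∀ n, ∃ K : ℝ≥0, LipschitzWith K (G n) := fun n =>
    ⟨_, lipschitzWith_thickenedIndicator (u_pos n).1 s⟩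
  have hG1 : ∀ n x, ‖G n x‖ ≤ 1 := fun n x => by
    simpa [G] using thickenedIndicator_le_one (u_pos n).1 s x
  have hz : ∀ n, ∫ x, G n x • h x ∂ν = 0 := fun n =>
    H _ (hGl n) (HasCompactSupport.intro hK (hG0 n))
  have hlim : Tendsto (fun n => ∫ x, G n x • h x ∂ν) atTop (𝓝 (∫ x in s, h x ∂ν)) := by
    rw [← integral_indicator hs.measurableSet]
    refine tendsto_integral_of_dominated_convergence
      ((Metric.cthickening 1 s).indicator fun x => ‖h x‖) (fun n => ?_) ?_ (fun n => ?_) ?_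
    · obtain ⟨K, hK'⟩ := hGl n
      exact hK'.continuous.aestronglyMeasurable.smul hh.aestronglyMeasurable
    · rw [integrable_indicator_iff hK.measurableSet]
      exact (hh.integrableOn_isCompact hK).norm
    · refine Eventually.of_forall fun x => ?_
      by_cases hx : x ∈ Metric.cthickening 1 s
      · rw [Set.indicator_of_mem hx, norm_smul]
        exact mul_le_of_le_one_left (norm_nonneg _) (hG1 n x)
      · simp [hx, hG0 n x hx]
    · refine Eventually.of_forall fun x => ?_
      have h1 := tendsto_pi_nhds.1 (thickenedIndicator_tendsto_indicator_closure
        (fun n => (u_pos n).1) u_lim s) x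
      have h2 := ((NNReal.continuous_coe.tendsto _).comp h1).smul_const (h x)
      rw [hs.isClosed.closure_eq] at h2
      refine h2.trans (le_of_eq ?_)
      by_cases hx : x ∈ s <;> simp [hx]
  exact tendsto_nhds_unique hlim (by simp only [hz, tendsto_const_nhds])

end LipschitzTest

section Fourier

variable {F : Type*} [NontriviallyNormedField F] [ProperSpace F] [MeasurableSpace F] [BorelSpace F]
  (μ : Measure F) [μ.IsAddHaarMeasure] {e : AddChar F Circle}

lemma continuous_neg_mul : Continuous fun p : F × F => (-(LinearMap.mul F F)) p.1 p.2 := by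
  simp only [LinearMap.neg_apply, LinearMap.mul_apply']
  fun_prop

lemma fourier_eq (f : F → ℂ) :
    fourier e μ f = VectorFourier.fourierIntegral e μ (-(LinearMap.mul F F)) f := by
  ext u
  simp [fourier, VectorFourier.fourierIntegral, Circle.smul_def, mul_comm u]

lemma continuous_fourier (he : Continuous e) {f : F → ℂ} (hf : Integrable f μ) :
    Continuous (fourier e μ f) := by
  rw [fourier_eq]
  exact VectorFourier.fourierIntegral_continuous he continuous_neg_mul hf

lemma norm_fourier_le (f : F → ℂ) (u : F) : ‖fourier e μ f u‖ ≤ ∫ v, ‖f v‖ ∂μ := by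
  rw [fourier_eq]
  exact VectorFourier.norm_fourierIntegral_le_integral_norm ..

lemma integrable_fourier_integrand (he : Continuous e) {f : F → ℂ} (hf : Integrable f μ) (u : F) :
    Integrable (fun v => (e (u * v) : ℂ) * f v) μ := by
  have := (VectorFourier.fourierIntegral_convergent_iff (L := -(LinearMap.mul F F)) he
    continuous_neg_mul u).2 hf
  simpa [Circle.smul_def, mul_comm u] using this

lemma integral_fourier_mul (he : Continuous e) {f g : F → ℂ} (hf : Integrable f μ)
    (hg : Integrable g μ) :
    ∫ u, fourier e μ f u * g u ∂μ = ∫ v, f v * fourier e μ g v ∂μ := by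
  have h := VectorFourier.integral_fourierIntegral_smul_eq_flip (L := -(LinearMap.mul F F))
    (ν := μ) he continuous_neg_mul hf hg
  have hflip : (-(LinearMap.mul F F)).flip = -(LinearMap.mul F F) := by
    ext; simp
  rw [hflip] at h
  simpa only [fourier_eq, smul_eq_mul] using h

/-- The Fourier transform of a modulated and dilated function. -/
lemma fourier_modulate_dilate (f : F → ℂ) {δ : F} (hδ : δ ≠ 0) (y v : F) :
    fourier e μ (fun u => (e (y * u) : ℂ) * f (δ * u)) v =
      ((nrm δ)⁻¹ : ℝ) • fourier e μ f (δ⁻¹ * (v + y)) := by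
  rw [fourier, fourier, ← integral_mul_left μ hδ fun u => (e (δ⁻¹ * (v + y) * u) : ℂ) * f u]
  refine integral_congr_ae (Eventually.of_forall fun u => ?_)
  simp only
  rw [show δ⁻¹ * (v + y) * (δ * u) = v * u + y * u by field_simp, AddChar.map_add_eq_mul,
    Circle.coe_mul]
  ring

lemma fourier_comp_sub (f : F → ℂ) (a u : F) :
    fourier e μ (fun v => f (v - a)) u = (e (u * a) : ℂ) * fourier e μ f u := by
  rw [fourier, fourier, ← integral_const_mul,
    ← integral_sub_right_eq_self (fun v => (e (u * a) : ℂ) * ((e (u * v) : ℂ) * f v)) a]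
  congr 1
  ext v
  rw [← mul_assoc, ← Circle.coe_mul, ← AddChar.map_add_eq_mul]
  ring_nf

/-- The tent function `max (0, 1 - ‖v‖)`. -/
def tent (v : F) : ℝ := max 0 (1 - ‖v‖)

lemma lipschitz_tent : LipschitzWith 1 (tent (F := F)) := by
  have h : LipschitzWith 1 fun v : F => 1 - ‖v‖ := by
    refine LipschitzWith.of_dist_le_mul fun x y => ?_
    rw [Real.dist_eq, dist_eq_norm, NNReal.coe_one, one_mul]
    simpa [abs_sub_comm] using abs_norm_sub_norm_le x y
  exact h.const_max 0

lemma tent_nonneg (v : F) : 0 ≤ tent v := le_max_left _ _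

lemma tent_eq_zero {v : F} (hv : 1 ≤ ‖v‖) : tent v = 0 := by
  rw [tent, max_eq_left]; linarith

lemma hasCompactSupport_tent : HasCompactSupport (tent (F := F)) :=
  HasCompactSupport.intro (isCompact_closedBall (0 : F) 1) fun v hv => tent_eq_zero <| by
    have : 1 < ‖v‖ := by simpa using hv
    exact this.le

lemma integrable_tent : Integrable (fun v : F => (tent v : ℂ)) μ :=
  (lipschitz_tent.continuous.integrable_of_hasCompactSupport hasCompactSupport_tent).ofReal

/-- The Fourier transform of the tent function is `O(1/‖u‖)`, because the tent function is
Lipschitz. -/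
lemma norm_fourier_tent_le (he : Continuous e) (he1 : e ≠ 1) :
    ∃ C : ℝ, 0 ≤ C ∧ ∀ u : F, u ≠ 0 → ‖fourier e μ (fun v => (tent v : ℂ)) u‖ ≤ C * ‖u‖⁻¹ := by
  obtain ⟨b, hb⟩ : ∃ b, e b ≠ 1 := by
    by_contra! h
    exact he1 (by ext x; simp [h x])
  have hb' : 0 < ‖(e b : ℂ) - 1‖ := by
    rw [norm_pos_iff, sub_ne_zero]
    exact fun h => hb (by ext; simpa using h)
  set f : F → ℂ := fun v => (tent v : ℂ)
  set B := ∫ v, ‖f v‖ ∂μ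
  have hB : 0 ≤ B := integral_nonneg fun _ => norm_nonneg _
  set V := μ.real (Metric.closedBall (0 : F) 2)
  refine ⟨max (B * ‖b‖) (V * ‖b‖ / ‖(e b : ℂ) - 1‖),
    le_max_of_le_left (by positivity), fun u hu => ?_⟩
  have hu' : 0 < ‖u‖ := norm_pos_iff.2 hu
  rcases le_total ‖u‖ ‖b‖ with hub | hub
  · -- for `‖u‖ ≤ ‖b‖` the trivial bound suffices
    refine (norm_fourier_le μ f u).trans ?_
    refine le_trans ?_ (mul_le_mul_of_nonneg_right (le_max_left _ _) (by positivity))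
    rw [mul_assoc]
    refine le_mul_of_one_le_right hB ?_
    rwa [← div_eq_mul_inv, one_le_div hu']
  · refine le_trans ?_ (mul_le_mul_of_nonneg_right (le_max_right _ _) (by positivity))
    -- translation by `a = b / u` multiplies the Fourier transform at `u` by `e b ≠ 1`
    set a := u⁻¹ * b
    have ha : ‖a‖ = ‖b‖ * ‖u‖⁻¹ := by rw [norm_mul, norm_inv, mul_comm]
    have ha1 : ‖a‖ ≤ 1 := by rw [ha, ← div_eq_mul_inv]; exact (div_le_one hu').2 hub
    have hint := integrable_tent μ (F := F)
    have key : ((e b : ℂ) - 1) * fourier e μ f u = ∫ v, (e (u * v) : ℂ) * (f (v - a) - f v) ∂μ := by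
      have h1 := fourier_comp_sub μ (e := e) f a u
      rw [show u * a = b by simp [a, hu]] at h1
      rw [sub_mul, one_mul, ← h1, fourier, fourier, ← integral_sub
        (integrable_fourier_integrand μ he (hint.comp_sub_right a) u)
        (integrable_fourier_integrand μ he hint u)]
      simp only [mul_sub, f]
    have h2 : ‖((e b : ℂ) - 1) * fourier e μ f u‖ ≤ V * ‖a‖ := by
      rw [key]
      refine (norm_integral_le_integral_norm _).trans ?_
      calc ∫ v, ‖(e (u * v) : ℂ) * (f (v - a) - f v)‖ ∂μ
          ≤ ∫ v, (Metric.closedBall (0 : F) 2).indicator (fun _ => ‖a‖) v ∂μ := by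
            refine integral_mono_of_nonneg (Eventually.of_forall fun _ => norm_nonneg _) ?_
              (Eventually.of_forall fun v => ?_)
            · exact (integrable_indicator_iff measurableSet_closedBall).2
                (integrableOn_const (isCompact_closedBall _ _).measure_lt_top.ne)
            · simp only [norm_mul, Circle.norm_coe, one_mul]
              by_cases hv : v ∈ Metric.closedBall (0 : F) 2
              · rw [Set.indicator_of_mem hv, ← Complex.ofReal_sub, Complex.norm_real]
                have := lipschitz_tent.dist_le_mul (v - a) v
                simpa [Real.dist_eq] using this
              · have hv' : 2 < ‖v‖ := by simpa using hv
                have h3 : 1 ≤ ‖v - a‖ := by linarith [norm_sub_norm_le v a]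
                simp [f, hv, tent_eq_zero h3, tent_eq_zero (show 1 ≤ ‖v‖ by linarith)]
        _ = V * ‖a‖ := by
            rw [integral_indicator measurableSet_closedBall, setIntegral_const, smul_eq_mul]
    rw [norm_mul, ha] at h2
    rw [div_mul_eq_mul_div, le_div_iff₀ hb', mul_comm]
    linarith

/-- The Fourier transform of the tent function is real, since the tent function is even. -/
lemma fourier_tent_real (u : F) : ((fourier e μ (fun v => (tent v : ℂ)) u).re : ℂ) =
    fourier e μ (fun v => (tent v : ℂ)) u := by
  rw [← Complex.conj_eq_iff_re, fourier, ← integral_conj, ← integral_neg_eq_self]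
  refine integral_congr_ae (Eventually.of_forall fun v => ?_)
  simp [← Circle.coe_inv_eq_conj, ← AddChar.map_neg_eq_inv, tent]

/-- The Fourier transform of the self-convolution of a real function is the square of the Fourier
transform. -/
lemma fourier_convolution_self {P : F → ℝ} (hP : Continuous P) (hc : HasCompactSupport P)
    (he : Continuous e) (u : F) :
    fourier e μ (fun v => ((∫ t, P t * P (v - t) ∂μ : ℝ) : ℂ)) u =
      fourier e μ (fun v => (P v : ℂ)) u ^ 2 := by
  have hi : Integrable (fun v => (e (u * v) : ℂ) * (P v : ℂ)) μ :=
    integrable_fourier_integrand μ he (hP.integrable_of_hasCompactSupport hc).ofReal u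
  have h := integral_convolution (μ := μ) (ν := μ) (ContinuousLinearMap.mul ℝ ℂ) hi hi
  rw [ContinuousLinearMap.mul_apply'] at h
  rw [sq]
  refine Eq.trans ?_ h
  refine integral_congr_ae (Eventually.of_forall fun v => ?_)
  simp only [convolution_def, ContinuousLinearMap.mul_apply']
  rw [← integral_complex_ofReal, ← integral_const_mul]
  congr 1
  ext t
  rw [show u * v = u * t + u * (v - t) by ring, AddChar.map_add_eq_mul, Circle.coe_mul]
  push_cast
  ring

/-- Convolution powers of the tent function. -/
lemma exists_fourier_eq_pow (he : Continuous e) (k : ℕ) : ∃ P : F → ℝ, Continuous P ∧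
    HasCompactSupport P ∧ (∀ v, 0 ≤ P v) ∧ ∀ u, fourier e μ (fun v => (P v : ℂ)) u =
      fourier e μ (fun v => (tent v : ℂ)) u ^ (2 ^ k) := by
  induction k with
  | zero => exact ⟨tent, lipschitz_tent.continuous, hasCompactSupport_tent, tent_nonneg, by simp⟩
  | succ k ih =>
    obtain ⟨P, hP, hc, h0, hf⟩ := ih
    refine ⟨fun v => ∫ t, P t * P (v - t) ∂μ, ?_, ?_, fun v => integral_nonneg fun t =>
      mul_nonneg (h0 _) (h0 _), fun u => ?_⟩
    · exact hc.continuous_convolution_right (ContinuousLinearMap.mul ℝ ℝ)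
        hP.locallyIntegrable hP
    · exact HasCompactSupport.convolution (ContinuousLinearMap.mul ℝ ℝ) (μ := μ) hc hc
    · rw [fourier_convolution_self μ hP hc he, hf, ← pow_mul, pow_succ]

lemma integral_tent_pos : 0 < ∫ v : F, tent v ∂μ := by
  refine lipschitz_tent.continuous.integral_pos_of_hasCompactSupport_nonneg_nonzero
    hasCompactSupport_tent tent_nonneg (x := 0) (by simp [tent])

lemma fourier_zero (f : F → ℂ) : fourier e μ f 0 = ∫ v, f v ∂μ := by
  simp [fourier]

/-- A convolution power of the tent function: its Fourier transform is a power of that of the tent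
function, hence decays fast, and for an even power it is nonnegative, hence has a nonzero integral. -/
lemma exists_integrable_fourier (he : Continuous e) (he1 : e ≠ 1) : ∃ P : F → ℝ, Continuous P ∧
    HasCompactSupport P ∧ (∀ v, 0 ≤ P v) ∧ (0 < ∫ v, P v ∂μ) ∧
    Integrable (fourier e μ fun v => (P v : ℂ)) μ ∧
    ∫ u, fourier e μ (fun v => (P v : ℂ)) u ∂μ ≠ 0 := by
  obtain ⟨C, hC, hdecay⟩ := norm_fourier_tent_le μ he he1
  obtain ⟨k, hk⟩ := exists_nat_gt (nrmExp F)
  obtain ⟨P, hP, hc, h0, hf⟩ := exists_fourier_eq_pow μ he (k + 1)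
  set T := fourier e μ (fun v => (tent v : ℂ))
  have hPi : Integrable (fun v => (P v : ℂ)) μ := (hP.integrable_of_hasCompactSupport hc).ofReal
  have hcont := continuous_fourier μ he hPi
  -- the Fourier transform is `O(‖u‖ ^ (-N))`, which is integrable at infinity for `N > nrmExp F`
  set N := 2 ^ (k + 1) with hN
  have hkN : nrmExp F < N := by
    refine hk.trans ?_
    exact_mod_cast (Nat.lt_succ_self k).trans Nat.lt_two_pow_self
  have hT0 : T 0 = ((∫ v : F, tent v ∂μ : ℝ) : ℂ) := by
    rw [← integral_complex_ofReal]; exact fourier_zero μ _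
  have hint : Integrable (fourier e μ fun v => (P v : ℂ)) μ := by
    rw [← integrableOn_univ, ← Set.union_compl_self {s : F | nrm s ≤ 1}]
    refine IntegrableOn.union (hcont.continuousOn.integrableOn_compact (isCompact_nrm_le 1)) ?_
    have h1 : (-(N / nrmExp F) : ℝ) < -1 := by
      rw [neg_lt_neg_iff, one_lt_div (nrmExp_pos F)]; exact hkN
    have h2 := (integrableOn_nrm_rpow_ge μ h1).const_mul (C ^ N)
    have h3 : IntegrableOn (fourier e μ fun v => (P v : ℂ)) {s : F | 1 ≤ nrm s} μ := ?_
    · refine h3.mono_set fun s hs => ?_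
      have : ¬ nrm s ≤ 1 := hs
      exact (not_le.1 this).le
    refine Integrable.mono' h2 hcont.aestronglyMeasurable.restrict ?_
    · refine (ae_restrict_iff' (measurableSet_le measurable_const measurable_nrm)).2
        (Eventually.of_forall fun u hu => ?_)
      have hu0 : u ≠ 0 := ne_zero_of_one_le_nrm hu
      rw [hf, norm_pow]
      refine (pow_le_pow_left₀ (norm_nonneg _) (hdecay u hu0) N).trans (le_of_eq ?_)
      rw [mul_pow, nrm_eq_rpow, ← Real.rpow_mul (norm_nonneg _),
        show nrmExp F * -(N / nrmExp F) = -(N : ℝ) by field_simp [(nrmExp_pos F).ne'],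
        Real.rpow_neg (norm_nonneg _), Real.rpow_natCast, inv_pow]
  have hPT : ∀ v : F, fourier e μ (fun v => (P v : ℂ)) v = (((T v).re ^ N : ℝ) : ℂ) := fun v => by
    rw [hf, Complex.ofReal_pow]; congr 1; exact (fourier_tent_real μ v).symm
  have hNe : Even N := by rw [hN, pow_succ]; exact even_two.mul_left _
  refine ⟨P, hP, hc, h0, ?_, hint, ?_⟩
  · have h1 := hPT 0
    rw [fourier_zero, integral_complex_ofReal, Complex.ofReal_inj] at h1
    rw [h1, hT0, Complex.ofReal_re]
    exact pow_pos (integral_tent_pos μ) N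
  · have hint2 := hint
    rw [show (fourier e μ fun v => (P v : ℂ)) = fun v => (((T v).re ^ N : ℝ) : ℂ) from funext hPT]
      at hint2 ⊢
    rw [integral_complex_ofReal, Complex.ofReal_ne_zero]
    have hcT : Continuous fun v => (T v).re ^ N :=
      (Complex.continuous_re.comp (continuous_fourier μ he (integrable_tent μ))).pow N
    have hint' : Integrable (fun v => (T v).re ^ N) μ := hint2.re.congr (Eventually.of_forall fun v => Complex.ofReal_re _)
    refine ((integral_pos_iff_support_of_nonneg (fun v => hNe.pow_nonneg _) hint').2 ?_).ne'
    refine (hcT.isOpen_support).measure_pos μ ⟨0, ?_⟩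
    rw [Function.mem_support, hT0, Complex.ofReal_re]
    exact (pow_pos (integral_tent_pos μ) N).ne'

/-- A sequence of nonzero elements that tends to zero. -/
lemma exists_seq_tendsto_zero (F : Type*) [NontriviallyNormedField F] :
    ∃ δ : ℕ → F, (∀ k, δ k ≠ 0) ∧ Tendsto δ atTop (𝓝 0) := by
  obtain ⟨b, hb0, hb1⟩ := NormedField.exists_norm_lt_one F
  exact ⟨fun k => b ^ k, fun k => pow_ne_zero _ (norm_pos_iff.1 hb0),
    tendsto_pow_atTop_nhds_zero_of_norm_lt_one hb1⟩

/-- Fourier inversion up to a constant, paired with a test function `G`: the integral defining the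
second Fourier transform is regularized by the dilated windows `p(δ u)`, `δ → 0`. -/
lemma integral_mul_fourier_fourier (he : Continuous e) {P : F → ℝ} (hP : Continuous P)
    (hPc : HasCompactSupport P) (hPh : Integrable (fourier e μ fun v => (P v : ℂ)) μ)
    {f : F → ℂ} (hf : Integrable f μ) (hfh : Integrable (fourier e μ f) μ)
    {G : F → ℝ} (hG : Continuous G) (hGc : HasCompactSupport G) :
    ∫ y, G y • ((P 0 : ℂ) * fourier e μ (fourier e μ f) y) ∂μ =
      ∫ y, G y • ((∫ u, fourier e μ (fun v => (P v : ℂ)) u ∂μ) * f (-y)) ∂μ := by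
  obtain ⟨δ, hδ0, hδ⟩ := exists_seq_tendsto_zero F
  set p : F → ℂ := fun v => (P v : ℂ)
  set q := fourier e μ p
  have hp : Continuous p := Complex.continuous_ofReal.comp hP
  have hpi : Integrable p μ := (hP.integrable_of_hasCompactSupport hPc).ofReal
  have hqc : Continuous q := continuous_fourier μ he hpi
  obtain ⟨A, hA⟩ := hPc.exists_bound_of_continuous hP
  obtain ⟨B, hB⟩ := hGc.exists_bound_of_continuous hG
  have hGi : Integrable G μ := hG.integrable_of_hasCompactSupport hGc
  -- the multiplication formula for a dilated and modulated window
  have hmult : ∀ k y, ∫ u, fourier e μ f u * ((e (y * u) : ℂ) * p (δ k * u)) ∂μ =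
      ∫ v, f v * (((nrm (δ k))⁻¹ : ℝ) • q ((δ k)⁻¹ * (v + y))) ∂μ := fun k y => by
    have h1 : Integrable (fun u => (e (y * u) : ℂ) * p (δ k * u)) μ :=
      integrable_fourier_integrand μ he ((integrable_mul_left μ (hδ0 k)).2 hpi) y
    rw [integral_fourier_mul μ he hf h1]
    simp only [fourier_modulate_dilate μ p (hδ0 k), q]
  -- the left side
  have hL : Tendsto (fun k => ∫ y, G y • ∫ u, fourier e μ f u *
      ((e (y * u) : ℂ) * p (δ k * u)) ∂μ ∂μ) atTop
      (𝓝 (∫ y, G y • (p 0 * fourier e μ (fourier e μ f) y) ∂μ)) := by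
    have hb : ∀ k y u, ‖fourier e μ f u * ((e (y * u) : ℂ) * p (δ k * u))‖ ≤
        ‖fourier e μ f u‖ * A := fun k y u => by
      rw [norm_mul, norm_mul, Circle.norm_coe, one_mul]
      exact mul_le_mul_of_nonneg_left (by simpa [p] using hA (δ k * u)) (norm_nonneg _)
    refine tendsto_integral_of_dominated_convergence
      (fun y => ‖G y‖ * ∫ u, ‖fourier e μ f u‖ * A ∂μ) (fun k => ?_) (hGi.norm.mul_const _)
      (fun k => Eventually.of_forall fun y => ?_) (Eventually.of_forall fun y => ?_)
    · refine hG.aestronglyMeasurable.smul (Continuous.aestronglyMeasurable ?_)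
      refine continuous_of_dominated (fun y => ?_) (fun y => Eventually.of_forall (hb k y))
        (hfh.norm.mul_const A) (Eventually.of_forall fun u => ?_)
      · exact hfh.1.mul ((Continuous.aestronglyMeasurable (by fun_prop)))
      · fun_prop
    · rw [norm_smul]
      exact mul_le_mul_of_nonneg_left ((norm_integral_le_integral_norm _).trans
        (integral_mono_of_nonneg (Eventually.of_forall fun _ => norm_nonneg _)
          (hfh.norm.mul_const A) (Eventually.of_forall (hb k y)))) (norm_nonneg _)
    · refine Tendsto.const_smul ?_ (G y)
      rw [fourier, ← integral_const_mul]
      refine tendsto_integral_of_dominated_convergence (fun u => ‖fourier e μ f u‖ * A)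
        (fun k => ?_) (hfh.norm.mul_const A) (fun k => Eventually.of_forall (hb k y))
        (Eventually.of_forall fun u => ?_)
      · exact hfh.1.mul ((Continuous.aestronglyMeasurable (by fun_prop)))
      · have h1 : Tendsto (fun k => p (δ k * u)) atTop (𝓝 (p 0)) := by
          refine (hp.tendsto 0).comp ?_
          simpa using hδ.mul_const u
        have h2 := (h1.const_mul ((e (y * u) : ℂ))).const_mul (fourier e μ f u)
        convert! h2 using 2
        ring
  -- the right side
  have hR : Tendsto (fun k => ∫ y, G y • ∫ u, fourier e μ f u *
      ((e (y * u) : ℂ) * p (δ k * u)) ∂μ ∂μ) atTop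
      (𝓝 (∫ v, f v * ∫ w, G (-v) • q w ∂μ ∂μ)) := by
    have hswap : ∀ k, ∫ y, G y • ∫ u, fourier e μ f u * ((e (y * u) : ℂ) * p (δ k * u)) ∂μ ∂μ =
        ∫ v, f v * ∫ w, G (δ k * w - v) • q w ∂μ ∂μ := fun k => by
      simp only [hmult, ← integral_smul]
      rw [integral_integral_swap]
      · refine integral_congr_ae (Eventually.of_forall fun v => ?_)
        simp only
        rw [← integral_const_mul, ← integral_sub_right_eq_self _ v]
        simp only [add_sub_cancel]
        have h1 := integral_mul_left μ (hδ0 k) fun y =>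
          f v * (G (y - v) • q ((δ k)⁻¹ * y))
        simp only [inv_mul_cancel_left₀ (hδ0 k)] at h1
        rw [h1, ← integral_smul]
        congr 1
        ext y
        simp only [Complex.real_smul]
        ring
      · have h1 : Integrable (fun z : F × F => G z.1 * ‖f z.2‖) (μ.prod μ) :=
          hGi.mul_prod hf.norm
        refine Integrable.mono' (h1.norm.mul_const ((nrm (δ k))⁻¹ * ∫ v, ‖p v‖ ∂μ)) ?_
          (Eventually.of_forall fun z => ?_)
        · refine (hG.comp continuous_fst).aestronglyMeasurable.smul
            ((hf.1.comp_snd).mul (Continuous.aestronglyMeasurable ?_))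
          fun_prop
        · simp only [Function.uncurry, norm_smul, norm_mul, norm_inv, Real.norm_eq_abs,
            abs_of_nonneg (nrm_nonneg (δ k)), abs_norm]
          rw [mul_assoc]
          refine mul_le_mul_of_nonneg_left (mul_le_mul_of_nonneg_left ?_ (norm_nonneg _))
            (abs_nonneg _)
          exact mul_le_mul_of_nonneg_left (norm_fourier_le μ _ _) (inv_nonneg.2 (nrm_nonneg _))
    simp only [hswap]
    have hb : ∀ x w, ‖G x • q w‖ ≤ B * ‖q w‖ := fun x w => by
      rw [norm_smul]; exact mul_le_mul_of_nonneg_right (hB x) (norm_nonneg _)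
    refine tendsto_integral_of_dominated_convergence
      (fun v => ‖f v‖ * ∫ w, B * ‖q w‖ ∂μ) (fun k => ?_) (hf.norm.mul_const _)
      (fun k => Eventually.of_forall fun v => ?_) (Eventually.of_forall fun v => ?_)
    · refine hf.1.mul (Continuous.aestronglyMeasurable ?_)
      refine continuous_of_dominated (fun v => ?_) (fun v => Eventually.of_forall fun w => hb _ w)
        (hPh.norm.const_mul B) (Eventually.of_forall fun w => ?_)
      · exact Continuous.aestronglyMeasurable (by fun_prop)
      · fun_prop
    · rw [norm_mul]
      exact mul_le_mul_of_nonneg_left ((norm_integral_le_integral_norm _).trans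
        (integral_mono_of_nonneg (Eventually.of_forall fun _ => norm_nonneg _)
          (hPh.norm.const_mul B) (Eventually.of_forall fun w => hb _ w))) (norm_nonneg _)
    · refine Tendsto.const_mul (f v) ?_
      refine tendsto_integral_of_dominated_convergence (fun w => B * ‖q w‖)
        (fun k => Continuous.aestronglyMeasurable (by fun_prop)) (hPh.norm.const_mul B)
        (fun k => Eventually.of_forall fun w => hb _ w) (Eventually.of_forall fun w => ?_)
      refine Tendsto.smul_const ((hG.tendsto _).comp ?_) _
      simpa using (hδ.mul_const w).sub_const v
  rw [tendsto_nhds_unique hL hR, ← integral_neg_eq_self]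
  refine integral_congr_ae (Eventually.of_forall fun y => ?_)
  simp only [neg_neg]
  rw [integral_smul, Complex.real_smul, Complex.real_smul]
  ring

/-- The Fourier inversion formula; the constant depends on the normalization of the measure. -/
theorem exists_fourier_inversion (he : Continuous e) (he1 : e ≠ 1) : ∃ κ : ℂ, κ ≠ 0 ∧
    ∀ f : F → ℂ, Integrable f μ → Integrable (fourier e μ f) μ →
      ∀ᵐ y ∂μ, fourier e μ (fourier e μ f) y = κ * f (-y) := by
  obtain ⟨P, hP, hPc, hP0, hPpos, hPh, hPI⟩ := exists_integrable_fourier μ he he1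
  set I := ∫ u, fourier e μ (fun v => (P v : ℂ)) u ∂μ
  have main : ∀ f : F → ℂ, Integrable f μ → Integrable (fourier e μ f) μ →
      ∀ᵐ y ∂μ, (P 0 : ℂ) * fourier e μ (fourier e μ f) y = I * f (-y) := fun f hf hfh => by
    have h1 : Integrable (fun y => I * f (-y)) μ := hf.comp_neg.const_mul I
    have hc : Continuous fun y => (P 0 : ℂ) * fourier e μ (fourier e μ f) y :=
      (continuous_fourier μ he hfh).const_mul _
    have h2 := ae_eq_zero_of_integral_lipschitz_smul (ν := μ)
      (h := fun y => (P 0 : ℂ) * fourier e μ (fourier e μ f) y - I * f (-y))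
      (hc.locallyIntegrable.sub h1.locallyIntegrable) fun G ⟨K, hG⟩ hGc => by
        simp only [smul_sub]
        have hGi := hG.continuous.integrable_of_hasCompactSupport hGc (μ := μ)
        rw [integral_sub, integral_mul_fourier_fourier μ he hP hPc hPh hf hfh hG.continuous hGc,
          sub_self]
        · exact (hG.continuous.smul hc).integrable_of_hasCompactSupport hGc.smul_right
        · obtain ⟨B, hB⟩ := hGc.exists_bound_of_continuous hG.continuous
          simp only [Complex.real_smul]
          exact h1.bdd_mul (c := B) (Complex.continuous_ofReal.comp
            hG.continuous).aestronglyMeasurable (Eventually.of_forall fun y => by simpa using hB y)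
    filter_upwards [h2] with y hy
    exact sub_eq_zero.1 hy
  have hP00 : (P 0 : ℂ) ≠ 0 := fun h0 => by
    have h1 := main _ (hP.integrable_of_hasCompactSupport hPc).ofReal hPh
    have h2 : ∫ y, P (-y) ∂μ = 0 := by
      rw [← Complex.ofReal_eq_zero, ← integral_complex_ofReal]
      refine integral_eq_zero_of_ae ?_
      filter_upwards [h1] with y hy
      rw [h0, zero_mul] at hy
      exact (mul_eq_zero.1 hy.symm).resolve_left hPI
    rw [integral_neg_eq_self] at h2
    exact hPpos.ne' h2
  refine ⟨I / P 0, div_ne_zero hPI hP00, fun f hf hfh => ?_⟩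
  filter_upwards [main f hf hfh] with y hy
  field_simp
  linear_combination hy

end Fourier



/-! ### The Gamma function of the local field -/

section Gamma

variable {F : Type*} [NontriviallyNormedField F] [ProperSpace F] [MeasurableSpace F] [BorelSpace F]
  (μ : Measure F) [μ.IsAddHaarMeasure] {e : AddChar F Circle}

/-- The zeta integral `∫ ‖u‖ ^ z f(u) du`. -/
noncomputable def zint (z : ℂ) (f : F → ℂ) : ℂ := ∫ u, npow u z * f u ∂μ

/-- A majorant of the integrands of zeta integrals. -/
noncomputable def zetaMajorant (σ B : ℝ) (f : F → ℂ) (u : F) : ℝ :=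
  {u : F | nrm u ≤ 1}.indicator (fun u => nrm u ^ σ * B) u + ‖f u‖

lemma norm_npow_mul_le {σ B : ℝ} {f : F → ℂ} {u : F} (hu : u ≠ 0) (hB : ‖f u‖ ≤ B)
    {z : ℂ} (h1 : σ ≤ z.re) (h2 : z.re ≤ 0) : ‖npow u z * f u‖ ≤ zetaMajorant σ B f u := by
  have hp := nrm_pos hu
  rw [norm_mul, norm_npow hu, zetaMajorant]
  by_cases h : nrm u ≤ 1
  · rw [Set.indicator_of_mem (show u ∈ {u : F | nrm u ≤ 1} from h)]
    have := mul_le_mul (Real.rpow_le_rpow_of_exponent_ge hp h h1) hB (norm_nonneg _)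
      (Real.rpow_nonneg hp.le _)
    linarith [norm_nonneg (f u)]
  · rw [Set.indicator_of_notMem (show u ∉ {u : F | nrm u ≤ 1} from h), zero_add]
    exact mul_le_of_le_one_left (norm_nonneg _)
      (Real.rpow_le_one_of_one_le_of_nonpos (not_le.1 h).le h2)

lemma integrable_zetaMajorant {σ : ℝ} (hσ : -1 < σ) (B : ℝ) {f : F → ℂ} (hf : Integrable f μ) :
    Integrable (zetaMajorant σ B f) μ :=
  ((integrable_indicator_iff (measurableSet_nrm_le 1)).2
    ((integrableOn_nrm_rpow μ hσ).mul_const B)).add hf.norm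

lemma aesm_npow_mul (z : ℂ) {f : F → ℂ} (hf : AEStronglyMeasurable f μ) :
    AEStronglyMeasurable (fun u => npow u z * f u) μ :=
  (measurable_npow z).aestronglyMeasurable.mul hf

lemma integrable_npow_mul {B : ℝ} {f : F → ℂ} (hf : Integrable f μ) (hB : ∀ᵐ u ∂μ, ‖f u‖ ≤ B)
    {z : ℂ} (h1 : -1 < z.re) (h2 : z.re ≤ 0) : Integrable (fun u => npow u z * f u) μ := by
  refine Integrable.mono' (integrable_zetaMajorant μ h1 B hf) (aesm_npow_mul μ z hf.1) ?_
  filter_upwards [hB, ae_ne μ 0] with u h hu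
  exact norm_npow_mul_le hu h le_rfl h2

lemma tendsto_zint {B : ℝ} {f : F → ℂ} (hf : Integrable f μ) (hB : ∀ᵐ u ∂μ, ‖f u‖ ≤ B)
    {ι : Type*} {l : Filter ι} [l.IsCountablyGenerated] {z : ι → ℂ} {z₀ : ℂ}
    (hz : Tendsto z l (𝓝 z₀)) (h1 : -1 < z₀.re) (h2 : ∀ᶠ i in l, (z i).re ≤ 0) :
    Tendsto (fun i => zint μ (z i) f) l (𝓝 (zint μ z₀ f)) := by
  obtain ⟨σ, hσ, hσ'⟩ := exists_between h1
  have h3 : ∀ᶠ i in l, σ < (z i).re :=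
    ((Complex.continuous_re.tendsto _).comp hz).eventually_const_lt hσ'
  refine tendsto_integral_filter_of_dominated_convergence (zetaMajorant σ B f)
    (Eventually.of_forall fun i => aesm_npow_mul μ _ hf.1) ?_ (integrable_zetaMajorant μ hσ B hf) ?_
  · filter_upwards [h2, h3] with i hi2 hi3
    filter_upwards [hB, ae_ne μ 0] with u h hu
    exact norm_npow_mul_le hu h hi3.le hi2
  · filter_upwards [ae_ne μ 0] with u hu
    exact (((continuousAt_npow_exp hu z₀).tendsto.comp hz).mul_const _)

lemma integral_fourier_dilate_mul (he : Continuous e) {f g : F → ℂ} (hf : Integrable f μ)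
    (hg : Integrable g μ) {u : F} (hu : u ≠ 0) :
    ∫ w, fourier e μ f (u * w) * g w ∂μ = ∫ v, fourier e μ g (u * v) * f v ∂μ := by
  have hu' := inv_ne_zero hu
  have h1 : ∀ w, fourier e μ (fun v => f (u⁻¹ * v)) w = (nrm u : ℂ) * fourier e μ f (u * w) :=
    fun w => by
      have := fourier_modulate_dilate μ (e := e) f hu' 0 w
      simpa [nrm_inv] using this
  have h2 := integral_fourier_mul μ he ((integrable_mul_left μ hu').2 hf) hg
  simp only [h1, mul_assoc] at h2
  rw [integral_const_mul] at h2
  have h3 := integral_mul_left μ hu' fun v => f v * fourier e μ g (u * v)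
  simp only [mul_inv_cancel_left₀ hu, nrm_inv, inv_inv, Complex.real_smul] at h3
  rw [h3] at h2
  rw [mul_left_cancel₀ (nrm_cast_ne hu) h2]
  simp only [mul_comm]

/-- The product of two zeta integrals of `𝓕 f` and `g`, as a zeta integral of a multiplicative
convolution. -/
lemma zint_mul_zint (he : Continuous e) {a : ℂ} {f g : F → ℂ} (hf : Integrable f μ)
    (hg : Integrable g μ) (h1 : Integrable (fun u => npow u (a - 1) * fourier e μ f u) μ)
    (h2 : Integrable (fun u => npow u (-a) * g u) μ) :
    zint μ (a - 1) (fourier e μ f) * zint μ (-a) g =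
      ∫ u, npow u (a - 1) * ∫ w, fourier e μ f (u * w) * g w ∂μ ∂μ := by
  set f' := fourier e μ f with hf'
  have hfc : Continuous f' := continuous_fourier μ he hf
  have hK : ∀ u w : F, w ≠ 0 → npow u (a - 1) * (f' (u * w) * g w) =
      npow w (1 - a) * g w * (npow (w * u) (a - 1) * f' (w * u)) := fun u w hw => by
    have h3 : npow w (1 - a) * npow w (a - 1) = 1 := by
      rw [← npow_add hw]; simp [npow_zero_exp]
    rw [npow_mul, mul_comm u w]
    linear_combination (-(g w) * npow u (a - 1) * f' (w * u)) * h3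
  have hw1 : ∀ w : F, w ≠ 0 → npow w (-a) = npow w (1 - a) * ((nrm w)⁻¹ : ℝ) := fun w hw => by
    rw [← npow_neg_one, ← npow_add hw]; ring_nf
  have hint : Integrable (fun p : F × F => npow p.1 (a - 1) * (f' (p.1 * p.2) * g p.2))
      (μ.prod μ) := by
    refine (integrable_prod_iff' ?_).2 ⟨?_, ?_⟩
    · exact ((measurable_npow _).comp measurable_fst).aestronglyMeasurable.mul
        ((hfc.comp continuous_mul).aestronglyMeasurable.mul hg.1.comp_snd)
    · filter_upwards [ae_ne μ 0] with w hw
      simp only [hK _ w hw]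
      exact ((integrable_mul_left μ hw).2 h1).const_mul _
    · refine (h2.norm.mul_const (∫ u, ‖npow u (a - 1) * f' u‖ ∂μ)).congr ?_
      filter_upwards [ae_ne μ 0] with w hw
      simp only [hK _ w hw]
      simp only [norm_mul _ (npow (w * _) (a - 1) * f' (w * _))]
      rw [integral_const_mul, integral_mul_left μ hw fun u => ‖npow u (a - 1) * f' u‖, hw1 w hw]
      simp only [norm_mul, Complex.norm_real, norm_inv, Real.norm_eq_abs,
        abs_of_pos (nrm_pos hw), smul_eq_mul]
      ring
  have hswap := integral_integral_swap (f := fun u w => npow u (a - 1) * (f' (u * w) * g w)) hint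
  simp only [integral_const_mul] at hswap
  rw [hswap, zint, zint, ← integral_const_mul]
  refine integral_congr_ae ?_
  filter_upwards [ae_ne μ 0] with w hw
  simp only [hK _ w hw]
  rw [integral_const_mul, integral_mul_left μ hw fun u => npow u (a - 1) * f' u, hw1 w hw,
    Complex.real_smul]
  ring

/-- The local functional equation. -/
lemma zint_mul_zint_comm (he : Continuous e) {a : ℂ} {f g : F → ℂ} (hf : Integrable f μ)
    (hg : Integrable g μ) (hf1 : Integrable (fun u => npow u (a - 1) * fourier e μ f u) μ)
    (hf2 : Integrable (fun u => npow u (-a) * f u) μ)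
    (hg1 : Integrable (fun u => npow u (a - 1) * fourier e μ g u) μ)
    (hg2 : Integrable (fun u => npow u (-a) * g u) μ) :
    zint μ (a - 1) (fourier e μ f) * zint μ (-a) g =
      zint μ (a - 1) (fourier e μ g) * zint μ (-a) f := by
  rw [zint_mul_zint μ he hf hg hf1 hg2, zint_mul_zint μ he hg hf hg1 hf2]
  refine integral_congr_ae ?_
  filter_upwards [ae_ne μ 0] with u hu
  rw [integral_fourier_dilate_mul μ he hf hg hu]

/-- An integrable function with an integrable Fourier transform is essentially bounded. -/
lemma exists_ae_bound (he : Continuous e) (he1 : e ≠ 1) {f : F → ℂ} (hf : Integrable f μ)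
    (hfh : Integrable (fourier e μ f) μ) : ∃ B : ℝ, ∀ᵐ u ∂μ, ‖f u‖ ≤ B := by
  obtain ⟨κ, hκ, h⟩ := exists_fourier_inversion μ he he1
  refine ⟨‖κ‖⁻¹ * ∫ v, ‖fourier e μ f v‖ ∂μ, ?_⟩
  have h1 : ∀ᵐ y ∂μ, fourier e μ (fourier e μ f) (-y) = κ * f y := by
    have := (Measure.measurePreserving_neg μ).quasiMeasurePreserving.ae (h f hf hfh)
    simpa using this
  filter_upwards [h1] with u hu
  have h2 := norm_fourier_le μ (e := e) (fourier e μ f) (-u)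
  rw [hu, norm_mul] at h2
  rwa [le_inv_mul_iff₀ (norm_pos_iff.2 hκ)]

lemma integrable_npow_fourier {f : F → ℂ}
    (hfh : Integrable (fourier e μ f) μ) {z : ℂ} (h1 : -1 < z.re) (h2 : z.re ≤ 0) :
    Integrable (fun u => npow u z * fourier e μ f u) μ :=
  integrable_npow_mul μ hfh (Eventually.of_forall (norm_fourier_le μ f)) h1 h2

/-- A function with integrable Fourier transform that is supported near `1` and has a nonzero zeta
integral at the given point. -/
lemma exists_bump (he : Continuous e) (he1 : e ≠ 1) (z : ℂ) : ∃ g : F → ℂ, Integrable g μ ∧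
    Integrable (fourier e μ g) μ ∧ (∀ u, 1 / 2 < ‖u - 1‖ → g u = 0) ∧ zint μ z g ≠ 0 := by
  obtain ⟨P, hP, hPc, hP0, hPpos, hPh, -⟩ := exists_integrable_fourier μ he he1
  obtain ⟨C, hC, hCz⟩ := norm_npow_sub_one_le (F := F) (norm_nonneg z)
  obtain ⟨R, hR0, hR⟩ := hPc.isCompact.isBounded.subset_ball_lt 0 (0 : F)
  -- on the support of the dilated function around `1`, the power `‖u‖ ^ z` is within `1 / 2` of `1`
  obtain ⟨δ, hδ, hδ'⟩ : ∃ δ : F, δ ≠ 0 ∧ ‖δ‖ < min (1 / 2) (1 / (2 * (C + 1))) / R := by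
    obtain ⟨δ, h0, h1⟩ := NormedField.exists_norm_lt F
      (show 0 < min (1 / 2) (1 / (2 * (C + 1))) / R by positivity)
    exact ⟨δ, norm_pos_iff.1 h0, h1⟩
  rw [lt_div_iff₀ hR0] at hδ'
  have hi : Integrable (fun v => (P v : ℂ)) μ := (hP.integrable_of_hasCompactSupport hPc).ofReal
  have hi1 : Integrable (fun v => (P (δ⁻¹ * v) : ℂ)) μ :=
    (integrable_mul_left μ (inv_ne_zero hδ)).2 hi
  have hsupp : ∀ u : F, ‖δ‖ * R < ‖u - 1‖ → P (δ⁻¹ * (u - 1)) = 0 := fun u hu => by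
    by_contra h
    have h1 : δ⁻¹ * (u - 1) ∈ Metric.ball (0 : F) R := hR (subset_tsupport _ h)
    rw [mem_ball_zero_iff, norm_mul, norm_inv, inv_mul_lt_iff₀ (norm_pos_iff.2 hδ)] at h1
    exact lt_asymm hu h1
  have hg : Integrable (fun u => (P (δ⁻¹ * (u - 1)) : ℂ)) μ := hi1.comp_sub_right 1
  refine ⟨fun u => (P (δ⁻¹ * (u - 1)) : ℂ), hg, ?_, fun u hu => ?_, ?_⟩
  · have h1 : fourier e μ (fun u => (P (δ⁻¹ * (u - 1)) : ℂ)) = fun u => (e (u * 1) : ℂ) *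
        ((nrm δ : ℝ) * fourier e μ (fun v => (P v : ℂ)) (δ * u)) := by
      ext u
      rw [fourier_comp_sub μ (fun v => (P (δ⁻¹ * v) : ℂ))]
      have h2 := fourier_modulate_dilate μ (e := e) (fun v => (P v : ℂ)) (inv_ne_zero hδ) 0 u
      simp only [zero_mul, AddChar.map_zero_eq_one, Circle.coe_one, one_mul, add_zero, inv_inv,
        nrm_inv, Complex.real_smul] at h2
      rw [h2]
    rw [h1]
    refine Integrable.bdd_mul (c := 1) (((integrable_mul_left μ hδ).2 hPh).const_mul _)
      (Continuous.aestronglyMeasurable (by fun_prop))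
      (Eventually.of_forall fun u => (Circle.norm_coe _).le)
  · simp only
    rw [hsupp u ((hδ'.trans_le (min_le_left _ _)).trans hu), Complex.ofReal_zero]
  · set g : F → ℝ := fun u => P (δ⁻¹ * (u - 1)) with hgdef
    have hgr : Integrable g μ := hg.re.congr (Eventually.of_forall fun v => Complex.ofReal_re _)
    have hpos : 0 < ∫ u, g u ∂μ := by
      have h1 := integral_sub_right_eq_self (μ := μ) (fun u => P (δ⁻¹ * u)) (1 : F)
      rw [hgdef, h1, integral_mul_left μ (inv_ne_zero hδ) P]
      simp only [nrm_inv, inv_inv, smul_eq_mul]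
      exact mul_pos (nrm_pos hδ) hPpos
    have hb : ∀ u, ‖(npow u z - 1) * (g u : ℂ)‖ ≤ 1 / 2 * g u := fun u => by
      by_cases h : ‖u - 1‖ ≤ ‖δ‖ * R
      · have h1 : ‖u - 1‖ ≤ 1 / 2 := h.trans (hδ'.le.trans (min_le_left _ _))
        have h2 : ‖u - 1‖ ≤ 1 / (2 * (C + 1)) := h.trans (hδ'.le.trans (min_le_right _ _))
        rw [norm_mul, Complex.norm_real, Real.norm_of_nonneg (hP0 _)]
        refine mul_le_mul_of_nonneg_right ?_ (hP0 _)
        refine (hCz u z le_rfl h1).trans ?_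
        calc C * ‖u - 1‖ ≤ (C + 1) * (1 / (2 * (C + 1))) := by gcongr; linarith
          _ = 1 / 2 := by field_simp
      · have h0 : g u = 0 := hsupp u (not_le.1 h)
        simp [h0]
    have hi2 : Integrable (fun u => (npow u z - 1) * (g u : ℂ)) μ :=
      Integrable.mono' (hgr.const_mul (1 / 2))
        (((measurable_npow z).sub_const 1).aestronglyMeasurable.mul hg.1)
        (Eventually.of_forall hb)
    have h3 : zint μ z (fun u => (g u : ℂ)) =
        ∫ u, (npow u z - 1) * (g u : ℂ) ∂μ + ((∫ u, g u ∂μ : ℝ) : ℂ) := by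
      rw [← integral_complex_ofReal, ← integral_add hi2 hg, zint]
      congr 1; ext u; ring
    intro h0
    have h4 : ‖∫ u, (npow u z - 1) * (g u : ℂ) ∂μ‖ ≤ 1 / 2 * ∫ u, g u ∂μ := by
      rw [← integral_const_mul]
      exact norm_integral_le_of_norm_le (hgr.const_mul _) (Eventually.of_forall hb)
    rw [h3] at h0
    rw [eq_neg_of_add_eq_zero_left h0, norm_neg, Complex.norm_real,
      Real.norm_of_nonneg hpos.le] at h4
    linarith

section Strip

variable (he : Continuous e) (he1 : e ≠ 1)
include he he1

lemma integrable_npow_mul' {f : F → ℂ} (hf : Integrable f μ) (hfh : Integrable (fourier e μ f) μ)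
    {z : ℂ} (h1 : -1 < z.re) (h2 : z.re ≤ 0) : Integrable (fun u => npow u z * f u) μ := by
  obtain ⟨B, hB⟩ := exists_ae_bound μ he he1 hf hfh
  exact integrable_npow_mul μ hf hB h1 h2

/-- By the local functional equation, the quotient of the two zeta integrals is the same for all
functions, so the identity that defines the Gamma function has a solution. -/
lemma isGammaFactor_gammaStrip {a : ℂ} (h0 : 0 < a.re) (h1 : a.re < 1) :
    IsGammaFactor e μ a (gammaStrip e μ a) := by
  refine Classical.epsilon_spec (p := IsGammaFactor e μ a) ?_
  obtain ⟨g, hg, hgh, -, hz⟩ := exists_bump μ he he1 (-a)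
  refine ⟨zint μ (a - 1) (fourier e μ g) / zint μ (-a) g, fun f hf hfh => ?_⟩
  have h2 : -1 < (a - 1).re ∧ (a - 1).re ≤ 0 := by simp; constructor <;> linarith
  have h3 : -1 < (-a).re ∧ (-a).re ≤ 0 := by simp; constructor <;> linarith
  have := zint_mul_zint_comm μ he hf hg (integrable_npow_fourier μ hfh h2.1 h2.2)
    (integrable_npow_mul' μ he he1 hf hfh h3.1 h3.2)
    (integrable_npow_fourier μ hgh h2.1 h2.2)
    (integrable_npow_mul' μ he he1 hg hgh h3.1 h3.2)
  change zint μ (a - 1) (fourier e μ f) = _ * zint μ (-a) f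
  field_simp
  exact this

lemma IsGammaFactor.eq_gammaStrip {a γ : ℂ} (h0 : 0 < a.re) (h1 : a.re < 1)
    (h : IsGammaFactor e μ a γ) : γ = gammaStrip e μ a := by
  obtain ⟨g, hg, hgh, -, hz⟩ := exists_bump μ he he1 (-a)
  exact mul_right_cancel₀ hz
    ((h g hg hgh).symm.trans (isGammaFactor_gammaStrip μ he he1 h0 h1 g hg hgh))

/-- The defining identity of the Gamma function holds as soon as both zeta integrals converge. -/
lemma zint_fourier {a : ℂ} (h0 : 0 < a.re) (h1 : a.re < 1) {f : F → ℂ} (hf : Integrable f μ)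
    (hf1 : Integrable (fun u => npow u (a - 1) * fourier e μ f u) μ)
    (hf2 : Integrable (fun u => npow u (-a) * f u) μ) :
    zint μ (a - 1) (fourier e μ f) = gammaStrip e μ a * zint μ (-a) f := by
  obtain ⟨g, hg, hgh, -, hz⟩ := exists_bump μ he he1 (-a)
  have h2 : -1 < (a - 1).re ∧ (a - 1).re ≤ 0 := by simp; constructor <;> linarith
  have h3 : -1 < (-a).re ∧ (-a).re ≤ 0 := by simp; constructor <;> linarith
  have h4 := zint_mul_zint_comm μ he hf hg hf1 hf2
    (integrable_npow_fourier μ hgh h2.1 h2.2)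
    (integrable_npow_mul' μ he he1 hg hgh h3.1 h3.2)
  have h5 : zint μ (a - 1) (fourier e μ g) = gammaStrip e μ a * zint μ (-a) g :=
    isGammaFactor_gammaStrip μ he he1 h0 h1 g hg hgh
  rw [h5] at h4
  refine mul_right_cancel₀ hz (h4.trans ?_)
  ring

lemma gammaStrip_conj {a : ℂ} (h0 : 0 < a.re) (h1 : a.re < 1) :
    gammaStrip e μ ((starRingEnd ℂ) a) = (starRingEnd ℂ) (gammaStrip e μ a) := by
  refine (IsGammaFactor.eq_gammaStrip μ he he1 (by simpa) (by simpa) fun f hf hfh => ?_).symm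
  -- complex conjugation turns the Fourier transform into its reflection
  have hF : ∀ u, fourier e μ (fun v => (starRingEnd ℂ) (f v)) u =
      (starRingEnd ℂ) (fourier e μ f (-u)) := fun u => by
    rw [fourier, fourier, ← integral_conj]
    congr 1
    ext v
    simp [← Circle.coe_inv_eq_conj, ← AddChar.map_neg_eq_inv]
  have hfc : Integrable (fun v => (starRingEnd ℂ) (f v)) μ :=
    (LinearIsometryEquiv.integrable_comp_iff Complex.conjLIE).2 hf
  have hfhc : Integrable (fourier e μ fun v => (starRingEnd ℂ) (f v)) μ := by
    rw [show fourier e μ (fun v => (starRingEnd ℂ) (f v)) = fun u => _ from funext hF]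
    exact (LinearIsometryEquiv.integrable_comp_iff Complex.conjLIE).2 hfh.comp_neg
  have h := congrArg (starRingEnd ℂ) (isGammaFactor_gammaStrip μ he he1 h0 h1 _ hfc hfhc)
  rw [map_mul, ← integral_conj, ← integral_conj] at h
  simp only [map_mul, conj_npow, Complex.conj_conj, map_neg, map_sub, map_one, hF] at h
  rw [← h, ← integral_neg_eq_self]
  refine integral_congr_ae (Eventually.of_forall fun u => ?_)
  simp [npow_neg_arg]

/-- The reflection formula. -/
lemma exists_gammaStrip_mul : ∃ κ : ℂ, κ ≠ 0 ∧ ∀ a : ℂ, 0 < a.re → a.re < 1 →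
    gammaStrip e μ a * gammaStrip e μ (1 - a) = κ := by
  obtain ⟨κ, hκ, hinv⟩ := exists_fourier_inversion μ he he1
  refine ⟨κ, hκ, fun a h0 h1 => ?_⟩
  obtain ⟨g, hg, hgh, -, hz⟩ := exists_bump μ he he1 (-a)
  have h2 : zint μ (a - 1) (fourier e μ g) = gammaStrip e μ a * zint μ (-a) g :=
    isGammaFactor_gammaStrip μ he he1 h0 h1 g hg hgh
  have h3 := isGammaFactor_gammaStrip μ he he1 (a := 1 - a) (by simpa) (by simpa) _ hgh
    ((hg.comp_neg.const_mul κ).congr ((hinv g hg hgh).mono fun y hy => hy.symm))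
  have h4 : ∫ u, npow u (1 - a - 1) * fourier e μ (fourier e μ g) u ∂μ = κ * zint μ (-a) g := by
    rw [zint, ← integral_neg_eq_self (fun u => npow u (-a) * g u), ← integral_const_mul]
    refine integral_congr_ae ?_
    filter_upwards [hinv g hg hgh] with u hu
    rw [hu, npow_neg_arg, show 1 - a - 1 = -a by ring]
    ring
  rw [h4, show -(1 - a) = a - 1 by ring] at h3
  change _ = _ * zint μ (a - 1) (fourier e μ g) at h3
  rw [h2] at h3
  refine mul_right_cancel₀ hz ?_
  rw [h3]
  ring

lemma gammaStrip_ne_zero {a : ℂ} (h0 : 0 < a.re) (h1 : a.re < 1) : gammaStrip e μ a ≠ 0 := by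
  obtain ⟨κ, hκ, h⟩ := exists_gammaStrip_mul μ he he1
  exact left_ne_zero_of_mul ((h a h0 h1).symm ▸ hκ)

/-- The Gamma function extends continuously to the part `0 < Re a ≤ 1` of the closed strip. -/
lemma exists_tendsto_gammaStrip {ι : Type*} {l : Filter ι} [l.IsCountablyGenerated] [l.NeBot]
    {a : ι → ℂ} {a₀ : ℂ} (ha : Tendsto a l (𝓝 a₀)) (h0 : 0 < a₀.re)
    (ha1 : ∀ᶠ i in l, (a i).re < 1) :
    ∃ L, Tendsto (fun i => gammaStrip e μ (a i)) l (𝓝 L) ∧ (a₀.re < 1 → L = gammaStrip e μ a₀) := by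
  obtain ⟨g, hg, hgh, hsupp, hz⟩ := exists_bump μ he he1 (-a₀)
  have ha0 : ∀ᶠ i in l, 0 < (a i).re :=
    ((Complex.continuous_re.tendsto _).comp ha).eventually_const_lt h0
  have hlim1 : Tendsto (fun i => zint μ (a i - 1) (fourier e μ g)) l
      (𝓝 (zint μ (a₀ - 1) (fourier e μ g))) := by
    refine tendsto_zint μ hgh (Eventually.of_forall (norm_fourier_le μ g)) (ha.sub_const 1)
      (by simpa) ?_
    filter_upwards [ha1] with i hi
    simpa using hi.le
  -- the function `g` is supported near `1`, where all powers of the norm are bounded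
  have hlim2 : Tendsto (fun i => zint μ (-a i) g) l (𝓝 (zint μ (-a₀) g)) := by
    obtain ⟨C, hC, hCz⟩ := norm_npow_sub_one_le (F := F) (show 0 ≤ ‖a₀‖ + 1 by positivity)
    have hn : ∀ᶠ i in l, ‖a i‖ < ‖a₀‖ + 1 := ha.norm.eventually_lt_const (by linarith)
    refine tendsto_integral_filter_of_dominated_convergence (fun u => (C * (1 / 2) + 1) * ‖g u‖)
      (Eventually.of_forall fun i => aesm_npow_mul μ _ hg.1) ?_ (hg.norm.const_mul _) ?_
    · filter_upwards [hn] with i hi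
      refine Eventually.of_forall fun u => ?_
      by_cases hu : ‖u - 1‖ ≤ 1 / 2
      · rw [norm_mul]
        refine mul_le_mul_of_nonneg_right ?_ (norm_nonneg _)
        have h2 := hCz u (-a i) (by rw [norm_neg]; exact hi.le) hu
        have h3 := norm_sub_norm_le (npow u (-a i)) 1
        rw [norm_one] at h3
        have h4 := mul_le_mul_of_nonneg_left hu hC
        linarith
      · simp [hsupp u (not_le.1 hu)]
    · filter_upwards [ae_ne μ 0] with u hu
      exact ((continuousAt_npow_exp hu (-a₀)).tendsto.comp ha.neg).mul_const _
  refine ⟨_, (hlim1.div hlim2 hz).congr' ?_, fun h2 => ?_⟩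
  · filter_upwards [ha0, ha1, hlim2.eventually_ne hz] with i hi0 hi1 hi
    have h3 : zint μ (a i - 1) (fourier e μ g) = gammaStrip e μ (a i) * zint μ (-a i) g :=
      isGammaFactor_gammaStrip μ he he1 hi0 hi1 g hg hgh
    rw [Pi.div_apply, h3, mul_div_cancel_right₀ _ hi]
  · have h3 : zint μ (a₀ - 1) (fourier e μ g) = gammaStrip e μ a₀ * zint μ (-a₀) g :=
      isGammaFactor_gammaStrip μ he he1 h0 h2 g hg hgh
    rw [h3, mul_div_cancel_right₀ _ hz]

lemma tendsto_gammaStrip {ι : Type*} {l : Filter ι} [l.IsCountablyGenerated] [l.NeBot]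
    {a : ι → ℂ} {a₀ : ℂ} (ha : Tendsto a l (𝓝 a₀)) (h0 : 0 < a₀.re) (h1 : a₀.re < 1) :
    Tendsto (fun i => gammaStrip e μ (a i)) l (𝓝 (gammaStrip e μ a₀)) := by
  obtain ⟨L, hL, h⟩ := exists_tendsto_gammaStrip μ he he1 ha h0
    (((Complex.continuous_re.tendsto _).comp ha).eventually_lt_const h1)
  rwa [← h h1]

/-- The beta function in terms of the Gamma function: the Fourier transform turns the convolution
of `‖·‖ ^ (a - 1)` and `‖·‖ ^ (b - 1)` into a product. -/
lemma betaF_mul_gammaStrip {a b : ℂ} (ha : 0 < a.re) (hb : 0 < b.re) (hab : a.re + b.re < 1) :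
    betaF μ a b * gammaStrip e μ (a + b) = gammaStrip e μ a * gammaStrip e μ b := by
  obtain ⟨f, hf, hfh, -, hz⟩ := exists_bump μ he he1 (-(a + b))
  set f' := fourier e μ f
  set g : F → ℂ := fun w => npow w (-b) * f w
  have hg : Integrable g μ :=
    integrable_npow_mul' μ he he1 hf hfh (by simp; linarith) (by simp; linarith)
  have hag : Integrable (fun w => npow w (-a) * g w) μ := by
    refine (integrable_npow_mul' μ he he1 hf hfh (z := -a - b) (by simp; linarith)
      (by simp; linarith)).congr ?_
    filter_upwards [ae_ne μ 0] with w hw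
    simp only [g]
    rw [← mul_assoc, ← npow_add hw, ← sub_eq_add_neg]
  have hfs : Integrable (fun u => npow u (a + b - 1) * f' u) μ :=
    integrable_npow_fourier μ hfh (by simp; linarith) (by simp; linarith)
  -- the Fourier transform of `g` is a convolution
  have hgh : ∀ v, gammaStrip e μ b * fourier e μ g v = ∫ u, npow (u - v) (b - 1) * f' u ∂μ := by
    intro v
    have h1 : Integrable (fun w => (e (v * w) : ℂ) * f w) μ := integrable_fourier_integrand μ he hf v
    have h2 : ∀ u, fourier e μ (fun w => (e (v * w) : ℂ) * f w) u = f' (u + v) := fun u => by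
      have := fourier_modulate_dilate μ (e := e) f one_ne_zero v u
      simpa [nrm_one] using this
    have h3 := isGammaFactor_gammaStrip μ he he1 hb (by linarith) _ h1
      (by rw [show fourier e μ (fun w => (e (v * w) : ℂ) * f w) = fun u => f' (u + v) from
        funext h2]; exact hfh.comp_add_right v)
    simp only [h2] at h3
    rw [← integral_add_right_eq_self _ v]
    simp only [add_sub_cancel_right]
    rw [h3, fourier]
    congr 2
    ext w
    simp only [g]
    ring
  have hK : ∀ u v : F, u ≠ 0 → npow v (a - 1) * (npow (u - v) (b - 1) * f' u) =
      (npow u (a + b - 2) * f' u) *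
        (npow (u⁻¹ * v) (a - 1) * npow (1 - u⁻¹ * v) (b - 1)) := fun u v hu => by
    rw [show u - v = u * (1 - u⁻¹ * v) by field_simp, npow_mul u, npow_mul u⁻¹, npow_inv,
      show a + b - 2 = (a - 1) + (b - 1) by ring, npow_add hu]
    have := npow_ne_zero hu (a - 1)
    field_simp
  have hker : Integrable (fun w : F => npow w (a - 1) * npow (1 - w) (b - 1)) μ :=
    integrable_kernel μ (by simpa) hb (by simp; linarith)
  have hu1 : ∀ u : F, u ≠ 0 → npow u (a + b - 2) * (nrm u : ℂ) = npow u (a + b - 1) :=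
    fun u hu => by
      rw [← npow_one_exp, ← npow_add hu]; ring_nf
  -- absolute convergence, by the substitution `v = u w` in the integral over `v`
  have hint : Integrable (fun p : F × F => npow p.2 (a - 1) * (npow (p.1 - p.2) (b - 1) * f' p.1))
      (μ.prod μ) := by
    refine (integrable_prod_iff ?_).2 ⟨?_, ?_⟩
    · exact ((measurable_npow _).comp measurable_snd).aestronglyMeasurable.mul
        (((measurable_npow _).comp (measurable_fst.sub measurable_snd)).aestronglyMeasurable.mul
          hfh.1.comp_fst)
    · filter_upwards [ae_ne μ 0] with u hu
      simp only [hK u _ hu]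
      exact ((integrable_mul_left μ (inv_ne_zero hu)).2 hker).const_mul _
    · refine (hfs.norm.mul_const (∫ w : F, ‖npow w (a - 1) * npow (1 - w) (b - 1)‖ ∂μ)).congr ?_
      filter_upwards [ae_ne μ 0] with u hu
      simp only [hK u _ hu]
      simp only [norm_mul (npow u (a + b - 2) * f' u)]
      rw [integral_const_mul, integral_mul_left μ (inv_ne_zero hu)
        fun w => ‖npow w (a - 1) * npow (1 - w) (b - 1)‖, ← hu1 u hu]
      simp only [norm_mul, Complex.norm_real, Real.norm_eq_abs, nrm_inv, inv_inv,
        abs_of_pos (nrm_pos hu), smul_eq_mul]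
      ring
  have hagh : Integrable (fun v => npow v (a - 1) * fourier e μ g v) μ := by
    have h1 := hint.integral_prod_right
    simp only [integral_const_mul, ← hgh] at h1
    refine (h1.const_mul (gammaStrip e μ b)⁻¹).congr (Eventually.of_forall fun v => ?_)
    have := gammaStrip_ne_zero μ he he1 hb (by linarith)
    simp only
    field_simp
  have h4 : gammaStrip e μ b * zint μ (a - 1) (fourier e μ g) =
      betaF μ a b * zint μ (a + b - 1) f' := by
    have hswap := integral_integral_swap
      (f := fun u v => npow v (a - 1) * (npow (u - v) (b - 1) * f' u)) hint
    simp only [integral_const_mul, ← hgh] at hswap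
    rw [zint, ← integral_const_mul]
    refine Eq.trans ?_ (hswap.symm.trans ?_)
    · congr 1; ext v; ring
    · rw [zint, ← integral_const_mul]
      refine integral_congr_ae ?_
      filter_upwards [ae_ne μ 0] with u hu
      simp only [hK u _ hu]
      rw [integral_const_mul, integral_mul_left μ (inv_ne_zero hu)
        fun w => npow w (a - 1) * npow (1 - w) (b - 1), ← hu1 u hu, nrm_inv, inv_inv,
        Complex.real_smul, betaF]
      ring
  -- the functional equation for `g` at `a`, and for `f` at `a + b`
  rw [zint_fourier μ he he1 ha (by linarith) hg hagh hag] at h4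
  have h5 : zint μ (a + b - 1) f' = gammaStrip e μ (a + b) * zint μ (-(a + b)) f :=
    isGammaFactor_gammaStrip μ he he1 (by simp; linarith) (by simp; linarith) f hf hfh
  have h6 : zint μ (-a) g = zint μ (-(a + b)) f := by
    refine integral_congr_ae ?_
    filter_upwards [ae_ne μ 0] with w hw
    simp only [g]
    rw [← mul_assoc, ← npow_add hw]
    ring_nf
  rw [h5, h6] at h4
  refine mul_right_cancel₀ hz ?_
  linear_combination -h4

end Strip

section Boundary

variable (he : Continuous e) (he1 : e ≠ 1)

/-- The trivial representation on the complex numbers. -/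
lemma isUnitaryRep_one : IsUnitaryRep (fun _ : F => ContinuousLinearMap.id ℂ ℂ) :=
  ⟨fun _ => rfl, fun _ _ _ _ _ => rfl, fun _ _ _ => rfl, fun _ => continuousOn_const⟩

lemma isLipVector_one (z : ℂ) : IsLipVector (fun _ : F => ContinuousLinearMap.id ℂ ℂ) z :=
  ⟨0, 1, le_rfl, one_pos, fun w _ => by simp⟩

lemma betaOp_one (ρ a : ℂ) :
    betaOp μ (fun _ : F => ContinuousLinearMap.id ℂ ℂ) ρ a 1 = betaF μ (ρ + 1) a := by
  simp [betaOp, betaF]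

variable {c : ℂ} (hc : c.re = 0) (hc1 : ∃ x : F, x ≠ 0 ∧ npow x c ≠ 1)
include he he1

/-- The limit that defines `gammaF` exists: express the Gamma function by the beta function, which is
a beta operator of the trivial representation. -/
lemma tendsto_gammaF (hc : c.re = 0) (hc1 : ∃ x : F, x ≠ 0 ∧ npow x c ≠ 1) :
    Tendsto (fun ε : ℝ => gammaStrip e μ (c + ε)) (𝓝[>] 0) (𝓝 (gammaF e μ c)) := by
  refine tendsto_nhds_limUnder ?_
  have h1 := tendsto_betaOp μ isUnitaryRep_one (isLipVector_one (F := F) 1) (ρ := -(1 / 2))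
    (by simp) hc hc1 le_rfl zero_le_one
  simp only [Complex.ofReal_zero, zero_mul, sub_zero, betaOp_one] at h1
  have h2 : Tendsto (fun ε : ℝ => gammaStrip e μ (1 / 2 + (c + ε))) (𝓝[>] 0)
      (𝓝 (gammaStrip e μ (1 / 2 + c))) :=
    tendsto_gammaStrip μ he he1 ((tendsto_add_ofReal c).const_add (1 / 2)) (by simp [hc])
      (by simp [hc]; norm_num)
  have h3 := gammaStrip_ne_zero μ he he1 (a := 1 / 2) (by norm_num) (by norm_num)
  refine ⟨_, ((h1.mul h2).div_const (gammaStrip e μ (1 / 2))).congr' ?_⟩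
  filter_upwards [eventually_small (show (0 : ℝ) < 1 / 2 by norm_num)] with ε hε
  rw [show (-(1 / 2) + 1 : ℂ) = 1 / 2 by norm_num, betaF_mul_gammaStrip μ he he1 (by norm_num)
    (by simp [hc, hε.1]) (by simp [hc]; linarith [hε.2]), mul_div_cancel_left₀ _ h3]

/-- In the reflection formula `Γ(c + ε) Γ(1 - c - ε) = κ` the second factor stays bounded. -/
lemma gammaF_ne_zero (hc : c.re = 0) (hc1 : ∃ x : F, x ≠ 0 ∧ npow x c ≠ 1) :
    gammaF e μ c ≠ 0 := by
  obtain ⟨κ, hκ, h⟩ := exists_gammaStrip_mul μ he he1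
  have h1 : Tendsto (fun ε : ℝ => 1 - (c + ε)) (𝓝[>] 0) (𝓝 (1 - c)) :=
    (tendsto_add_ofReal c).const_sub 1
  obtain ⟨L, hL, -⟩ := exists_tendsto_gammaStrip μ he he1 h1 (by simp [hc]) (by
    filter_upwards [eventually_small one_pos] with ε hε
    simp [hc, hε.1])
  have h2 := (tendsto_gammaF μ he he1 hc hc1).mul hL
  have h3 : gammaF e μ c * L = κ := by
    refine tendsto_nhds_unique h2 (tendsto_const_nhds.congr' ?_)
    filter_upwards [eventually_small one_pos] with ε hε
    exact (h _ (by simp [hc, hε.1]) (by simp [hc, hε.2])).symm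
  exact left_ne_zero_of_mul (h3 ▸ hκ)

lemma gammaF_neg (hc : c.re = 0) (hc1 : ∃ x : F, x ≠ 0 ∧ npow x c ≠ 1) :
    gammaF e μ (-c) = (starRingEnd ℂ) (gammaF e μ c) := by
  refine Tendsto.limUnder_eq ?_
  refine ((Complex.continuous_conj.tendsto _).comp (tendsto_gammaF μ he he1 hc hc1)).congr' ?_
  filter_upwards [eventually_small one_pos] with ε hε
  rw [Function.comp_apply, ← gammaStrip_conj μ he he1 (by simp [hc, hε.1]) (by simp [hc, hε.2]),
    map_add, conj_eq_neg_of_re hc, Complex.conj_ofReal]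

/-- The Gamma function has a simple pole with residue `1` at the origin. -/
lemma tendsto_mul_gammaStrip (hμ : IsNormalizedHaar μ) :
    Tendsto (fun ε : ℝ => ((2 * ε : ℝ) : ℂ) * gammaStrip e μ ((2 * ε : ℝ) : ℂ)) (𝓝[>] 0)
      (𝓝 1) := by
  have h1 := tendsto_mul_betaOp μ hμ isUnitaryRep_one (isLipVector_one (F := F) 1) (ρ := -(1 / 2))
    (by simp)
  simp only [betaOp_one, smul_eq_mul] at h1
  have h0 : Tendsto (fun ε : ℝ => (ε : ℂ)) (𝓝[>] 0) (𝓝 0) := by simpa using tendsto_add_ofReal 0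
  have hne := gammaStrip_ne_zero μ he he1 (a := 1 / 2) (by norm_num) (by norm_num)
  have h2 : Tendsto (fun ε : ℝ => gammaStrip e μ (1 / 2 + ε)) (𝓝[>] 0)
      (𝓝 (gammaStrip e μ (1 / 2))) :=
    tendsto_gammaStrip μ he he1 (by simpa only [add_zero] using h0.const_add (1 / 2)) (by norm_num) (by norm_num)
  have h3 : Tendsto (fun ε : ℝ => gammaStrip e μ (1 / 2 - ε)) (𝓝[>] 0)
      (𝓝 (gammaStrip e μ (1 / 2))) :=
    tendsto_gammaStrip μ he he1 (by simpa only [sub_zero] using h0.const_sub (1 / 2)) (by norm_num) (by norm_num)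
  have h4 := (h1.mul h2).div h3 hne
  rw [one_mul, div_self hne] at h4
  refine h4.congr' ?_
  filter_upwards [eventually_small (show (0 : ℝ) < 1 / 4 by norm_num)] with ε hε
  have h5 := betaF_mul_gammaStrip μ he he1 (a := -(1 / 2) - ε + 1) (b := ((2 * ε : ℝ) : ℂ))
    (by simp; linarith [hε.2]) (by simp [hε.1]) (by simp; linarith [hε.2])
  rw [show -(1 / 2) - (ε : ℂ) + 1 + ((2 * ε : ℝ) : ℂ) = 1 / 2 + ε by push_cast; ring,
    show -(1 / 2) - (ε : ℂ) + 1 = 1 / 2 - ε by ring] at h5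
  have h6 := gammaStrip_ne_zero μ he he1 (a := 1 / 2 - ε) (by simp; linarith [hε.2])
    (by simp; linarith [hε.1])
  rw [Pi.div_apply, show -(1 / 2) - (ε : ℂ) + 1 = 1 / 2 - ε by ring, mul_assoc, h5]
  rw [mul_left_comm, mul_div_cancel_left₀ _ h6]

lemma tendsto_betaF_div (hμ : IsNormalizedHaar μ) (hc : c.re = 0)
    (hc1 : ∃ x : F, x ≠ 0 ∧ npow x c ≠ 1) :
    Tendsto (fun ε : ℝ => betaF μ (c + ε) (-c + ε) / ((2 * ε : ℝ) : ℂ)) (𝓝[>] 0)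
      (𝓝 (gammaF e μ c * gammaF e μ (-c))) := by
  have hc1' : ∃ x : F, x ≠ 0 ∧ npow x (-c) ≠ 1 := by
    obtain ⟨x, hx, h⟩ := hc1
    exact ⟨x, hx, by rwa [npow_neg, Ne, inv_eq_one]⟩
  have h1 := ((tendsto_gammaF μ he he1 hc hc1).mul
    (tendsto_gammaF μ he he1 (c := -c) (by simp [hc]) hc1')).div
    (tendsto_mul_gammaStrip μ he he1 hμ) one_ne_zero
  rw [div_one] at h1
  refine h1.congr' ?_
  filter_upwards [eventually_small (show (0 : ℝ) < 1 / 4 by norm_num)] with ε hε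
  have h2 := betaF_mul_gammaStrip μ he he1 (a := c + ε) (b := -c + ε) (by simp [hc, hε.1])
    (by simp [hc, hε.1]) (by simp [hc]; linarith [hε.2])
  rw [show c + (ε : ℂ) + (-c + ε) = ((2 * ε : ℝ) : ℂ) by push_cast; ring] at h2
  have h3 := gammaStrip_ne_zero μ he he1 (a := ((2 * ε : ℝ) : ℂ)) (by simp [hε.1])
    (by simp; linarith [hε.2])
  have h4 : ((2 * ε : ℝ) : ℂ) ≠ 0 := by rw [Complex.ofReal_ne_zero]; linarith [hε.1]
  rw [Pi.div_apply, ← h2]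
  field_simp

end Boundary

end Gamma



/-! ### Square integrable functions -/

section LTwo

variable {Y : Type*} [MeasurableSpace Y] {ν : Measure Y}

/-- The Radon–Riesz property: convergence almost everywhere together with convergence of the norms
implies convergence in `L²`. -/
lemma tendsto_Lp_of_ae_of_norm {ι : Type*} {l : Filter ι} [l.IsCountablyGenerated]
    {u : ι → Lp ℂ 2 ν} {f : Lp ℂ 2 ν} {g : ι → Y → ℂ} {g₀ : Y → ℂ} (hu : ∀ i, u i =ᵐ[ν] g i)
    (hf : f =ᵐ[ν] g₀) (hg : ∀ᵐ y ∂ν, Tendsto (fun i => g i y) l (𝓝 (g₀ y)))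
    (hn : Tendsto (fun i => ‖u i‖) l (𝓝 ‖f‖)) : Tendsto u l (𝓝 f) := by
  refine tendsto_of_seq_tendsto fun x hx => ?_
  have hn' : Tendsto (fun k => ‖u (x k)‖) atTop (𝓝 ‖f‖) := hn.comp hx
  have hlim : ∀ᵐ y ∂ν, Tendsto (fun k => (u (x k) + f : Lp ℂ 2 ν) y) atTop
      (𝓝 ((f + f : Lp ℂ 2 ν) y)) := by
    filter_upwards [hg, ae_all_iff.2 fun k => hu (x k), hf, Lp.coeFn_add f f,
      ae_all_iff.2 fun k => Lp.coeFn_add (u (x k)) f] with y h1 h2 h3 h4 h5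
    simp only [h4, h5, Pi.add_apply, h2, h3]
    exact (h1.comp hx).add_const _
  -- Fatou's lemma for `u + f`, together with the parallelogram law
  have h1 : ‖f + f‖ₑ ≤ liminf (fun k => ‖u (x k) + f‖ₑ) atTop := by
    simp only [Lp.enorm_def]
    exact Lp.eLpNorm_lim_le_liminf_eLpNorm (fun k => Lp.aestronglyMeasurable _) _ hlim
  have hen : Tendsto (fun k => ‖u (x k)‖ₑ + ‖f‖ₑ) atTop (𝓝 (‖f‖ₑ + ‖f‖ₑ)) := by
    refine Tendsto.add ?_ tendsto_const_nhds
    simp only [← ofReal_norm]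
    exact (ENNReal.continuous_ofReal.tendsto _).comp hn'
  have hff : ‖f + f‖ₑ = ‖f‖ₑ + ‖f‖ₑ := by
    rw [← two_smul ℝ f, enorm_smul, ← two_mul]
    congr 1
    simp [Real.enorm_eq_ofReal]
  have h2 : Tendsto (fun k => ‖u (x k) + f‖ₑ) atTop (𝓝 ‖f + f‖ₑ) := by
    refine tendsto_of_le_liminf_of_limsup_le h1 ?_
    rw [hff, ← hen.limsup_eq]
    exact limsup_le_limsup (Eventually.of_forall fun k => enorm_add_le _ _)
  have h3 : Tendsto (fun k => ‖u (x k) + f‖) atTop (𝓝 ‖f + f‖) := by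
    have := (ENNReal.tendsto_toReal (enorm_ne_top (x := f + f))).comp h2
    simpa [Function.comp_def] using this
  have h4 : Tendsto (fun k => ‖u (x k) - f‖ * ‖u (x k) - f‖) atTop (𝓝 0) := by
    have h5 := (((hn'.mul hn').add_const (‖f‖ * ‖f‖)).const_mul 2).sub (h3.mul h3)
    have h6 : 2 * (‖f‖ * ‖f‖ + ‖f‖ * ‖f‖) - ‖f + f‖ * ‖f + f‖ = 0 := by
      have := parallelogram_law_with_norm ℂ f f
      simp only [sub_self, norm_zero] at this
      linarith
    rw [h6] at h5
    refine h5.congr fun k => ?_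
    have := parallelogram_law_with_norm ℂ (u (x k)) f
    linarith
  rw [tendsto_iff_norm_sub_tendsto_zero]
  have h7 := h4.sqrt
  simpa [Real.sqrt_mul_self (norm_nonneg _)] using h7

variable {X : Type*} [MeasurableSpace X] {μ : Measure X} [SigmaFinite μ] [SigmaFinite ν]

/-- A Bochner integral of square integrable functions can be evaluated pointwise. -/
lemma ae_integral_apply {f : X → Lp ℂ 2 ν} (hf : Integrable f μ) {g : X → Y → ℂ}
    (hg : AEStronglyMeasurable (Function.uncurry g) (μ.prod ν)) (hfg : ∀ᵐ s ∂μ, f s =ᵐ[ν] g s) :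
    ∀ᵐ y ∂ν, Integrable (fun s => g s y) μ ∧ (∫ s, f s ∂μ : Lp ℂ 2 ν) y = ∫ s, g s y ∂μ := by
  -- it suffices to argue on the sets of an exhaustion by sets of finite measure
  suffices H : ∀ k, ∀ᵐ y ∂(ν.restrict (spanningSets ν k)),
      Integrable (fun s => g s y) μ ∧ (∫ s, f s ∂μ : Lp ℂ 2 ν) y = ∫ s, g s y ∂μ by
    have := (ae_restrict_iUnion_iff (spanningSets ν) _).2 H
    rwa [iUnion_spanningSets, Measure.restrict_univ] at this
  intro k
  set A := spanningSets ν k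
  have hA : MeasurableSet A := measurableSet_spanningSets ν k
  have hνA : ν A < ∞ := measure_spanningSets_lt_top ν k
  have : IsFiniteMeasure (ν.restrict A) := ⟨by simpa using hνA⟩
  have hgA : AEStronglyMeasurable (Function.uncurry g) (μ.prod (ν.restrict A)) := by
    refine hg.mono_measure ?_
    exact Measure.prod_mono le_rfl Measure.restrict_le_self
  have hintA : ∀ φ : Lp ℂ 2 ν, Integrable φ (ν.restrict A) := fun φ =>
    (((Lp.memLp φ).restrict A).integrable one_le_two)
  have hint : Integrable (Function.uncurry g) (μ.prod (ν.restrict A)) := by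
    refine (integrable_prod_iff hgA).2 ⟨?_, ?_⟩
    · filter_upwards [hfg] with s hs
      exact (hintA (f s)).congr (ae_restrict_of_ae hs)
    · refine Integrable.mono' (hf.norm.mul_const (ν.real A ^ (1 / 2 : ℝ)))
        hgA.norm.integral_prod_right' ?_
      filter_upwards [hfg] with s hs
      rw [Real.norm_of_nonneg (integral_nonneg fun _ => norm_nonneg _)]
      have h1 : ∫ y, ‖Function.uncurry g (s, y)‖ ∂(ν.restrict A) = ∫ y in A, ‖f s y‖ ∂ν :=
        integral_congr_ae (ae_restrict_of_ae (hs.mono fun y hy => by simp [hy]))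
      rw [h1, integral_norm_eq_lintegral_enorm (hintA _).1, ← eLpNorm_one_eq_lintegral_enorm]
      have h2 := eLpNorm_le_eLpNorm_mul_rpow_measure_univ (μ := ν.restrict A)
        (show (1 : ℝ≥0∞) ≤ 2 from one_le_two) (hintA (f s)).1
      have h3 : eLpNorm (f s) 2 (ν.restrict A) ≤ ‖f s‖ₑ := by
        rw [Lp.enorm_def]; exact eLpNorm_mono_measure _ Measure.restrict_le_self
      have h4 := ENNReal.toReal_mono ?_ (h2.trans (mul_le_mul_left h3 _))
      · rw [ENNReal.toReal_mul, toReal_enorm, ← ENNReal.toReal_rpow] at h4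
        refine h4.trans (le_of_eq ?_)
        rw [Measure.restrict_apply_univ]
        norm_num [Measure.real]
      · refine ENNReal.mul_ne_top enorm_ne_top (ENNReal.rpow_ne_top_of_nonneg ?_ ?_)
        · norm_num
        · simpa using hνA.ne
  have h1 : ∀ᵐ y ∂(ν.restrict A), Integrable (fun s => g s y) μ := hint.prod_left_ae
  have h2 : (∫ s, f s ∂μ : Lp ℂ 2 ν) =ᵐ[ν.restrict A] fun y => ∫ s, g s y ∂μ := by
    -- compare the integrals over measurable sets `B`, that is, pair with indicator functions
    refine Integrable.ae_eq_of_forall_setIntegral_eq _ _ (hintA _) hint.integral_prod_right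
      fun B hB hνB => ?_
    have hBA : ν (B ∩ A) ≠ ∞ := by
      rw [Measure.restrict_apply hB] at hνB; exact hνB.ne
    rw [Measure.restrict_restrict hB, ← L2.inner_indicatorConstLp_one (hB.inter hA) hBA,
      ← integral_inner hf]
    have h3 : Integrable (Function.uncurry g) (μ.prod (ν.restrict (B ∩ A))) := by
      refine hint.mono_measure (Measure.prod_mono le_rfl ?_)
      exact Measure.restrict_mono Set.inter_subset_right le_rfl
    have h4 := integral_integral_swap h3
    rw [← h4]
    refine integral_congr_ae ?_
    filter_upwards [hfg] with s hs
    rw [L2.inner_indicatorConstLp_one]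
    exact integral_congr_ae (ae_restrict_of_ae hs)
  filter_upwards [h1, h2] with y hy1 hy2
  exact ⟨hy1, hy2⟩

end LTwo

section TestFunctions

variable {F : Type*} [NontriviallyNormedField F] [ProperSpace F] [MeasurableSpace F] [BorelSpace F]
  (μ : Measure F) [μ.IsAddHaarMeasure] {n : ℕ}

lemma IsTest.continuous {g : (Fin n → F) → ℂ} (hg : IsTest g) : Continuous g := by
  obtain ⟨⟨K, hK⟩, -⟩ := hg
  exact hK.continuous

lemma IsTest.memLp {g : (Fin n → F) → ℂ} (hg : IsTest g) :
    MemLp g 2 (Measure.pi fun _ : Fin n => μ) :=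
  hg.continuous.memLp_of_hasCompactSupport hg.2

/-- The test functions are dense. -/
theorem dense_testSpace : Dense (testSpace n μ : Set (HSpace n μ)) := by
  rw [Submodule.dense_iff_topologicalClosure_eq_top, Submodule.topologicalClosure_eq_top_iff,
    Submodule.eq_bot_iff]
  intro φ hφ
  rw [Submodule.mem_orthogonal] at hφ
  rw [Lp.eq_zero_iff_ae_eq_zero]
  refine ae_eq_zero_of_integral_lipschitz_smul
    ((Lp.memLp φ).locallyIntegrable one_le_two) fun G ⟨K, hG⟩ hGc => ?_
  have hT : IsTest fun y => (G y : ℂ) :=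
    ⟨⟨K, fun x y => by
      rw [Complex.isometry_ofReal.edist_eq]; exact hG x y⟩,
      hGc.comp_left (g := ((↑) : ℝ → ℂ)) Complex.ofReal_zero⟩
  have h1 := hφ ((hT.memLp μ).toLp _) ⟨_, hT, (hT.memLp μ).coeFn_toLp⟩
  rw [L2.inner_def] at h1
  rw [← h1]
  refine integral_congr_ae ?_
  filter_upwards [(hT.memLp μ).coeFn_toLp] with y hy
  rw [hy]
  simp [mul_comm]

end TestFunctions

section PiMeasure

variable {X : Type*} [MeasurableSpace X] {μ : Measure X} [SigmaFinite μ]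

lemma lintegral_pi_prod {n : ℕ} {E : Fin n → Type*}
    {mE : ∀ i, MeasurableSpace (E i)} {μ : (i : Fin n) → Measure (E i)} [∀ i, SigmaFinite (μ i)]
    {f : (i : Fin n) → E i → ℝ≥0∞} (hf : ∀ i, Measurable (f i)) :
    ∫⁻ y : (i : Fin n) → E i, ∏ i, f i (y i) ∂(Measure.pi μ) = ∏ i, ∫⁻ x, f i x ∂(μ i) := by
  induction n with
  | zero => simp
  | succ n ih =>
    have h := (measurePreserving_piFinSuccAbove μ 0).symm
    have hm : Measurable fun y : (i : Fin (n+1)) → E i => ∏ i, f i (y i) :=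
      Finset.measurable_prod _ fun i _ => (hf i).comp (measurable_pi_apply i)
    rw [← h.lintegral_comp hm, Fin.prod_univ_succ, ← ih fun i => hf i.succ]
    rw [← lintegral_prod_mul (hf 0).aemeasurable
      (Finset.measurable_prod _ fun i _ => (hf i.succ).comp (measurable_pi_apply i)).aemeasurable]
    refine lintegral_congr fun z => ?_
    rw [Fin.prod_univ_succ]
    rfl

lemma pi_withDensity {n : ℕ} {f : Fin n → X → ℝ≥0} (hf : ∀ i, Measurable (f i)) :
    Measure.pi (fun i => μ.withDensity fun x => (f i x : ℝ≥0∞)) =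
      (Measure.pi fun _ : Fin n => μ).withDensity fun y => ((∏ i, f i (y i) : ℝ≥0) : ℝ≥0∞) := by
  refine Measure.pi_eq fun s hs => ?_
  rw [withDensity_apply _ (MeasurableSet.univ_pi hs),
    ← lintegral_indicator (MeasurableSet.univ_pi hs)]
  have h1 := lintegral_pi_prod (μ := fun _ => μ)
    (f := fun i => (s i).indicator fun x => (f i x : ℝ≥0∞))
    fun i => (hf i).coe_nnreal_ennreal.indicator (hs i)
  simp only [lintegral_indicator (hs _)] at h1
  simp only [withDensity_apply _ (hs _)]
  rw [← h1]
  congr 1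
  ext y
  by_cases hy : y ∈ Set.univ.pi s
  · rw [Set.indicator_of_mem hy, ENNReal.ofNNReal_finsetProd]
    exact Finset.prod_congr rfl fun i _ => (Set.indicator_of_mem (hy i trivial)
      fun x => (f i x : ℝ≥0∞)).symm
  · rw [Set.indicator_of_notMem hy]
    obtain ⟨i, hi⟩ : ∃ i, y i ∉ s i := by simpa [Set.mem_pi] using hy
    exact (Finset.prod_eq_zero (Finset.mem_univ i) (Set.indicator_of_notMem hi
      fun x => (f i x : ℝ≥0∞))).symm

end PiMeasure



/-! ### Weighted composition with Möbius transformations -/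

section Moebius

variable {F : Type*} [NontriviallyNormedField F] [ProperSpace F] [MeasurableSpace F] [BorelSpace F]
  (μ : Measure F) [μ.IsAddHaarMeasure]

/-- The denominator `c x + d` of the Möbius transformation of a matrix. -/
def mobDen (g : Matrix (Fin 2) (Fin 2) F) (x : F) : F := g 1 0 * x + g 1 1

/-- The Möbius transformation `(a x + b) / (c x + d)` of a matrix, with value `0` at its pole. -/
def mobMap (g : Matrix (Fin 2) (Fin 2) F) (x : F) : F := (g 0 0 * x + g 0 1) / mobDen g x

lemma measurable_mobDen (g : Matrix (Fin 2) (Fin 2) F) : Measurable (mobDen g) :=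
  (measurable_id.const_mul _).add_const _

lemma measurable_mobMap (g : Matrix (Fin 2) (Fin 2) F) : Measurable (mobMap g) :=
  ((measurable_id.const_mul _).add_const _).div (measurable_mobDen g)

lemma ae_mobDen_ne {g : Matrix (Fin 2) (Fin 2) F} (hg : g.det ≠ 0) :
    ∀ᵐ x ∂μ, mobDen g x ≠ 0 := by
  rw [Matrix.det_fin_two] at hg
  filter_upwards [ae_ne μ (-(g 1 1) / g 1 0)] with x hx h
  rw [mobDen] at h
  by_cases hc : g 1 0 = 0
  · rw [hc, zero_mul, zero_add] at h
    exact hg (by rw [hc, h]; ring)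
  · exact hx (by field_simp; linear_combination h)

/-- The change of variables for a Möbius transformation. -/
lemma lintegral_mob {g : Matrix (Fin 2) (Fin 2) F} (hg : g.det ≠ 0) {f : F → ℝ≥0∞}
    (hf : Measurable f) :
    ∫⁻ x, ENNReal.ofReal ((nrm (mobDen g x))⁻¹ ^ 2) * f (mobMap g x) ∂μ =
      ENNReal.ofReal (nrm g.det)⁻¹ * ∫⁻ x, f x ∂μ := by
  have hdet := Matrix.det_fin_two g
  by_cases hc : g 1 0 = 0
  · rw [hc, mul_zero, sub_zero] at hdet
    have ha : g 0 0 ≠ 0 := fun h => hg (by rw [hdet, h, zero_mul])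
    have hd : g 1 1 ≠ 0 := fun h => hg (by rw [hdet, h, mul_zero])
    have h1 : ∀ x, mobMap g x = g 0 0 / g 1 1 * x + g 0 1 / g 1 1 := fun x => by
      rw [mobMap, mobDen, hc, zero_mul, zero_add, add_div, mul_div_right_comm]
    simp only [h1, mobDen, hc, zero_mul, zero_add]
    rw [lintegral_const_mul _ (by fun_prop), lintegral_mul_left μ (div_ne_zero ha hd)
      fun x => f (x + g 0 1 / g 1 1), lintegral_add_right_eq_self, ← mul_assoc,
      ← ENNReal.ofReal_mul (by positivity), hdet, nrm_div, nrm_mul]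
    congr 2
    have := (nrm_pos ha).ne'
    have := (nrm_pos hd).ne'
    field_simp
  · -- away from the affine case, the map is an inversion between two affine maps
    have h1 : ∀ᵐ x ∂μ, mobMap g x = g 0 0 / g 1 0 - g.det / g 1 0 * (mobDen g x)⁻¹ := by
      filter_upwards [ae_mobDen_ne μ hg] with x hx
      have h2 : g 1 0 * x = mobDen g x - g 1 1 := by rw [mobDen]; ring
      rw [mobMap, hdet, eq_comm, ← sub_eq_zero]
      have h3 : (g 0 0 * (g 1 0 * x) + g 0 1 * g 1 0) / (g 1 0 * mobDen g x) =
          (g 0 0 * x + g 0 1) / mobDen g x := by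
        rw [← mul_div_mul_left (g 0 0 * x + g 0 1) (mobDen g x) hc]; congr 1; ring
      rw [← h3, h2]
      field_simp
      ring
    set G : F → ℝ≥0∞ := fun v => f (g 0 0 / g 1 0 - g.det / g 1 0 * v)
    have hG : Measurable G := by fun_prop
    have hm : Measurable fun x : F => ENNReal.ofReal ((nrm x)⁻¹ ^ 2) * G x⁻¹ :=
      ((measurable_nrm.inv.pow_const 2).ennreal_ofReal).mul (hG.comp measurable_inv)
    calc ∫⁻ x, ENNReal.ofReal ((nrm (mobDen g x))⁻¹ ^ 2) * f (mobMap g x) ∂μ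
        = ∫⁻ x, (fun u => ENNReal.ofReal ((nrm (u + g 1 1))⁻¹ ^ 2) * G (u + g 1 1)⁻¹)
            (g 1 0 * x) ∂μ := by
          refine lintegral_congr_ae ?_
          filter_upwards [h1] with x hx
          rw [hx]; rfl
      _ = ENNReal.ofReal (nrm (g 1 0))⁻¹ * ∫⁻ x, G x ∂μ := by
          refine (lintegral_mul_left μ hc fun u =>
            ENNReal.ofReal ((nrm (u + g 1 1))⁻¹ ^ 2) * G (u + g 1 1)⁻¹).trans ?_
          rw [lintegral_add_right_eq_self (fun u => ENNReal.ofReal ((nrm u)⁻¹ ^ 2) * G u⁻¹) (g 1 1), lintegral_inv μ G hG]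
      _ = ENNReal.ofReal (nrm g.det)⁻¹ * ∫⁻ x, f x ∂μ := by
          simp only [G]
          rw [lintegral_mul_left μ (div_ne_zero hg hc) fun v => f (g 0 0 / g 1 0 - v),
            lintegral_sub_left_eq_self, ← mul_assoc, ← ENNReal.ofReal_mul (inv_nonneg.2
            (nrm_nonneg _)), nrm_div]
          congr 2
          have := (nrm_pos hc).ne'
          have := (nrm_pos hg).ne'
          field_simp

/-- The Jacobian of a Möbius transformation. -/
noncomputable def mobJac (g : Matrix (Fin 2) (Fin 2) F) (x : F) : ℝ≥0 :=
  Real.toNNReal (nrm g.det * (nrm (mobDen g x))⁻¹ ^ 2)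

lemma coe_mobJac (g : Matrix (Fin 2) (Fin 2) F) (x : F) :
    (mobJac g x : ℝ≥0∞) = ENNReal.ofReal (nrm g.det) * ENNReal.ofReal ((nrm (mobDen g x))⁻¹ ^ 2) :=
  ENNReal.ofReal_mul (nrm_nonneg _)

lemma measurable_mobJac (g : Matrix (Fin 2) (Fin 2) F) : Measurable (mobJac g) :=
  measurable_real_toNNReal.comp
    ((((measurable_nrm.comp (measurable_mobDen g)).inv).pow_const 2).const_mul _)

lemma measurePreserving_mob {g : Matrix (Fin 2) (Fin 2) F} (hg : g.det ≠ 0) :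
    MeasurePreserving (mobMap g) (μ.withDensity fun x => (mobJac g x : ℝ≥0∞)) μ := by
  refine ⟨measurable_mobMap g, ?_⟩
  ext s hs
  have hsm : Measurable (s.indicator (1 : F → ℝ≥0∞)) := measurable_one.indicator hs
  rw [← lintegral_indicator_one hs, ← lintegral_indicator_one hs,
    lintegral_map hsm (measurable_mobMap g)]
  have h0 := lintegral_withDensity_eq_lintegral_mul μ (measurable_mobJac g).coe_nnreal_ennreal
    (hsm.comp (measurable_mobMap g))
  simp only [Function.comp_def] at h0
  rw [h0]
  simp only [Pi.mul_apply, coe_mobJac, mul_assoc]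
  rw [lintegral_const_mul, lintegral_mob μ hg hsm, ← mul_assoc, ← ENNReal.ofReal_mul
    (nrm_nonneg _), mul_inv_cancel₀ (nrm_pos hg).ne', ENNReal.ofReal_one, one_mul]
  exact ((((measurable_nrm.comp (measurable_mobDen g)).inv).pow_const 2).ennreal_ofReal).mul
    (hsm.comp (measurable_mobMap g))

variable {n : ℕ}

/-- The coordinatewise Möbius transformation of a family of matrices. -/
def piMob (g : Fin n → Matrix (Fin 2) (Fin 2) F) (y : Fin n → F) : Fin n → F :=
  fun i => mobMap (g i) (y i)

lemma measurePreserving_piMob {g : Fin n → Matrix (Fin 2) (Fin 2) F} (hg : ∀ i, (g i).det ≠ 0) :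
    MeasurePreserving (piMob g) ((Measure.pi fun _ : Fin n => μ).withDensity
      fun y => ((∏ i, mobJac (g i) (y i) : ℝ≥0) : ℝ≥0∞)) (Measure.pi fun _ : Fin n => μ) := by
  rw [← pi_withDensity fun i => measurable_mobJac (g i)]
  exact measurePreserving_pi _ _ fun i => measurePreserving_mob μ (hg i)

lemma ae_forall_mobDen_ne {g : Fin n → Matrix (Fin 2) (Fin 2) F} (hg : ∀ i, (g i).det ≠ 0) :
    ∀ᵐ y ∂(Measure.pi fun _ : Fin n => μ), ∀ i, mobDen (g i) (y i) ≠ 0 :=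
  ae_all_iff.2 fun i =>
    (Measure.quasiMeasurePreserving_eval (fun _ : Fin n => μ) i).ae (ae_mobDen_ne μ (hg i))

lemma quasiMeasurePreserving_piMob {g : Fin n → Matrix (Fin 2) (Fin 2) F}
    (hg : ∀ i, (g i).det ≠ 0) : Measure.QuasiMeasurePreserving (piMob g)
      (Measure.pi fun _ : Fin n => μ) (Measure.pi fun _ : Fin n => μ) := by
  refine (measurePreserving_piMob μ hg).quasiMeasurePreserving.mono_left ?_
  refine withDensity_absolutelyContinuous' ?_ ?_
  · exact (Finset.measurable_prod _ fun i _ => (measurable_mobJac (g i)).comp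
      (measurable_pi_apply i)).coe_nnreal_ennreal.aemeasurable
  · filter_upwards [ae_forall_mobDen_ne μ hg] with y hy
    rw [Ne, ENNReal.coe_eq_zero, Finset.prod_eq_zero_iff]
    rintro ⟨i, -, hi⟩
    rw [mobJac, Real.toNNReal_eq_zero] at hi
    have h1 := nrm_pos (hy i)
    have h2 := nrm_pos (hg i)
    exact absurd hi (not_le.2 (by positivity))

variable (l : Fin n → ℂ)

/-- The weighted composition of a function with a coordinatewise Möbius transformation. -/
noncomputable def mobFun (g : Fin n → Matrix (Fin 2) (Fin 2) F) (φ : (Fin n → F) → ℂ)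
    (y : Fin n → F) : ℂ :=
  (∏ i, npow (mobDen (g i) (y i)) (l i)) * φ (piMob g y)

/-- The factor by which the weighted composition scales the norm. -/
noncomputable def mobScale (g : Fin n → Matrix (Fin 2) (Fin 2) F) : ℝ :=
  ∏ i, nrm (g i).det ^ (-(1 / 2) : ℝ)

lemma mobScale_nonneg (g : Fin n → Matrix (Fin 2) (Fin 2) F) : 0 ≤ mobScale g :=
  Finset.prod_nonneg fun _ _ => Real.rpow_nonneg (nrm_nonneg _) _

lemma mobFun_congr {g : Fin n → Matrix (Fin 2) (Fin 2) F} (hg : ∀ i, (g i).det ≠ 0)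
    {φ ψ : (Fin n → F) → ℂ} (h : φ =ᵐ[Measure.pi fun _ : Fin n => μ] ψ) :
    mobFun l g φ =ᵐ[Measure.pi fun _ : Fin n => μ] mobFun l g ψ := by
  filter_upwards [(quasiMeasurePreserving_piMob μ hg).ae h] with y hy
  rw [mobFun, mobFun, hy]

lemma aesm_mobFun {g : Fin n → Matrix (Fin 2) (Fin 2) F} (hg : ∀ i, (g i).det ≠ 0)
    {φ : (Fin n → F) → ℂ} (hφ : AEStronglyMeasurable φ (Measure.pi fun _ : Fin n => μ)) :
    AEStronglyMeasurable (mobFun l g φ) (Measure.pi fun _ : Fin n => μ) :=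
  (Finset.measurable_prod _ fun i _ => (measurable_npow _).comp ((measurable_mobDen _).comp
    (measurable_pi_apply i))).aestronglyMeasurable.mul
    (hφ.comp_quasiMeasurePreserving (quasiMeasurePreserving_piMob μ hg))

variable {l} (hl : ∀ i, (l i).re = -1)
include hl

lemma lintegral_mobFun {g : Fin n → Matrix (Fin 2) (Fin 2) F} (hg : ∀ i, (g i).det ≠ 0)
    {φ : (Fin n → F) → ℂ} (hφ : AEStronglyMeasurable φ (Measure.pi fun _ : Fin n => μ)) :
    ∫⁻ y, ‖mobFun l g φ y‖ₑ ^ 2 ∂(Measure.pi fun _ : Fin n => μ) =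
      ENNReal.ofReal (mobScale g) ^ 2 * ∫⁻ y, ‖φ y‖ₑ ^ 2 ∂(Measure.pi fun _ : Fin n => μ) := by
  have hmp := measurePreserving_piMob μ hg
  have hJ : Measurable fun y : Fin n → F => ∏ i, mobJac (g i) (y i) :=
    Finset.measurable_prod _ fun i _ => (measurable_mobJac (g i)).comp (measurable_pi_apply i)
  have h1 : AEMeasurable (fun y => ‖φ y‖ₑ ^ 2) (Measure.pi fun _ : Fin n => μ) :=
    hφ.enorm.pow_const 2
  have hq : AEMeasurable (fun y => ‖φ (piMob g y)‖ₑ ^ 2) (Measure.pi fun _ : Fin n => μ) :=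
    (hφ.comp_quasiMeasurePreserving (quasiMeasurePreserving_piMob μ hg)).enorm.pow_const 2
  conv_rhs => rw [← hmp.map_eq]
  rw [lintegral_map' (hmp.map_eq.symm ▸ h1) hmp.measurable.aemeasurable,
    lintegral_withDensity_eq_lintegral_mul₀ hJ.coe_nnreal_ennreal.aemeasurable hq,
    ← lintegral_const_mul'' _ (hJ.coe_nnreal_ennreal.aemeasurable.mul hq)]
  refine lintegral_congr_ae ?_
  filter_upwards [ae_forall_mobDen_ne μ hg] with y hy
  rw [mobFun, enorm_mul, mul_pow, Pi.mul_apply, ← mul_assoc]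
  congr 1
  rw [← ofReal_norm, ← ENNReal.ofReal_pow (norm_nonneg _), ← ENNReal.ofReal_pow
    (mobScale_nonneg g), ← ENNReal.ofReal_coe_nnreal, ← ENNReal.ofReal_mul (by positivity)]
  congr 1
  rw [norm_prod, mobScale, NNReal.coe_prod, ← Finset.prod_pow, ← Finset.prod_pow,
    ← Finset.prod_mul_distrib]
  refine Finset.prod_congr rfl fun i _ => ?_
  have hp := nrm_pos (hg i)
  have h2 : (nrm (g i).det ^ (-(1 / 2) : ℝ)) ^ 2 = (nrm (g i).det)⁻¹ := by
    rw [← Real.rpow_natCast, ← Real.rpow_mul hp.le, ← Real.rpow_neg_one]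
    norm_num
  rw [norm_npow (hy i), hl, mobJac, Real.coe_toNNReal _ (by positivity), h2,
    Real.rpow_neg_one, inv_mul_cancel_left₀ hp.ne']

lemma eLpNorm_mobFun {g : Fin n → Matrix (Fin 2) (Fin 2) F} (hg : ∀ i, (g i).det ≠ 0)
    {φ : (Fin n → F) → ℂ} (hφ : AEStronglyMeasurable φ (Measure.pi fun _ : Fin n => μ)) :
    eLpNorm (mobFun l g φ) 2 (Measure.pi fun _ : Fin n => μ) =
      ENNReal.ofReal (mobScale g) * eLpNorm φ 2 (Measure.pi fun _ : Fin n => μ) := by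
  have h := lintegral_mobFun μ hl hg hφ
  have h1 : ∀ f : (Fin n → F) → ℂ, ∫⁻ y, ‖f y‖ₑ ^ 2 ∂(Measure.pi fun _ : Fin n => μ) =
      eLpNorm f 2 (Measure.pi fun _ : Fin n => μ) ^ 2 := fun f => by
    have := eLpNorm_nnreal_pow_eq_lintegral (f := f) (p := 2)
      (μ := Measure.pi fun _ : Fin n => μ) two_ne_zero
    norm_num at this
    exact_mod_cast this.symm
  rw [h1, h1, ← mul_pow] at h
  exact ENNReal.rpow_left_injective (x := 2) two_ne_zero (by simpa using h)

lemma memLp_mobFun {g : Fin n → Matrix (Fin 2) (Fin 2) F} (hg : ∀ i, (g i).det ≠ 0)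
    {φ : (Fin n → F) → ℂ} (hφ : MemLp φ 2 (Measure.pi fun _ : Fin n => μ)) :
    MemLp (mobFun l g φ) 2 (Measure.pi fun _ : Fin n => μ) :=
  ⟨aesm_mobFun μ l hg hφ.1, by
    rw [eLpNorm_mobFun μ hl hg hφ.1]; exact ENNReal.mul_lt_top ENNReal.ofReal_lt_top hφ.2⟩

omit hl

variable (l)

open scoped Classical in
/-- The bounded operator of weighted composition with a coordinatewise Möbius transformation. It is
defined for weights of real part `-1` and invertible matrices, and zero otherwise. -/
noncomputable def mobOp (g : Fin n → Matrix (Fin 2) (Fin 2) F) : HSpace n μ →L[ℂ] HSpace n μ :=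
  if h : (∀ i, (l i).re = -1) ∧ ∀ i, (g i).det ≠ 0 then
    LinearMap.mkContinuous
      { toFun := fun φ => (memLp_mobFun μ h.1 h.2 (Lp.memLp φ)).toLp _
        map_add' := fun φ ψ => by
          rw [← MemLp.toLp_add]
          refine MemLp.toLp_congr _ _ ((mobFun_congr μ l h.2 (Lp.coeFn_add φ ψ)).trans ?_)
          exact Eventually.of_forall fun y => by simp [mobFun, mul_add]
        map_smul' := fun z φ => by
          rw [RingHom.id_apply, ← MemLp.toLp_const_smul]
          refine MemLp.toLp_congr _ _ ((mobFun_congr μ l h.2 (Lp.coeFn_smul z φ)).trans ?_)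
          exact Eventually.of_forall fun y => by simp [mobFun, mul_left_comm] }
      (mobScale g) fun φ => by
        simp only [LinearMap.coe_mk, AddHom.coe_mk]
        rw [Lp.norm_toLp, eLpNorm_mobFun μ h.1 h.2 (Lp.aestronglyMeasurable φ), ENNReal.toReal_mul,
          ENNReal.toReal_ofReal (mobScale_nonneg g), Lp.norm_def]
  else 0

variable {l}
include hl

lemma coeFn_mobOp {g : Fin n → Matrix (Fin 2) (Fin 2) F} (hg : ∀ i, (g i).det ≠ 0)
    (φ : HSpace n μ) : mobOp μ l g φ =ᵐ[Measure.pi fun _ : Fin n => μ] mobFun l g φ := by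
  rw [mobOp, dif_pos ⟨hl, hg⟩]
  exact MemLp.coeFn_toLp (memLp_mobFun μ hl hg (Lp.memLp φ))

lemma coeFn_mobOp' {g : Fin n → Matrix (Fin 2) (Fin 2) F} (hg : ∀ i, (g i).det ≠ 0)
    {φ : HSpace n μ} {f : (Fin n → F) → ℂ} (h : φ =ᵐ[Measure.pi fun _ : Fin n => μ] f) :
    mobOp μ l g φ =ᵐ[Measure.pi fun _ : Fin n => μ] mobFun l g f :=
  (coeFn_mobOp μ hl hg φ).trans (mobFun_congr μ l hg h)

lemma norm_mobOp {g : Fin n → Matrix (Fin 2) (Fin 2) F} (hg : ∀ i, (g i).det ≠ 0)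
    (φ : HSpace n μ) : ‖mobOp μ l g φ‖ = mobScale g * ‖φ‖ := by
  rw [Lp.norm_def, eLpNorm_congr_ae (coeFn_mobOp μ hl hg φ),
    eLpNorm_mobFun μ hl hg (Lp.aestronglyMeasurable φ), ENNReal.toReal_mul,
    ENNReal.toReal_ofReal (mobScale_nonneg g), Lp.norm_def]

omit hl in
lemma mobDen_mul (g h : Matrix (Fin 2) (Fin 2) F) {x : F} (hx : mobDen g x ≠ 0) :
    mobDen (h * g) x = mobDen g x * mobDen h (mobMap g x) := by
  have h1 : mobDen g x * mobMap g x = g 0 0 * x + g 0 1 := by rw [mobMap]; field_simp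
  have h2 : mobDen g x * mobDen h (mobMap g x) =
      h 1 0 * (mobDen g x * mobMap g x) + h 1 1 * mobDen g x := by
    rw [mobDen.eq_1 h]; ring
  rw [h2, h1]
  simp only [mobDen, Matrix.mul_apply, Fin.sum_univ_two]
  ring

omit hl in
lemma mobMap_mul (g h : Matrix (Fin 2) (Fin 2) F) {x : F} (hx : mobDen g x ≠ 0) :
    mobMap (h * g) x = mobMap h (mobMap g x) := by
  have h1 : mobDen g x * mobMap g x = g 0 0 * x + g 0 1 := by rw [mobMap]; field_simp
  rw [mobMap.eq_1 (h * g), mobDen_mul g h hx, mobMap.eq_1 h,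
    ← mul_div_mul_left (h 0 0 * mobMap g x + h 0 1) _ hx]
  congr 1
  have h2 : mobDen g x * (h 0 0 * mobMap g x + h 0 1) =
      h 0 0 * (mobDen g x * mobMap g x) + h 0 1 * mobDen g x := by ring
  rw [h2, h1]
  simp only [mobDen, Matrix.mul_apply, Fin.sum_univ_two]
  ring

lemma mobOp_mobOp {g h : Fin n → Matrix (Fin 2) (Fin 2) F} (hg : ∀ i, (g i).det ≠ 0)
    (hh : ∀ i, (h i).det ≠ 0) (φ : HSpace n μ) :
    mobOp μ l g (mobOp μ l h φ) = mobOp μ l (fun i => h i * g i) φ := by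
  have hhg : ∀ i, (h i * g i).det ≠ 0 := fun i => by
    rw [Matrix.det_mul]; exact mul_ne_zero (hh i) (hg i)
  refine Lp.ext ((coeFn_mobOp' μ hl hg (coeFn_mobOp μ hl hh φ)).trans
    (EventuallyEq.trans ?_ (coeFn_mobOp μ hl hhg φ).symm))
  filter_upwards [ae_forall_mobDen_ne μ hg] with y hy
  simp only [mobFun]
  rw [← mul_assoc, ← Finset.prod_mul_distrib]
  congr 1
  · refine Finset.prod_congr rfl fun i _ => ?_
    rw [mobDen_mul _ _ (hy i), npow_mul]
    rfl
  · congr 1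
    ext i
    exact (mobMap_mul _ _ (hy i)).symm

lemma mobOp_scalar {k : Fin n → F} (hk : ∀ i, k i ≠ 0) (φ : HSpace n μ) :
    mobOp μ l (fun i => k i • (1 : Matrix (Fin 2) (Fin 2) F)) φ = (∏ i, npow (k i) (l i)) • φ := by
  have hdet : ∀ i, (k i • (1 : Matrix (Fin 2) (Fin 2) F)).det ≠ 0 := fun i => by simp [hk i]
  refine Lp.ext ((coeFn_mobOp μ hl hdet φ).trans
    (EventuallyEq.trans ?_ (Lp.coeFn_smul _ φ).symm))
  refine Eventually.of_forall fun y => ?_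
  have h1 : piMob (fun i => k i • (1 : Matrix (Fin 2) (Fin 2) F)) y = y := by
    ext i
    simp [piMob, mobMap, mobDen, hk i]
  simp only [mobFun, h1, Pi.smul_apply, smul_eq_mul]
  congr 1
  exact Finset.prod_congr rfl fun i _ => by simp [mobDen]

lemma mobOp_one (φ : HSpace n μ) :
    mobOp μ l (fun _ => (1 : Matrix (Fin 2) (Fin 2) F)) φ = φ := by
  have h := mobOp_scalar μ hl (k := fun _ => 1) (fun _ => one_ne_zero) φ
  simpa using h

lemma tendsto_mobOp_of_forall {ι : Type*} {𝓕 : Filter ι} [𝓕.IsCountablyGenerated]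
    {g : ι → Fin n → Matrix (Fin 2) (Fin 2) F} {g₀ : Fin n → Matrix (Fin 2) (Fin 2) F}
    (h : ∀ i a b, Tendsto (fun j => g j i a b) 𝓕 (𝓝 (g₀ i a b)))
    (hg : ∀ j i, (g j i).det ≠ 0) (hg₀ : ∀ i, (g₀ i).det ≠ 0) (φ : HSpace n μ) :
    Tendsto (fun j => mobOp μ l (g j) φ) 𝓕 (𝓝 (mobOp μ l g₀ φ)) := by
  have hscale : Tendsto (fun j => mobScale (g j)) 𝓕 (𝓝 (mobScale g₀)) := by
    refine tendsto_finsetProd _ fun i _ => ?_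
    refine Tendsto.rpow_const ((continuous_nrm.tendsto _).comp ?_) (Or.inl (nrm_pos (hg₀ i)).ne')
    simp only [Matrix.det_fin_two]
    exact ((h i 0 0).mul (h i 1 1)).sub ((h i 0 1).mul (h i 1 0))
  -- the statement for test functions
  have htest : ∀ φ ∈ testSpace n μ,
      Tendsto (fun j => mobOp μ l (g j) φ) 𝓕 (𝓝 (mobOp μ l g₀ φ)) := by
    rintro φ ⟨f, hf, hφ⟩
    refine tendsto_Lp_of_ae_of_norm (fun j => coeFn_mobOp' μ hl (hg j) hφ)
      (coeFn_mobOp' μ hl hg₀ hφ) ?_ ?_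
    · filter_upwards [ae_forall_mobDen_ne μ hg₀] with y hy
      have hden : ∀ i, Tendsto (fun j => mobDen (g j i) (y i)) 𝓕 (𝓝 (mobDen (g₀ i) (y i))) :=
        fun i => ((h i 1 0).mul_const _).add (h i 1 1)
      refine Tendsto.mul (tendsto_finsetProd _ fun i _ =>
        (continuousAt_npow (hy i) _).tendsto.comp (hden i)) ((hf.continuous.tendsto _).comp ?_)
      exact tendsto_pi_nhds.2 fun i =>
        (((h i 0 0).mul_const _).add (h i 0 1)).div (hden i) (hy i)
    · simp only [norm_mobOp μ hl (hg _), norm_mobOp μ hl hg₀]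
      exact hscale.mul_const _
  -- the norms are locally bounded, so density of the test functions gives the general case
  rw [Metric.tendsto_nhds]
  intro ε hε
  set K := mobScale g₀ + 1
  have hK : 0 < K := by have := mobScale_nonneg g₀; positivity
  obtain ⟨ψ, hψ, hφψ⟩ := Metric.dense_iff.1 (dense_testSpace μ (n := n)) φ (ε / (3 * K))
    (by positivity)
  rw [Metric.mem_ball, dist_comm, dist_eq_norm] at hψ
  filter_upwards [Metric.tendsto_nhds.1 (htest ψ hφψ) (ε / 3) (by positivity),
    hscale.eventually_lt_const (show mobScale g₀ < K by simp [K])] with j h1 h2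
  rw [dist_eq_norm] at h1 ⊢
  have e1 : mobOp μ l (g j) φ - mobOp μ l g₀ φ = mobOp μ l (g j) (φ - ψ) +
      (mobOp μ l (g j) ψ - mobOp μ l g₀ ψ) - mobOp μ l g₀ (φ - ψ) := by
    simp only [map_sub]; abel
  have h3 : ‖mobOp μ l (g j) (φ - ψ)‖ < ε / 3 := by
    rw [norm_mobOp μ hl (hg j)]
    calc mobScale (g j) * ‖φ - ψ‖ ≤ K * ‖φ - ψ‖ := by gcongr
      _ < K * (ε / (3 * K)) := by gcongr
      _ = ε / 3 := by field_simp
  have h4 : ‖mobOp μ l g₀ (φ - ψ)‖ < ε / 3 := by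
    rw [norm_mobOp μ hl hg₀]
    calc mobScale g₀ * ‖φ - ψ‖ ≤ K * ‖φ - ψ‖ := by gcongr; simp [K]
      _ < K * (ε / (3 * K)) := by gcongr
      _ = ε / 3 := by field_simp
  rw [e1]
  calc _ ≤ ‖mobOp μ l (g j) (φ - ψ)‖ + ‖mobOp μ l (g j) ψ - mobOp μ l g₀ ψ‖ +
        ‖mobOp μ l g₀ (φ - ψ)‖ := (norm_sub_le _ _).trans (by gcongr; exact norm_add_le _ _)
    _ < ε := by linarith

/-- The operators of weighted composition depend strongly continuously on the matrices. -/
lemma tendsto_mobOp {ι : Type*} {𝓕 : Filter ι} [𝓕.IsCountablyGenerated]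
    {g : ι → Fin n → Matrix (Fin 2) (Fin 2) F} {g₀ : Fin n → Matrix (Fin 2) (Fin 2) F}
    (h : ∀ i a b, Tendsto (fun j => g j i a b) 𝓕 (𝓝 (g₀ i a b)))
    (hg₀ : ∀ i, (g₀ i).det ≠ 0) (φ : HSpace n μ) :
    Tendsto (fun j => mobOp μ l (g j) φ) 𝓕 (𝓝 (mobOp μ l g₀ φ)) := by
  classical
  -- the matrices are eventually invertible, and the others may be replaced by the limit
  have hev : ∀ᶠ j in 𝓕, ∀ i, (g j i).det ≠ 0 := by
    refine eventually_all.2 fun i => ?_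
    have h1 : Tendsto (fun j => (g j i).det) 𝓕 (𝓝 (g₀ i).det) := by
      simp only [Matrix.det_fin_two]
      exact ((h i 0 0).mul (h i 1 1)).sub ((h i 0 1).mul (h i 1 0))
    exact h1.eventually_ne (hg₀ i)
  set g' : ι → Fin n → Matrix (Fin 2) (Fin 2) F := fun j =>
    if ∀ i, (g j i).det ≠ 0 then g j else g₀
  have hg' : g' =ᶠ[𝓕] g := hev.mono fun j hj => if_pos hj
  have hdet : ∀ j i, (g' j i).det ≠ 0 := fun j => by
    by_cases hj : ∀ i, (g j i).det ≠ 0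
    · simpa only [g', if_pos hj] using hj
    · simpa only [g', if_neg hj] using hg₀
  refine (tendsto_mobOp_of_forall μ hl (fun i a b => (h i a b).congr' ?_) hdet hg₀ φ).congr' ?_
  · filter_upwards [hg'] with j hj
    rw [hj]
  · filter_upwards [hg'] with j hj
    rw [hj]

omit hl in
lemma mobScale_pos {g : Fin n → Matrix (Fin 2) (Fin 2) F} (hg : ∀ i, (g i).det ≠ 0) :
    0 < mobScale g :=
  Finset.prod_pos fun i _ => Real.rpow_pos_of_pos (nrm_pos (hg i)) _

lemma inner_mobOp_mobOp {g : Fin n → Matrix (Fin 2) (Fin 2) F} (hg : ∀ i, (g i).det ≠ 0)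
    (φ ψ : HSpace n μ) :
    inner ℂ (mobOp μ l g φ) (mobOp μ l g ψ) = (mobScale g : ℂ) ^ 2 * inner ℂ φ ψ := by
  have hs := mobScale_pos hg
  let L : HSpace n μ →ₗᵢ[ℂ] HSpace n μ :=
    ⟨(((mobScale g)⁻¹ : ℝ) : ℂ) • (mobOp μ l g).toLinearMap, fun χ => by
      simp only [LinearMap.smul_apply, ContinuousLinearMap.coe_coe]
      rw [norm_smul, norm_mobOp μ hl hg, Complex.norm_real, Real.norm_of_nonneg (inv_nonneg.2 hs.le),
        inv_mul_cancel_left₀ hs.ne']⟩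
  have h1 : ∀ χ, mobOp μ l g χ = (mobScale g : ℂ) • L χ := fun χ => by
    change _ = (mobScale g : ℂ) • ((((mobScale g)⁻¹ : ℝ) : ℂ) • mobOp μ l g χ)
    rw [smul_smul, ← Complex.ofReal_mul, mul_inv_cancel₀ hs.ne', Complex.ofReal_one, one_smul]
  rw [h1, h1, inner_smul_left, inner_smul_right, L.inner_map_map, Complex.conj_ofReal]
  ring

/-- The adjoint of a weighted composition operator is a multiple of its inverse. -/
lemma inner_mobOp {g h : Fin n → Matrix (Fin 2) (Fin 2) F} (hg : ∀ i, (g i).det ≠ 0)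
    (hh : ∀ i, (h i).det ≠ 0) {k : Fin n → F} (hk : ∀ i, k i ≠ 0)
    (hgh : ∀ i, h i * g i = k i • (1 : Matrix (Fin 2) (Fin 2) F)) (φ ψ : HSpace n μ) :
    inner ℂ (mobOp μ l g φ) ψ = (mobScale g : ℂ) ^ 2 *
      ((∏ i, npow (k i) (l i))⁻¹ * inner ℂ φ (mobOp μ l h ψ)) := by
  have hne : ∏ i, npow (k i) (l i) ≠ 0 := Finset.prod_ne_zero_iff.2 fun i _ => npow_ne_zero (hk i) _
  have h1 : mobOp μ l g ((∏ i, npow (k i) (l i))⁻¹ • mobOp μ l h ψ) = ψ := by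
    rw [map_smul, mobOp_mobOp μ hl hg hh]
    simp only [hgh]
    rw [mobOp_scalar μ hl hk, smul_smul, inv_mul_cancel₀ hne, one_smul]
  rw [← inner_smul_right, ← inner_mobOp_mobOp μ hl hg, h1]

end Moebius



/-! ### The two-parameter family of operators behind the Hecke operators -/

section Gauge

variable {F : Type*} [NontriviallyNormedField F] {n : ℕ}

@[simp] lemma gauge_zero (y : Fin n → F) : gauge y 0 = 0 := rfl

@[simp] lemma gauge_last (y : Fin n → F) : gauge y (Fin.last (n + 1)) = 1 := by
  rw [gauge, ← Fin.succ_last, Fin.cons_succ, Fin.snoc_last]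

@[simp] lemma gauge_mid (y : Fin n → F) (i : Fin n) : gauge y i.succ.castSucc = y i := by
  rw [gauge, ← Fin.succ_castSucc, Fin.cons_succ, Fin.snoc_castSucc]

lemma prod_gauge {M : Type*} [CommMonoid M] (f : Fin (n + 2) → M) :
    ∏ j, f j = f 0 * (∏ i : Fin n, f i.succ.castSucc) * f (Fin.last (n + 1)) := by
  rw [Fin.prod_univ_castSucc, Fin.prod_univ_succ]
  rfl

end Gauge

section TwoParameter

variable {F : Type*} [NontriviallyNormedField F] [ProperSpace F] [MeasurableSpace F] [BorelSpace F]
  (μ : Measure F) [μ.IsAddHaarMeasure] {n : ℕ} (t : Fin (n + 2) → F) (lam : Fin (n + 2) → ℂ)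
  (d : ℂ)

/-- The weights of the inner coordinates. -/
def midWeight (i : Fin n) : ℂ := lam i.succ.castSucc

/-- The translate `t j - t 0` of a ramification point. -/
def shiftPt (j : Fin (n + 2)) : F := t j - t 0

/-- The difference of the last and the first ramification point. -/
def gap : F := t (Fin.last (n + 1)) - t 0

/-- The translate of an inner ramification point. -/
def midPt (i : Fin n) : F := t i.succ.castSucc - t 0

/-- The function `y ↦ φ((y j - t j r) / (1 - y j ρ)) ∏ ‖1 - y j ρ‖ ^ (λ j)`, where the points `t j`
are translated so that `t 0 = 0`, and `φ` is extended to a homogeneous function of degree `d`. The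
integrands of the operators `H x`, `Q` and `R` all are of this form. -/
noncomputable def gFun (ρ r : F) (φ : (Fin n → F) → ℂ) (y : Fin n → F) : ℂ :=
  homExt d φ (fun j => (gauge y j - shiftPt t j * r) / (1 - gauge y j * ρ)) *
    ∏ j, npow (1 - gauge y j * ρ) (lam j)

/-- The matrices of `gFun` on the slice: the points `(y j - t j r) / (1 - y j ρ)` are rescaled so that
the last one, at `y = 1`, becomes `1`. -/
noncomputable def gMat (ρ r : F) (i : Fin n) : Matrix (Fin 2) (Fin 2) F :=
  !![(1 - ρ) / (1 - gap t * r), -(midPt t i * r) * ((1 - ρ) / (1 - gap t * r)); -ρ, 1]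

/-- The scalar factor of `gFun` on the slice: the homogeneity factor of the rescaling and the weight
of the last coordinate `y = 1`. -/
noncomputable def gCoef (ρ r : F) : ℂ :=
  npow ((1 - gap t * r) / (1 - ρ)) d * npow (1 - ρ) (lam (Fin.last (n + 1)))

/-- The operator with the kernel `gFun`. -/
noncomputable def gOp (ρ r : F) : HSpace n μ →L[ℂ] HSpace n μ :=
  gCoef t lam d ρ r • mobOp μ (midWeight lam) (gMat t ρ r)

lemma gFun_eq (ρ r : F) (φ : (Fin n → F) → ℂ) (y : Fin n → F) :
    gFun t lam d ρ r φ y = gCoef t lam d ρ r * mobFun (midWeight lam) (gMat t ρ r) φ y := by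
  have h1 : (fun i : Fin n => ((gauge y i.succ.castSucc - shiftPt t i.succ.castSucc * r) /
      (1 - gauge y i.succ.castSucc * ρ) - 0) / ((1 - gap t * r) / (1 - ρ) - 0)) =
      piMob (gMat t ρ r) y := by
    ext i
    simp only [gauge_mid, sub_zero, piMob, mobMap, mobDen, gMat, Matrix.of_apply, Matrix.cons_val',
      Matrix.cons_val_zero, Matrix.cons_val_one, Matrix.cons_val_fin_one]
    rw [div_div_eq_mul_div, mul_comm, ← mul_div_assoc, mul_comm, ← mul_div_assoc, ]
    rw [show -ρ * y i + 1 = 1 - y i * ρ by ring, shiftPt, midPt]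
    simp only [div_eq_mul_inv]
    ring
  have h0 : (gauge y 0 - shiftPt t 0 * r) / (1 - gauge y 0 * ρ) = 0 := by simp [shiftPt]
  have hl : (gauge y (Fin.last (n + 1)) - shiftPt t (Fin.last (n + 1)) * r) /
      (1 - gauge y (Fin.last (n + 1)) * ρ) = (1 - gap t * r) / (1 - ρ) := by
    simp [shiftPt, gap]
  rw [gFun, homExt, h0, hl, h1, prod_gauge, mobFun, gCoef]
  simp only [gauge_zero, gauge_last, gauge_mid, zero_mul, sub_zero, one_mul, npow_one]
  have h2 : ∀ i, npow (1 - y i * ρ) (lam i.succ.castSucc) =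
      npow (mobDen (gMat t ρ r i) (y i)) (midWeight lam i) := fun i => by
    simp only [mobDen, gMat, Matrix.of_apply, Matrix.cons_val', Matrix.cons_val_zero,
      Matrix.cons_val_one, Matrix.cons_val_fin_one, midWeight]
    ring_nf
  simp only [h2]
  ring

/-- The parameters for which the operator is invertible: the scalar factor and the matrices are
invertible. -/
def Good (ρ r : F) : Prop := 1 - ρ ≠ 0 ∧ 1 - gap t * r ≠ 0 ∧ ∀ i, 1 - midPt t i * (r * ρ) ≠ 0

variable {t}

lemma det_gMat (ρ r : F) (i : Fin n) : (gMat t ρ r i).det =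
    (1 - midPt t i * (r * ρ)) * ((1 - ρ) / (1 - gap t * r)) := by
  rw [gMat, Matrix.det_fin_two_of]
  ring

lemma Good.det_ne {ρ r : F} (h : Good t ρ r) (i : Fin n) : (gMat t ρ r i).det ≠ 0 := by
  rw [det_gMat]
  exact mul_ne_zero (h.2.2 i) (div_ne_zero h.1 h.2.1)

lemma good_zero_left {r : F} (h : 1 - gap t * r ≠ 0) : Good t 0 r := ⟨by simp, h, by simp⟩

lemma good_zero_right {ρ : F} (h : 1 - ρ ≠ 0) : Good t ρ 0 := ⟨h, by simp, by simp⟩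

variable {lam} (hlam : ∀ j, (lam j).re = -1)
include hlam

omit [ProperSpace F] [MeasurableSpace F] [BorelSpace F] in
lemma midWeight_re (i : Fin n) : (midWeight lam i).re = -1 := hlam _

lemma coeFn_gOp {ρ r : F} (h : Good t ρ r) {φ : HSpace n μ} {f : (Fin n → F) → ℂ}
    (hf : φ =ᵐ[Measure.pi fun _ : Fin n => μ] f) :
    gOp μ t lam d ρ r φ =ᵐ[Measure.pi fun _ : Fin n => μ] gFun t lam d ρ r f := by
  have h1 := coeFn_mobOp' μ (midWeight_re hlam) h.det_ne hf
  have h2 := Lp.coeFn_smul (gCoef t lam d ρ r) (mobOp μ (midWeight lam) (gMat t ρ r) φ)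
  filter_upwards [h1, h2] with y hy hy'
  rw [gFun_eq]
  refine hy'.trans ?_
  rw [Pi.smul_apply, smul_eq_mul, hy]

omit hlam in
lemma mobScale_gMat {ρ r : F} :
    mobScale (gMat t ρ r) = nrm ((1 - ρ) / (1 - gap t * r)) ^ (-(n / 2) : ℝ) *
      ∏ i, nrm (1 - midPt t i * (r * ρ)) ^ (-(1 / 2) : ℝ) := by
  simp only [mobScale, det_gMat, nrm_mul, Real.mul_rpow (nrm_nonneg _) (nrm_nonneg _)]
  rw [Finset.prod_mul_distrib, Finset.prod_const, Finset.card_univ, Fintype.card_fin, mul_comm,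
    ← Real.rpow_mul_natCast (nrm_nonneg _)]
  congr 2
  ring

variable {d} (hd : d.re = -((n + 1 : ℝ) / 2))
include hd

lemma norm_gOp {ρ r : F} (h : Good t ρ r) (φ : HSpace n μ) :
    ‖gOp μ t lam d ρ r φ‖ = nrm (1 - gap t * r) ^ (-(1 / 2) : ℝ) * nrm (1 - ρ) ^ (-(1 / 2) : ℝ) *
      (∏ i, nrm (1 - midPt t i * (r * ρ)) ^ (-(1 / 2) : ℝ)) * ‖φ‖ := by
  have h1 := nrm_pos h.1
  have h2 := nrm_pos h.2.1
  rw [gOp, smul_apply, norm_smul, norm_mobOp μ (midWeight_re hlam) h.det_ne,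
    mobScale_gMat, gCoef, norm_mul, norm_npow (div_ne_zero h.2.1 h.1), norm_npow h.1, hlam, hd,
    nrm_div, nrm_div, Real.div_rpow h2.le h1.le, Real.div_rpow h1.le h2.le]
  have e1 : nrm (1 - gap t * r) ^ (-((n + 1 : ℝ) / 2)) = nrm (1 - gap t * r) ^ (-(n / 2) : ℝ) *
      nrm (1 - gap t * r) ^ (-(1 / 2) : ℝ) := by rw [← Real.rpow_add h2]; ring_nf
  have e2 : nrm (1 - ρ) ^ (-1 : ℝ) * nrm (1 - ρ) ^ (-(n / 2) : ℝ) =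
      nrm (1 - ρ) ^ (-((n + 1 : ℝ) / 2)) * nrm (1 - ρ) ^ (-(1 / 2) : ℝ) := by
    rw [← Real.rpow_add h1, ← Real.rpow_add h1]; ring_nf
  have p1 := (Real.rpow_pos_of_pos h2 (-(n / 2) : ℝ)).ne'
  have p2 := (Real.rpow_pos_of_pos h1 (-((n + 1 : ℝ) / 2))).ne'
  rw [e1]
  generalize ∏ i, nrm (1 - midPt t i * (r * ρ)) ^ (-(1 / 2) : ℝ) = P
  field_simp
  linear_combination (P * ‖φ‖) * e2

omit hd in
/-- The operators depend strongly continuously on the two parameters. -/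
lemma tendsto_gOp {ι : Type*} {𝓕 : Filter ι} [𝓕.IsCountablyGenerated] {ρ r : ι → F} {ρ₀ r₀ : F}
    (hρ : Tendsto ρ 𝓕 (𝓝 ρ₀)) (hr : Tendsto r 𝓕 (𝓝 r₀)) (h : Good t ρ₀ r₀) (φ : HSpace n μ) :
    Tendsto (fun j => gOp μ t lam d (ρ j) (r j) φ) 𝓕 (𝓝 (gOp μ t lam d ρ₀ r₀ φ)) := by
  have h1 : Tendsto (fun j => 1 - ρ j) 𝓕 (𝓝 (1 - ρ₀)) := hρ.const_sub 1
  have h2 : Tendsto (fun j => 1 - gap t * r j) 𝓕 (𝓝 (1 - gap t * r₀)) :=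
    Tendsto.const_sub (1 : F) (hr.const_mul (gap t))
  have h0 : Tendsto (fun j => gCoef t lam d (ρ j) (r j)) 𝓕 (𝓝 (gCoef t lam d ρ₀ r₀)) := by
    refine Tendsto.mul ?_ ?_
    · exact (continuousAt_npow (div_ne_zero h.2.1 h.1) d).tendsto.comp (h2.div h1 h.1)
    · exact (continuousAt_npow h.1 _).tendsto.comp h1
  refine h0.smul (tendsto_mobOp μ (midWeight_re hlam) ?_ h.det_ne φ)
  · intro i a b
    have h3 : Tendsto (fun j => (1 - ρ j) / (1 - gap t * r j)) 𝓕
        (𝓝 ((1 - ρ₀) / (1 - gap t * r₀))) := h1.div h2 h.2.1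
    fin_cases a <;> fin_cases b
    · simpa [gMat] using h3
    · simpa [gMat] using (hr.const_mul (midPt t i)).neg.mul h3
    · simpa [gMat] using hρ.neg
    · simpa [gMat] using tendsto_const_nhds

end TwoParameter

section Representations

variable {F : Type*} [NontriviallyNormedField F] [ProperSpace F] [MeasurableSpace F] [BorelSpace F]
  (μ : Measure F) [μ.IsAddHaarMeasure] {n : ℕ} (t : Fin (n + 2) → F) (lam : Fin (n + 2) → ℂ)
  {d : ℂ}

/-- The unitary representation of the multiplicative group behind the operator `Q`. -/
noncomputable def repQ (w : F) : HSpace n μ →L[ℂ] HSpace n μ :=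
  npow w (-(n / 2)) • mobOp μ (midWeight lam) (gMat t 0 ((1 - w) / gap t))

/-- The unitary representation of the multiplicative group behind the operator `R`. -/
noncomputable def repR (w : F) : HSpace n μ →L[ℂ] HSpace n μ :=
  npow w (n / 2) • mobOp μ (midWeight lam) (gMat t (1 - w) 0)

variable {t lam} (hlam : ∀ j, (lam j).re = -1)

lemma gMat_repQ (hgap : gap t ≠ 0) (w : F) (i : Fin n) : gMat t 0 ((1 - w) / gap t) i =
    !![w⁻¹, -(midPt t i / gap t * (1 - w)) * w⁻¹; 0, 1] := by
  rw [gMat, mul_div_cancel₀ _ hgap, sub_sub_cancel, sub_zero, one_div, neg_zero]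
  congr 3
  simp only [div_eq_mul_inv]
  ring_nf

lemma gMat_repR (w : F) (i : Fin n) : gMat t (1 - w) 0 i = !![w, 0; -(1 - w), 1] := by
  simp [gMat]

lemma gOp_zero_left (hgap : gap t ≠ 0) {w : F} (hw : w ≠ 0) :
    gOp μ t lam d 0 ((1 - w) / gap t) = npow w (d + n / 2) • repQ μ t lam w := by
  rw [gOp, repQ, smul_smul, ← npow_add hw, gCoef, mul_div_cancel₀ _ hgap, sub_sub_cancel, sub_zero,
    div_one, npow_one, mul_one]
  congr 2
  ring

lemma gOp_zero_right {w : F} (hw : w ≠ 0) : gOp μ t lam d (1 - w) 0 =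
    npow w (-d + lam (Fin.last (n + 1)) - n / 2) • repR μ t lam w := by
  rw [gOp, repR, smul_smul, ← npow_add hw, gCoef, mul_zero, sub_zero, sub_sub_cancel, one_div,
    npow_inv, ← npow_neg, ← npow_add hw]
  congr 2
  ring

include hlam

lemma isUnitaryRep_repQ (hgap : gap t ≠ 0) : IsUnitaryRep (repQ μ t lam) where
  one φ := by
    have h : gMat t 0 ((1 - 1) / gap t) = fun _ => (1 : Matrix (Fin 2) (Fin 2) F) := by
      ext1 i
      rw [gMat_repQ hgap]
      simp [Matrix.one_fin_two]
    rw [repQ, h, npow_one, one_smul, mobOp_one μ (midWeight_re hlam)]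
  mul x y hx hy φ := by
    have hdet : ∀ w : F, w ≠ 0 → ∀ i, (gMat t 0 ((1 - w) / gap t) i).det ≠ 0 := fun w hw i => by
      simpa [gMat_repQ hgap, Matrix.det_fin_two_of] using hw
    simp only [repQ, smul_apply, map_smul]
    rw [mobOp_mobOp μ (midWeight_re hlam) (hdet x hx) (hdet y hy), smul_smul]
    have h : (fun i => gMat t 0 ((1 - y) / gap t) i * gMat t 0 ((1 - x) / gap t) i) =
        gMat t 0 ((1 - x * y) / gap t) := by
      ext1 i
      rw [gMat_repQ hgap, gMat_repQ hgap, gMat_repQ hgap, Matrix.mul_fin_two]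
      ext a b
      fin_cases a <;> fin_cases b <;> simp
      field_simp
      ring
    rw [h, npow_mul, mul_comm]
  norm w hw φ := by
    have hdet : ∀ i, (gMat t 0 ((1 - w) / gap t) i).det = w⁻¹ := fun i => by
      simp [gMat_repQ hgap, Matrix.det_fin_two_of]
    rw [repQ, smul_apply, norm_smul, norm_mobOp μ (midWeight_re hlam)
      (fun i => by rw [hdet]; exact inv_ne_zero hw), mobScale]
    simp only [hdet]
    have hp := nrm_pos hw
    have e1 : (-((n : ℂ) / 2)).re = -((n : ℝ) / 2) := by simp
    have e2 : (nrm w⁻¹ ^ (-(1 / 2) : ℝ)) ^ n = nrm w ^ ((n : ℝ) / 2) := by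
      rw [nrm_inv, Real.inv_rpow hp.le, Real.rpow_neg hp.le (1 / 2), inv_inv,
        ← Real.rpow_mul_natCast hp.le]
      ring_nf
    rw [Finset.prod_const, Finset.card_univ, Fintype.card_fin, norm_npow hw, e1, e2, ← mul_assoc,
      ← Real.rpow_add hp, neg_add_cancel, Real.rpow_zero, one_mul]
  cont φ := by
    intro w hw
    refine Tendsto.smul ((continuousAt_npow hw _).tendsto.mono_left nhdsWithin_le_nhds)
      (tendsto_mobOp μ (midWeight_re hlam) (fun i a b => ?_) (fun i => ?_) φ)
    · simp only [gMat_repQ hgap]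
      have h1 : Tendsto (fun w : F => w) (𝓝[{0}ᶜ] w) (𝓝 w) := tendsto_id.mono_left nhdsWithin_le_nhds
      have h2 := h1.inv₀ hw
      fin_cases a <;> fin_cases b
      · simpa using h2
      · simpa using (((h1.const_sub 1).const_mul (midPt t i / gap t)).neg.mul h2)
      · simpa using tendsto_const_nhds
      · simpa using tendsto_const_nhds
    · simpa [gMat_repQ hgap, Matrix.det_fin_two_of] using hw

lemma isUnitaryRep_repR : IsUnitaryRep (repR μ t lam) where
  one φ := by
    have h : gMat t (1 - 1) 0 = fun _ => (1 : Matrix (Fin 2) (Fin 2) F) := by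
      ext1 i
      rw [gMat_repR]
      simp [Matrix.one_fin_two]
    rw [repR, h, npow_one, one_smul, mobOp_one μ (midWeight_re hlam)]
  mul x y hx hy φ := by
    have hdet : ∀ w : F, w ≠ 0 → ∀ i, (gMat t (1 - w) 0 i).det ≠ 0 := fun w hw i => by
      simpa [gMat_repR, Matrix.det_fin_two_of] using hw
    simp only [repR, smul_apply, map_smul]
    rw [mobOp_mobOp μ (midWeight_re hlam) (hdet x hx) (hdet y hy), smul_smul]
    have h : (fun i => gMat t (1 - y) 0 i * gMat t (1 - x) 0 i) = gMat t (1 - x * y) 0 := by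
      ext1 i
      rw [gMat_repR, gMat_repR, gMat_repR, Matrix.mul_fin_two]
      ext a b
      fin_cases a <;> fin_cases b <;> simp
      · ring
      · ring
    rw [h, npow_mul, mul_comm]
  norm w hw φ := by
    have hdet : ∀ i, (gMat t (1 - w) 0 i).det = w := fun i => by
      simp [gMat_repR, Matrix.det_fin_two_of]
    rw [repR, smul_apply, norm_smul, norm_mobOp μ (midWeight_re hlam)
      (fun i => by rw [hdet]; exact hw), mobScale]
    simp only [hdet]
    have hp := nrm_pos hw
    have e1 : ((n : ℂ) / 2).re = (n : ℝ) / 2 := by simp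
    have e2 : (nrm w ^ (-(1 / 2) : ℝ)) ^ n = nrm w ^ (-((n : ℝ) / 2)) := by
      rw [← Real.rpow_mul_natCast hp.le]
      ring_nf
    rw [Finset.prod_const, Finset.card_univ, Fintype.card_fin, norm_npow hw, e1, e2, ← mul_assoc,
      ← Real.rpow_add hp, add_neg_cancel, Real.rpow_zero, one_mul]
  cont φ := by
    intro w hw
    refine Tendsto.smul ((continuousAt_npow hw _).tendsto.mono_left nhdsWithin_le_nhds)
      (tendsto_mobOp μ (midWeight_re hlam) (fun i a b => ?_) (fun i => ?_) φ)
    · simp only [gMat_repR]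
      have h1 : Tendsto (fun w : F => w) (𝓝[{0}ᶜ] w) (𝓝 w) := tendsto_id.mono_left nhdsWithin_le_nhds
      fin_cases a <;> fin_cases b
      · simpa using h1
      · simpa using tendsto_const_nhds
      · simpa using (h1.const_sub 1).neg
      · simpa using tendsto_const_nhds
    · simpa [gMat_repR, Matrix.det_fin_two_of] using hw

end Representations



/-! ### Test vectors are Lipschitz vectors -/

section CloseToOne

open Asymptotics

variable {X E F : Type*} [NormedAddCommGroup E] {𝓕 : Filter X} {p : X → E}

lemma isBigO_mul_sub_one [NormedDivisionRing F] (hp : Tendsto p 𝓕 (𝓝 0)) {a b : X → F}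
    (ha : (fun q => a q - 1) =O[𝓕] p) (hb : (fun q => b q - 1) =O[𝓕] p) :
    (fun q => a q * b q - 1) =O[𝓕] p := by
  have h1 : (fun q => (a q - 1) * (b q - 1)) =O[𝓕] p := by
    have h2 := ((ha.trans_tendsto hp).isBigO_one ℝ).mul hb.norm_right
    simpa using h2
  refine ((h1.add ha).add hb).congr_left fun q => ?_
  noncomm_ring

lemma isBigO_inv_sub_one [NormedField F] (hp : Tendsto p 𝓕 (𝓝 0)) {a : X → F}
    (ha : (fun q => a q - 1) =O[𝓕] p) : (fun q => (a q)⁻¹ - 1) =O[𝓕] p := by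
  have h1 : Tendsto a 𝓕 (𝓝 1) := by
    simpa using (ha.trans_tendsto hp).add_const 1
  have h2 := h1.inv₀ one_ne_zero
  have h3 := (h2.isBigO_one ℝ).mul ha.norm_right.neg_left
  refine (h3.congr' ?_ (by simp)).of_norm_right
  filter_upwards [h1.eventually_ne one_ne_zero] with q hq
  field_simp
  ring

lemma isBigO_prod_sub_one [NormedField F] (hp : Tendsto p 𝓕 (𝓝 0)) {ι : Type*} (s : Finset ι)
    {a : ι → X → F} (ha : ∀ i, (fun q => a i q - 1) =O[𝓕] p) :
    (fun q => ∏ i ∈ s, a i q - 1) =O[𝓕] p := by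
  classical
  induction s using Finset.induction_on with
  | empty => simpa using isBigO_zero p 𝓕
  | insert i s hi ih =>
    simp only [Finset.prod_insert hi]
    exact isBigO_mul_sub_one hp (ha i) ih

lemma isBigO_npow_sub_one [NontriviallyNormedField F] [ProperSpace F] [MeasurableSpace F]
    [BorelSpace F] (hp : Tendsto p 𝓕 (𝓝 0)) {a : X → F}
    (ha : (fun q => a q - 1) =O[𝓕] p) (z : ℂ) : (fun q => npow (a q) z - 1) =O[𝓕] p := by
  obtain ⟨C, -, hC⟩ := norm_npow_sub_one_le (F := F) (norm_nonneg z)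
  refine IsBigO.trans (IsBigO.of_bound C ?_) ha
  have h1 : ∀ᶠ q in 𝓕, ‖a q - 1‖ < 1 / 2 := by
    have := (ha.trans_tendsto hp).norm
    rw [norm_zero] at this
    exact this.eventually_lt_const (by norm_num)
  filter_upwards [h1] with q hq using hC _ _ le_rfl hq.le

end CloseToOne

section Lipschitz

open Asymptotics Metric

variable {F : Type*} [NontriviallyNormedField F] [ProperSpace F] [MeasurableSpace F] [BorelSpace F]
  (μ : Measure F) [μ.IsAddHaarMeasure] {n : ℕ} {t : Fin (n + 2) → F} {lam : Fin (n + 2) → ℂ}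
  {d : ℂ}

omit [ProperSpace F] [MeasurableSpace F] [BorelSpace F] in
lemma mobMap_gMat (ρ r : F) (i : Fin n) (x : F) : mobMap (gMat t ρ r i) x =
    (x - midPt t i * r) * ((1 - ρ) / (1 - gap t * r)) * (1 - ρ * x)⁻¹ := by
  simp only [mobMap, mobDen, gMat, Matrix.of_apply, Matrix.cons_val',
    Matrix.cons_val_zero, Matrix.cons_val_one, Matrix.cons_val_fin_one]
  rw [div_eq_mul_inv]
  congr 1
  · ring
  · congr 1
    ring

omit [ProperSpace F] [MeasurableSpace F] [BorelSpace F] in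
lemma mobDen_gMat (ρ r : F) (i : Fin n) (x : F) : mobDen (gMat t ρ r i) x = 1 - ρ * x := by
  simp only [mobDen, gMat, Matrix.of_apply, Matrix.cons_val',
    Matrix.cons_val_zero, Matrix.cons_val_one, Matrix.cons_val_fin_one]
  ring

/-- For a Lipschitz function, `gFun` differs from the function by at most a multiple of the
parameters, uniformly on balls. -/
lemma isBigO_gFun_sub {f : (Fin n → F) → ℂ} (hf : IsTest f) (R : ℝ) :
    (fun q : (F × F) × (Fin n → F) => gFun t lam d q.1.1 q.1.2 f q.2 - f q.2)
      =O[𝓝 0 ×ˢ 𝓟 (closedBall 0 R)] fun q => q.1 := by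
  set 𝓕 : Filter ((F × F) × (Fin n → F)) := 𝓝 0 ×ˢ 𝓟 (closedBall 0 R) with h𝓕
  have hp : Tendsto (fun q : (F × F) × (Fin n → F) => q.1) 𝓕 (𝓝 0) := tendsto_fst
  have hy : ∀ i, (fun q : (F × F) × (Fin n → F) => q.2 i) =O[𝓕] fun _ => (1 : ℝ) := fun i => by
    refine IsBigO.of_bound R ?_
    have h1 : ∀ᶠ q : (F × F) × (Fin n → F) in 𝓕, q.2 ∈ closedBall (0 : Fin n → F) R :=
      tendsto_snd.eventually (eventually_principal.2 fun y hy => hy)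
    filter_upwards [h1] with q hq
    rw [mem_closedBall_zero_iff] at hq
    simpa using (norm_le_pi_norm q.2 i).trans hq
  have hρ : (fun q : (F × F) × (Fin n → F) => q.1.1) =O[𝓕] fun q => q.1 :=
    IsBigO.of_bound 1 (Eventually.of_forall fun q => by simpa using norm_fst_le q.1)
  have hr : (fun q : (F × F) × (Fin n → F) => q.1.2) =O[𝓕] fun q => q.1 :=
    IsBigO.of_bound 1 (Eventually.of_forall fun q => by simpa using norm_snd_le q.1)
  have h1 : (fun q : (F × F) × (Fin n → F) => (1 - q.1.1) - 1) =O[𝓕] fun q => q.1 :=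
    hρ.neg_left.congr_left fun q => by ring
  have h2 : (fun q : (F × F) × (Fin n → F) => (1 - gap t * q.1.2) - 1) =O[𝓕] fun q => q.1 :=
    (hr.const_mul_left (-gap t)).congr_left fun q => by ring
  have h3 : ∀ i, (fun q : (F × F) × (Fin n → F) => (1 - q.1.1 * q.2 i) - 1) =O[𝓕] fun q => q.1 :=
    fun i => by
      have := (hρ.norm_right.mul (hy i)).neg_left
      simp only [mul_one] at this
      exact this.of_norm_right.congr_left fun q => by ring
  have hcoef : (fun q : (F × F) × (Fin n → F) => gCoef t lam d q.1.1 q.1.2 *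
      ∏ i, npow (1 - q.1.1 * q.2 i) (midWeight lam i) - 1) =O[𝓕] fun q => q.1 := by
    refine isBigO_mul_sub_one hp (isBigO_mul_sub_one hp ?_ ?_)
      (isBigO_prod_sub_one hp _ fun i => isBigO_npow_sub_one hp (h3 i) _)
    · simp only [div_eq_mul_inv]
      exact isBigO_npow_sub_one hp (isBigO_mul_sub_one hp h2 (isBigO_inv_sub_one hp h1)) _
    · exact isBigO_npow_sub_one hp h1 _
  have hM : (fun q : (F × F) × (Fin n → F) => piMob (gMat t q.1.1 q.1.2) q.2 - q.2)
      =O[𝓕] fun q => q.1 := by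
    rw [isBigO_pi]
    intro i
    have h4 : (fun q : (F × F) × (Fin n → F) =>
        ((1 - q.1.1) / (1 - gap t * q.1.2)) * (1 - q.1.1 * q.2 i)⁻¹ - 1) =O[𝓕] fun q => q.1 := by
      simp only [div_eq_mul_inv]
      exact isBigO_mul_sub_one hp (isBigO_mul_sub_one hp h1 (isBigO_inv_sub_one hp h2))
        (isBigO_inv_sub_one hp (h3 i))
    have h5 := (hy i).mul h4.norm_right
    simp only [one_mul] at h5
    have h6 : (fun q : (F × F) × (Fin n → F) =>
        ((1 - q.1.1) / (1 - gap t * q.1.2)) * (1 - q.1.1 * q.2 i)⁻¹) =O[𝓕] fun _ => (1 : ℝ) := by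
      have : Tendsto (fun q : (F × F) × (Fin n → F) =>
        ((1 - q.1.1) / (1 - gap t * q.1.2)) * (1 - q.1.1 * q.2 i)⁻¹) 𝓕 (𝓝 1) := by
        simpa using (h4.trans_tendsto hp).add_const 1
      exact this.isBigO_one ℝ
    have h7 := ((hr.const_mul_left (midPt t i)).norm_right.mul h6)
    simp only [mul_one] at h7
    refine (h5.of_norm_right.sub h7.of_norm_right).congr_left fun q => ?_
    rw [Pi.sub_apply, piMob, mobMap_gMat]
    ring
  obtain ⟨⟨K, hK⟩, hs⟩ := hf
  have hfM : (fun q : (F × F) × (Fin n → F) => f (piMob (gMat t q.1.1 q.1.2) q.2) - f q.2)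
      =O[𝓕] fun q => q.1 :=
    IsBigO.trans (IsBigO.of_bound K (Eventually.of_forall fun q => by
      simpa [dist_eq_norm] using hK.dist_le_mul (piMob (gMat t q.1.1 q.1.2) q.2) q.2)) hM
  obtain ⟨B, hB⟩ := hs.exists_bound_of_continuous hK.continuous
  have hfB : ∀ g : (F × F) × (Fin n → F) → Fin n → F, (fun q => f (g q)) =O[𝓕] fun _ => (1 : ℝ) :=
    fun g => IsBigO.of_bound B (Eventually.of_forall fun q => by simpa using hB (g q))
  have h8 := (hcoef.norm_right.mul (hfB fun q => piMob (gMat t q.1.1 q.1.2) q.2))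
  simp only [mul_one] at h8
  refine (h8.of_norm_right.add hfM).congr_left fun q => ?_
  rw [gFun_eq, mobFun]
  simp only [mobDen_gMat]
  ring

/-- Outside a fixed ball, `gFun` of a compactly supported function vanishes for small
parameters. -/
lemma exists_gFun_eq_zero (hlam : ∀ j, (lam j).re = -1) {f : (Fin n → F) → ℂ} (hf : IsTest f) :
    ∃ R : ℝ, (∀ y ∉ closedBall (0 : Fin n → F) R, f y = 0) ∧
      ∀ᶠ q : F × F in 𝓝 0, ∀ y ∉ closedBall (0 : Fin n → F) R, gFun t lam d q.1 q.2 f y = 0 := by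
  obtain ⟨R, hR0, hR⟩ : ∃ R : ℝ, 0 < R ∧ ∀ y ∉ closedBall (0 : Fin n → F) R, f y = 0 := by
    obtain ⟨R, hR0, hR⟩ := hf.2.isBounded.subset_closedBall_lt 0 0
    exact ⟨R, hR0, fun y hy => image_eq_zero_of_notMem_tsupport fun h => hy (hR h)⟩
  -- for small parameters the inner coordinates `v` of the argument satisfy
  -- `‖v‖ ≥ (‖y i‖ - 1) / (2 (1 + ‖y i‖ / (4 R)))`, which exceeds `R` for `‖y i‖ > 4 R + 2`
  refine ⟨4 * R + 2, fun y hy => hR y fun h => hy (closedBall_subset_closedBall (by linarith) h), ?_⟩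
  have h1 : ∀ᶠ q : F × F in 𝓝 0, ‖(1 - q.1) / (1 - gap t * q.2)‖ > 1 / 2 := by
    have : Tendsto (fun q : F × F => ‖(1 - q.1) / (1 - gap t * q.2)‖) (𝓝 0) (𝓝 1) := by
      have h : ContinuousAt (fun q : F × F => ‖(1 - q.1) / (1 - gap t * q.2)‖) 0 := by
        refine ContinuousAt.norm (ContinuousAt.div (by fun_prop) (by fun_prop) (by simp))
      simpa [ContinuousAt] using h
    exact this.eventually_const_lt (by norm_num)
  have h2 : ∀ᶠ q : F × F in 𝓝 0, ∀ i, ‖midPt t i * q.2‖ < 1 := by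
    rw [eventually_all]
    intro i
    have : Tendsto (fun q : F × F => ‖midPt t i * q.2‖) (𝓝 0) (𝓝 0) := by
      have h : ContinuousAt (fun q : F × F => ‖midPt t i * q.2‖) 0 := by fun_prop
      simpa [ContinuousAt] using h
    exact this.eventually_lt_const (by norm_num)
  have h3 : ∀ᶠ q : F × F in 𝓝 0, ‖q.1‖ < 1 / (4 * R) := by
    have : Tendsto (fun q : F × F => ‖q.1‖) (𝓝 0) (𝓝 0) := by
      have h : ContinuousAt (fun q : F × F => ‖q.1‖) 0 := by fun_prop
      simpa [ContinuousAt] using h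
    exact this.eventually_lt_const (by positivity)
  filter_upwards [h1, h2, h3] with q hq1 hq2 hq3 y hy
  obtain ⟨i, hi⟩ : ∃ i, 4 * R + 2 < ‖y i‖ := by
    by_contra! h
    exact hy (mem_closedBall_zero_iff.2 ((pi_norm_le_iff_of_nonneg (by linarith)).2 h))
  rw [gFun_eq, mobFun]
  by_cases h0 : 1 - q.1 * y i = 0
  · have : ∏ i, npow (mobDen (gMat t q.1 q.2 i) (y i)) (midWeight lam i) = 0 := by
      refine Finset.prod_eq_zero (Finset.mem_univ i) ?_
      rw [mobDen_gMat, h0, npow_zero_base]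
      intro h
      have := midWeight_re hlam i
      rw [h] at this
      norm_num at this
    rw [this, zero_mul, mul_zero]
  · rw [hR _ fun h => ?_, mul_zero, mul_zero]
    rw [mem_closedBall_zero_iff] at h
    have h4 := (norm_le_pi_norm _ i).trans h
    rw [piMob, mobMap_gMat, norm_mul, norm_mul, norm_inv] at h4
    have h5 : 0 < ‖1 - q.1 * y i‖ := norm_pos_iff.2 h0
    rw [← div_eq_mul_inv, div_le_iff₀ h5] at h4
    have h6 : ‖1 - q.1 * y i‖ ≤ 1 + 1 / (4 * R) * ‖y i‖ := by
      refine (norm_sub_le _ _).trans ?_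
      rw [norm_one, norm_mul]
      gcongr
    have h7 : ‖y i‖ - 1 ≤ ‖y i - midPt t i * q.2‖ := by
      have := norm_sub_norm_le (y i) (midPt t i * q.2)
      linarith [hq2 i]
    have h8 : (‖y i‖ - 1) * (1 / 2) ≤ R * (1 + 1 / (4 * R) * ‖y i‖) := by
      refine le_trans ?_ (h4.trans (by gcongr))
      have : 0 ≤ ‖y i‖ - 1 := by linarith
      gcongr
    have h9 : R * (1 + 1 / (4 * R) * ‖y i‖) = R + ‖y i‖ / 4 := by field_simp
    linarith

/-- The orbit maps of test functions under the two-parameter family are Lipschitz at the origin. -/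
lemma exists_norm_gOp_sub_le (hlam : ∀ j, (lam j).re = -1) {φ : HSpace n μ}
    (hφ : φ ∈ testSpace n μ) :
    ∃ C η : ℝ, 0 ≤ C ∧ 0 < η ∧ ∀ ρ r : F, ‖ρ‖ ≤ η → ‖r‖ ≤ η → Good t ρ r →
      ‖gOp μ t lam d ρ r φ - φ‖ ≤ C * (‖ρ‖ + ‖r‖) := by
  obtain ⟨f, hf, hφf⟩ := hφ
  obtain ⟨R, hR, hR'⟩ := exists_gFun_eq_zero (t := t) (lam := lam) (d := d) hlam hf
  obtain ⟨C, hC0, hC⟩ := (isBigO_gFun_sub (t := t) (lam := lam) (d := d) hf R).exists_pos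
  have hC := hC.bound
  rw [eventually_prod_principal_iff] at hC
  obtain ⟨η, hη, hball⟩ := Metric.eventually_nhds_iff.1 (hC.and hR')
  set V := (Measure.pi fun _ : Fin n => μ).real (closedBall 0 R) ^ (1 / (2 : ℝ≥0∞).toReal)
  refine ⟨C * V, η / 2, by positivity, by positivity, fun ρ r hρ hr hgood => ?_⟩
  have hd : dist ((ρ, r) : F × F) 0 < η := by
    rw [dist_zero_right, Prod.norm_def]
    exact max_lt (by linarith) (by linarith)
  obtain ⟨h1, h2⟩ := hball hd
  have hfin : (Measure.pi fun _ : Fin n => μ) (closedBall 0 R) ≠ ∞ :=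
    (isCompact_closedBall _ _).measure_lt_top.ne
  have h3 : ‖gOp μ t lam d ρ r φ - φ‖ ≤ ‖indicatorConstLp 2 (measurableSet_closedBall (x := 0) (ε := R))
      hfin (C * (‖ρ‖ + ‖r‖) : ℝ)‖ := by
    refine Lp.norm_le_norm_of_ae_le ?_
    filter_upwards [Lp.coeFn_sub (gOp μ t lam d ρ r φ) φ, coeFn_gOp μ d hlam hgood hφf, hφf,
      indicatorConstLp_coeFn (p := 2) (hs := measurableSet_closedBall (x := 0) (ε := R))
        (hμs := hfin) (c := (C * (‖ρ‖ + ‖r‖) : ℝ))] with y hy1 hy2 hy3 hy4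
    rw [hy1, Pi.sub_apply, hy2, hy3, hy4]
    by_cases hy : y ∈ closedBall (0 : Fin n → F) R
    · rw [Set.indicator_of_mem hy]
      refine (h1 y hy).trans ((mul_le_mul_of_nonneg_left ?_ hC0.le).trans (le_abs_self _))
      rw [Prod.norm_def]
      exact max_le (by simp) (by simp)
    · rw [h2 y hy, hR y hy, sub_zero, norm_zero]
      exact norm_nonneg _
  refine h3.trans ?_
  rw [norm_indicatorConstLp (by norm_num) (by norm_num), Real.norm_of_nonneg (by positivity)]
  exact le_of_eq (by ring)

end Lipschitz



/-! ### Asymptotics of the integral of a two-parameter family -/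

section Asymptotics

variable {F : Type*} [NontriviallyNormedField F] [ProperSpace F] [MeasurableSpace F] [BorelSpace F]
  (μ : Measure F) [μ.IsAddHaarMeasure] {H : Type*} [NormedAddCommGroup H] [NormedSpace ℂ H]

omit [ProperSpace F] [MeasurableSpace F] [BorelSpace F] in
instance isCountablyGenerated_cobounded : (cobounded F).IsCountablyGenerated := by
  rw [← comap_norm_atTop]
  infer_instance

lemma tendsto_nrm_cobounded : Tendsto (nrm : F → ℝ) (cobounded F) atTop := by
  have h : (nrm : F → ℝ) = fun x => ‖x‖ ^ nrmExp F := funext nrm_eq_rpow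
  rw [h]
  exact (tendsto_rpow_atTop (nrmExp_pos F)).comp tendsto_norm_cobounded_atTop

lemma npow_neg_sub_one {p : F} (hp : p ≠ 0) (c : ℂ) :
    npow p (-c - 1) = (((nrm p)⁻¹ ^ 2 : ℝ) : ℂ) * npow p⁻¹ (c - 1) := by
  rw [npow_inv, ← npow_neg, show -c - 1 = -1 + -1 + -(c - 1) by ring, npow_add hp, npow_add hp,
    npow_neg_one]
  push_cast
  ring

lemma integral_npow_smul_inv (c : ℂ) (f : F → H) :
    ∫ p, npow p (-c - 1) • f p⁻¹ ∂μ = ∫ s, npow s (c - 1) • f s ∂μ := by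
  rw [← integral_inv μ fun s => npow s (c - 1) • f s]
  refine integral_congr_ae ?_
  filter_upwards [ae_ne μ 0] with p hp
  rw [npow_neg_sub_one hp, mul_smul]
  exact Complex.coe_smul _ _

lemma integral_npow_smul_scale (c : ℂ) {x : F} (hx : x ≠ 0) (f : F → H) :
    npow x c • ∫ r, npow r (c - 1) • f (x * r) ∂μ = ∫ s, npow s (c - 1) • f s ∂μ := by
  have h := integral_mul_left μ hx fun s => npow s (c - 1) • f s
  have hn := (nrm_pos hx).ne'
  have h2 : npow x c = (nrm x : ℂ) * npow x (c - 1) := by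
    rw [npow_sub hx, npow_one_exp, mul_div_cancel₀ _ (by exact_mod_cast hn)]
  simp only [npow_mul, mul_smul] at h
  rw [integral_smul, eq_inv_smul_iff₀ hn, ← Complex.coe_smul, smul_smul, ← h2] at h
  exact h

lemma integrableOn_npow_annulus_one (b : F) (a : ℂ) :
    IntegrableOn (fun p : F => npow p (a - 1)) {p | 1 ≤ nrm p ∧ nrm p ≤ nrm b} μ := by
  have hc : IsCompact {p : F | 1 ≤ nrm p ∧ nrm p ≤ nrm b} :=
    (isCompact_nrm_le (nrm b)).inter_left (isClosed_le continuous_const continuous_nrm)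
  refine ContinuousOn.integrableOn_compact hc fun p hp => ?_
  exact (continuousAt_npow (ne_zero_of_one_le_nrm hp.1) _).continuousWithinAt

lemma setIntegral_npow_annulus_one {b : F} (hb : 1 ≤ nrm b) (a : ℂ) :
    ∫ p in {p : F | 1 ≤ nrm p ∧ nrm p ≤ nrm b}, npow p (a - 1) ∂μ =
      sphereVol μ + annInt μ b a := by
  have hS : MeasurableSet {p : F | nrm p = 1} :=
    measurableSet_eq_fun measurable_nrm measurable_const
  have hu : {p : F | 1 ≤ nrm p ∧ nrm p ≤ nrm b} =
      {p | nrm p = 1} ∪ {p | 1 < nrm p ∧ nrm p ≤ nrm b} := by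
    ext p
    simp only [Set.mem_ofPred_eq, Set.mem_union]
    constructor
    · rintro ⟨h1, h2⟩
      rcases h1.eq_or_lt with h | h
      · exact Or.inl h.symm
      · exact Or.inr ⟨h, h2⟩
    · rintro (h | h)
      · exact ⟨h.ge, h.le.trans hb⟩
      · exact ⟨h.1.le, h.2⟩
  have hi := integrableOn_npow_annulus_one μ b a
  rw [hu] at hi ⊢
  rw [setIntegral_union _ (measurableSet_annulus b) hi.left_of_union hi.right_of_union,
    integral_sphere, annInt]
  rw [Set.disjoint_left]
  rintro p h1 h2
  simp only [Set.mem_ofPred_eq] at h1 h2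
  linarith [h2.1]

lemma norm_add_smul_sub_le {z : ℂ} (hz : ‖z‖ = 1) (a b a' b' : H) :
    ‖a + z • b - (z • b' + a')‖ ≤ ‖a - a'‖ + ‖b - b'‖ := by
  rw [show a + z • b - (z • b' + a') = (a - a') + z • (b - b') by rw [smul_sub]; abel]
  refine (norm_add_le _ _).trans_eq ?_
  rw [norm_smul, hz, one_mul]

/-- The integral of `‖s‖ ^ (c - 1) v(1 / s, s / x)` splits, at `‖s‖ ^ 2 = ‖x‖`, into a part where the
second argument is small and, after the substitution `s = x r`, a part where the first argument is
small. Both have a limit, once the divergent multiple of `φ` is subtracted. -/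
theorem tendsto_integral_two_parameter [CompleteSpace H] {c : ℂ} (hc : c.re = 0) {κ : F}
    (hκ : κ ≠ 0) {η C : ℝ}
    (hη : 0 < η) {φ : H} {v : F → F → H}
    (hmR : ∀ᶠ x in cobounded F, AEStronglyMeasurable (fun p => v p (x⁻¹ * p⁻¹)) μ)
    (hmQ : ∀ᶠ x in cobounded F, AEStronglyMeasurable (fun r => v (x⁻¹ * r⁻¹) r) μ)
    (hint : ∀ᶠ x in cobounded F, Integrable (fun s => npow s (c - 1) • v s⁻¹ (x⁻¹ * s)) μ)
    (hbR : ∀ᶠ x in cobounded F, ∀ᵐ p ∂μ, nrm x⁻¹ ≤ nrm p ^ 2 →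
      ‖cutOff φ (fun p => v p (x⁻¹ * p⁻¹)) p‖ ≤ C * majorant 1 η p)
    (hbQ : ∀ᶠ x in cobounded F, ∀ᵐ r ∂μ, nrm x⁻¹ ≤ nrm r ^ 2 →
      ‖cutOff φ (fun r => v (x⁻¹ * r⁻¹) r) r‖ ≤ C * majorant κ η r)
    (hlR : ∀ᵐ p ∂μ, Tendsto (fun x => v p (x⁻¹ * p⁻¹)) (cobounded F) (𝓝 (v p 0)))
    (hlQ : ∀ᵐ r ∂μ, Tendsto (fun x => v (x⁻¹ * r⁻¹) r) (cobounded F) (𝓝 (v 0 r))) :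
    Tendsto (fun x => ∫ s, npow s (c - 1) • v s⁻¹ (x⁻¹ * s) ∂μ -
      (npow x c • ∫ r, npow r (c - 1) • cutOff φ (v 0) r ∂μ +
        ∫ p, npow p (-c - 1) • cutOff φ (fun p => v p 0) p ∂μ +
        (sphereVol μ + annInt μ x c) • φ)) (cobounded F) (𝓝 0) := by
  have hC : 0 ≤ |C| := abs_nonneg C
  have hle : ∀ (κ' p : F), C * majorant κ' η p ≤ |C| * majorant κ' η p := fun κ' p =>
    mul_le_mul_of_nonneg_right (le_abs_self C) (majorant_nonneg _ _ _)
  -- the two parts `‖s‖ ^ 2 ≤ ‖x‖` and `‖s‖ ^ 2 > ‖x‖`, in the variables `p = 1 / s` and `r = s / x`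
  set A : F → Set F := fun x => {p | nrm x⁻¹ ≤ nrm p ^ 2} with hA
  set B : F → Set F := fun x => {p | nrm x⁻¹ < nrm p ^ 2} with hB
  have hAm : ∀ x, MeasurableSet (A x) := fun x =>
    measurableSet_le measurable_const (measurable_nrm.pow_const 2)
  have hBm : ∀ x, MeasurableSet (B x) := fun x =>
    measurableSet_lt measurable_const (measurable_nrm.pow_const 2)
  have h0 : Tendsto (fun x : F => nrm x⁻¹) (cobounded F) (𝓝 0) := by
    simp only [nrm_inv]
    exact tendsto_inv_atTop_zero.comp tendsto_nrm_cobounded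
  have hev : ∀ p : F, p ≠ 0 → ∀ᶠ x in cobounded F, nrm x⁻¹ < nrm p ^ 2 := fun p hp =>
    h0.eventually_lt_const (pow_pos (nrm_pos hp) 2)
  -- the two limits
  have hR : Tendsto (fun x => ∫ p, npow p (-c - 1) •
      (A x).indicator (cutOff φ fun p => v p (x⁻¹ * p⁻¹)) p ∂μ) (cobounded F)
      (𝓝 (∫ p, npow p (-c - 1) • cutOff φ (fun p => v p 0) p ∂μ)) := by
    refine tendsto_integral_npow_smul μ one_ne_zero hη (C := |C|) tendsto_const_nhds
      (Eventually.of_forall fun _ => by simp [hc]) ?_ ?_ ?_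
    · filter_upwards [hmR] with x hx
      exact AEStronglyMeasurable.indicator (hx.sub ((stronglyMeasurable_const.indicator
        (measurableSet_nrm_le 1)).aestronglyMeasurable)) (hAm x)
    · filter_upwards [hbR] with x hx
      filter_upwards [hx] with p hp
      by_cases h : p ∈ A x
      · rw [Set.indicator_of_mem h]
        exact (hp h).trans (hle _ _)
      · rw [Set.indicator_of_notMem h, norm_zero]
        exact mul_nonneg hC (majorant_nonneg _ _ _)
    · filter_upwards [hlR, ae_ne μ 0] with p hp hp0
      refine (hp.sub_const _).congr' ?_
      filter_upwards [hev p hp0] with x hx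
      rw [Set.indicator_of_mem (show p ∈ A x from hx.le)]
      rfl
  have hQ : Tendsto (fun x => ∫ r, npow r (c - 1) •
      (B x).indicator (cutOff φ fun r => v (x⁻¹ * r⁻¹) r) r ∂μ) (cobounded F)
      (𝓝 (∫ r, npow r (c - 1) • cutOff φ (v 0) r ∂μ)) := by
    refine tendsto_integral_npow_smul μ hκ hη (C := |C|) tendsto_const_nhds
      (Eventually.of_forall fun _ => by simp [hc]) ?_ ?_ ?_
    · filter_upwards [hmQ] with x hx
      exact AEStronglyMeasurable.indicator (hx.sub ((stronglyMeasurable_const.indicator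
        (measurableSet_nrm_le 1)).aestronglyMeasurable)) (hBm x)
    · filter_upwards [hbQ] with x hx
      filter_upwards [hx] with p hp
      by_cases h : p ∈ B x
      · rw [Set.indicator_of_mem h]
        exact (hp (le_of_lt h)).trans (hle _ _)
      · rw [Set.indicator_of_notMem h, norm_zero]
        exact mul_nonneg hC (majorant_nonneg _ _ _)
    · filter_upwards [hlQ, ae_ne μ 0] with p hp hp0
      refine (hp.sub_const _).congr' ?_
      filter_upwards [hev p hp0] with x hx
      rw [Set.indicator_of_mem (show p ∈ B x from hx)]
      rfl
  -- the exact decomposition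
  have hdec : ∀ᶠ x in cobounded F, ∫ s, npow s (c - 1) • v s⁻¹ (x⁻¹ * s) ∂μ -
      (sphereVol μ + annInt μ x c) • φ =
      ∫ p, npow p (-c - 1) • (A x).indicator (cutOff φ fun p => v p (x⁻¹ * p⁻¹)) p ∂μ +
      npow x c • ∫ r, npow r (c - 1) •
        (B x).indicator (cutOff φ fun r => v (x⁻¹ * r⁻¹) r) r ∂μ := by
    filter_upwards [hint, tendsto_nrm_cobounded.eventually_ge_atTop 1] with x hi hx
    have hx0 := ne_zero_of_one_le_nrm hx
    have hxp := nrm_pos hx0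
    -- the constant `φ` is subtracted on the annulus `U`, which the cut at `D` divides into the two
    -- parts where `p`, respectively `r`, belongs to the unit ball
    set U : Set F := {s : F | 1 ≤ nrm s ∧ nrm s ≤ nrm x} with hU
    have hUm : MeasurableSet U := (measurableSet_le measurable_const measurable_nrm).inter
      (measurableSet_nrm_le _)
    set D : Set F := {s : F | nrm s ^ 2 ≤ nrm x} with hD
    have hDm : MeasurableSet D := measurableSet_le (measurable_nrm.pow_const 2) measurable_const
    set w : F → H := fun s => v s⁻¹ (x⁻¹ * s) - U.indicator (fun _ => φ) s with hw
    have hiU : Integrable (fun s => npow s (c - 1) • U.indicator (fun _ => φ) s) μ := by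
      have := (integrable_indicator_iff hUm).2
        ((integrableOn_npow_annulus_one μ x c).smul_const φ)
      refine this.congr (Eventually.of_forall fun p => ?_)
      by_cases h : p ∈ U <;> simp [h]
    have hIU : ∫ s, npow s (c - 1) • U.indicator (fun _ => φ) s ∂μ =
        (sphereVol μ + annInt μ x c) • φ := by
      rw [← setIntegral_npow_annulus_one μ hx, ← integral_smul_const, ← integral_indicator hUm]
      congr 1
      ext p
      by_cases h : p ∈ U <;> simp [h]
    have hiw : Integrable (fun s => npow s (c - 1) • w s) μ := by
      simp only [hw, smul_sub]
      exact hi.sub hiU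
    have e1 : ∫ s, npow s (c - 1) • v s⁻¹ (x⁻¹ * s) ∂μ - (sphereVol μ + annInt μ x c) • φ =
        ∫ s, npow s (c - 1) • w s ∂μ := by
      rw [← hIU, ← integral_sub hi hiU]
      simp only [hw, smul_sub]
    rw [e1, ← integral_add_compl hDm hiw, ← integral_indicator hDm, ← integral_indicator hDm.compl]
    congr 1
    · have e2 : (D.indicator fun s => npow s (c - 1) • w s) =
          fun s => npow s (c - 1) • D.indicator w s := by
        ext s
        by_cases h : s ∈ D <;> simp [h]
      rw [e2, ← integral_npow_smul_inv]
      refine integral_congr_ae ?_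
      filter_upwards [ae_ne μ 0] with p hp
      have hpp := nrm_pos hp
      have e3 : p⁻¹ ∈ D ↔ p ∈ A x := by
        simp only [hD, hA, Set.mem_ofPred_eq, nrm_inv]
        rw [inv_pow, inv_le_comm₀ (pow_pos hpp 2) hxp]
      by_cases h : p ∈ A x
      · rw [Set.indicator_of_mem h, Set.indicator_of_mem (e3.2 h)]
        simp only [hw, cutOff, inv_inv]
        congr 2
        have e4 : p⁻¹ ∈ U ↔ p ∈ {p : F | nrm p ≤ 1} := by
          have h5 : nrm p⁻¹ ^ 2 ≤ nrm x := e3.2 h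
          simp only [hU, Set.mem_ofPred_eq]
          constructor
          · rintro ⟨h6, -⟩
            rw [nrm_inv] at h6
            exact (one_le_inv₀ hpp).1 h6
          · intro h6
            have h7 : 1 ≤ nrm p⁻¹ := by rw [nrm_inv]; exact (one_le_inv₀ hpp).2 h6
            exact ⟨h7, by nlinarith⟩
        by_cases h6 : p ∈ {p : F | nrm p ≤ 1}
        · rw [Set.indicator_of_mem h6, Set.indicator_of_mem (e4.2 h6)]
        · rw [Set.indicator_of_notMem h6, Set.indicator_of_notMem fun h7 => h6 (e4.1 h7)]
      · rw [Set.indicator_of_notMem h, Set.indicator_of_notMem fun h7 => h (e3.1 h7)]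
    · have e2 : (Dᶜ.indicator fun s => npow s (c - 1) • w s) =
          fun s => npow s (c - 1) • Dᶜ.indicator w s := by
        ext s
        by_cases h : s ∈ D <;> simp [h]
      rw [e2, ← integral_npow_smul_scale μ c hx0]
      congr 1
      refine integral_congr_ae ?_
      filter_upwards [ae_ne μ 0] with r hr
      have hrp := nrm_pos hr
      have e3 : x * r ∈ Dᶜ ↔ r ∈ B x := by
        simp only [hD, hB, Set.mem_compl_iff, Set.mem_ofPred_eq, nrm_inv, nrm_mul, not_le]
        rw [inv_lt_iff_one_lt_mul₀ hxp, mul_comm (nrm r ^ 2), mul_pow, pow_two (nrm x),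
          mul_assoc]
        exact lt_mul_iff_one_lt_right hxp
      by_cases h : r ∈ B x
      · rw [Set.indicator_of_mem h, Set.indicator_of_mem (e3.2 h)]
        simp only [hw, cutOff, mul_inv, inv_mul_cancel_left₀ hx0]
        congr 2
        have e4 : x * r ∈ U ↔ r ∈ {p : F | nrm p ≤ 1} := by
          have h5 : nrm x < nrm (x * r) ^ 2 := by
            have := e3.2 h
            simpa only [hD, Set.mem_compl_iff, Set.mem_ofPred_eq, not_le] using this
          simp only [hU, Set.mem_ofPred_eq]
          have h7 : nrm (x * r) ≤ nrm x ↔ nrm r ≤ 1 := by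
            rw [nrm_mul]
            exact mul_le_iff_le_one_right hxp
          rw [h7]
          refine ⟨fun h => h.2, fun h => ⟨?_, h⟩⟩
          have := nrm_nonneg (x * r)
          nlinarith
        by_cases h6 : r ∈ {p : F | nrm p ≤ 1}
        · rw [Set.indicator_of_mem h6, Set.indicator_of_mem (e4.2 h6)]
        · rw [Set.indicator_of_notMem h6, Set.indicator_of_notMem fun h7 => h6 (e4.1 h7)]
      · rw [Set.indicator_of_notMem h, Set.indicator_of_notMem fun h7 => h (e3.1 h7)]
  have hfin := (hR.sub_const (∫ p, npow p (-c - 1) • cutOff φ (fun p => v p 0) p ∂μ)).norm.add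
    (hQ.sub_const (∫ r, npow r (c - 1) • cutOff φ (v 0) r ∂μ)).norm
  simp only [sub_self, norm_zero, add_zero] at hfin
  refine squeeze_zero_norm' ?_ hfin
  filter_upwards [hdec, tendsto_nrm_cobounded.eventually_ge_atTop 1] with x hx hx1
  rw [sub_add_eq_sub_sub_swap, hx]
  have hn : ‖npow x c‖ = 1 := norm_npow_imag (ne_zero_of_one_le_nrm hx1) hc
  exact norm_add_smul_sub_le hn _ _ _ _

end Asymptotics



/-! ### Estimates and measurability for the two-parameter family -/

section Family

variable {F : Type*} [NontriviallyNormedField F] [ProperSpace F] [MeasurableSpace F] [BorelSpace F]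
  (μ : Measure F) [μ.IsAddHaarMeasure] {n : ℕ} {t : Fin (n + 2) → F} {lam : Fin (n + 2) → ℂ}
  {d : ℂ}

lemma nrm_le_nrm_iff {x y : F} : nrm x ≤ nrm y ↔ ‖x‖ ≤ ‖y‖ := by
  rw [nrm_eq_rpow, nrm_eq_rpow,
    Real.rpow_le_rpow_iff (norm_nonneg _) (norm_nonneg _) (nrmExp_pos F)]

lemma ae_notMem_finite {T : Set F} (hT : T.Finite) : ∀ᵐ s ∂μ, s ∉ T :=
  measure_eq_zero_iff_ae_notMem.1 (hT.measure_zero μ)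

lemma isLipVector_of_npow_smul {H : Type*} [NormedAddCommGroup H] [InnerProductSpace ℂ H]
    {u : F → H →L[ℂ] H} {φ : H} {z : ℂ} {g : F → H} {C η : ℝ} (hC : 0 ≤ C) (hη : 0 < η)
    (hg : ∀ w, w ≠ 0 → ‖w - 1‖ ≤ η → ‖g w - φ‖ ≤ C * ‖w - 1‖)
    (hu : ∀ w, w ≠ 0 → u w φ = npow w z • g w) : IsLipVector u φ := by
  obtain ⟨D, hD, hD'⟩ := norm_npow_sub_one_le (F := F) (norm_nonneg z)
  refine ⟨(1 + D) * C + D * ‖φ‖, min η (1 / 2), by positivity, by positivity, fun w hw => ?_⟩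
  have hw2 := hw.trans (min_le_right _ _)
  have hw0 : w ≠ 0 := by
    rintro rfl
    rw [zero_sub, norm_neg, norm_one] at hw2
    norm_num at hw2
  have h1 := hD' w z le_rfl hw2
  have h2 : ‖npow w z‖ ≤ 1 + D := by
    have := norm_add_le (npow w z - 1) 1
    rw [sub_add_cancel, norm_one] at this
    have h3 : D * ‖w - 1‖ ≤ D * 1 := by gcongr; linarith
    linarith
  rw [hu w hw0, show npow w z • g w - φ = npow w z • (g w - φ) + (npow w z - 1) • φ by
    rw [smul_sub, sub_smul, one_smul]; abel]
  refine (norm_add_le _ _).trans ?_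
  rw [norm_smul, norm_smul]
  have h4 := hg w hw0 (hw.trans (min_le_left _ _))
  calc ‖npow w z‖ * ‖g w - φ‖ + ‖npow w z - 1‖ * ‖φ‖
      ≤ (1 + D) * (C * ‖w - 1‖) + D * ‖w - 1‖ * ‖φ‖ := by gcongr
    _ = ((1 + D) * C + D * ‖φ‖) * ‖w - 1‖ := by ring

variable (hlam : ∀ j, (lam j).re = -1)
include hlam

lemma isLipVector_repQ (hgap : gap t ≠ 0) {φ : HSpace n μ} (hφ : φ ∈ testSpace n μ) :
    IsLipVector (repQ μ t lam) φ := by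
  obtain ⟨C, η, hC, hη, h⟩ := exists_norm_gOp_sub_le μ (t := t) (d := 0) hlam hφ
  have hκ : 0 < ‖gap t‖ := norm_pos_iff.2 hgap
  refine isLipVector_of_npow_smul (z := -(0 + n / 2))
    (g := fun w => gOp μ t lam 0 0 ((1 - w) / gap t) φ) (C := C / ‖gap t‖) (η := η * ‖gap t‖)
    (by positivity) (by positivity) (fun w hw0 hw => ?_) fun w hw => ?_
  · have e : ‖(1 - w) / gap t‖ = ‖w - 1‖ / ‖gap t‖ := by rw [norm_div, norm_sub_rev]
    refine (h 0 _ (by simpa using hη.le) ?_ (good_zero_left ?_)).trans_eq ?_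
    · rw [e, div_le_iff₀ hκ]; exact hw
    · rw [mul_div_cancel₀ _ hgap, sub_sub_cancel]; exact hw0
    · rw [e, norm_zero, zero_add]; ring
  · rw [gOp_zero_left μ hgap hw, smul_apply, smul_smul, npow_neg,
      inv_mul_cancel₀ (npow_ne_zero hw _), one_smul]

lemma isLipVector_repR {φ : HSpace n μ} (hφ : φ ∈ testSpace n μ) :
    IsLipVector (repR μ t lam) φ := by
  obtain ⟨C, η, hC, hη, h⟩ := exists_norm_gOp_sub_le μ (t := t) (d := 0) hlam hφ
  refine isLipVector_of_npow_smul (z := -(-0 + lam (Fin.last (n + 1)) - n / 2))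
    (g := fun w => gOp μ t lam 0 (1 - w) 0 φ) hC hη (fun w hw0 hw => ?_) fun w hw => ?_
  · refine (h (1 - w) 0 (by rwa [norm_sub_rev]) (by simpa using hη.le)
      (good_zero_right (by simpa using hw0))).trans_eq ?_
    rw [norm_zero, add_zero, norm_sub_rev]
  · rw [gOp_zero_right μ hw, smul_apply, smul_smul, npow_neg,
      inv_mul_cancel₀ (npow_ne_zero hw _), one_smul]

lemma aesm_gOp {ρ r : F → F} {T : Set F} (hT : T.Finite) (hρ : ∀ s ∉ T, ContinuousAt ρ s)
    (hr : ∀ s ∉ T, ContinuousAt r s) (h : ∀ s ∉ T, Good t (ρ s) (r s)) (φ : HSpace n μ) :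
    AEStronglyMeasurable (fun s => gOp μ t lam d (ρ s) (r s) φ) μ := by
  have h1 : AEStronglyMeasurable (fun s => gOp μ t lam d (ρ s) (r s) φ) (μ.restrict Tᶜ) := by
    refine ContinuousOn.aestronglyMeasurable (fun s hs => ?_) hT.measurableSet.compl
    exact (tendsto_gOp μ hlam (hρ s hs) (hr s hs) (h s hs) φ).mono_left nhdsWithin_le_nhds
  rwa [Measure.restrict_eq_self_of_ae_mem] at h1
  exact ae_notMem_finite μ hT

omit hlam [ProperSpace F] [MeasurableSpace F] [BorelSpace F] in
lemma good_R {x p : F} (hm : ∀ i, midPt t i ≠ x) (hx : x ≠ 0)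
    (hp : p ∉ ({0, 1, gap t * x⁻¹} : Set F)) : Good t p (x⁻¹ * p⁻¹) := by
  simp only [Set.mem_insert_iff, Set.mem_singleton_iff, not_or] at hp
  refine ⟨sub_ne_zero.2 (Ne.symm hp.2.1), ?_, fun i => ?_⟩
  · rw [← mul_assoc, ← div_eq_mul_inv, one_sub_div hp.1]
    exact div_ne_zero (sub_ne_zero.2 hp.2.2) hp.1
  · rw [inv_mul_cancel_right₀ hp.1, ← div_eq_mul_inv, one_sub_div hx]
    exact div_ne_zero (sub_ne_zero.2 (hm i).symm) hx

omit hlam [ProperSpace F] [MeasurableSpace F] [BorelSpace F] in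
lemma good_Q {x r : F} (hm : ∀ i, midPt t i ≠ x) (hx : x ≠ 0)
    (hr : r ∉ ({0, x⁻¹, (gap t)⁻¹} : Set F)) : Good t (x⁻¹ * r⁻¹) r := by
  simp only [Set.mem_insert_iff, Set.mem_singleton_iff, not_or] at hr
  refine ⟨?_, ?_, fun i => ?_⟩
  · rw [← div_eq_mul_inv, one_sub_div hr.1]
    exact div_ne_zero (sub_ne_zero.2 hr.2.1) hr.1
  · intro h
    exact hr.2.2 (eq_inv_of_mul_eq_one_right (sub_eq_zero.1 h).symm)
  · rw [mul_comm x⁻¹, mul_inv_cancel_left₀ hr.1, ← div_eq_mul_inv, one_sub_div hx]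
    exact div_ne_zero (sub_ne_zero.2 (hm i).symm) hx

omit hlam [ProperSpace F] [MeasurableSpace F] [BorelSpace F] in
lemma good_S {x s : F} (hm : ∀ i, midPt t i ≠ x) (hx : x ≠ 0)
    (hs : s ∉ ({0, 1, x * (gap t)⁻¹} : Set F)) : Good t s⁻¹ (x⁻¹ * s) := by
  simp only [Set.mem_insert_iff, Set.mem_singleton_iff, not_or] at hs
  have h := good_R (t := t) (p := s⁻¹) hm hx (by
    simp only [Set.mem_insert_iff, Set.mem_singleton_iff, not_or]
    refine ⟨inv_ne_zero hs.1, fun h => hs.2.1 (inv_eq_one.1 h), fun h => hs.2.2 ?_⟩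
    rw [← inv_inv s, h, mul_inv, inv_inv, mul_comm])
  rwa [inv_inv] at h

lemma aesm_gOp_R {x : F} (hm : ∀ i, midPt t i ≠ x) (hx : x ≠ 0) (φ : HSpace n μ) :
    AEStronglyMeasurable (fun p => gOp μ t lam d p (x⁻¹ * p⁻¹) φ) μ := by
  refine aesm_gOp μ hlam (T := {0, 1, gap t * x⁻¹}) (Set.toFinite _) (fun s _ => continuousAt_id)
    (fun s hs => ?_) (fun s hs => good_R hm hx hs) φ
  simp only [Set.mem_insert_iff, Set.mem_singleton_iff, not_or] at hs
  exact continuousAt_const.mul (continuousAt_inv₀ hs.1)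

lemma aesm_gOp_Q {x : F} (hm : ∀ i, midPt t i ≠ x) (hx : x ≠ 0)
    (φ : HSpace n μ) :
    AEStronglyMeasurable (fun r => gOp μ t lam d (x⁻¹ * r⁻¹) r φ) μ := by
  refine aesm_gOp μ hlam (T := {0, x⁻¹, (gap t)⁻¹}) (Set.toFinite _) (fun s hs => ?_)
    (fun s _ => continuousAt_id) (fun s hs => good_Q hm hx hs) φ
  simp only [Set.mem_insert_iff, Set.mem_singleton_iff, not_or] at hs
  exact continuousAt_const.mul (continuousAt_inv₀ hs.1)

lemma aesm_gOp_S {x : F} (hm : ∀ i, midPt t i ≠ x) (hx : x ≠ 0)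
    (φ : HSpace n μ) :
    AEStronglyMeasurable (fun s => gOp μ t lam d s⁻¹ (x⁻¹ * s) φ) μ := by
  refine aesm_gOp μ hlam (T := {0, 1, x * (gap t)⁻¹}) (Set.toFinite _) (fun s hs => ?_)
    (fun s _ => continuousAt_const.mul continuousAt_id) (fun s hs => good_S hm hx hs) φ
  simp only [Set.mem_insert_iff, Set.mem_singleton_iff, not_or] at hs
  exact continuousAt_inv₀ hs.1

omit hlam

omit [MeasurableSpace F] [BorelSpace F] in
lemma tendsto_inv_cobounded : Tendsto (fun x : F => x⁻¹) (cobounded F) (𝓝 0) :=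
  tendsto_inv₀_cobounded

lemma tendsto_prod_mid : Tendsto (fun x : F => ∏ i, nrm (1 - midPt t i * x⁻¹) ^ (-(1 / 2) : ℝ))
    (cobounded F) (𝓝 1) := by
  have h : ∀ i, Tendsto (fun x : F => nrm (1 - midPt t i * x⁻¹) ^ (-(1 / 2) : ℝ))
      (cobounded F) (𝓝 1) := fun i => by
    have h1 : Tendsto (fun x : F => 1 - midPt t i * x⁻¹) (cobounded F) (𝓝 (1 - midPt t i * 0)) :=
      Tendsto.const_sub (1 : F) (tendsto_inv_cobounded.const_mul (midPt t i))
    rw [mul_zero, sub_zero] at h1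
    have h2 := ((continuous_nrm.tendsto (1 : F)).comp h1).rpow_const (p := (-(1 / 2) : ℝ))
      (Or.inl (by simp))
    simpa using h2
  simpa using tendsto_finsetProd Finset.univ fun i _ => h i

lemma eventually_ne_midPt : ∀ᶠ x : F in cobounded F, x ≠ 0 ∧ ∀ i, midPt t i ≠ x := by
  have h : ∀ a : F, ∀ᶠ x : F in cobounded F, x ≠ a := fun a =>
    (tendsto_norm_cobounded_atTop.eventually_gt_atTop ‖a‖).mono fun x hx h => by
      rw [h] at hx; exact lt_irrefl _ hx
  exact (h 0).and (eventually_all.2 fun i => (h _).mono fun x hx => hx.symm)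

lemma exists_nrm_one_sub_rpow_le : ∃ δ : ℝ, 0 < δ ∧ ∀ u : F, ‖u‖ < δ →
    nrm (1 - u) ^ (-(1 / 2) : ℝ) ≤ 2 := by
  have h : Tendsto (fun u : F => nrm (1 - u) ^ (-(1 / 2) : ℝ)) (𝓝 0) (𝓝 1) := by
    have h1 : Tendsto (fun u : F => nrm (1 - u)) (𝓝 0) (𝓝 1) := by
      have h2 : Continuous fun u : F => nrm (1 - u) :=
        continuous_nrm.comp (continuous_const.sub continuous_id)
      simpa using h2.tendsto 0
    simpa using h1.rpow_const (p := (-(1 / 2) : ℝ)) (Or.inl one_ne_zero)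
  obtain ⟨δ, hδ, h'⟩ := Metric.eventually_nhds_iff.1 (h.eventually_lt_const one_lt_two)
  exact ⟨δ, hδ, fun u hu => (h' (by simpa using hu)).le⟩

lemma norm_inv_mul_inv_le {x p : F} (hp : p ≠ 0) (h : nrm x⁻¹ ≤ nrm p ^ 2) :
    ‖x⁻¹ * p⁻¹‖ ≤ ‖p‖ := by
  rw [← nrm_pow, nrm_le_nrm_iff, norm_pow] at h
  rw [norm_mul, norm_inv p, ← div_eq_mul_inv, div_le_iff₀ (norm_pos_iff.2 hp), ← pow_two]
  exact h

include hlam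
variable (hd : d.re = -((n + 1 : ℝ) / 2))
include hd

/-- The bounds that are needed for the asymptotics, on both sides. -/
lemma exists_norm_cutOff_gOp_le {φ : HSpace n μ} (hφ : φ ∈ testSpace n μ) :
    ∃ C η : ℝ, 0 < η ∧
      (∀ᶠ x in cobounded F, ∀ᵐ p ∂μ, nrm x⁻¹ ≤ nrm p ^ 2 →
        ‖cutOff φ (fun p => gOp μ t lam d p (x⁻¹ * p⁻¹) φ) p‖ ≤ C * majorant 1 η p) ∧
      (∀ᶠ x in cobounded F, ∀ᵐ r ∂μ, nrm x⁻¹ ≤ nrm r ^ 2 →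
        ‖cutOff φ (fun r => gOp μ t lam d (x⁻¹ * r⁻¹) r φ) r‖ ≤ C * majorant (gap t) η r) := by
  obtain ⟨C, η₀, hC, hη₀, hL⟩ := exists_norm_gOp_sub_le μ (t := t) (d := d) hlam hφ
  obtain ⟨δ, hδ, hδ'⟩ := exists_nrm_one_sub_rpow_le (F := F)
  set η := min η₀ 1 with hηdef
  have hη : 0 < η := by positivity
  have hη1 : η ≤ 1 := min_le_right _ _
  have hprod : ∀ᶠ x in cobounded F, ∏ i, nrm (1 - midPt t i * x⁻¹) ^ (-(1 / 2) : ℝ) ≤ 2 :=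
    (tendsto_prod_mid.eventually_lt_const one_lt_two).mono fun x hx => hx.le
  have hsmall : ∀ a : ℝ, ∀ᶠ x : F in cobounded F, a * ‖x⁻¹‖ < δ * η := fun a => by
    have := (tendsto_inv_cobounded (F := F)).norm.const_mul a
    rw [norm_zero, mul_zero] at this
    exact this.eventually_lt_const (by positivity)
  have hrp : ∀ u : F, 0 ≤ nrm u ^ (-(1 / 2) : ℝ) := fun u => Real.rpow_nonneg (nrm_nonneg _) _
  have hrp' : ∀ u : F, 0 ≤ nrm u ^ (-(3 / 4) : ℝ) := fun u => Real.rpow_nonneg (nrm_nonneg _) _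
  -- `2 C` bounds the Lipschitz part (both parameters are at most `‖p‖`), `4 ‖φ‖` the norm of the
  -- operator away from the origin, and `‖φ‖ / η` the subtracted constant there
  refine ⟨2 * C + 4 * ‖φ‖ + ‖φ‖ / η, η, hη, ?_, ?_⟩
  · filter_upwards [hprod, hsmall ‖gap t‖, eventually_ne_midPt (t := t)] with x hx1 hx2 hx3
    filter_upwards [ae_notMem_finite μ (T := {0, 1, gap t * x⁻¹}) (Set.toFinite _)] with p hp hxp
    have hgood := good_R hx3.2 hx3.1 hp
    simp only [Set.mem_insert_iff, Set.mem_singleton_iff, not_or] at hp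
    refine norm_cutOff_le hη hη1 (by positivity) (by positivity) (fun h => ?_) (fun h => ?_)
    · have h1 := norm_inv_mul_inv_le hp.1 hxp
      have h2 := h.trans (min_le_left _ _)
      refine (hL p _ h2 (h1.trans h2) hgood).trans ?_
      rw [mul_comm 2 C, mul_assoc]
      gcongr
      linarith
    · rw [norm_gOp μ hlam hd hgood, one_mul]
      have h1 : nrm (1 - gap t * (x⁻¹ * p⁻¹)) ^ (-(1 / 2) : ℝ) ≤ 2 := by
        refine hδ' _ ?_
        rw [← mul_assoc, norm_mul, norm_mul, norm_inv p, ← div_eq_mul_inv,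
          div_lt_iff₀ (hη.trans h)]
        exact hx2.trans (by gcongr)
      have h2 : ∀ i, midPt t i * (x⁻¹ * p⁻¹ * p) = midPt t i * x⁻¹ := fun i => by
        rw [inv_mul_cancel_right₀ hp.1]
      simp only [h2]
      have h3 := hrp (1 - p)
      have h5 : 0 ≤ ∏ i, nrm (1 - midPt t i * x⁻¹) ^ (-(1 / 2) : ℝ) :=
        Finset.prod_nonneg fun i _ => hrp _
      calc nrm (1 - gap t * (x⁻¹ * p⁻¹)) ^ (-(1 / 2) : ℝ) * nrm (1 - p) ^ (-(1 / 2) : ℝ) *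
            (∏ i, nrm (1 - midPt t i * x⁻¹) ^ (-(1 / 2) : ℝ)) * ‖φ‖
          ≤ 2 * nrm (1 - p) ^ (-(1 / 2) : ℝ) * 2 * ‖φ‖ := by gcongr
        _ = 4 * ‖φ‖ * nrm (1 - p) ^ (-(1 / 2) : ℝ) := by ring
        _ ≤ _ := by
          gcongr
          exact le_add_of_nonneg_right (hrp' _)
  · filter_upwards [hprod, hsmall 1, eventually_ne_midPt (t := t)] with x hx1 hx2 hx3
    filter_upwards [ae_notMem_finite μ (T := {0, x⁻¹, (gap t)⁻¹}) (Set.toFinite _)] with p hp hxp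
    have hgood := good_Q hx3.2 hx3.1 hp
    simp only [Set.mem_insert_iff, Set.mem_singleton_iff, not_or] at hp
    refine norm_cutOff_le hη hη1 (by positivity) (by positivity) (fun h => ?_) (fun h => ?_)
    · have h1 := norm_inv_mul_inv_le hp.1 hxp
      have h2 := h.trans (min_le_left _ _)
      refine (hL _ p (h1.trans h2) h2 hgood).trans ?_
      rw [mul_comm 2 C, mul_assoc]
      gcongr
      linarith
    · rw [norm_gOp μ hlam hd hgood]
      have h1 : nrm (1 - x⁻¹ * p⁻¹) ^ (-(1 / 2) : ℝ) ≤ 2 := by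
        refine hδ' _ ?_
        rw [one_mul] at hx2
        rw [norm_mul, norm_inv p, ← div_eq_mul_inv, div_lt_iff₀ (hη.trans h)]
        exact hx2.trans (by gcongr)
      have h2 : ∀ i, midPt t i * (p * (x⁻¹ * p⁻¹)) = midPt t i * x⁻¹ := fun i => by
        rw [mul_comm x⁻¹, mul_inv_cancel_left₀ hp.1]
      simp only [h2]
      have h3 := hrp (1 - gap t * p)
      have h5 : 0 ≤ ∏ i, nrm (1 - midPt t i * x⁻¹) ^ (-(1 / 2) : ℝ) :=
        Finset.prod_nonneg fun i _ => hrp _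
      calc nrm (1 - gap t * p) ^ (-(1 / 2) : ℝ) * nrm (1 - x⁻¹ * p⁻¹) ^ (-(1 / 2) : ℝ) *
            (∏ i, nrm (1 - midPt t i * x⁻¹) ^ (-(1 / 2) : ℝ)) * ‖φ‖
          ≤ nrm (1 - gap t * p) ^ (-(1 / 2) : ℝ) * 2 * 2 * ‖φ‖ := by gcongr
        _ = 4 * ‖φ‖ * nrm (1 - gap t * p) ^ (-(1 / 2) : ℝ) := by ring
        _ ≤ _ := by
          gcongr
          exact le_add_of_nonneg_right (hrp' _)

/-- The kernel of the Hecke operator is integrable. -/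
lemma integrable_gOp_S (hgap : gap t ≠ 0) {x : F} (hm : ∀ i, midPt t i ≠ x) (hx : x ≠ 0)
    (hxg : x ≠ gap t) {c : ℂ} (hc : c.re = 0) :
    ∃ k : F → ℝ, Integrable k μ ∧ ∀ φ : HSpace n μ, ∀ᵐ s ∂μ,
      ‖npow s (c - 1) • gOp μ t lam d s⁻¹ (x⁻¹ * s) φ‖ ≤ k s * ‖φ‖ := by
  have hinj : Function.Injective ![(0 : F), 1, x * (gap t)⁻¹] := by
    have h1 : x * (gap t)⁻¹ ≠ 0 := mul_ne_zero hx (inv_ne_zero hgap)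
    have h2 : x * (gap t)⁻¹ ≠ 1 := fun h => hxg (by
      rw [← div_eq_mul_inv, div_eq_one_iff_eq hgap] at h; exact h)
    intro i j hij
    fin_cases i <;> fin_cases j <;> simp_all [eq_comm]
  have hi := integrable_prod_rpow μ hinj (α := fun _ => -(1 / 2)) (fun i => by norm_num)
    (by simp; norm_num)
  refine ⟨_, hi.const_mul (nrm (gap t * x⁻¹) ^ (-(1 / 2) : ℝ) *
    ∏ i, nrm (1 - midPt t i * x⁻¹) ^ (-(1 / 2) : ℝ)), fun φ => ?_⟩
  filter_upwards [ae_notMem_finite μ (T := {0, 1, x * (gap t)⁻¹}) (Set.toFinite _)] with s hs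
  have hgood := good_S hm hx hs
  simp only [Set.mem_insert_iff, Set.mem_singleton_iff, not_or] at hs
  rw [norm_smul, norm_gOp μ hlam hd hgood, norm_npow hs.1]
  have h2 : ∀ i, midPt t i * (x⁻¹ * s * s⁻¹) = midPt t i * x⁻¹ := fun i => by
    rw [mul_inv_cancel_right₀ hs.1]
  have e1 : 1 - gap t * (x⁻¹ * s) = -(gap t * x⁻¹) * (s - x * (gap t)⁻¹) := by
    field_simp; ring
  have e2 : 1 - s⁻¹ = (s - 1) * s⁻¹ := by rw [sub_mul, mul_inv_cancel₀ hs.1, one_mul]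
  have hp := nrm_pos hs.1
  simp only [h2]
  rw [e1, e2, nrm_mul, nrm_mul (s - 1), nrm_neg, Real.mul_rpow (nrm_nonneg _) (nrm_nonneg _),
    Real.mul_rpow (nrm_nonneg _) (nrm_nonneg _), nrm_inv, Real.inv_rpow hp.le]
  have e3 : nrm s ^ (c - 1).re * (nrm s ^ (-(1 / 2) : ℝ))⁻¹ = nrm s ^ (-(1 / 2) : ℝ) := by
    rw [← Real.rpow_neg hp.le, ← Real.rpow_add hp]
    congr 1
    simp [hc]; norm_num
  simp only [Fin.prod_univ_three, Matrix.cons_val_zero, Matrix.cons_val_one, Matrix.cons_val,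
    sub_zero]
  refine le_of_eq ?_
  linear_combination (nrm (gap t * x⁻¹) ^ (-(1 / 2) : ℝ) *
    (nrm (s - x * (gap t)⁻¹) ^ (-(1 / 2) : ℝ)) * nrm (s - 1) ^ (-(1 / 2) : ℝ) *
    (∏ i, nrm (1 - midPt t i * x⁻¹) ^ (-(1 / 2) : ℝ)) * ‖φ‖) * e3

end Family



/-! ### The Hecke operators and their adjoints -/

section Hecke

variable {F : Type*} [NontriviallyNormedField F] [ProperSpace F] [MeasurableSpace F] [BorelSpace F]
  (μ : Measure F) [μ.IsAddHaarMeasure] {n : ℕ} (t : Fin (n + 2) → F) (lam : Fin (n + 2) → ℂ)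
  (d c : ℂ)

/-- The vector-valued integral that defines the Hecke operator at the point `x + t 0`, up to the
factor `heckeConst`. -/
noncomputable def heckeVec (x : F) (φ : HSpace n μ) : HSpace n μ :=
  ∫ s, npow s (c - 1) • gOp μ t lam d s⁻¹ (x⁻¹ * s) φ ∂μ

/-- The scalar factor of the Hecke operator at the point `x + t 0`. -/
noncomputable def heckeConst (x : F) : ℂ :=
  npow x ((1 - c) / 2) * ∏ j, npow (1 - shiftPt t j * x⁻¹) (-lam j / 2)

/-- The involution of the projective line that takes the kernel of a Hecke operator to the kernel
of the adjoint. -/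
def swapMat (κ x : F) : Matrix (Fin 2) (Fin 2) F := !![x, -x; κ, -x]

lemma mobDen_swapMat (κ x s : F) : mobDen (swapMat κ x) s = κ * s - x := by
  simp only [mobDen, swapMat, Matrix.of_apply, Matrix.cons_val', Matrix.cons_val_zero,
    Matrix.cons_val_one, Matrix.cons_val_fin_one]
  ring

lemma mobMap_swapMat (κ x s : F) : mobMap (swapMat κ x) s = x * (s - 1) / (κ * s - x) := by
  rw [mobMap, mobDen_swapMat]
  simp only [swapMat, Matrix.of_apply, Matrix.cons_val', Matrix.cons_val_zero,
    Matrix.cons_val_one, Matrix.cons_val_fin_one]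
  congr 1
  ring

lemma integral_mobMap {E : Type*} [NormedAddCommGroup E] [NormedSpace ℝ E]
    {g : Matrix (Fin 2) (Fin 2) F} (hg : g.det ≠ 0) {f : F → E} (hf : AEStronglyMeasurable f μ) :
    ∫ s, (mobJac g s : ℝ) • f (mobMap g s) ∂μ = ∫ s, f s ∂μ := by
  have h := measurePreserving_mob μ hg
  conv_rhs => rw [← h.map_eq]
  rw [integral_map h.measurable.aemeasurable (by rwa [h.map_eq]),
    integral_withDensity_eq_integral_smul (measurable_mobJac g)]
  rfl

variable {t lam d c}

lemma prod_npow {ι : Type*} (S : Finset ι) {x : F} (hx : x ≠ 0) (z : ι → ℂ) :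
    ∏ i ∈ S, npow x (z i) = npow x (∑ i ∈ S, z i) := by
  classical
  induction S using Finset.induction_on with
  | empty => simp [npow]
  | insert i s hi ih => rw [Finset.prod_insert hi, Finset.sum_insert hi, ih, npow_add hx]

lemma degree_re (hlam : ∀ j, (lam j).re = -1) {lamInf : ℂ} (hlamInf : lamInf.re = -1) :
    (degree lam lamInf).re = -((n + 1 : ℝ) / 2) := by
  rw [degree, Complex.div_ofNat_re, Complex.sub_re, Complex.re_sum, hlamInf,
    Finset.sum_congr rfl fun j _ => hlam j]
  simp
  ring

lemma npow_two (x : F) : npow x 2 = (nrm x : ℂ) ^ 2 := by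
  rw [npow, Complex.cpow_ofNat]

lemma npow_sq (x : F) (z : ℂ) : npow (x ^ 2) z = npow x z * npow x z := by
  rw [pow_two, npow_mul]

/-- The point `x + t 0` is not one of the points `t j`. -/
def OffPts (t : Fin (n + 2) → F) (x : F) : Prop := x ≠ 0 ∧ x ≠ gap t ∧ ∀ i, midPt t i ≠ x

lemma offPts_sub {x : F} (hx : x ∉ Set.range t) : OffPts t (x - t 0) :=
  ⟨fun h => hx ⟨0, (sub_eq_zero.1 h).symm⟩, fun h => hx ⟨_, (sub_left_inj.1 h).symm⟩,
    fun _ h => hx ⟨_, sub_left_inj.1 h⟩⟩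

section Adjoint

variable {κ x s : F}

lemma one_sub_inv_swap (hx : x ≠ 0) (hs0 : s ≠ 0) (hs1 : s ≠ 1) (hs : κ * s ≠ x) :
    1 - (mobMap (swapMat κ x) s)⁻¹ = (1 - κ * x⁻¹) * (1 - s⁻¹)⁻¹ := by
  rw [mobMap_swapMat]
  have h1 : s - 1 ≠ 0 := sub_ne_zero.2 hs1
  have h2 : κ * s - x ≠ 0 := sub_ne_zero.2 hs
  have h3 : 1 - s⁻¹ = (s - 1) / s := by field_simp
  rw [h3]
  field_simp
  ring

lemma swap_ne_zero (hx : x ≠ 0) (hs1 : s ≠ 1) (hs : κ * s ≠ x) :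
    mobMap (swapMat κ x) s ≠ 0 := by
  rw [mobMap_swapMat]
  exact div_ne_zero (mul_ne_zero hx (sub_ne_zero.2 hs1)) (sub_ne_zero.2 hs)

lemma swap_swap (hx : x ≠ 0) (hκ : x ≠ κ) (hs : κ * s ≠ x) :
    mobMap (swapMat κ x) (mobMap (swapMat κ x) s) = s := by
  have h2 : κ * s - x ≠ 0 := sub_ne_zero.2 hs
  have h4 : x - κ ≠ 0 := sub_ne_zero.2 hκ
  have e1 : x * (s - 1) / (κ * s - x) - 1 = s * (x - κ) / (κ * s - x) := by
    rw [div_sub_one h2]; congr 1; ring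
  have e2 : κ * (x * (s - 1) / (κ * s - x)) - x = x * (x - κ) / (κ * s - x) := by
    field_simp; ring
  rw [mobMap_swapMat, mobMap_swapMat, e1, e2, mul_div_assoc', div_div_div_cancel_right₀ h2,
    mul_left_comm, mul_div_assoc, div_self (mul_ne_zero hx h4), mul_one]

lemma swap_quot (hx : x ≠ 0) (hs0 : s ≠ 0) (hs1 : s ≠ 1) (hs : κ * s ≠ x) :
    (1 - s⁻¹) / (1 - κ * (x⁻¹ * s)) = -(mobMap (swapMat κ x) s / s) := by
  rw [mobMap_swapMat]
  have h2 : κ * s - x ≠ 0 := sub_ne_zero.2 hs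
  have h5 : 1 - κ * (x⁻¹ * s) = -((κ * s - x) / x) := by field_simp; ring
  rw [h5]
  field_simp

lemma gMat_S (hx : x ≠ 0) (hs0 : s ≠ 0) (hs1 : s ≠ 1) (hs : gap t * s ≠ x) (i : Fin n) :
    gMat t s⁻¹ (x⁻¹ * s) i = !![-(mobMap (swapMat (gap t) x) s / s),
      midPt t i * x⁻¹ * mobMap (swapMat (gap t) x) s; -s⁻¹, 1] := by
  rw [gMat, swap_quot hx hs0 hs1 hs]
  have : -(midPt t i * (x⁻¹ * s)) * -(mobMap (swapMat (gap t) x) s / s) =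
      midPt t i * x⁻¹ * mobMap (swapMat (gap t) x) s := by field_simp
  rw [this]

lemma gMat_S_mul (hx : OffPts t x) (hs0 : s ≠ 0) (hs1 : s ≠ 1) (hs : gap t * s ≠ x) (i : Fin n) :
    gMat t (mobMap (swapMat (gap t) x) s)⁻¹ (x⁻¹ * mobMap (swapMat (gap t) x) s) i *
      gMat t s⁻¹ (x⁻¹ * s) i = (1 - midPt t i * x⁻¹) • (1 : Matrix (Fin 2) (Fin 2) F) := by
  have hs'0 := swap_ne_zero hx.1 hs1 hs
  have hs'1 : mobMap (swapMat (gap t) x) s ≠ 1 := by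
    intro h
    have := one_sub_inv_swap hx.1 hs0 hs1 hs
    rw [h, inv_one, sub_self, eq_comm, mul_eq_zero, ← div_eq_mul_inv, one_sub_div hx.1,
      inv_eq_zero, sub_eq_zero, eq_comm (a := (1 : F)), inv_eq_one] at this
    rcases this with h1 | h1
    · exact div_ne_zero (sub_ne_zero.2 hx.2.1) hx.1 h1
    · exact hs1 h1
  have hs' : gap t * mobMap (swapMat (gap t) x) s ≠ x := by
    intro h
    rw [mobMap_swapMat] at h
    have h2 : gap t * s - x ≠ 0 := sub_ne_zero.2 hs
    rw [← mul_div_assoc, div_eq_iff h2] at h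
    have h4 : x * (x - gap t) = 0 := by linear_combination h
    exact mul_ne_zero hx.1 (sub_ne_zero.2 hx.2.1) h4
  rw [gMat_S hx.1 hs0 hs1 hs, gMat_S hx.1 hs'0 hs'1 hs', swap_swap hx.1 hx.2.1 hs,
    Matrix.mul_fin_two]
  ext a b
  fin_cases a <;> fin_cases b <;> simp <;> field_simp <;> ring

variable (hlam : ∀ j, (lam j).re = -1) (hd : d.re = -((n + 1 : ℝ) / 2)) (hc : c.re = 0)
include hlam hd hc

/-- The adjoint of an operator in the kernel of a Hecke operator: up to explicit factors it is the
operator of the kernel at the image of `s` under the involution, because the product of the two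
matrices is scalar. -/
lemma inner_gOp_S (hx : OffPts t x) (hs0 : s ≠ 0) (hs1 : s ≠ 1) (hs : gap t * s ≠ x)
    (φ ψ : HSpace n μ) :
    inner ℂ (gOp μ t lam d s⁻¹ (x⁻¹ * s) φ) ψ =
      (∏ i, npow (1 - midPt t i * x⁻¹) (-midWeight lam i - 1)) *
        npow (1 - gap t * x⁻¹) (-lam (Fin.last (n + 1))) *
        npow (mobMap (swapMat (gap t) x) s / s) (1 - c) * npow (1 - s⁻¹) (-2) *
      inner ℂ φ (gOp μ t lam (d + c) (mobMap (swapMat (gap t) x) s)⁻¹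
        (x⁻¹ * mobMap (swapMat (gap t) x) s) ψ) := by
  have hmem : ∀ u : F, u ≠ 0 → u ≠ 1 → gap t * u ≠ x → Good t u⁻¹ (x⁻¹ * u) := by
    intro u hu0 hu1 hu
    refine ⟨?_, ?_, fun i => ?_⟩
    · rw [sub_ne_zero]; exact fun h => hu1 (inv_eq_one.1 h.symm)
    · intro h
      apply hu
      have h' := sub_eq_zero.1 h
      field_simp [hx.1] at h'
      exact h'.symm
    · rw [mul_inv_cancel_right₀ hu0, ← div_eq_mul_inv, one_sub_div hx.1]
      exact div_ne_zero (sub_ne_zero.2 (hx.2.2 i).symm) hx.1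
  have hs'0 := swap_ne_zero hx.1 hs1 hs
  have e0 := one_sub_inv_swap hx.1 hs0 hs1 hs
  have e1 := swap_quot hx.1 hs0 hs1 hs
  have hmul := gMat_S_mul hx hs0 hs1 hs
  have hinv := swap_swap hx.1 hx.2.1 hs
  set u := mobMap (swapMat (gap t) x) s with hu
  have hw : 1 - s⁻¹ ≠ 0 := sub_ne_zero.2 fun h => hs1 (inv_eq_one.1 h.symm)
  have hk : 1 - gap t * x⁻¹ ≠ 0 := by
    rw [← div_eq_mul_inv, one_sub_div hx.1]
    exact div_ne_zero (sub_ne_zero.2 hx.2.1) hx.1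
  have hki : ∀ i, 1 - midPt t i * x⁻¹ ≠ 0 := fun i => by
    rw [← div_eq_mul_inv, one_sub_div hx.1]
    exact div_ne_zero (sub_ne_zero.2 (hx.2.2 i).symm) hx.1
  have hu1 : u ≠ 1 := by
    intro h
    rw [h, inv_one, sub_self] at e0
    exact mul_ne_zero hk (inv_ne_zero hw) e0.symm
  have hux : gap t * u ≠ x := by
    intro h
    have h2 : gap t * s - x ≠ 0 := sub_ne_zero.2 hs
    rw [hu, mobMap_swapMat, ← mul_div_assoc, div_eq_iff h2] at h
    have h4 : x * (x - gap t) = 0 := by linear_combination h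
    exact mul_ne_zero hx.1 (sub_ne_zero.2 hx.2.1) h4
  have e2 := swap_quot hx.1 hs'0 hu1 hux
  rw [hinv] at e2
  have hq : u / s ≠ 0 := div_ne_zero hs'0 hs0
  have hscale : ((mobScale (gMat t s⁻¹ (x⁻¹ * s)) : ℝ) : ℂ) ^ 2 =
      npow (u / s) (-n) * ∏ i, npow (1 - midPt t i * x⁻¹) (-1) := by
    have h2 : ∀ i, midPt t i * (x⁻¹ * s * s⁻¹) = midPt t i * x⁻¹ := fun i => by
      rw [mul_inv_cancel_right₀ hs0]
    rw [mobScale_gMat, e1, nrm_neg]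
    simp only [h2]
    push_cast
    rw [mul_pow, ← Finset.prod_pow, ← npow_ofReal, pow_two, ← npow_add hq]
    congr 1
    · congr 1
      push_cast; ring
    · refine Finset.prod_congr rfl fun i _ => ?_
      rw [← npow_ofReal, pow_two, ← npow_add (hki i)]
      congr 1
      push_cast; ring
  have hc1 : gCoef t lam d s⁻¹ (x⁻¹ * s) = npow (u / s) (-d) * npow (1 - s⁻¹)
      (lam (Fin.last (n + 1))) := by
    rw [gCoef, ← inv_div (1 - s⁻¹), e1, npow_inv, npow_neg_arg, npow_neg]
  have hc2 : gCoef t lam (d + c) u⁻¹ (x⁻¹ * u) = npow (u / s) (d + c) *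
      (npow (1 - gap t * x⁻¹) (lam (Fin.last (n + 1))) *
        npow (1 - s⁻¹) (-lam (Fin.last (n + 1)))) := by
    rw [gCoef, ← inv_div (1 - u⁻¹), e2, npow_inv, npow_neg_arg, e0, npow_mul,
      npow_inv (1 - s⁻¹), ← npow_neg (1 - s⁻¹), ← npow_inv, inv_div]
  have hcd : (starRingEnd ℂ) d = -d - (n + 1) := by
    apply Complex.ext
    · simp [hd]; ring
    · simp
  have hcl : (starRingEnd ℂ) (lam (Fin.last (n + 1))) = -lam (Fin.last (n + 1)) - 2 := by
    apply Complex.ext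
    · simp [hlam]; norm_num
    · simp
  rw [gOp, gOp, smul_apply, smul_apply, inner_smul_left, inner_smul_right,
    inner_mobOp μ (midWeight_re hlam) (hmem s hs0 hs1 hs).det_ne (hmem u hs'0 hu1 hux).det_ne hki
      hmul, hscale, hc1, hc2, map_mul, conj_npow, conj_npow, map_neg, hcd, hcl]
  generalize inner ℂ φ (mobOp μ (midWeight lam) (gMat t u⁻¹ (x⁻¹ * u)) ψ) = I
  have p1 : ∏ i, npow (1 - midPt t i * x⁻¹) (-midWeight lam i - 1) =
      (∏ i, npow (1 - midPt t i * x⁻¹) (midWeight lam i))⁻¹ *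
        ∏ i, npow (1 - midPt t i * x⁻¹) (-1) := by
    rw [← Finset.prod_inv_distrib, ← Finset.prod_mul_distrib]
    refine Finset.prod_congr rfl fun i _ => ?_
    rw [← npow_neg, ← npow_add (hki i), ← sub_eq_add_neg]
  rw [p1]
  generalize (∏ i, npow (1 - midPt t i * x⁻¹) (midWeight lam i))⁻¹ = P1
  generalize ∏ i, npow (1 - midPt t i * x⁻¹) (-1) = P2
  have q1 : npow (u / s) (-(-d - (n + 1))) * npow (u / s) (-n) =
      npow (u / s) (1 - c) * npow (u / s) (d + c) := by
    rw [← npow_add hq, ← npow_add hq]; congr 1; ring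
  have q2 : npow (1 - s⁻¹) (-lam (Fin.last (n + 1)) - 2) =
      npow (1 - s⁻¹) (-2) * npow (1 - s⁻¹) (-lam (Fin.last (n + 1))) := by
    rw [← npow_add hw]; congr 1; ring
  have q3 : npow (1 - gap t * x⁻¹) (-lam (Fin.last (n + 1))) *
      npow (1 - gap t * x⁻¹) (lam (Fin.last (n + 1))) = 1 := by
    rw [npow_neg, inv_mul_cancel₀ (npow_ne_zero hk _)]
  rw [q2]
  linear_combination (npow (1 - s⁻¹) (-2) * npow (1 - s⁻¹) (-lam (Fin.last (n + 1))) * P1 * P2 * I)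
    * q1 - (P1 * P2 * I * npow (u / s) (1 - c) * npow (1 - s⁻¹) (-2) * npow (u / s) (d + c) *
      npow (1 - s⁻¹) (-lam (Fin.last (n + 1)))) * q3

end Adjoint

section Operator

variable (hlam : ∀ j, (lam j).re = -1) (hd : d.re = -((n + 1 : ℝ) / 2)) (hc : c.re = 0)
include hlam hd hc

lemma integrable_heckeVec (hgap : gap t ≠ 0) {x : F} (hx : OffPts t x) (φ : HSpace n μ) :
    Integrable (fun s => npow s (c - 1) • gOp μ t lam d s⁻¹ (x⁻¹ * s) φ) μ := by
  obtain ⟨k, hk, hk'⟩ := integrable_gOp_S μ hlam hd hgap hx.2.2 hx.1 hx.2.1 hc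
  exact (hk.mul_const ‖φ‖).mono' ((measurable_npow _).aestronglyMeasurable.smul
    (aesm_gOp_S μ hlam hx.2.2 hx.1 φ)) (hk' φ)

/-- The vector-valued integral defines a bounded operator. -/
lemma exists_heckeOp (hgap : gap t ≠ 0) {x : F} (hx : OffPts t x) :
    ∃ T : HSpace n μ →L[ℂ] HSpace n μ, ∀ φ, T φ = heckeVec μ t lam d c x φ := by
  obtain ⟨k, hk, hk'⟩ := integrable_gOp_S μ hlam hd hgap hx.2.2 hx.1 hx.2.1 hc
  refine ⟨LinearMap.mkContinuous
    { toFun := heckeVec μ t lam d c x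
      map_add' := fun φ ψ => ?_
      map_smul' := fun z φ => ?_ } (∫ s, k s ∂μ) fun φ => ?_, fun φ => rfl⟩
  · rw [heckeVec, heckeVec, heckeVec, ← integral_add (integrable_heckeVec μ hlam hd hc hgap hx φ)
      (integrable_heckeVec μ hlam hd hc hgap hx ψ)]
    simp only [map_add, smul_add]
  · rw [heckeVec, heckeVec, RingHom.id_apply, ← integral_smul]
    simp only [map_smul, smul_comm z]
  · refine (norm_integral_le_of_norm_le (hk.mul_const ‖φ‖) (hk' φ)).trans_eq ?_
    rw [integral_mul_const]

/-- The adjoint of a Hecke operator, up to the scalar factors: move every operator to the other side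
and substitute the involution. -/
lemma inner_heckeVec (hgap : gap t ≠ 0) {x : F} (hx : OffPts t x) (φ ψ : HSpace n μ) :
    inner ℂ (heckeVec μ t lam d c x φ) ψ = (∏ j, npow (1 - shiftPt t j * x⁻¹) (-lam j - 1)) *
      inner ℂ φ (heckeVec μ t lam (d + c) (-c) x ψ) := by
  have hd' : (d + c).re = -((n + 1 : ℝ) / 2) := by simp [hd, hc]
  have hc' : (-c).re = 0 := by simp [hc]
  have hk : 1 - gap t * x⁻¹ ≠ 0 := by
    rw [← div_eq_mul_inv, one_sub_div hx.1]
    exact div_ne_zero (sub_ne_zero.2 hx.2.1) hx.1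
  have hprod : ∏ j, npow (1 - shiftPt t j * x⁻¹) (-lam j - 1) =
      (∏ i, npow (1 - midPt t i * x⁻¹) (-midWeight lam i - 1)) *
        npow (1 - gap t * x⁻¹) (-lam (Fin.last (n + 1))) * npow (1 - gap t * x⁻¹) (-1) := by
    rw [prod_gauge, mul_assoc, mul_assoc, ← npow_add hk, ← sub_eq_add_neg]
    simp only [shiftPt, sub_self, zero_mul, sub_zero, npow_one, one_mul]
    rfl
  set G : F → ℂ := fun u => npow u (-c - 1) * inner ℂ φ (gOp μ t lam (d + c) u⁻¹ (x⁻¹ * u) ψ)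
    with hG
  have hGm : AEStronglyMeasurable G μ := (measurable_npow _).aestronglyMeasurable.mul
    (aestronglyMeasurable_const.inner (aesm_gOp_S μ hlam hx.2.2 hx.1 ψ))
  have hdet : (swapMat (gap t) x).det = -(x * (x - gap t)) := by
    rw [swapMat, Matrix.det_fin_two_of]; ring
  have hdet0 : (swapMat (gap t) x).det ≠ 0 := by
    rw [hdet]; exact neg_ne_zero.2 (mul_ne_zero hx.1 (sub_ne_zero.2 hx.2.1))
  have hR : inner ℂ φ (heckeVec μ t lam (d + c) (-c) x ψ) = ∫ u, G u ∂μ := by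
    rw [heckeVec, ← integral_inner (integrable_heckeVec μ hlam hd' hc' hgap hx ψ)]
    simp only [inner_smul_right, hG]
  have hL : inner ℂ (heckeVec μ t lam d c x φ) ψ =
      ∫ s, npow s (-c - 1) * inner ℂ (gOp μ t lam d s⁻¹ (x⁻¹ * s) φ) ψ ∂μ := by
    rw [← inner_conj_symm, heckeVec, ← integral_inner (integrable_heckeVec μ hlam hd hc hgap hx φ),
      ← integral_conj]
    refine integral_congr_ae (Eventually.of_forall fun s => ?_)
    simp only [inner_smul_right, map_mul, inner_conj_symm, conj_npow, map_sub, map_one,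
      conj_eq_neg_of_re hc]
  rw [hL, hR, ← integral_mobMap μ hdet0 hGm, hprod, ← integral_const_mul]
  refine integral_congr_ae ?_
  filter_upwards [ae_notMem_finite μ (T := {0, 1, x * (gap t)⁻¹}) (Set.toFinite _)] with s hs
  simp only [Set.mem_insert_iff, Set.mem_singleton_iff, not_or] at hs
  have hsx : gap t * s ≠ x := fun h => hs.2.2 (by rw [← h]; field_simp)
  have hden : gap t * s - x ≠ 0 := sub_ne_zero.2 hsx
  have hs1 : s - 1 ≠ 0 := sub_ne_zero.2 hs.2.1
  have hu0 := swap_ne_zero hx.1 hs.2.1 hsx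
  rw [inner_gOp_S μ hlam hd hc hx hs.1 hs.2.1 hsx]
  have hu := mobMap_swapMat (gap t) x s
  have hJ : (mobJac (swapMat (gap t) x) s : ℝ) =
      nrm (x * (x - gap t)) * (nrm (gap t * s - x))⁻¹ ^ 2 := by
    have h := coe_mobJac (swapMat (gap t) x) s
    rw [hdet, nrm_neg, mobDen_swapMat, ← ENNReal.ofReal_mul (nrm_nonneg _)] at h
    have h2 := congrArg ENNReal.toReal h
    rwa [ENNReal.coe_toReal, ENNReal.toReal_ofReal (by positivity [nrm_nonneg (x * (x - gap t))])]
      at h2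
  -- the factors of the adjoint kernel combine with the Jacobian of the involution
  have key : npow s (-c - 1) * (npow (mobMap (swapMat (gap t) x) s / s) (1 - c) *
      npow (1 - s⁻¹) (-2)) = npow (1 - gap t * x⁻¹) (-1) *
        ((nrm (x * (x - gap t)) * (nrm (gap t * s - x))⁻¹ ^ 2 : ℝ) *
          npow (mobMap (swapMat (gap t) x) s) (-c - 1)) := by
    have cS := nrm_cast_ne hs.1
    have cX := nrm_cast_ne hx.1
    have cU := nrm_cast_ne hs1
    have cD := nrm_cast_ne hden
    have cK := nrm_cast_ne (sub_ne_zero.2 hx.2.1)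
    have w1 : 1 - s⁻¹ = (s - 1) / s := by rw [sub_div, div_self hs.1, one_div]
    have w2 : 1 - gap t * x⁻¹ = (x - gap t) / x := by rw [sub_div, div_self hx.1, div_eq_mul_inv]
    have hab : npow s (-c - 1) * npow s (c - 1) * (nrm s : ℂ) ^ 2 = 1 := by
      rw [← npow_two, ← npow_add hs.1, ← npow_add hs.1,
        show -c - 1 + (c - 1) + 2 = 0 by ring, npow_zero_exp]
    have hq : npow (mobMap (swapMat (gap t) x) s / s) (1 - c) =
        npow (mobMap (swapMat (gap t) x) s) (-c - 1) *
          ((nrm x : ℂ) * nrm (s - 1) / nrm (gap t * s - x)) ^ 2 * npow s (c - 1) := by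
      rw [npow_div, div_eq_mul_inv, ← npow_neg, neg_sub, show 1 - c = -c - 1 + 2 by ring,
        npow_add hu0, npow_two, hu, nrm_div, nrm_mul]
      push_cast
      ring
    rw [hq, w1, w2, npow_neg, npow_two, npow_neg, npow_one_exp, nrm_div, nrm_div, nrm_mul]
    push_cast
    generalize npow (mobMap (swapMat (gap t) x) s) (-c - 1) = p
    generalize (nrm (gap t * s - x) : ℂ) = D at cD ⊢
    field_simp
    linear_combination p * hab
  rw [hJ, hG, Complex.real_smul]
  linear_combination ((∏ i, npow (1 - midPt t i * x⁻¹) (-midWeight lam i - 1)) *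
    npow (1 - gap t * x⁻¹) (-lam (Fin.last (n + 1))) *
    inner ℂ φ (gOp μ t lam (d + c) (mobMap (swapMat (gap t) x) s)⁻¹
        (x⁻¹ * mobMap (swapMat (gap t) x) s) ψ)) * key

end Operator

section Scalars

variable {x : F}

omit [MeasurableSpace F] [BorelSpace F] in
lemma one_sub_shiftPt_ne (hx : OffPts t x) (j : Fin (n + 2)) : 1 - shiftPt t j * x⁻¹ ≠ 0 := by
  rw [← div_eq_mul_inv, one_sub_div hx.1]
  refine div_ne_zero (sub_ne_zero.2 ?_) hx.1
  refine Fin.lastCases ?_ (fun j => ?_) j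
  · exact hx.2.1
  · refine Fin.cases ?_ (fun i => ?_) j
    · simpa [shiftPt] using hx.1
    · exact (hx.2.2 i).symm

lemma conj_heckeConst (hlam : ∀ j, (lam j).re = -1) (hc : c.re = 0) (hx : OffPts t x) :
    (starRingEnd ℂ) (heckeConst t lam c x) * ∏ j, npow (1 - shiftPt t j * x⁻¹) (-lam j - 1) =
      heckeConst t lam (-c) x := by
  rw [heckeConst, heckeConst, map_mul, conj_npow, map_prod, mul_assoc, ← Finset.prod_mul_distrib]
  congr 1
  · congr 1
    simp only [map_div₀, map_sub, map_one, conj_eq_neg_of_re hc, Complex.conj_ofNat]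
  · refine Finset.prod_congr rfl fun j _ => ?_
    have hcl : (starRingEnd ℂ) (lam j) = -lam j - 2 := by
      apply Complex.ext
      · simp [hlam]; norm_num
      · simp
    rw [conj_npow, ← npow_add (one_sub_shiftPt_ne hx j)]
    congr 1
    simp only [map_div₀, map_neg, hcl, Complex.conj_ofNat]
    ring

end Scalars

section Integrand

lemma homExt_affine {a b : F} (ha : a ≠ 0) (d : ℂ) (f : (Fin n → F) → ℂ) (z : Fin (n + 2) → F) :
    homExt d f (fun j => a * z j + b) = npow a d * homExt d f z := by
  simp only [homExt, add_sub_add_right_eq_sub, ← mul_sub, npow_mul, mul_div_mul_left _ _ ha,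
    mul_assoc]

lemma measurable_gFun {f : (Fin n → F) → ℂ} (hf : Measurable f) {ρ r : F → F} (hρ : Measurable ρ)
    (hr : Measurable r) :
    Measurable (Function.uncurry fun (s : F) (y : Fin n → F) => gFun t lam d (ρ s) (r s) f y) := by
  have hg : ∀ j, Measurable fun q : F × (Fin n → F) => gauge q.2 j := by
    intro j
    refine Fin.lastCases ?_ (fun j => ?_) j
    · simp only [gauge_last]; exact measurable_const
    · refine Fin.cases ?_ (fun i => ?_) j
      · simp only [Fin.castSucc_zero, gauge_zero]; exact measurable_const
      · simp only [gauge_mid]; exact (measurable_pi_apply i).comp measurable_snd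
  have hρ' : Measurable fun q : F × (Fin n → F) => ρ q.1 := hρ.comp measurable_fst
  have hr' : Measurable fun q : F × (Fin n → F) => r q.1 := hr.comp measurable_fst
  have hz : ∀ j, Measurable fun q : F × (Fin n → F) =>
      (gauge q.2 j - shiftPt t j * r q.1) / (1 - gauge q.2 j * ρ q.1) := fun j =>
    ((hg j).sub (hr'.const_mul _)).div (measurable_const.sub ((hg j).mul hρ'))
  refine Measurable.mul (Measurable.mul ?_ ?_) ?_
  · exact (measurable_npow d).comp ((hz _).sub (hz _))
  · exact hf.comp (measurable_pi_iff.2 fun i => ((hz _).sub (hz _)).div ((hz _).sub (hz _)))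
  · exact Finset.measurable_prod _ fun j _ =>
      (measurable_npow _).comp (measurable_const.sub ((hg j).mul hρ'))

/-- The integrand of the Hecke operator in terms of the two-parameter family: the points
`(t j - x) / (s - y j)` are an affine transform of the points that occur in `gFun`. -/
lemma heckeIntegrand_eq {lamInf : ℂ} {x : F} (hx : x - t 0 ≠ 0) (f : (Fin n → F) → ℂ)
    (y : Fin n → F) {s : F} (hs : ∀ j, s ≠ gauge y j) :
    heckeIntegrand t lam lamInf x f y s = npow (x - t 0) (degree lam lamInf) * (npow s lamInf *
      gFun t lam (degree lam lamInf) s⁻¹ ((x - t 0)⁻¹ * s) f y) := by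
  have hs0 : s ≠ 0 := by simpa using hs 0
  set w := x - t 0 with hw
  have ha : -(s ^ 2 / w) ≠ 0 := neg_ne_zero.2 (div_ne_zero (pow_ne_zero 2 hs0) hx)
  have h1 : (fun j => (gauge y j - shiftPt t j * (w⁻¹ * s)) / (1 - gauge y j * s⁻¹)) =
      fun j => -(s ^ 2 / w) * ((t j - x) / (s - gauge y j)) + -s := by
    ext j
    have h2 : s - gauge y j ≠ 0 := sub_ne_zero.2 (hs j)
    have h3 : 1 - gauge y j * s⁻¹ = (s - gauge y j) / s := by
      rw [sub_div, div_self hs0, div_eq_mul_inv]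
    have h4 : t j - x = shiftPt t j - w := by rw [hw, shiftPt]; ring
    rw [h3, h4]
    field_simp
    ring
  have h5 : ∏ j, npow (s - gauge y j) (lam j) =
      npow s (∑ j, lam j) * ∏ j, npow (1 - gauge y j * s⁻¹) (lam j) := by
    rw [← prod_npow _ hs0, ← Finset.prod_mul_distrib]
    refine Finset.prod_congr rfl fun j _ => ?_
    rw [← npow_mul, mul_sub, mul_one, mul_left_comm, mul_inv_cancel₀ hs0, mul_one]
  rw [heckeIntegrand, gFun, h1, homExt_affine ha, h5, npow_neg_arg, npow_div, npow_sq,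
    show ∑ j, lam j = degree lam lamInf + degree lam lamInf + lamInf by rw [degree]; ring,
    npow_add hs0, npow_add hs0]
  have := npow_ne_zero hx (degree lam lamInf)
  field_simp

lemma prod_npow_mul_eq_heckeConst {lamInf : ℂ} {x : F} (hx : OffPts t (x - t 0)) :
    (∏ j, npow (x - t j) (-lam j / 2)) * npow (x - t 0) (degree lam lamInf) =
      heckeConst t lam (lamInf + 1) (x - t 0) := by
  have h1 : ∀ j, x - t j = (x - t 0) * (1 - shiftPt t j * (x - t 0)⁻¹) := fun j => by
    rw [mul_sub, mul_one, mul_left_comm, mul_inv_cancel₀ hx.1, mul_one, shiftPt]; ring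
  have h2 : ∏ j, npow (x - t j) (-lam j / 2) = npow (x - t 0) (∑ j, -lam j / 2) *
      ∏ j, npow (1 - shiftPt t j * (x - t 0)⁻¹) (-lam j / 2) := by
    rw [← prod_npow _ hx.1, ← Finset.prod_mul_distrib]
    refine Finset.prod_congr rfl fun j _ => ?_
    rw [← npow_mul, ← h1]
  rw [h2, heckeConst, mul_right_comm, ← npow_add hx.1]
  congr 2
  rw [← Finset.sum_div, Finset.sum_neg_distrib, degree]
  ring

/-- The vector-valued integral represents the Hecke operator. -/
lemma isHecke_of_eq (hlam : ∀ j, (lam j).re = -1) {lamInf : ℂ} (hlamInf : lamInf.re = -1)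
    (hgap : gap t ≠ 0) {x : F} (hx : x ∉ Set.range t) {T : HSpace n μ →L[ℂ] HSpace n μ}
    (hT : ∀ φ, T φ = heckeConst t lam (lamInf + 1) (x - t 0) •
      heckeVec μ t lam (degree lam lamInf) (lamInf + 1) (x - t 0) φ) :
    IsHecke μ t lam lamInf x T := by
  intro φ
  have hx' := offPts_sub hx
  have hd : (degree lam lamInf).re = -((n + 1 : ℝ) / 2) := degree_re hlam hlamInf
  have hc : (lamInf + 1).re = 0 := by simp [hlamInf]
  have hφm : Measurable (φ : (Fin n → F) → ℂ) := (Lp.stronglyMeasurable φ).measurable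
  have hlink := ae_integral_apply (μ := μ) (ν := Measure.pi fun _ : Fin n => μ)
    (integrable_heckeVec μ hlam hd hc hgap hx' φ)
    (g := fun s y => npow s (lamInf + 1 - 1) *
      gFun t lam (degree lam lamInf) s⁻¹ ((x - t 0)⁻¹ * s) φ y) ?_ ?_
  · rw [hT]
    filter_upwards [hlink, Lp.coeFn_smul (heckeConst t lam (lamInf + 1) (x - t 0))
      (heckeVec μ t lam (degree lam lamInf) (lamInf + 1) (x - t 0) φ)] with y hy hy2
    have hae : heckeIntegrand t lam lamInf x φ y =ᵐ[μ] fun s =>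
        npow (x - t 0) (degree lam lamInf) * (npow s (lamInf + 1 - 1) *
          gFun t lam (degree lam lamInf) s⁻¹ ((x - t 0)⁻¹ * s) φ y) := by
      filter_upwards [ae_notMem_finite μ (Set.finite_range (gauge y))] with s hs
      rw [heckeIntegrand_eq hx'.1 _ _ fun j h => hs ⟨j, h.symm⟩, add_sub_cancel_right]
    refine ⟨(hy.1.const_mul _).congr hae.symm, ?_⟩
    rw [hy2, Pi.smul_apply, smul_eq_mul, heckeVec, hy.2, integral_congr_ae hae,
      integral_const_mul, ← mul_assoc, prod_npow_mul_eq_heckeConst hx']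
  · refine Measurable.aestronglyMeasurable ?_
    exact ((measurable_npow _).comp measurable_fst).mul
      (measurable_gFun hφm measurable_inv (measurable_const_mul _))
  · filter_upwards [ae_notMem_finite μ (T := {0, 1, (x - t 0) * (gap t)⁻¹}) (Set.toFinite _)]
      with s hs
    have h1 := coeFn_gOp μ (degree lam lamInf) hlam (good_S hx'.2.2 hx'.1 hs)
      (EventuallyEq.refl _ (φ : (Fin n → F) → ℂ))
    filter_upwards [h1, Lp.coeFn_smul (npow s (lamInf + 1 - 1))
      (gOp μ t lam (degree lam lamInf) s⁻¹ ((x - t 0)⁻¹ * s) φ)] with y hy1 hy2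
    rw [hy2, Pi.smul_apply, smul_eq_mul, hy1]

end Integrand

end Hecke



/-! ### The operators `Q` and `R` -/

section Regularized

variable {F : Type*} [NontriviallyNormedField F] [ProperSpace F] [MeasurableSpace F] [BorelSpace F]
  (μ : Measure F) [μ.IsAddHaarMeasure]

lemma integrable_npow_smul_inv {E : Type*} [NormedAddCommGroup E] [NormedSpace ℂ E] (c : ℂ)
    {f : F → E} : Integrable (fun p => npow p (-c - 1) • f p⁻¹) μ ↔
      Integrable (fun s => npow s (c - 1) • f s) μ := by
  rw [← integrable_inv μ (f := fun s => npow s (c - 1) • f s)]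
  refine integrable_congr ?_
  filter_upwards [ae_ne μ 0] with p hp
  rw [npow_neg_sub_one hp, mul_smul]
  exact Complex.coe_smul _ _

variable {H : Type*} [NormedAddCommGroup H] [InnerProductSpace ℂ H] [CompleteSpace H]

omit [CompleteSpace H] in
lemma eventually_re_add {c : ℂ} (hc : c.re = 0) :
    ∀ᶠ ε : ℝ in 𝓝[>] 0, 0 < (c + ε).re ∧ (c + ε).re ≤ 1 / 4 := by
  filter_upwards [eventually_small (show (0 : ℝ) < 1 / 4 by norm_num)] with ε hε
  simp only [Complex.add_re, Complex.ofReal_re, hc, zero_add]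
  exact ⟨hε.1, hε.2.le⟩

lemma tendsto_regInt {κ : F} (hκ : κ ≠ 0) {η C : ℝ} (hη : 0 < η) {c : ℂ} (hc : c.re = 0)
    (hc1 : ∃ x : F, x ≠ 0 ∧ npow x c ≠ 1) {φ : H} {v : F → H} (hv : AEStronglyMeasurable v μ)
    (hb : ∀ᵐ p ∂μ, ‖cutOff φ v p‖ ≤ C * majorant κ η p) :
    Tendsto (fun ε : ℝ => ∫ p, npow p (c + ε - 1) • v p ∂μ) (𝓝[>] 0) (𝓝 (regInt μ c φ v)) := by
  have hm : AEStronglyMeasurable (cutOff φ v) μ :=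
    hv.sub ((stronglyMeasurable_const.indicator (measurableSet_nrm_le 1)).aestronglyMeasurable)
  have h1 := tendsto_integral_npow_smul μ hκ hη (tendsto_add_ofReal c)
    ((eventually_re_add hc).mono fun ε h => ⟨h.1.le, h.2⟩)
    (Eventually.of_forall fun _ => hm) (Eventually.of_forall fun _ => hb)
    (Eventually.of_forall fun p => tendsto_const_nhds)
  refine (h1.add ((tendsto_unitInt μ hc hc1).smul_const φ)).congr' ?_
  filter_upwards [eventually_re_add hc] with ε hε
  rw [integral_eq_cutOff_add μ hε.1 (integrable_npow_smul μ hκ hη hε.1.le hε.2 hm hb)]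

variable {Y : Type*} [MeasurableSpace Y] {ν : Measure Y} [SigmaFinite ν]

/-- The integral of the cut-off function can be computed pointwise. -/
lemma ae_integral_cutOff {κ : F} (hκ : κ ≠ 0) {η C : ℝ} (hη : 0 < η) {φ : Lp ℂ 2 ν}
    {v : F → Lp ℂ 2 ν} (hv : AEStronglyMeasurable v μ)
    (hb : ∀ᵐ p ∂μ, ‖cutOff φ v p‖ ≤ C * majorant κ η p) {g : Y → ℂ} (hg : Measurable g)
    (hφg : φ =ᵐ[ν] g) {w : F → Y → ℂ} (hw : Measurable (Function.uncurry w))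
    (hvw : ∀ᵐ p ∂μ, v p =ᵐ[ν] w p) {k : F → ℂ} (hk : Measurable k)
    (hkb : ∀ p, p ≠ 0 → ‖k p‖ ≤ powMajorant p) :
    ∀ᵐ y ∂ν, Integrable (fun p => k p * cutOff (g y) (fun p => w p y) p) μ ∧
      (∫ p, k p • cutOff φ v p ∂μ : Lp ℂ 2 ν) y =
        ∫ p, k p * cutOff (g y) (fun p => w p y) p ∂μ := by
  have hm : AEStronglyMeasurable (cutOff φ v) μ :=
    hv.sub ((stronglyMeasurable_const.indicator (measurableSet_nrm_le 1)).aestronglyMeasurable)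
  refine ae_integral_apply (g := fun p y => k p * cutOff (g y) (fun p => w p y) p) ?_ ?_ ?_
  · refine Integrable.mono' ((integrable_powMajorant_mul_majorant μ hκ hη).const_mul C)
      (hk.aestronglyMeasurable.smul hm) ?_
    filter_upwards [hb, ae_ne μ 0] with p hp hp0
    rw [norm_smul, mul_left_comm]
    exact mul_le_mul (hkb p hp0) hp (norm_nonneg _) (powMajorant_nonneg p)
  · refine Measurable.aestronglyMeasurable ?_
    refine (hk.comp measurable_fst).mul (hw.sub ?_)
    exact Measurable.indicator (hg.comp measurable_snd) (measurable_fst (measurableSet_nrm_le 1))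
  · filter_upwards [hvw] with p hp
    refine (Lp.coeFn_smul _ _).trans ?_
    by_cases h : p ∈ {p : F | nrm p ≤ 1}
    · filter_upwards [Lp.coeFn_sub (v p) φ, hp, hφg] with y h1 h2 h3
      simp only [Pi.smul_apply, smul_eq_mul, cutOff, Set.indicator_of_mem h]
      rw [h1, Pi.sub_apply, h2, h3]
    · filter_upwards [hp] with y h2
      simp only [Pi.smul_apply, smul_eq_mul, cutOff, Set.indicator_of_notMem h, sub_zero]
      rw [h2]

/-- The regularized integral can be computed pointwise: by `h1` the pointwise integrands have a
common majorant, so the limit in `ε` exists for almost every `y`. -/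
lemma ae_tendsto_regInt {κ : F} (hκ : κ ≠ 0) {η C : ℝ} (hη : 0 < η) {c : ℂ} (hc : c.re = 0)
    (hc1 : ∃ x : F, x ≠ 0 ∧ npow x c ≠ 1) {φ : Lp ℂ 2 ν}
    {v : F → Lp ℂ 2 ν} (hv : AEStronglyMeasurable v μ)
    (hb : ∀ᵐ p ∂μ, ‖cutOff φ v p‖ ≤ C * majorant κ η p) {g : Y → ℂ} (hg : Measurable g)
    (hφg : φ =ᵐ[ν] g) {w : F → Y → ℂ} (hw : Measurable (Function.uncurry w))
    (hvw : ∀ᵐ p ∂μ, v p =ᵐ[ν] w p) :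
    ∀ᵐ y ∂ν, (∀ᶠ ε : ℝ in 𝓝[>] 0, Integrable (fun p => npow p (c + ε - 1) • w p y) μ) ∧
      Tendsto (fun ε : ℝ => ∫ p, npow p (c + ε - 1) • w p y ∂μ) (𝓝[>] 0)
        (𝓝 (regInt μ c φ v y)) := by
  have h1 := ae_integral_cutOff μ hκ hη hv hb hg hφg hw hvw (k := fun p => (powMajorant p : ℂ))
    (Complex.measurable_ofReal.comp measurable_powMajorant) fun p _ => by
      rw [Complex.norm_real, Real.norm_of_nonneg (powMajorant_nonneg p)]
  have h2 := ae_integral_cutOff μ hκ hη hv hb hg hφg hw hvw (measurable_npow (c - 1)) fun p hp =>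
    norm_npow_le_powMajorant hp hc.ge (by rw [hc]; norm_num)
  filter_upwards [h1, h2, hφg, Lp.coeFn_add (∫ p, npow p (c - 1) • cutOff φ v p ∂μ : Lp ℂ 2 ν)
    (unitReg μ c • φ), Lp.coeFn_smul (unitReg μ c) φ] with y hy1 hy2 hy3 hy4 hy5
  have hm : AEStronglyMeasurable (cutOff (g y) fun p => w p y) μ :=
    ((hw.comp (measurable_id.prodMk measurable_const)).sub
      (measurable_const.indicator (measurableSet_nrm_le 1))).aestronglyMeasurable
  have hle : ∀ a : ℂ, 0 ≤ a.re → a.re ≤ 1 / 4 → ∀ p : F, p ≠ 0 →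
      ‖npow p (a - 1) • cutOff (g y) (fun p => w p y) p‖ ≤
        ‖(powMajorant p : ℂ) * cutOff (g y) (fun p => w p y) p‖ := fun a h0 h1 p hp => by
    rw [norm_smul, norm_mul, Complex.norm_real, Real.norm_of_nonneg (powMajorant_nonneg p)]
    exact mul_le_mul_of_nonneg_right (norm_npow_le_powMajorant hp h0 h1) (norm_nonneg _)
  have hint : ∀ a : ℂ, 0 ≤ a.re → a.re ≤ 1 / 4 →
      Integrable (fun p => npow p (a - 1) • cutOff (g y) (fun p => w p y) p) μ := fun a h0 h1 =>
    hy1.1.norm.mono' ((measurable_npow _).aestronglyMeasurable.smul hm)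
      ((ae_ne μ 0).mono fun p hp => hle a h0 h1 p hp)
  refine ⟨(eventually_re_add hc).mono fun ε hε =>
    integrable_of_cutOff μ hε.1 (hint _ hε.1.le hε.2), ?_⟩
  have h3 : Tendsto (fun ε : ℝ => ∫ p, npow p (c + ε - 1) • cutOff (g y) (fun p => w p y) p ∂μ)
      (𝓝[>] 0) (𝓝 (∫ p, npow p (c - 1) • cutOff (g y) (fun p => w p y) p ∂μ)) := by
    refine tendsto_integral_filter_of_dominated_convergence _ (Eventually.of_forall fun ε =>
      (measurable_npow _).aestronglyMeasurable.smul hm) ?_ hy1.1.norm ?_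
    · filter_upwards [eventually_re_add hc] with ε hε
      exact (ae_ne μ 0).mono fun p hp => hle _ hε.1.le hε.2 p hp
    · filter_upwards [ae_ne μ 0] with p hp
      exact ((continuousAt_npow_exp hp _).tendsto.comp
        ((tendsto_add_ofReal c).sub_const 1)).smul_const _
  have h4 : regInt μ c φ v y = (∫ p, npow p (c - 1) • cutOff (g y) (fun p => w p y) p ∂μ) +
      unitReg μ c • g y := by
    rw [regInt]
    refine hy4.trans ?_
    rw [Pi.add_apply, hy2.2, hy5, Pi.smul_apply, hy3]
    rfl
  rw [h4]
  refine (h3.add ((tendsto_unitInt μ hc hc1).smul_const (g y))).congr' ?_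
  filter_upwards [eventually_re_add hc] with ε hε
  rw [integral_eq_cutOff_add μ hε.1 (hint _ hε.1.le hε.2)]

end Regularized

section QR

variable {F : Type*} [NontriviallyNormedField F] [ProperSpace F] [MeasurableSpace F] [BorelSpace F]
  (μ : Measure F) [μ.IsAddHaarMeasure] {n : ℕ} {t : Fin (n + 2) → F} {lam : Fin (n + 2) → ℂ}
  {d c lamInf : ℂ}

lemma gFun_zero_left (r : F) (f : (Fin n → F) → ℂ) (y : Fin n → F) :
    gFun t lam d 0 r f y = homExt d f fun j => gauge y j - t j * r := by
  have h := homExt_affine (one_ne_zero (α := F)) (b := t 0 * r) d f fun j => gauge y j - t j * r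
  rw [npow_one, one_mul] at h
  rw [← h, gFun]
  simp only [mul_zero, sub_zero, npow_one, Finset.prod_const_one, mul_one, div_one, shiftPt]
  congr 1
  ext j
  ring

lemma gFun_zero_right (ρ : F) (f : (Fin n → F) → ℂ) (y : Fin n → F) :
    gFun t lam d ρ 0 f y = homExt d f (fun j => gauge y j / (1 - gauge y j * ρ)) *
      ∏ j, npow (1 - gauge y j * ρ) (lam j) := by
  simp only [gFun, mul_zero, sub_zero]

lemma rIntegrand_eq (ε : ℝ) (f : (Fin n → F) → ℂ) (y : Fin n → F) {s : F}
    (hs : ∀ j, s ≠ gauge y j) : rIntegrand lam lamInf ε f y s =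
      npow s (lamInf - ε) • gFun t lam (degree lam lamInf) s⁻¹ 0 f y := by
  have hs0 : s ≠ 0 := by simpa using hs 0
  have h1 : (fun j => gauge y j / (1 - gauge y j * s⁻¹)) =
      fun j => s ^ 2 * (1 / (s - gauge y j)) + -s := by
    ext j
    have h2 : s - gauge y j ≠ 0 := sub_ne_zero.2 (hs j)
    have h3 : 1 - gauge y j * s⁻¹ = (s - gauge y j) / s := by
      rw [sub_div, div_self hs0, div_eq_mul_inv]
    rw [h3]
    field_simp
    ring
  have h5 : ∏ j, npow (s - gauge y j) (lam j) =
      npow s (∑ j, lam j) * ∏ j, npow (1 - gauge y j * s⁻¹) (lam j) := by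
    rw [← prod_npow _ hs0, ← Finset.prod_mul_distrib]
    refine Finset.prod_congr rfl fun j _ => ?_
    rw [← npow_mul, mul_sub, mul_one, mul_left_comm, mul_inv_cancel₀ hs0, mul_one]
  rw [rIntegrand, gFun_zero_right, h1, homExt_affine (pow_ne_zero 2 hs0), h5, npow_sq,
    show ∑ j, lam j = degree lam lamInf + degree lam lamInf + lamInf by rw [degree]; ring,
    npow_add hs0, npow_add hs0, sub_eq_add_neg, npow_add hs0, smul_eq_mul]
  ring

lemma qIntegrand_eq (ε : ℝ) (f : (Fin n → F) → ℂ) (y : Fin n → F) (s : F) :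
    qIntegrand t lam lamInf ε f y s =
      npow s (lamInf + ε) • gFun t lam (degree lam lamInf) 0 s f y := by
  rw [qIntegrand, gFun_zero_left, smul_eq_mul, mul_comm]

variable (hlam : ∀ j, (lam j).re = -1)
include hlam

lemma aesm_gOp_left (φ : HSpace n μ) :
    AEStronglyMeasurable (fun r => gOp μ t lam d 0 r φ) μ := by
  refine aesm_gOp μ hlam (T := {(gap t)⁻¹}) (Set.toFinite _) (fun s _ => continuousAt_const)
    (fun s _ => continuousAt_id) (fun s hs => good_zero_left fun h => hs ?_) φ
  exact eq_inv_of_mul_eq_one_right (sub_eq_zero.1 h).symm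

lemma aesm_gOp_right (φ : HSpace n μ) :
    AEStronglyMeasurable (fun p => gOp μ t lam d p 0 φ) μ := by
  refine aesm_gOp μ hlam (T := {1}) (Set.toFinite _) (fun s _ => continuousAt_id)
    (fun s _ => continuousAt_const) (fun s hs => good_zero_right fun h => hs ?_) φ
  exact (sub_eq_zero.1 h).symm

lemma ae_coeFn_gOp_left {φ : HSpace n μ} {g : (Fin n → F) → ℂ}
    (hg : φ =ᵐ[Measure.pi fun _ : Fin n => μ] g) : ∀ᵐ r ∂μ,
      gOp μ t lam d 0 r φ =ᵐ[Measure.pi fun _ : Fin n => μ] gFun t lam d 0 r g := by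
  filter_upwards [ae_ne μ (gap t)⁻¹] with r hr
  refine coeFn_gOp μ d hlam (good_zero_left fun h => hr ?_) hg
  exact eq_inv_of_mul_eq_one_right (sub_eq_zero.1 h).symm

lemma ae_coeFn_gOp_right {φ : HSpace n μ} {g : (Fin n → F) → ℂ}
    (hg : φ =ᵐ[Measure.pi fun _ : Fin n => μ] g) : ∀ᵐ p ∂μ,
      gOp μ t lam d p 0 φ =ᵐ[Measure.pi fun _ : Fin n => μ] gFun t lam d p 0 g := by
  filter_upwards [ae_ne μ 1] with p hp
  exact coeFn_gOp μ d hlam (good_zero_right fun h => hp (sub_eq_zero.1 h).symm) hg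

variable (hd : d.re = -((n + 1 : ℝ) / 2))
include hd

lemma exists_norm_cutOff_gOp_zero_le {φ : HSpace n μ}
    (hφ : φ ∈ testSpace n μ) : ∃ C η : ℝ, 0 < η ∧
      (∀ᵐ p ∂μ, ‖cutOff φ (fun p => gOp μ t lam d p 0 φ) p‖ ≤ C * majorant 1 η p) ∧
      (∀ᵐ r ∂μ, ‖cutOff φ (fun r => gOp μ t lam d 0 r φ) r‖ ≤ C * majorant (gap t) η r) := by
  obtain ⟨C, η₀, hC, hη₀, hL⟩ := exists_norm_gOp_sub_le μ (t := t) (d := d) hlam hφ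
  refine ⟨C + ‖φ‖ + ‖φ‖ / min η₀ 1, min η₀ 1, by positivity, ?_, ?_⟩
  · filter_upwards [ae_ne μ 1] with p hp
    have hgood : Good t p 0 := good_zero_right fun h => hp (sub_eq_zero.1 h).symm
    refine norm_cutOff_le (by positivity) (min_le_right _ _) hC (norm_nonneg φ) (fun h => ?_)
      fun _ => ?_
    · simpa using hL p 0 (h.trans (min_le_left _ _)) (by simpa using hη₀.le) hgood
    · rw [norm_gOp μ hlam hd hgood]
      simp only [mul_zero, zero_mul, sub_zero, nrm_one, Real.one_rpow, Finset.prod_const_one,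
        mul_one, one_mul]
      rw [mul_comm]
      refine mul_le_mul_of_nonneg_left ?_ (norm_nonneg φ)
      exact le_add_of_nonneg_right (Real.rpow_nonneg (nrm_nonneg _) _)
  · filter_upwards [ae_ne μ (gap t)⁻¹] with r hr
    have hgood : Good t 0 r := good_zero_left fun h => hr
      (eq_inv_of_mul_eq_one_right (sub_eq_zero.1 h).symm)
    refine norm_cutOff_le (by positivity) (min_le_right _ _) hC (norm_nonneg φ) (fun h => ?_)
      fun _ => ?_
    · simpa using hL 0 r (by simpa using hη₀.le) (h.trans (min_le_left _ _)) hgood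
    · rw [norm_gOp μ hlam hd hgood]
      simp only [mul_zero, sub_zero, nrm_one, Real.one_rpow, Finset.prod_const_one,
        mul_one]
      rw [mul_comm]
      refine mul_le_mul_of_nonneg_left ?_ (norm_nonneg φ)
      exact le_add_of_nonneg_right (Real.rpow_nonneg (nrm_nonneg _) _)

omit hd
variable (hc : c.re = 0) (hc1 : ∃ x : F, x ≠ 0 ∧ npow x c ≠ 1)
include hc hc1

lemma regInt_gOp_right (φ : HSpace n μ) : regInt μ c φ (fun p => gOp μ t lam d p 0 φ) =
    regInt μ c φ (betaVec (repR μ t lam) (-d + lam (Fin.last (n + 1)) - n / 2) φ) := by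
  rw [regInt, regInt]
  congr 1
  refine integral_congr_ae ?_
  filter_upwards [ae_ne μ 1] with p hp
  have h := gOp_zero_right μ (t := t) (lam := lam) (d := d) (sub_ne_zero.2 hp.symm)
  rw [sub_sub_cancel] at h
  simp only [cutOff, betaVec, h, smul_apply]

include hd in
lemma regInt_gOp_left (hgap : gap t ≠ 0) {φ : HSpace n μ} (hφ : φ ∈ testSpace n μ) :
    npow (gap t) c • regInt μ c φ (fun r => gOp μ t lam d 0 r φ) =
      regInt μ c φ (betaVec (repQ μ t lam) (d + n / 2) φ) := by
  obtain ⟨C, η, hη, -, hb⟩ := exists_norm_cutOff_gOp_zero_le μ hlam hd hφ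
  have h1 := tendsto_regInt μ hgap hη hc hc1 (aesm_gOp_left μ hlam φ) hb
  have hρ : (d + n / 2).re = -(1 / 2) := by simp [hd]; ring
  have h2 := tendsto_betaOp μ (isUnitaryRep_repQ μ hlam hgap) (isLipVector_repQ μ hlam hgap hφ) hρ hc
    hc1 le_rfl zero_le_one
  have h3 : Tendsto (fun ε : ℝ => npow (gap t) (c + ε)) (𝓝[>] 0) (𝓝 (npow (gap t) c)) :=
    (continuousAt_npow_exp hgap c).tendsto.comp (tendsto_add_ofReal c)
  refine tendsto_nhds_unique (h3.smul h1) (h2.congr fun ε => ?_)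
  rw [betaOp_eq_integral_betaVec, ← integral_npow_smul_scale μ _ hgap]
  congr 1
  refine integral_congr_ae ?_
  filter_upwards [ae_ne μ (gap t)⁻¹] with r hr
  have hw : 1 - gap t * r ≠ 0 := fun h => hr (eq_inv_of_mul_eq_one_right (sub_eq_zero.1 h).symm)
  have h := gOp_zero_left μ (lam := lam) (d := d) hgap hw
  rw [sub_sub_cancel, mul_div_cancel_left₀ _ hgap] at h
  simp only [betaVec, h, smul_apply, Complex.ofReal_zero, zero_mul, sub_zero]

omit hc hc1

include hd in
/-- The unitary operators `Q`: the substitution `w = 1 - gap t * r` gives a regularized beta operator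
of `repQ`. The operator for the second set of parameters is the inverse. -/
lemma exists_Q (hμ : IsNormalizedHaar μ) {e : AddChar F Circle} (he : Continuous e) (he1 : e ≠ 1)
    (hc : c.re = 0) (hc1 : ∃ x : F, x ≠ 0 ∧ npow x c ≠ 1) (hgap : gap t ≠ 0) :
    ∃ V : HSpace n μ ≃ₗᵢ[ℂ] HSpace n μ, (∀ φ ∈ testSpace n μ,
      regInt μ c φ (fun r => gOp μ t lam d 0 r φ) = gammaF e μ c • V φ) ∧
      ∀ φ ∈ testSpace n μ,
        regInt μ (-c) φ (fun r => gOp μ t lam (d + c) 0 r φ) = gammaF e μ (-c) • V.symm φ := by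
  have hc1' : ∃ x : F, x ≠ 0 ∧ npow x (-c) ≠ 1 := by
    obtain ⟨x, hx, h⟩ := hc1
    exact ⟨x, hx, by rwa [npow_neg, Ne, inv_eq_one]⟩
  have hκ := npow_ne_zero hgap c
  have hκ' := npow_ne_zero hgap (-c)
  have hρ : (d + n / 2).re = -(1 / 2) := by simp [hd]; ring
  have hg := tendsto_betaF_div μ he he1 hμ hc hc1
  obtain ⟨V, hV1, hV2⟩ := exists_unitary μ hμ (isUnitaryRep_repQ μ hlam hgap) (testSpace n μ)
    (dense_testSpace μ) (fun φ hφ => isLipVector_repQ μ hlam hgap hφ) hρ hc hc1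
    (γ := npow (gap t) c * gammaF e μ c) (γ' := npow (gap t) (-c) * gammaF e μ (-c))
    (mul_ne_zero hκ (gammaF_ne_zero μ he he1 hc hc1))
    (by rw [map_mul, conj_npow, conj_eq_neg_of_re hc, gammaF_neg μ he he1 hc hc1]) (by
      have h : npow (gap t) c * npow (gap t) (-c) = 1 := by
        rw [npow_neg, mul_inv_cancel₀ hκ]
      rwa [mul_mul_mul_comm, h, one_mul])
  refine ⟨V, fun φ hφ => ?_, fun φ hφ => ?_⟩
  · have h := hV1 φ hφ
    rw [← regInt_gOp_left μ hlam hd hc hc1 hgap hφ, mul_smul] at h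
    exact smul_right_injective _ hκ h
  · have h := hV2 φ hφ
    rw [show d + n / 2 + c = d + c + n / 2 by ring,
      ← regInt_gOp_left μ hlam (by simp [hd, hc]) (by simp [hc]) hc1' hgap hφ, mul_smul] at h
    exact smul_right_injective _ hκ' h

include hd in
/-- The unitary operators `R`: the substitution `w = 1 - p` gives a regularized beta operator of
`repR`. The operator for the second set of parameters is the inverse. -/
lemma exists_R (hμ : IsNormalizedHaar μ) {e : AddChar F Circle} (he : Continuous e) (he1 : e ≠ 1)
    (hc : c.re = 0) (hc1 : ∃ x : F, x ≠ 0 ∧ npow x c ≠ 1) :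
    ∃ V : HSpace n μ ≃ₗᵢ[ℂ] HSpace n μ, (∀ φ ∈ testSpace n μ,
      regInt μ (-c) φ (fun p => gOp μ t lam d p 0 φ) = gammaF e μ (-c) • V φ) ∧
      ∀ φ ∈ testSpace n μ,
        regInt μ c φ (fun p => gOp μ t lam (d + c) p 0 φ) = gammaF e μ c • V.symm φ := by
  have hc1' : ∃ x : F, x ≠ 0 ∧ npow x (-c) ≠ 1 := by
    obtain ⟨x, hx, h⟩ := hc1
    exact ⟨x, hx, by rwa [npow_neg, Ne, inv_eq_one]⟩
  have hc' : (-c).re = 0 := by simp [hc]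
  have hρ : (-d + lam (Fin.last (n + 1)) - n / 2).re = -(1 / 2) := by
    simp [hd, hlam]; ring
  have hg := tendsto_betaF_div μ he he1 hμ hc' hc1'
  have hconj := gammaF_neg μ he he1 hc' hc1'
  obtain ⟨V, hV1, hV2⟩ := exists_unitary μ hμ (isUnitaryRep_repR μ (t := t) hlam) (testSpace n μ)
    (dense_testSpace μ) (fun φ hφ => isLipVector_repR μ hlam hφ) hρ hc' hc1'
    (gammaF_ne_zero μ he he1 hc' hc1') hconj hg
  rw [neg_neg] at hV2
  refine ⟨V, fun φ hφ => ?_, fun φ hφ => ?_⟩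
  · rw [regInt_gOp_right μ hlam hc' hc1', hV1 φ hφ]
  · rw [regInt_gOp_right μ hlam hc hc1, ← hV2 φ hφ]
    congr 2
    ring

lemma isQ_of_eq {e : AddChar F Circle} (hlamInf : lamInf.re = -1)
    (hc1 : ∃ x : F, x ≠ 0 ∧ npow x (lamInf + 1) ≠ 1) (hgap : gap t ≠ 0)
    (hγ : gammaF e μ (lamInf + 1) ≠ 0) {T : HSpace n μ ≃ₗᵢ[ℂ] HSpace n μ}
    (hT : ∀ φ ∈ testSpace n μ, regInt μ (lamInf + 1) φ
      (fun r => gOp μ t lam (degree lam lamInf) 0 r φ) = gammaF e μ (lamInf + 1) • T φ) :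
    IsQ e μ t lam lamInf T := by
  intro g φ hg hφ
  have hφS : φ ∈ testSpace n μ := ⟨g, hg, hφ⟩
  obtain ⟨C, η, hη, -, hb⟩ :=
    exists_norm_cutOff_gOp_zero_le μ hlam (degree_re hlam hlamInf) hφS
  have h := ae_tendsto_regInt μ hgap hη (by simp [hlamInf]) hc1 (aesm_gOp_left μ hlam φ) hb
    hg.continuous.measurable hφ (measurable_gFun hg.continuous.measurable measurable_const
      measurable_id) (ae_coeFn_gOp_left μ hlam hφ)
  rw [hT φ hφS] at h
  filter_upwards [h, Lp.coeFn_smul (gammaF e μ (lamInf + 1)) (T φ)] with y hy hy2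
  have e1 : ∀ ε : ℝ, qIntegrand t lam lamInf ε g y = fun s =>
      npow s (lamInf + 1 + ε - 1) • gFun t lam (degree lam lamInf) 0 s g y := fun ε => by
    ext s
    rw [qIntegrand_eq, show lamInf + 1 + ε - 1 = lamInf + ε by ring]
  simp only [e1]
  refine ⟨hy.1, ?_⟩
  have h2 := hy.2.const_mul (gammaF e μ (lamInf + 1))⁻¹
  rwa [hy2, Pi.smul_apply, smul_eq_mul, inv_mul_cancel_left₀ hγ] at h2

lemma isR_of_eq {e : AddChar F Circle} (hlamInf : lamInf.re = -1)
    (hc1 : ∃ x : F, x ≠ 0 ∧ npow x (-lamInf - 1) ≠ 1)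
    (hγ : gammaF e μ (-lamInf - 1) ≠ 0) {T : HSpace n μ ≃ₗᵢ[ℂ] HSpace n μ}
    (hT : ∀ φ ∈ testSpace n μ, regInt μ (-lamInf - 1) φ
      (fun p => gOp μ t lam (degree lam lamInf) p 0 φ) = gammaF e μ (-lamInf - 1) • T φ) :
    IsR e μ lam lamInf T := by
  intro g φ hg hφ
  have hφS : φ ∈ testSpace n μ := ⟨g, hg, hφ⟩
  obtain ⟨C, η, hη, hb, -⟩ :=
    exists_norm_cutOff_gOp_zero_le μ (t := t) hlam (degree_re hlam hlamInf) hφS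
  have h := ae_tendsto_regInt μ one_ne_zero hη (by simp [hlamInf]) hc1 (aesm_gOp_right μ hlam φ) hb
    (w := fun p y => gFun t lam (degree lam lamInf) p 0 g y)
    hg.continuous.measurable hφ (measurable_gFun hg.continuous.measurable measurable_id
      measurable_const) (ae_coeFn_gOp_right μ hlam hφ)
  rw [hT φ hφS] at h
  filter_upwards [h, Lp.coeFn_smul (gammaF e μ (-lamInf - 1)) (T φ)] with y hy hy2
  have e1 : ∀ ε : ℝ, rIntegrand lam lamInf ε g y =ᵐ[μ] fun s => npow s (lamInf + 1 - ε - 1) •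
      gFun t lam (degree lam lamInf) s⁻¹ 0 g y := fun ε => by
    filter_upwards [ae_notMem_finite μ (Set.finite_range (gauge y))] with s hs
    rw [rIntegrand_eq (t := t) ε g y fun j h => hs ⟨j, h.symm⟩,
      show lamInf + 1 - ε - 1 = lamInf - ε by ring]
  have e2 : ∀ ε : ℝ, (fun p => npow p (-lamInf - 1 + ε - 1) •
      gFun t lam (degree lam lamInf) p 0 g y) = fun p => npow p (-(lamInf + 1 - ε) - 1) •
        (fun s => gFun t lam (degree lam lamInf) s⁻¹ 0 g y) p⁻¹ := fun ε => by
    ext p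
    simp only [inv_inv]
    congr 2
    ring
  simp only [e2] at hy
  refine ⟨hy.1.mono fun ε h => ?_, ?_⟩
  · have h' := (integrable_npow_smul_inv μ (lamInf + 1 - ε)
      (f := fun s => gFun t lam (degree lam lamInf) s⁻¹ 0 g y)).1 h
    exact h'.congr (e1 ε).symm
  · have h2 := hy.2.const_mul (gammaF e μ (-lamInf - 1))⁻¹
    rw [hy2, Pi.smul_apply, smul_eq_mul, inv_mul_cancel_left₀ hγ] at h2
    refine h2.congr fun ε => ?_
    have h3 := integral_npow_smul_inv μ (lamInf + 1 - ε)
      fun s => gFun t lam (degree lam lamInf) s⁻¹ 0 g y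
    rw [h3, integral_congr_ae (e1 ε)]

end QR



/-! ### The operator `M` and the asymptotics of the Hecke operators -/

section Limit

variable {F : Type*} [NontriviallyNormedField F] [ProperSpace F] [MeasurableSpace F] [BorelSpace F]
  (μ : Measure F) [μ.IsAddHaarMeasure] {n : ℕ} {t : Fin (n + 2) → F} {lam : Fin (n + 2) → ℂ}
  {d c : ℂ}

variable (t lam d c) in
/-- The cut-off integral of `gOp 0 r`, without the regularized multiple of `φ`. -/
noncomputable def cutVecQ (φ : HSpace n μ) : HSpace n μ :=
  ∫ r, npow r (c - 1) • cutOff φ (fun r => gOp μ t lam d 0 r φ) r ∂μ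

variable (t lam d c) in
/-- The cut-off integral of `gOp p 0`, without the regularized multiple of `φ`. -/
noncomputable def cutVecR (φ : HSpace n μ) : HSpace n μ :=
  ∫ p, npow p (-c - 1) • cutOff φ (fun p => gOp μ t lam d p 0 φ) p ∂μ

variable (hlam : ∀ j, (lam j).re = -1) (hd : d.re = -((n + 1 : ℝ) / 2)) (hc : c.re = 0)
include hlam hd hc

lemma integrable_cutVecQ (hgap : gap t ≠ 0) {φ : HSpace n μ} (hφ : φ ∈ testSpace n μ) :
    Integrable (fun r => npow r (c - 1) • cutOff φ (fun r => gOp μ t lam d 0 r φ) r) μ := by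
  obtain ⟨C, η, hη, -, hb⟩ := exists_norm_cutOff_gOp_zero_le μ (t := t) hlam hd hφ
  exact integrable_npow_smul μ hgap hη hc.ge (by rw [hc]; norm_num)
    (aesm_cutOff μ (aesm_gOp_left μ hlam φ)) hb

lemma integrable_cutVecR {φ : HSpace n μ} (hφ : φ ∈ testSpace n μ) :
    Integrable (fun p => npow p (-c - 1) • cutOff φ (fun p => gOp μ t lam d p 0 φ) p) μ := by
  obtain ⟨C, η, hη, hb, -⟩ := exists_norm_cutOff_gOp_zero_le μ (t := t) hlam hd hφ
  exact integrable_npow_smul μ one_ne_zero hη (by simp [hc]) (by simp [hc])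
    (aesm_cutOff μ (aesm_gOp_right μ hlam φ)) hb

lemma tendsto_heckeVec_sub (hgap : gap t ≠ 0) {φ : HSpace n μ} (hφ : φ ∈ testSpace n μ) :
    Tendsto (fun x => heckeVec μ t lam d c x φ - (npow x c • cutVecQ μ t lam d c φ +
      cutVecR μ t lam d c φ + (sphereVol μ + annInt μ x c) • φ)) (cobounded F) (𝓝 0) := by
  obtain ⟨C, η, hη, hbR, hbQ⟩ := exists_norm_cutOff_gOp_le μ (t := t) hlam hd hφ
  have hinv : ∀ p : F, Tendsto (fun x : F => x⁻¹ * p⁻¹) (cobounded F) (𝓝 0) := fun p => by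
    simpa using (tendsto_inv_cobounded (F := F)).mul_const p⁻¹
  have hne : ∀ a : F, ∀ᶠ x : F in cobounded F, x ≠ a := fun a =>
    (tendsto_norm_cobounded_atTop.eventually_gt_atTop ‖a‖).mono fun x hx h => by
      rw [h] at hx; exact lt_irrefl _ hx
  refine tendsto_integral_two_parameter μ hc hgap hη (v := fun ρ r => gOp μ t lam d ρ r φ)
    ?_ ?_ ?_ hbR hbQ ?_ ?_
  · filter_upwards [eventually_ne_midPt (t := t)] with x hx
    exact aesm_gOp_R μ hlam hx.2 hx.1 φ
  · filter_upwards [eventually_ne_midPt (t := t)] with x hx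
    exact aesm_gOp_Q μ hlam hx.2 hx.1 φ
  · filter_upwards [eventually_ne_midPt (t := t), hne (gap t)] with x hx hxg
    exact integrable_heckeVec μ hlam hd hc hgap ⟨hx.1, hxg, hx.2⟩ φ
  · filter_upwards [ae_ne μ 1] with p hp
    exact tendsto_gOp μ hlam tendsto_const_nhds (hinv p)
      (good_zero_right fun h => hp (sub_eq_zero.1 h).symm) φ
  · filter_upwards [ae_ne μ (gap t)⁻¹] with r hr
    exact tendsto_gOp μ hlam (hinv r) tendsto_const_nhds
      (good_zero_left fun h => hr (eq_inv_of_mul_eq_one_right (sub_eq_zero.1 h).symm)) φ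

/-- For a nontrivial character `‖·‖ ^ c` the multiple of `φ` in the asymptotics is absorbed by the
regularized integrals. -/
lemma tendsto_heckeVec_sub_regInt (hc1 : ∃ x : F, x ≠ 0 ∧ npow x c ≠ 1) (hgap : gap t ≠ 0)
    {φ : HSpace n μ} (hφ : φ ∈ testSpace n μ) :
    Tendsto (fun x => heckeVec μ t lam d c x φ -
      (npow x c • regInt μ c φ (fun r => gOp μ t lam d 0 r φ) +
        regInt μ (-c) φ (fun p => gOp μ t lam d p 0 φ))) (cobounded F) (𝓝 0) := by
  refine (tendsto_heckeVec_sub μ hlam hd hc hgap hφ).congr' ?_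
  filter_upwards [tendsto_nrm_cobounded.eventually_ge_atTop 1] with x hx
  congr 1
  have hQ : regInt μ c φ (fun r => gOp μ t lam d 0 r φ) =
      cutVecQ μ t lam d c φ + unitReg μ c • φ := rfl
  have hR : regInt μ (-c) φ (fun p => gOp μ t lam d p 0 φ) =
      cutVecR μ t lam d c φ + unitReg μ (-c) • φ := rfl
  rw [← npow_sub_one_mul_unitReg μ hc hc1 hx, ← unitReg_add_neg μ hc hc1, hQ, hR]
  module

omit hc in
/-- The operator `M` on test functions. -/
lemma exists_M (hgap : gap t ≠ 0) : ∃ M : testSpace n μ →ₗ[ℂ] HSpace n μ, ∀ φ : testSpace n μ,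
    M φ = cutVecQ μ t lam d 0 (φ : HSpace n μ) + cutVecR μ t lam d 0 (φ : HSpace n μ) +
      (sphereVol μ : ℂ) • (φ : HSpace n μ) := by
  have h0 : (0 : ℂ).re = 0 := rfl
  have hcut : ∀ (φ ψ : HSpace n μ) (v w : F → HSpace n μ) (p : F),
      cutOff (φ + ψ) (fun p => v p + w p) p = cutOff φ v p + cutOff ψ w p := fun φ ψ v w p => by
    by_cases h : p ∈ {p : F | nrm p ≤ 1}
    · simp only [cutOff, Set.indicator_of_mem h]; abel
    · simp only [cutOff, Set.indicator_of_notMem h]; abel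
  have hcut' : ∀ (z : ℂ) (φ : HSpace n μ) (v : F → HSpace n μ) (p : F),
      cutOff (z • φ) (fun p => z • v p) p = z • cutOff φ v p := fun z φ v p => by
    by_cases h : p ∈ {p : F | nrm p ≤ 1}
    · simp only [cutOff, Set.indicator_of_mem h, smul_sub]
    · simp only [cutOff, Set.indicator_of_notMem h, sub_zero]
  refine ⟨{ toFun := fun φ => cutVecQ μ t lam d 0 (φ : HSpace n μ) +
              cutVecR μ t lam d 0 (φ : HSpace n μ) + (sphereVol μ : ℂ) • (φ : HSpace n μ)
            map_add' := fun φ ψ => ?_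
            map_smul' := fun z φ => ?_ }, fun φ => rfl⟩
  · have h1 : cutVecQ μ t lam d 0 ((φ : HSpace n μ) + ψ) =
        cutVecQ μ t lam d 0 (φ : HSpace n μ) + cutVecQ μ t lam d 0 (ψ : HSpace n μ) := by
      rw [cutVecQ, cutVecQ, cutVecQ, ← integral_add (integrable_cutVecQ μ hlam hd h0 hgap φ.2)
        (integrable_cutVecQ μ hlam hd h0 hgap ψ.2)]
      simp only [map_add, hcut, smul_add]
    have h2 : cutVecR μ t lam d 0 ((φ : HSpace n μ) + ψ) =
        cutVecR μ t lam d 0 (φ : HSpace n μ) + cutVecR μ t lam d 0 (ψ : HSpace n μ) := by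
      rw [cutVecR, cutVecR, cutVecR, ← integral_add (integrable_cutVecR μ hlam hd h0 φ.2)
        (integrable_cutVecR μ hlam hd h0 ψ.2)]
      simp only [map_add, hcut, smul_add]
    rw [Submodule.coe_add, h1, h2]
    module
  · have h1 : cutVecQ μ t lam d 0 (z • (φ : HSpace n μ)) =
        z • cutVecQ μ t lam d 0 (φ : HSpace n μ) := by
      rw [cutVecQ, cutVecQ, ← integral_smul]
      simp only [map_smul, hcut', smul_comm z]
    have h2 : cutVecR μ t lam d 0 (z • (φ : HSpace n μ)) =
        z • cutVecR μ t lam d 0 (φ : HSpace n μ) := by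
      rw [cutVecR, cutVecR, ← integral_smul]
      simp only [map_smul, hcut', smul_comm z]
    rw [Submodule.coe_smul, h1, h2, RingHom.id_apply]
    module

omit hd hc in
/-- The integral that defines `M` is the sum of the two cut-off integrals; on the unit sphere the
function `φ` is subtracted twice. -/
lemma isM_of_eq (hgap : gap t ≠ 0) {M : testSpace n μ →ₗ[ℂ] HSpace n μ}
    (hM : ∀ φ : testSpace n μ, M φ = cutVecQ μ t lam (degree lam (-1)) 0 (φ : HSpace n μ) +
      cutVecR μ t lam (degree lam (-1)) 0 (φ : HSpace n μ) +
      (sphereVol μ : ℂ) • (φ : HSpace n μ)) : IsM μ t lam M := by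
  rintro g ⟨φ, hφS⟩ hg hφ
  change φ =ᵐ[Measure.pi fun _ : Fin n => μ] g at hφ
  have hd : (degree lam (-1)).re = -((n + 1 : ℝ) / 2) := degree_re hlam (by simp)
  set d := degree lam (-1) with hdd
  obtain ⟨C, η, hη, hbR, hbQ⟩ := exists_norm_cutOff_gOp_zero_le μ (t := t) hlam hd hφS
  have hgm := hg.continuous.measurable
  have hk : ∀ a : ℂ, a.re = 0 → ∀ p : F, p ≠ 0 → ‖npow p (a - 1)‖ ≤ powMajorant p := fun a ha p hp =>
    norm_npow_le_powMajorant hp ha.ge (by rw [ha]; norm_num)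
  have hQ := ae_integral_cutOff μ hgap hη (aesm_gOp_left μ hlam φ) hbQ hgm hφ
    (w := fun r y => gFun t lam d 0 r g y)
    (measurable_gFun hgm measurable_const measurable_id) (ae_coeFn_gOp_left μ hlam hφ)
    (measurable_npow (0 - 1)) (hk 0 rfl)
  have hR := ae_integral_cutOff μ one_ne_zero hη (aesm_gOp_right μ hlam φ) hbR hgm hφ
    (w := fun p y => gFun t lam d p 0 g y)
    (measurable_gFun hgm measurable_id measurable_const) (ae_coeFn_gOp_right μ hlam hφ)
    (measurable_npow (-0 - 1)) (hk (-0) (by simp))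
  filter_upwards [hQ, hR, hφ, Lp.coeFn_add (cutVecQ μ t lam d 0 φ + cutVecR μ t lam d 0 φ)
    ((sphereVol μ : ℂ) • φ), Lp.coeFn_add (cutVecQ μ t lam d 0 φ) (cutVecR μ t lam d 0 φ),
    Lp.coeFn_smul (sphereVol μ : ℂ) φ] with y hy1 hy2 hy3 hy4 hy5 hy6
  set q : F → ℂ := cutOff (g y) fun r => gFun t lam d 0 r g y with hq
  set k : F → ℂ := cutOff (g y) fun p => gFun t lam d p 0 g y with hk'
  have i2 : Integrable (fun s => npow s (0 - 1) • k s⁻¹) μ := by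
    rw [← integrable_npow_smul_inv]
    simpa only [inv_inv, smul_eq_mul] using hy2.1
  have e2 : ∫ s, npow s (0 - 1) • k s⁻¹ ∂μ = ∫ p, npow p (-0 - 1) * k p ∂μ := by
    rw [← integral_npow_smul_inv]
    simp only [inv_inv, smul_eq_mul]
  have hS : MeasurableSet {p : F | nrm p = 1} :=
    measurableSet_eq_fun measurable_nrm measurable_const
  have hSfin : IntegrableOn (fun p : F => npow p (0 - 1)) {p | nrm p = 1} μ := by
    refine (integrableOn_npow_annulus_one μ 1 0).mono_set fun p hp => ?_
    have hp' : nrm p = 1 := hp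
    simp [hp']
  have i3 : Integrable (fun s => {p : F | nrm p = 1}.indicator
      (fun s => npow s (0 - 1) * g y) s) μ := (integrable_indicator_iff hS).2 (hSfin.mul_const _)
  have e3 : ∫ s, {p : F | nrm p = 1}.indicator (fun s => npow s (0 - 1) * g y) s ∂μ =
      sphereVol μ * g y := by
    rw [integral_indicator hS, integral_mul_const, integral_sphere]
  have hae : mIntegrand t lam g y =ᵐ[μ] fun s => (npow s (0 - 1) * q s + npow s (0 - 1) • k s⁻¹) +
      {p : F | nrm p = 1}.indicator (fun s => npow s (0 - 1) * g y) s := by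
    filter_upwards [ae_ne μ 0] with s hs
    have hsp := nrm_pos hs
    rw [mIntegrand, ← gFun_zero_left (lam := lam), ← gFun_zero_right (t := t), ← hdd, zero_sub,
      hq, hk', smul_eq_mul]
    rcases lt_trichotomy (nrm s) 1 with h | h | h
    · have m1 : s ∈ {p : F | nrm p ≤ 1} := h.le
      have m2 : s⁻¹ ∉ {p : F | nrm p ≤ 1} := by
        simp only [Set.mem_ofPred_eq, nrm_inv, not_le]
        exact (one_lt_inv₀ hsp).2 h
      have m3 : s ∉ {p : F | nrm p = 1} := h.ne
      simp only [cutOff, Set.indicator_of_mem m1, Set.indicator_of_notMem m2,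
        Set.indicator_of_notMem m3]
      ring
    · have m1 : s ∈ {p : F | nrm p ≤ 1} := h.le
      have m2 : s⁻¹ ∈ {p : F | nrm p ≤ 1} := by
        simp only [Set.mem_ofPred_eq, nrm_inv, h, inv_one, le_refl]
      have m3 : s ∈ {p : F | nrm p = 1} := h
      simp only [cutOff, Set.indicator_of_mem m1, Set.indicator_of_mem m2,
        Set.indicator_of_mem m3]
      ring
    · have m1 : s ∉ {p : F | nrm p ≤ 1} := not_le.2 h
      have m2 : s⁻¹ ∈ {p : F | nrm p ≤ 1} := by
        simp only [Set.mem_ofPred_eq, nrm_inv]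
        exact inv_le_one_of_one_le₀ h.le
      have m3 : s ∉ {p : F | nrm p = 1} := h.ne'
      simp only [cutOff, Set.indicator_of_notMem m1, Set.indicator_of_mem m2,
        Set.indicator_of_notMem m3]
      ring
  refine ⟨((hy1.1.add i2).add i3).congr hae.symm, ?_⟩
  have e4 := integral_add (hy1.1.add i2) i3
  simp only [Pi.add_apply] at e4
  rw [integral_congr_ae hae, e4, integral_add hy1.1 i2, e2, e3, ← hy3, ← hy1.2, ← hy2.2, hM]
  refine hy4.trans ?_
  rw [Pi.add_apply, hy5, hy6, Pi.add_apply, Pi.smul_apply, smul_eq_mul]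
  rfl

end Limit

section Comparison

open Asymptotics

variable {F : Type*} [NontriviallyNormedField F] [ProperSpace F] [MeasurableSpace F] [BorelSpace F]
  {n : ℕ} (t : Fin (n + 2) → F) (lam : Fin (n + 2) → ℂ) (c : ℂ)

/-- The factor by which the scalar factor of the Hecke operator at the point `z + t 0` differs from
`‖z + t 0‖ ^ ((1 - c) / 2)`. -/
noncomputable def heckeErr (z : F) : ℂ := npow (1 + t 0 * z⁻¹) (-((1 - c) / 2)) *
  ∏ j, npow (1 - shiftPt t j * z⁻¹) (-lam j / 2)

variable {t lam c}

lemma isBigO_one_sub_inv (a : F) :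
    (fun z : F => (1 + a * z⁻¹) - 1) =O[cobounded F] fun z => z⁻¹ :=
  ((isBigO_refl (fun z : F => z⁻¹) _).const_mul_left a).congr_left fun z => by ring

lemma isBigO_heckeErr_sub_one :
    (fun z : F => heckeErr t lam c z - 1) =O[cobounded F] fun z => z⁻¹ := by
  refine isBigO_mul_sub_one tendsto_inv_cobounded
    (isBigO_npow_sub_one tendsto_inv_cobounded (isBigO_one_sub_inv _) _)
    (isBigO_prod_sub_one tendsto_inv_cobounded _ fun j =>
      isBigO_npow_sub_one tendsto_inv_cobounded ?_ _)
  simpa only [neg_mul, ← sub_eq_add_neg] using isBigO_one_sub_inv (-shiftPt t j)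

lemma tendsto_heckeErr : Tendsto (heckeErr t lam c) (cobounded F) (𝓝 1) := by
  simpa using ((isBigO_heckeErr_sub_one (t := t) (lam := lam) (c := c)).trans_tendsto
    tendsto_inv_cobounded).add_const 1

lemma tendsto_npow_one_add (a : F) (w : ℂ) :
    Tendsto (fun z : F => npow (1 + a * z⁻¹) w) (cobounded F) (𝓝 1) := by
  simpa using ((isBigO_npow_sub_one tendsto_inv_cobounded (isBigO_one_sub_inv a) w).trans_tendsto
    tendsto_inv_cobounded).add_const 1

lemma add_eq_mul_one_add {z : F} (hz : z ≠ 0) (a : F) : z + a = z * (1 + a * z⁻¹) := by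
  rw [mul_add, mul_one, mul_left_comm, mul_inv_cancel₀ hz, mul_one]

lemma npow_mul_heckeConst {z : F} (hz : z ≠ 0) (hz' : z + t 0 ≠ 0) :
    npow (z + t 0) (-1 / 2) * heckeConst t lam c z =
      npow (z + t 0) (-c / 2) * heckeErr t lam c z := by
  have h1 : 1 + t 0 * z⁻¹ ≠ 0 := by
    intro h
    rw [add_eq_mul_one_add hz, h, mul_zero] at hz'
    exact hz' rfl
  have h2 : npow z ((1 - c) / 2) =
      npow (z + t 0) ((1 - c) / 2) * npow (1 + t 0 * z⁻¹) (-((1 - c) / 2)) := by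
    rw [add_eq_mul_one_add hz, npow_mul, npow_neg, mul_assoc,
      mul_inv_cancel₀ (npow_ne_zero h1 _), mul_one]
  rw [heckeConst, heckeErr, h2, ← mul_assoc, ← mul_assoc, ← npow_add hz', ← mul_assoc]
  congr 3
  ring

lemma tendsto_log_mul_inv : Tendsto (fun z : F => Real.log (nrm z) * ‖z⁻¹‖) (cobounded F) (𝓝 0) := by
  have h1 : Tendsto (fun y : ℝ => Real.log y * y⁻¹) atTop (𝓝 0) := by
    simpa [div_eq_mul_inv] using Real.isLittleO_log_id_atTop.tendsto_div_nhds_zero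
  have h2 := ((h1.comp (tendsto_norm_cobounded_atTop (E := F))).const_mul (nrmExp F))
  rw [mul_zero] at h2
  refine h2.congr' ?_
  filter_upwards [tendsto_norm_cobounded_atTop.eventually_gt_atTop 0] with z hz
  rw [nrm_eq_rpow, Real.log_rpow hz, norm_inv, Function.comp_apply, mul_assoc]

variable {H : Type*} [NormedAddCommGroup H] [NormedSpace ℂ H]

lemma eventually_ne_zero_add : ∀ᶠ z : F in cobounded F, z ≠ 0 ∧ z + t 0 ≠ 0 := by
  have hne : ∀ a : F, ∀ᶠ x : F in cobounded F, x ≠ a := fun a =>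
    (tendsto_norm_cobounded_atTop.eventually_gt_atTop ‖a‖).mono fun x hx h => by
      rw [h] at hx; exact lt_irrefl _ hx
  filter_upwards [hne 0, hne (-t 0)] with z h1 h2
  exact ⟨h1, fun h => h2 (eq_neg_of_add_eq_zero_left h)⟩

/-- Passage from the translated variable to `x` in the asymptotics, for a nontrivial character. -/
lemma tendsto_smul_heckeConst (hc : c.re = 0) {f : F → H} {q r : H}
    (hf : Tendsto (fun z => f z - (npow z c • q + r)) (cobounded F) (𝓝 0)) :
    Tendsto (fun z => npow (z + t 0) (-1 / 2) • heckeConst t lam c z • f z -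
      (npow (z + t 0) (c / 2) • q + npow (z + t 0) (-c / 2) • r)) (cobounded F) (𝓝 0) := by
  have hE := tendsto_heckeErr (t := t) (lam := lam) (c := c)
  have h1 := hE.smul hf
  have h2 : Tendsto (fun z => heckeErr t lam c z - npow (1 + t 0 * z⁻¹) c) (cobounded F) (𝓝 0) := by
    simpa using hE.sub (tendsto_npow_one_add (t 0) c)
  have h3 := h2.norm.mul_const ‖q‖
  have h4 := (hE.sub_const 1).norm.mul_const ‖r‖
  have h5 := (h1.norm.add h3).add h4
  simp only [smul_zero, norm_zero, sub_self, zero_mul, add_zero] at h5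
  refine squeeze_zero_norm' ?_ h5
  filter_upwards [eventually_ne_zero_add (t := t)] with z hz
  have n1 : ‖npow (z + t 0) (-c / 2)‖ = 1 := norm_npow_imag hz.2 (by simp [hc])
  have n2 : ‖npow z c‖ = 1 := norm_npow_imag hz.1 hc
  have e1 : npow (z + t 0) (c / 2) =
      npow (z + t 0) (-c / 2) * (npow z c * npow (1 + t 0 * z⁻¹) c) := by
    rw [← npow_mul, ← add_eq_mul_one_add hz.1, ← npow_add hz.2]
    congr 1
    ring
  have e2 : npow (z + t 0) (-1 / 2) • heckeConst t lam c z • f z -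
      (npow (z + t 0) (c / 2) • q + npow (z + t 0) (-c / 2) • r) =
      npow (z + t 0) (-c / 2) • (heckeErr t lam c z • (f z - (npow z c • q + r)) +
        (npow z c * (heckeErr t lam c z - npow (1 + t 0 * z⁻¹) c)) • q +
        (heckeErr t lam c z - 1) • r) := by
    rw [smul_smul, npow_mul_heckeConst hz.1 hz.2, e1]
    module
  rw [e2, norm_smul, n1, one_mul]
  refine (norm_add₃_le ..).trans_eq ?_
  rw [norm_smul (npow z c * _), norm_mul, n2, one_mul, norm_smul (heckeErr t lam c z - 1)]

/-- Passage from the translated variable to `x` in the asymptotics, for `c = 0`. -/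
lemma tendsto_smul_heckeConst_zero {f : F → H} {q r : H}
    (hf : Tendsto (fun z => f z - ((Real.log (nrm z) : ℂ) • q + r)) (cobounded F) (𝓝 0)) :
    Tendsto (fun z => npow (z + t 0) (-1 / 2) • heckeConst t lam 0 z • f z -
      ((Real.log (nrm (z + t 0)) : ℂ) • q + r)) (cobounded F) (𝓝 0) := by
  have hE := tendsto_heckeErr (t := t) (lam := lam) (c := 0)
  have h1 := hE.smul hf
  have h2 : Tendsto (fun z => (heckeErr t lam 0 z - 1) * (Real.log (nrm z) : ℂ)) (cobounded F)
      (𝓝 0) := by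
    have h := (isBigO_heckeErr_sub_one (t := t) (lam := lam) (c := 0)).norm_right.mul
      (IsBigO.of_bound (g := fun z : F => Real.log (nrm z)) (l := cobounded F) 1
        (f := fun z : F => (Real.log (nrm z) : ℂ)) (Eventually.of_forall fun z => by
          rw [one_mul, Complex.norm_real]))
    exact h.trans_tendsto (tendsto_log_mul_inv.congr fun z => mul_comm _ _)
  have h3 : Tendsto (fun z : F => (Real.log (nrm (1 + t 0 * z⁻¹)) : ℂ)) (cobounded F) (𝓝 0) := by
    have h : Tendsto (fun z : F => 1 + t 0 * z⁻¹) (cobounded F) (𝓝 1) := by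
      have := Tendsto.const_add (1 : F) ((tendsto_inv_cobounded (F := F)).const_mul (t 0))
      simpa using this
    have h' : Tendsto (fun z : F => nrm (1 + t 0 * z⁻¹)) (cobounded F) (𝓝 1) := by
      simpa [Function.comp_def] using (continuous_nrm.tendsto (1 : F)).comp h
    have h'' := (Real.continuousAt_log one_ne_zero).tendsto.comp h'
    rw [Real.log_one] at h''
    exact_mod_cast (Complex.continuous_ofReal.tendsto 0).comp h''
  -- `log ‖z + t 0‖ = log ‖z‖ + log ‖1 + t 0 / z‖`, where the last term tends to zero
  have h4 := (h1.add ((h2.sub h3).smul_const q)).add ((hE.sub_const 1).smul_const r)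
  simp only [smul_zero, sub_self, zero_smul, add_zero] at h4
  refine h4.congr' ?_
  filter_upwards [eventually_ne_zero_add (t := t)] with z hz
  have hz1 : 1 + t 0 * z⁻¹ ≠ 0 := by
    intro h
    have h0 := hz.2
    rw [add_eq_mul_one_add hz.1, h, mul_zero] at h0
    exact h0 rfl
  have e1 : Real.log (nrm (z + t 0)) = Real.log (nrm z) + Real.log (nrm (1 + t 0 * z⁻¹)) := by
    rw [add_eq_mul_one_add hz.1, nrm_mul, Real.log_mul (nrm_pos hz.1).ne' (nrm_pos hz1).ne']
  rw [smul_smul, npow_mul_heckeConst hz.1 hz.2, e1, neg_zero, zero_div, npow_zero_exp, one_mul]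
  push_cast
  module

end Comparison



/-! ### Strong and weak convergence -/

section Weak

variable {F : Type*} [NontriviallyNormedField F]
  {E : Type*} [NormedAddCommGroup E] [InnerProductSpace ℂ E] {S : Submodule ℂ E}

/-- Strong convergence of the adjoints on `S` gives weak convergence against the elements of `S`. -/
lemma isLittleOOne_of_adjoint {A B : F → E →L[ℂ] E}
    (hA : ∀ u ∈ S, Tendsto (fun x => A x u) (cobounded F) (𝓝 0))
    (hB : ∀ u ∈ S, Tendsto (fun x => B x u) (cobounded F) (𝓝 0))
    (h : ∀ᶠ x in cobounded F, ∀ u v, inner ℂ v (A x u) = inner ℂ (B x v) u) :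
    IsLittleOOne S A := by
  refine ⟨hA, fun u v hv => ?_⟩
  have h1 : Tendsto (fun x => inner ℂ (B x v) u) (cobounded F) (𝓝 0) := by
    simpa using (hB v hv).inner (tendsto_const_nhds (x := u))
  exact h1.congr' (h.mono fun x h => (h u v).symm)

lemma offDiag_apply (A B : E →L[ℂ] E) (u : WithLp 2 (E × E)) :
    offDiag A B u = WithLp.toLp 2 (A u.snd, B u.fst) := rfl

lemma isLittleOOne_offDiag {A B : F → E →L[ℂ] E} (hA : IsLittleOOne S A) (hB : IsLittleOOne S B) :
    IsLittleOOne (sumSpace S) fun x => offDiag (A x) (B x) := by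
  refine ⟨fun u hu => ?_, fun u v hv => ?_⟩
  · have h := (hA.1 u.snd hu.2).prodMk_nhds (hB.1 u.fst hu.1)
    have h' := (WithLp.prodContinuousLinearEquiv 2 ℂ E E).symm.continuous.tendsto (0, 0)
    have h0 : (WithLp.prodContinuousLinearEquiv 2 ℂ E E).symm (0, 0) = 0 := map_zero _
    rw [h0] at h'
    exact h'.comp h
  · have h := (hA.2 u.snd v.fst hv.1).add (hB.2 u.fst v.snd hv.2)
    rw [add_zero] at h
    exact h

lemma adjoint_offDiag [CompleteSpace E] (Q R : E ≃ₗᵢ[ℂ] E) :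
    ContinuousLinearMap.adjoint (offDiag (R : E →L[ℂ] E) (Q : E →L[ℂ] E)) =
      offDiag (Q.symm : E →L[ℂ] E) (R.symm : E →L[ℂ] E) := by
  symm
  rw [ContinuousLinearMap.eq_adjoint_iff]
  intro u v
  rw [offDiag_apply, offDiag_apply, WithLp.prod_inner_apply, WithLp.prod_inner_apply, add_comm]
  congr 1
  · exact (R.symm.inner_map_eq_flip _ _)
  · exact (Q.symm.inner_map_eq_flip _ _)

end Weak

/-! ### The Hecke operators at infinity -/

section Asymptotic

variable {F : Type*} [NontriviallyNormedField F] [ProperSpace F] [MeasurableSpace F] [BorelSpace F]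
  (μ : Measure F) [μ.IsAddHaarMeasure] {n : ℕ} {t : Fin (n + 2) → F} {lam : Fin (n + 2) → ℂ}
  {d c : ℂ}

variable (hlam : ∀ j, (lam j).re = -1) (hd : d.re = -((n + 1 : ℝ) / 2)) (hc : c.re = 0)

lemma degree_neg_sub_two (lam : Fin (n + 2) → ℂ) (lamInf : ℂ) :
    degree lam (-lamInf - 2) = degree lam lamInf + (lamInf + 1) := by
  rw [degree, degree]
  ring

lemma conj_npow_neg_half (x : F) :
    (starRingEnd ℂ) (npow x (-1 / 2)) = npow x (-1 / 2) := by
  rw [conj_npow, map_div₀, map_neg, map_one, Complex.conj_ofNat]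

/-- The operators `H` are the Hecke operators with parameters `(d, c)`, written with the unitary
operators `gOp`. -/
def IsHeckeFamily (t : Fin (n + 2) → F) (lam : Fin (n + 2) → ℂ) (d c : ℂ)
    (H : F → HSpace n μ →L[ℂ] HSpace n μ) : Prop :=
  ∀ x ∉ Set.range t, ∀ φ, H x φ =
    heckeConst t lam c (x - t 0) • heckeVec μ t lam d c (x - t 0) φ

include hlam hd hc in
lemma exists_isHeckeFamily (hgap : gap t ≠ 0) : ∃ H, IsHeckeFamily μ t lam d c H := by
  have h : ∀ x : F, ∃ T : HSpace n μ →L[ℂ] HSpace n μ, x ∉ Set.range t → ∀ φ, T φ =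
      heckeConst t lam c (x - t 0) • heckeVec μ t lam d c (x - t 0) φ := fun x => by
    by_cases hx : x ∈ Set.range t
    · exact ⟨0, fun h => absurd hx h⟩
    · obtain ⟨T, hT⟩ := exists_heckeOp μ hlam hd hc hgap (offPts_sub hx)
      refine ⟨heckeConst t lam c (x - t 0) • T, fun _ φ => ?_⟩
      rw [smul_apply, hT]
  choose H hH using h
  exact ⟨H, hH⟩

lemma eventually_notMem_range : ∀ᶠ x in cobounded F, x ∉ Set.range t :=
  (Set.finite_range t).isBounded

include hlam hd hc

/-- The Hecke operators with parameters `(d, c)` and `(d + c, -c)` are adjoint. -/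
lemma IsHeckeFamily.inner_eq (hgap : gap t ≠ 0) {H H' : F → HSpace n μ →L[ℂ] HSpace n μ}
    (hH : IsHeckeFamily μ t lam d c H) (hH' : IsHeckeFamily μ t lam (d + c) (-c) H') {x : F}
    (hx : x ∉ Set.range t) (φ ψ : HSpace n μ) :
    inner ℂ (H x φ) ψ = inner ℂ φ (H' x ψ) := by
  have hx' := offPts_sub hx
  rw [hH x hx, hH' x hx, inner_smul_left, inner_smul_right, inner_heckeVec μ hlam hd hc hgap hx',
    ← mul_assoc, conj_heckeConst hlam hc hx']

lemma IsHeckeFamily.tendsto (hgap : gap t ≠ 0) (hc1 : ∃ x : F, x ≠ 0 ∧ npow x c ≠ 1)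
    {H : F → HSpace n μ →L[ℂ] HSpace n μ} (hH : IsHeckeFamily μ t lam d c H) {γ γ' : ℂ}
    {Q R : HSpace n μ ≃ₗᵢ[ℂ] HSpace n μ} {φ : HSpace n μ} (hφ : φ ∈ testSpace n μ)
    (hQ : regInt μ c φ (fun r => gOp μ t lam d 0 r φ) = γ • Q φ)
    (hR : regInt μ (-c) φ (fun p => gOp μ t lam d p 0 φ) = γ' • R φ) :
    Tendsto (fun x => (npow x (-1 / 2) • H x -
      ((γ * npow x (c / 2)) • (Q : HSpace n μ →L[ℂ] HSpace n μ) +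
        (γ' * npow x (-c / 2)) • (R : HSpace n μ →L[ℂ] HSpace n μ))) φ) (cobounded F) (𝓝 0) := by
  have h1 := tendsto_heckeVec_sub_regInt μ hlam hd hc hc1 hgap hφ
  rw [hQ, hR] at h1
  have h2 := (tendsto_smul_heckeConst (t := t) (lam := lam) hc h1).comp
    (tendsto_sub_const_cobounded (t 0))
  refine h2.congr' ?_
  filter_upwards [eventually_notMem_range (t := t)] with x hx
  simp only [Function.comp_apply, sub_add_cancel, sub_apply,
    add_apply, smul_apply, hH x hx, smul_smul,
    mul_comm γ, mul_comm γ']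
  rfl

omit hc in
lemma IsHeckeFamily.tendsto_zero (hμ : IsNormalizedHaar μ) (hgap : gap t ≠ 0)
    {H : F → HSpace n μ →L[ℂ] HSpace n μ} (hH : IsHeckeFamily μ t lam d 0 H)
    {M : testSpace n μ →ₗ[ℂ] HSpace n μ}
    (hM : ∀ φ : testSpace n μ, M φ = cutVecQ μ t lam d 0 (φ : HSpace n μ) +
      cutVecR μ t lam d 0 (φ : HSpace n μ) + (sphereVol μ : ℂ) • (φ : HSpace n μ))
    (φ : testSpace n μ) :
    Tendsto (fun x : F => npow x (-1 / 2) • H x (φ : HSpace n μ) -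
      ((Real.log (nrm x) : ℂ) • (φ : HSpace n μ) + M φ)) (cobounded F) (𝓝 0) := by
  have h1 : Tendsto (fun x => heckeVec μ t lam d 0 x (φ : HSpace n μ) -
      ((Real.log (nrm x) : ℂ) • (φ : HSpace n μ) + M φ)) (cobounded F) (𝓝 0) := by
    refine (tendsto_heckeVec_sub μ hlam hd Complex.zero_re hgap φ.2).congr' ?_
    filter_upwards [tendsto_nrm_cobounded.eventually_ge_atTop 1] with x hx
    rw [annInt_zero μ hμ hx, npow_zero_exp, hM]
    module
  refine ((tendsto_smul_heckeConst_zero (t := t) (lam := lam) h1).comp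
    (tendsto_sub_const_cobounded (t 0))).congr' ?_
  filter_upwards [eventually_notMem_range (t := t)] with x hx
  simp only [Function.comp_apply, sub_add_cancel, hH x hx]

/-- The expansion at infinity of the Hecke operators in both directions, for a nontrivial
character `‖·‖ ^ c`. -/
lemma IsHeckeFamily.isLittleOOne (hgap : gap t ≠ 0) (hc1 : ∃ x : F, x ≠ 0 ∧ npow x c ≠ 1)
    {H H' : F → HSpace n μ →L[ℂ] HSpace n μ}
    (hH : IsHeckeFamily μ t lam d c H) (hH' : IsHeckeFamily μ t lam (d + c) (-c) H')
    {γ γ' : ℂ} (hγ : γ' = (starRingEnd ℂ) γ) {Q R : HSpace n μ ≃ₗᵢ[ℂ] HSpace n μ}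
    (hQ : ∀ φ ∈ testSpace n μ, regInt μ c φ (fun r => gOp μ t lam d 0 r φ) = γ • Q φ)
    (hQ' : ∀ φ ∈ testSpace n μ,
      regInt μ (-c) φ (fun r => gOp μ t lam (d + c) 0 r φ) = γ' • Q.symm φ)
    (hR : ∀ φ ∈ testSpace n μ, regInt μ (-c) φ (fun p => gOp μ t lam d p 0 φ) = γ' • R φ)
    (hR' : ∀ φ ∈ testSpace n μ,
      regInt μ c φ (fun p => gOp μ t lam (d + c) p 0 φ) = γ • R.symm φ) :
    IsLittleOOne (testSpace n μ) (fun x : F => npow x (-1 / 2) • H x -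
      ((γ * npow x (c / 2)) • (Q : HSpace n μ →L[ℂ] HSpace n μ) +
       (γ' * npow x (-c / 2)) • (R : HSpace n μ →L[ℂ] HSpace n μ))) ∧
    IsLittleOOne (testSpace n μ) (fun x : F => npow x (-1 / 2) • H' x -
      ((γ' * npow x (-c / 2)) • (Q.symm : HSpace n μ →L[ℂ] HSpace n μ) +
       (γ * npow x (c / 2)) • (R.symm : HSpace n μ →L[ℂ] HSpace n μ))) := by
  have hd' : (d + c).re = -((n + 1 : ℝ) / 2) := by simp [hd, hc]
  have hc' : (-c).re = 0 := by simp [hc]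
  have hc1' : ∃ x : F, x ≠ 0 ∧ npow x (-c) ≠ 1 := by
    obtain ⟨x, hx, h⟩ := hc1
    exact ⟨x, hx, by rwa [npow_neg, Ne, inv_eq_one]⟩
  have h1 := fun φ hφ => hH.tendsto μ hlam hd hc hgap hc1 hφ (hQ φ hφ) (hR φ hφ)
  have h2 := fun φ hφ => hH'.tendsto μ hlam hd' hc' hgap hc1' hφ (hQ' φ hφ)
    (by rw [neg_neg]; exact hR' φ hφ)
  rw [neg_neg] at h2
  have hconj : ∀ x : F, (starRingEnd ℂ) (γ * npow x (c / 2)) = γ' * npow x (-c / 2) := fun x => by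
    rw [map_mul, conj_npow, ← hγ, map_div₀, conj_eq_neg_of_re hc, Complex.conj_ofNat]
  have hconj' : ∀ x : F, (starRingEnd ℂ) (γ' * npow x (-c / 2)) = γ * npow x (c / 2) := fun x => by
    rw [← hconj, Complex.conj_conj]
  have hadj : ∀ᶠ x in cobounded F, ∀ u v : HSpace n μ,
      inner ℂ v ((npow x (-1 / 2) • H x -
        ((γ * npow x (c / 2)) • (Q : HSpace n μ →L[ℂ] HSpace n μ) +
         (γ' * npow x (-c / 2)) • (R : HSpace n μ →L[ℂ] HSpace n μ))) u) =
      inner ℂ ((npow x (-1 / 2) • H' x -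
        ((γ' * npow x (-c / 2)) • (Q.symm : HSpace n μ →L[ℂ] HSpace n μ) +
         (γ * npow x (c / 2)) • (R.symm : HSpace n μ →L[ℂ] HSpace n μ))) v) u := by
    filter_upwards [eventually_notMem_range (t := t)] with x hx u v
    have e1 : inner ℂ v (H x u) = inner ℂ (H' x v) u := by
      rw [← inner_conj_symm, hH.inner_eq μ hlam hd hc hgap hH' hx, inner_conj_symm]
    have e2 : ∀ V : HSpace n μ ≃ₗᵢ[ℂ] HSpace n μ, inner ℂ (V.symm v) u = inner ℂ v (V u) :=
      fun V => by rw [← V.inner_map_map, V.apply_symm_apply]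
    have e3 : ∀ V : HSpace n μ ≃ₗᵢ[ℂ] HSpace n μ, ∀ w,
        (V : HSpace n μ →L[ℂ] HSpace n μ) w = V w := fun V w => rfl
    simp only [sub_apply, add_apply,
      smul_apply, inner_sub_left, inner_sub_right, inner_add_left,
      inner_add_right, inner_smul_left, inner_smul_right, e1, e2, e3, hconj, hconj',
      conj_npow_neg_half]
  refine ⟨isLittleOOne_of_adjoint h1 h2 hadj, isLittleOOne_of_adjoint h2 h1 ?_⟩
  filter_upwards [hadj] with x hx u v
  rw [← inner_conj_symm, ← hx, inner_conj_symm]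

end Asymptotic

end TameHecke

theorem mainTheorem4 {F : Type*} [NontriviallyNormedField F] [ProperSpace F] [MeasurableSpace F]
    [BorelSpace F] (μ : Measure F) [μ.IsAddHaarMeasure] (hμ : IsNormalizedHaar μ)
    (e : AddChar F Circle) (he : Continuous e) (he1 : e ≠ 1)
    (n : ℕ) (t : Fin (n + 2) → F) (ht : Function.Injective t)
    (lam : Fin (n + 2) → ℂ) (hlam : ∀ j, (lam j).re = -1)
    (lamInf : ℂ) (hlamInf : lamInf.re = -1) (c : ℂ) (hc : c = lamInf + 1) :
    Dense (testSpace n μ : Set (HSpace n μ)) ∧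
    ∃ Hp Hm : F → HSpace n μ →L[ℂ] HSpace n μ,
      (∀ x ∉ Set.range t, IsHecke μ t lam lamInf x (Hp x) ∧
        IsHecke μ t lam (-lamInf - 2) x (Hm x)) ∧
      ((∃ x : F, x ≠ 0 ∧ npow x c ≠ 1) →
        ∃ Qp Qm Rp Rm : HSpace n μ ≃ₗᵢ[ℂ] HSpace n μ,
          IsQ e μ t lam lamInf Qp ∧ IsQ e μ t lam (-lamInf - 2) Qm ∧
          IsR e μ lam lamInf Rp ∧ IsR e μ lam (-lamInf - 2) Rm ∧
          IsLittleOOne (testSpace n μ) (fun x : F =>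
            npow x (-1 / 2) • Hp x -
              ((gammaF e μ c * npow x (c / 2)) • (Qp : HSpace n μ →L[ℂ] HSpace n μ) +
               (gammaF e μ (-c) * npow x (-c / 2)) • (Rp : HSpace n μ →L[ℂ] HSpace n μ))) ∧
          IsLittleOOne (testSpace n μ) (fun x : F =>
            npow x (-1 / 2) • Hm x -
              ((gammaF e μ (-c) * npow x (-c / 2)) • (Qm : HSpace n μ →L[ℂ] HSpace n μ) +
               (gammaF e μ c * npow x (c / 2)) • (Rm : HSpace n μ →L[ℂ] HSpace n μ))) ∧
          IsLittleOOne (sumSpace (testSpace n μ)) (fun x : F =>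
            npow x (-1 / 2) • offDiag (Hm x) (Hp x) -
              ((gammaF e μ c * npow x (c / 2)) •
                  offDiag (Rm : HSpace n μ →L[ℂ] HSpace n μ) (Qp : HSpace n μ →L[ℂ] HSpace n μ) +
               (gammaF e μ (-c) * npow x (-c / 2)) •
                  ContinuousLinearMap.adjoint
                    (offDiag (Rm : HSpace n μ →L[ℂ] HSpace n μ)
                      (Qp : HSpace n μ →L[ℂ] HSpace n μ))))) ∧
      (c = 0 →
        ∃ M : testSpace n μ →ₗ[ℂ] HSpace n μ, IsM μ t lam M ∧
          ∀ φ : testSpace n μ,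
            Tendsto (fun x : F => npow x (-1 / 2) • Hp x (φ : HSpace n μ) -
              ((Real.log (nrm x) : ℂ) • (φ : HSpace n μ) + M φ)) (cobounded F) (𝓝 0) ∧
            Tendsto (fun x : F => npow x (-1 / 2) • Hm x (φ : HSpace n μ) -
              ((Real.log (nrm x) : ℂ) • (φ : HSpace n μ) + M φ)) (cobounded F) (𝓝 0)) := by
  subst hc
  have hgap : gap t ≠ 0 := sub_ne_zero.2 fun h => Fin.last_pos.ne' (ht h)
  have hd : (degree lam lamInf).re = -((n + 1 : ℝ) / 2) := degree_re hlam hlamInf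
  have hc0 : (lamInf + 1).re = 0 := by simp [hlamInf]
  have hlamInf' : (-lamInf - 2).re = -1 := by simp [hlamInf]; norm_num
  have hd' : (degree lam lamInf + (lamInf + 1)).re = -((n + 1 : ℝ) / 2) := by
    rw [← degree_neg_sub_two]
    exact degree_re hlam hlamInf'
  have e1 : -lamInf - 2 + 1 = -(lamInf + 1) := by ring
  have e2 : -lamInf - 1 = -(lamInf + 1) := by ring
  have e3 : -(-lamInf - 2) - 1 = lamInf + 1 := by ring
  -- in terms of `(d, c)`, passing to the second set of parameters means `(d + c, -c)`
  obtain ⟨Hp, hHp⟩ := exists_isHeckeFamily μ hlam hd hc0 hgap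
  obtain ⟨Hm, hHm⟩ := exists_isHeckeFamily (c := -(lamInf + 1)) μ hlam hd' (by rw [Complex.neg_re, hc0, neg_zero]) hgap
  refine ⟨dense_testSpace μ, Hp, Hm, fun x hx =>
    ⟨isHecke_of_eq μ hlam hlamInf hgap hx (hHp x hx), isHecke_of_eq μ hlam hlamInf' hgap hx ?_⟩,
    fun hc1 => ?_, fun h0 => ?_⟩
  · rw [e1, degree_neg_sub_two]
    exact hHm x hx
  · have hc1' : ∃ x : F, x ≠ 0 ∧ npow x (-(lamInf + 1)) ≠ 1 := by
      obtain ⟨x, hx, h⟩ := hc1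
      exact ⟨x, hx, by rwa [npow_neg, Ne, inv_eq_one]⟩
    have hγ := gammaF_ne_zero μ he he1 hc0 hc1
    have hγ' := gammaF_ne_zero (c := -(lamInf + 1)) μ he he1 (by rw [Complex.neg_re, hc0, neg_zero]) hc1'
    obtain ⟨Q, hQ, hQ'⟩ := exists_Q μ hlam hd hμ he he1 hc0 hc1 hgap
    obtain ⟨R, hR, hR'⟩ := exists_R μ (t := t) hlam hd hμ he he1 hc0 hc1
    obtain ⟨hp, hm⟩ := hHp.isLittleOOne μ hlam hd hc0 hgap hc1 hHm
      (gammaF_neg μ he he1 hc0 hc1) hQ hQ' hR hR'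
    refine ⟨Q, Q.symm, R, R.symm, isQ_of_eq μ hlam hlamInf hc1 hgap hγ hQ,
      isQ_of_eq μ hlam hlamInf' ?_ hgap ?_ ?_, isR_of_eq (t := t) μ hlam hlamInf ?_ ?_ ?_,
      isR_of_eq (t := t) μ hlam hlamInf' ?_ ?_ ?_, hp, hm, ?_⟩
    · rwa [e1]
    · rwa [e1]
    · rw [e1, degree_neg_sub_two]
      exact hQ'
    · rwa [e2]
    · rwa [e2]
    · rw [e2]
      exact hR
    · rwa [e3]
    · rwa [e3]
    · rw [e3, degree_neg_sub_two]
      exact hR'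
    · rw [adjoint_offDiag]
      convert isLittleOOne_offDiag hm hp using 2 with x
      ext u : 1
      simp only [sub_apply, add_apply, smul_apply, offDiag_apply, ← WithLp.toLp_smul,
        ← WithLp.toLp_add, ← WithLp.toLp_sub, Prod.smul_mk, Prod.mk_add_mk, Prod.mk_sub_mk]
      rw [add_comm (_ • (R.symm : HSpace n μ →L[ℂ] HSpace n μ) _)]
      rfl
  · obtain ⟨M, hM⟩ := exists_M μ hlam hd hgap
    obtain rfl : lamInf = -1 := eq_neg_of_add_eq_zero_left h0
    refine ⟨M, isM_of_eq μ hlam hgap hM, fun φ => ⟨?_, ?_⟩⟩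
    · rw [h0] at hHp
      exact hHp.tendsto_zero μ hlam hd hμ hgap hM φ
    · rw [h0, neg_zero, add_zero] at hHm
      exact hHm.tendsto_zero μ hlam hd hμ hgap hM φ
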